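/- **Setting.** Let $n\ge 1$ and let $\mathfrak X$ be a connected smooth $n$-dimensional Riemannian manifold (without boundary, second countable) with geodesic distance $\mathrm{dist}$ and Riemannian volume measure $\omega$. Let $g:\mathfrak X\times\mathfrak X\to(-\infty,+\infty]$, $V:\mathfrak X\to(-\infty,+\infty]$ and let $\vartheta:\mathfrak X\to[0,\infty)$ be continuous. Put $e^{-\infty}=0$ and, for $\kappa\ge0$, $\widetilde V_\kappa=V-\kappa\vartheta$. Assume: 1. $g$ is symmetric and lower semicontinuous, and for every $\epsilon>0$ there is $\delta>0$ such that $|g(u,x)|\le\epsilon\,\mathrm{dist}(u,x)^{-n}$ for all $u\neq x$ with $\mathrm{dist}(u,x)\le\delta$. 2. There are $p>1$ and $c_k\to0$ such that for every integer $k\ge1$ one can write $g=g_k+g^k$ with $g_k:\mathfrak X\times\mathfrak X\to(-\infty,k]$ continuous, $g^k\ge0$ and $\int g^k(u,x)^p\,\omega(dx)\le c_k$ for all $u\in\mathfrak X$. 3. $-g(u,x)\le\vartheta(u)+\vartheta(x)$ for all $u,x\in\mathfrak X$. 4. The set $S_V=\{V<+\infty\}$ is open and non-empty, $V$ is continuous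 on $S_V$, and for every $\kappa\ge0$ the function $\widetilde V_\kappa$ is bounded from below and $\int e^{-\widetilde V_\kappa}\,d\omega<\infty$. For $\beta>0$ and $N\in\mathbb N$ let $\mathbb P_N$ be the Gibbs measure on $\mathfrak X^N$, $$\mathbb P_N(d\mathbf x)=\frac1{Z_N}\,e^{-\mathscr H_N(\mathbf x)}\prod_{j=1}^N\omega(dx_j),\qquad \mathscr H_N(\mathbf x)=\beta\sum_{i<j}g(x_i,x_j)+\sum_{j}V(x_j),$$ where $Z_N$ is the normalizing constant. For $\gamma\ge0$ let $\nu_\gamma$ be the probability measure proportional to $e^{-\widetilde V_\gamma}\omega$ and, for Borel probability measures $\mu$ on $\mathfrak X$, let $$\mathscr F_\gamma(\mu)=\frac\gamma2\iint\big(g(x,z)+\vartheta(x)+\vartheta(z)\big)\,\mu(dz)\,\mu(dx)+\mathrm H(\mu|\nu_\gamma)\in[0,+\infty],$$ where $\mathrm H(\cdot|\cdot)$ is the relative entropy and $0\cdot\infty=0$. **Theorem.** Fix $\gamma\ge0$ and suppose that $\mathscr F_\gamma$ has a unique minimizer $\mu_\gamma$ among the probability measures on $\mathfrak X$. Then $\mu_\gamma$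 has a density with respect to $\omega$, again denoted by $\mu_\gamma(\cdot)$, that is continuous on $S_V$, and $\mu_\gamma(E)>0$ for every $E\in S_V$. Let $E\in S_V$, let $U\subseteq S_V$ be a normal neighbourhood of $E$, and let $\varphi:U\to\mathbb R^n$ be a normal coordinate chart centred at $E$ (so $\varphi^{-1}$ is the exponential map at $E$ read in an orthonormal basis of $T_E\mathfrak X$, on an open set star-shaped about $0$). Then for all $\beta=\beta_N>0$ with $N\beta_N\to\gamma$ as $N\to\infty$, the local point process $$\Xi_N=\sum_{j:\,x_j\in U}\boldsymbol\delta_{N^{1/n}\varphi(x_j)}$$ under $\mathbb P_N$ converges in distribution as $N\to\infty$ to a homogeneous Poisson point process $\Xi$ on $\mathbb R^n$ with intensity $\mu_\gamma(E)$, that is, $\mathbb E_N[e^{-\Xi_N(f)}]\to\mathbb E[e^{-\Xi(f)}]$ for every continuous compactly supported $f:\mathbb R^n\to[0,\infty)$. -/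

import Mathlib

open MeasureTheory Filter Bundle
open scoped Manifold ContDiff ENNReal NNReal Topology

noncomputable section

namespace MeanFieldGas

/-! ### Riemannian geometry in charts -/

section Riemannian

variable {n : ℕ} {X : Type*} [MetricSpace X] [ChartedSpace (EuclideanSpace ℝ (Fin n)) X]
  [RiemannianBundle (fun x : X ↦ TangentSpace (𝓡 n) x)]

/-- The coordinate vector field `∂_i` of a chart `e`, at the point with coordinates `y`. -/
def coordVector (e : OpenPartialHomeomorph X (EuclideanSpace ℝ (Fin n)))
    (y : EuclideanSpace ℝ (Fin n)) (i : Fin n) : TangentSpace (𝓡 n) (e.symm y) :=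
  mfderiv (𝓡 n) (𝓡 n) e.symm y (EuclideanSpace.single i (1 : ℝ))

/-- The matrix `g_ij` of the Riemannian metric in the coordinates of a chart `e`, as a function of
the coordinates. -/
def metricMatrix (e : OpenPartialHomeomorph X (EuclideanSpace ℝ (Fin n)))
    (y : EuclideanSpace ℝ (Fin n)) : Matrix (Fin n) (Fin n) ℝ :=
  Matrix.of fun i j ↦ inner ℝ (coordVector e y i) (coordVector e y j)

/-- The measure on the domain of a chart `e` (extended by zero to the manifold) which is
`√(det g) dx_1 ⋯ dx_n` in the coordinates of `e`. -/
def chartVolume [MeasurableSpace X] (e : OpenPartialHomeomorph X (EuclideanSpace ℝ (Fin n))) :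
    Measure X :=
  ((volume.restrict e.target).withDensity
    fun y ↦ ENNReal.ofReal √(metricMatrix e y).det).map e.symm

/-- The Riemannian volume measure. By the change of variables formula the measures `chartVolume e`
agree on the overlaps of the chart domains, so their supremum in the lattice of measures is the
measure that restricts to `chartVolume e` on the domain of every smooth chart `e`. -/
def riemannianVolume (n : ℕ) (X : Type*) [MetricSpace X]
    [ChartedSpace (EuclideanSpace ℝ (Fin n)) X]
    [RiemannianBundle (fun x : X ↦ TangentSpace (𝓡 n) x)] [MeasurableSpace X] : Measure X :=
  ⨆ e ∈ IsManifold.maximalAtlas (𝓡 n) ∞ X, chartVolume e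

/-- The partial derivative `∂_i g_jl` in the coordinates of the chart `e`. -/
def partialMetric (e : OpenPartialHomeomorph X (EuclideanSpace ℝ (Fin n)))
    (y : EuclideanSpace ℝ (Fin n)) (i j l : Fin n) : ℝ :=
  fderiv ℝ (fun z ↦ metricMatrix e z j l) y (EuclideanSpace.single i (1 : ℝ))

/-- The Christoffel symbol `Γ^k_ij` of the Levi-Civita connection in the chart `e`. -/
def christoffel (e : OpenPartialHomeomorph X (EuclideanSpace ℝ (Fin n)))
    (y : EuclideanSpace ℝ (Fin n)) (k i j : Fin n) : ℝ :=
  (1 / 2 : ℝ) * ∑ l, ((metricMatrix e y)⁻¹) k l *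
    (partialMetric e y i j l + partialMetric e y j i l - partialMetric e y l i j)

/-- The curve `c` satisfies the geodesic equation at all times in the (open) set `s`, in every
smooth chart. -/
def IsGeodesicOn (c : ℝ → X) (s : Set ℝ) : Prop :=
  ∀ t ∈ s, ContinuousAt c t ∧
    ∀ e ∈ IsManifold.maximalAtlas (𝓡 n) ∞ X, c t ∈ e.source →
      ContDiffAt ℝ 2 (fun τ ↦ e (c τ)) t ∧
      ∀ k : Fin n, deriv (deriv fun τ ↦ e (c τ) k) t +
        ∑ i, ∑ j, christoffel e (e (c t)) k i j *
          deriv (fun τ ↦ e (c τ) i) t * deriv (fun τ ↦ e (c τ) j) t = 0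

/-- `φ` is a normal coordinate chart centred at `E`, and its domain `φ.source` a normal
neighbourhood of `E`: the inverse of `φ` is the exponential map at `E`, read in an orthonormal
basis of the tangent space at `E`, on an open set that is star-shaped about the origin. -/
structure IsNormalChart (φ : OpenPartialHomeomorph X (EuclideanSpace ℝ (Fin n))) (E : X) :
    Prop where
  mem_atlas : φ ∈ IsManifold.maximalAtlas (𝓡 n) ∞ X
  mem_source : E ∈ φ.source
  map_center : φ E = 0
  starConvex : StarConvex ℝ 0 φ.target
  orthonormal : metricMatrix φ 0 = 1
  geodesic : ∀ v : EuclideanSpace ℝ (Fin n),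
    IsGeodesicOn (n := n) (fun t : ℝ ↦ φ.symm (t • v)) {t : ℝ | t • v ∈ φ.target}

end Riemannian

/-! ### Assumptions on the kernel and on the potential -/

section Model

variable {X : Type*} [MeasurableSpace X]

/-- Symmetry, lower semicontinuity, and `g(u,x) = o(dist(u,x)^{-n})` at the diagonal, uniformly. -/
structure KernelRegularity [MetricSpace X] (n : ℕ) (g : X → X → EReal) : Prop where
  symm : ∀ u x, g u x = g x u
  lsc : LowerSemicontinuous fun z : X × X ↦ g z.1 z.2
  diagonal : ∀ ε : ℝ, 0 < ε → ∃ δ : ℝ, 0 < δ ∧ ∀ u x, u ≠ x → dist u x ≤ δ →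
    (g u x).abs ≤ ENNReal.ofReal (ε / dist u x ^ n)

/-- For every `k ≥ 1`, `g = g_k + g^k` with `g_k ≤ k` continuous, `g^k ≥ 0` and
`∫ g^k(u,x)^p ω(dx) ≤ c_k` for all `u`, where `p > 1` and `c_k → 0`. -/
def KernelDecomposition [TopologicalSpace X] (vol : Measure X) (g : X → X → EReal) : Prop :=
  ∃ (gLow : ℕ → X → X → ℝ) (gUp : ℕ → X → X → ℝ≥0∞) (p : ℝ) (c : ℕ → ℝ),
    1 < p ∧ Tendsto c atTop (𝓝 0) ∧
    ∀ k : ℕ, 1 ≤ k →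
      (∀ u x, g u x = (gLow k u x : EReal) + (gUp k u x : EReal)) ∧
      (Continuous fun z : X × X ↦ gLow k z.1 z.2) ∧
      (∀ u x, gLow k u x ≤ k) ∧
      ∀ u, ∫⁻ x, gUp k u x ^ p ∂vol ≤ ENNReal.ofReal (c k)

/-- `W` is continuous on the nonempty open set `{W < ∞}` and `e^{-W}` is integrable. -/
structure PotentialRegularity [TopologicalSpace X] (vol : Measure X) (W : X → EReal) : Prop where
  isOpen : IsOpen {x | W x < ⊤}
  nonempty : {x | W x < ⊤}.Nonempty
  continuousOn : ContinuousOn W {x | W x < ⊤}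
  integrable : ∫⁻ x, EReal.exp (-W x) ∂vol < ⊤

/-- The modified potential `V - κ ϑ`. -/
def tiltedPotential (V : X → EReal) (ϑ : X → ℝ) (κ : ℝ) (x : X) : EReal :=
  V x - ((κ * ϑ x : ℝ) : EReal)

/-- The modified kernel `g(u,x) + ϑ(u) + ϑ(x)`. -/
def tiltedKernel (g : X → X → EReal) (ϑ : X → ℝ) (u x : X) : EReal :=
  g u x + ((ϑ u + ϑ x : ℝ) : EReal)

/-- The standing assumptions on the kernel `g` and the potential `V`, both with values in
`(-∞, ∞]`, and the auxiliary function `ϑ`, on a space of dimension `n` with volume `vol`. -/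
structure GasAssumptions [MetricSpace X] (n : ℕ) (vol : Measure X)
    (g : X → X → EReal) (V : X → EReal) (ϑ : X → ℝ) : Prop where
  kernel_ne_bot : ∀ u x, g u x ≠ ⊥
  potential_ne_bot : ∀ x, V x ≠ ⊥
  kernel_regular : KernelRegularity n g
  kernel_decomp : KernelDecomposition vol g
  theta_continuous : Continuous ϑ
  theta_nonneg : ∀ x, 0 ≤ ϑ x
  kernel_lower : ∀ u x, -g u x ≤ ((ϑ u + ϑ x : ℝ) : EReal)
  potential_bddBelow : ∀ κ : ℝ, 0 ≤ κ → ∃ m : ℝ, ∀ x, (m : EReal) ≤ tiltedPotential V ϑ κ x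
  potential_regular : ∀ κ : ℝ, 0 ≤ κ → PotentialRegularity vol (tiltedPotential V ϑ κ)

/-! ### Gibbs measure and free energy -/

/-- The energy `β ∑_{i<j} g(x_i,x_j) + ∑_j V(x_j)` of a configuration of `N` particles. -/
def energy (g : X → X → EReal) (V : X → EReal) (β : ℝ) {N : ℕ} (x : Fin N → X) : EReal :=
  (β : EReal) * ∑ q : Fin N × Fin N with q.1 < q.2, g (x q.1) (x q.2) + ∑ j, V (x j)

/-- The partition function. -/
def partitionFunction (vol : Measure X) (g : X → X → EReal) (V : X → EReal) (β : ℝ) (N : ℕ) :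
    ℝ≥0∞ :=
  ∫⁻ x : Fin N → X, EReal.exp (-energy g V β x) ∂(Measure.pi fun _ ↦ vol)

/-- The Gibbs measure of `N` particles at inverse temperature `β`. -/
def gibbsMeasure (vol : Measure X) (g : X → X → EReal) (V : X → EReal) (β : ℝ) (N : ℕ) :
    Measure (Fin N → X) :=
  (partitionFunction vol g V β N)⁻¹ •
    (Measure.pi fun _ ↦ vol).withDensity fun x ↦ EReal.exp (-energy g V β x)

/-- The reference measure `ν_γ = C_γ⁻¹ e^{-(V - γ ϑ)} ω`. -/
def referenceMeasure (vol : Measure X) (V : X → EReal) (ϑ : X → ℝ) (γ : ℝ) : Measure X :=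
  (∫⁻ x, EReal.exp (-tiltedPotential V ϑ γ x) ∂vol)⁻¹ •
    vol.withDensity fun x ↦ EReal.exp (-tiltedPotential V ϑ γ x)

/-- The weighted energy `∬ (g(x,z) + ϑ(x) + ϑ(z)) μ(dz) μ(dx)`, whose integrand is nonnegative
under the standing assumptions. -/
def weightedEnergy (g : X → X → EReal) (ϑ : X → ℝ) (μ : Measure X) : ℝ≥0∞ :=
  ∫⁻ x, ∫⁻ z, (tiltedKernel g ϑ x z).toENNReal ∂μ ∂μ

/-- The free energy, with values in `[0, ∞]`, where `0 · ∞ = 0` if `γ = 0`. -/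
def freeEnergy (vol : Measure X) (g : X → X → EReal) (V : X → EReal) (ϑ : X → ℝ) (γ : ℝ)
    (μ : ProbabilityMeasure X) : ℝ≥0∞ :=
  ENNReal.ofReal (γ / 2) * weightedEnergy g ϑ (μ : Measure X) +
    InformationTheory.klDiv (μ : Measure X) (referenceMeasure vol V ϑ γ)

/-- `μ` is the unique minimizer of `F`. -/
def IsUniqueMinimizer {M : Type*} (F : M → ℝ≥0∞) (μ : M) : Prop :=
  (∀ ν, F μ ≤ F ν) ∧ ∀ μ', (∀ ν, F μ' ≤ F ν) → μ' = μ

/-- The local point process `∑_{x_j ∈ U} δ_{N^{1/n} φ(x_j)}`, where `U` is the domain of `φ`. -/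
def localProcess {n : ℕ} [TopologicalSpace X]
    (φ : OpenPartialHomeomorph X (EuclideanSpace ℝ (Fin n))) {N : ℕ} (x : Fin N → X) :
    Measure (EuclideanSpace ℝ (Fin n)) :=
  open Classical in
  ∑ j with x j ∈ φ.source, Measure.dirac (((N : ℝ) ^ (1 / (n : ℝ))) • φ (x j))

end Model

/-! ### Point processes -/

section PointProcess

variable {S : Type*} [TopologicalSpace S] [MeasurableSpace S]

/-- A random measure which is almost surely the sum of the Dirac masses at the points of a locally
finite set. -/
def IsPointProcess {Ω : Type*} [MeasurableSpace Ω] (P : Measure Ω) (Ξ : Ω → Measure S) : Prop :=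
  Measurable Ξ ∧ ∀ᵐ w ∂P, ∃ Λ : Set S, (∀ K, IsCompact K → (Λ ∩ K).Finite) ∧
    Ξ w = Measure.sum fun y : Λ ↦ Measure.dirac (y : S)

/-- The Laplace functional `𝔼[exp(-∫ f dΞ)]`. -/
def laplaceFunctional {Ω : Type*} [MeasurableSpace Ω] (P : Measure Ω) (Ξ : Ω → Measure S)
    (f : S → ℝ≥0) : ℝ≥0∞ :=
  ∫⁻ w, EReal.exp (-((∫⁻ y, (f y : ℝ≥0∞) ∂(Ξ w) : ℝ≥0∞) : EReal)) ∂P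

/-- `Ξ` is a Poisson point process with intensity measure `θ`: its Laplace functional is
`exp(-∫ (1 - e^{-f}) dθ)`. -/
def IsPoissonProcess {Ω : Type*} [MeasurableSpace Ω] (P : Measure Ω) (Ξ : Ω → Measure S)
    (θ : Measure S) : Prop :=
  IsPointProcess P Ξ ∧ ∀ f : S → ℝ≥0, Measurable f →
    laplaceFunctional P Ξ f =
      EReal.exp (-((∫⁻ y, ENNReal.ofReal (1 - Real.exp (-(f y : ℝ))) ∂θ : ℝ≥0∞) : EReal))

/-- Convergence in distribution of the point processes `Ξ_N` under `P_N` to `Ξ` under `P`: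
the Laplace functionals converge at every continuous compactly supported `f ≥ 0`. -/
def ConvergesInDistribution {Ω : ℕ → Type*} [∀ N, MeasurableSpace (Ω N)]
    (P : ∀ N, Measure (Ω N)) (Ξ : ∀ N, Ω N → Measure S)
    {Ω' : Type*} [MeasurableSpace Ω'] (P' : Measure Ω') (Ξ' : Ω' → Measure S) : Prop :=
  ∀ f : S → ℝ≥0, Continuous f → HasCompactSupport f →
    Tendsto (fun N ↦ laplaceFunctional (P N) (Ξ N) f) atTop (𝓝 (laplaceFunctional P' Ξ' f))

end PointProcess

end MeanFieldGas

end

open MeasureTheory Filter Bundle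
open scoped Manifold ContDiff ENNReal NNReal Topology

noncomputable section

set_option linter.unusedSectionVars false

/-! The kernel G = g + ϑ + ϑ (`gasKernel`) is nonnegative, and each particle belongs to N - 1 pairs.
Hence the Gibbs measure is that of a gas with pair energy β G ≥ 0 and one-particle weight e^{-(V - κ
ϑ)}, where κ = β (N - 1) → γ (`GasAssumptions.exp_neg_energy`). The Laplace functional at f is the
quotient of two partition functions, with and without the tilt e^{-F_N} of the one-particle measure,
where F_N(x) = f(N^{1/n} φ(x)). Differentiating log Z along the tilts e^{-t F_N} gives minus the
mean of Σ F_N(x_j) in the tilted gas, and this involves the one-particle intensity only. By the mean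
value theorem (`exists_log_gasZ_sub_log_gasZ`) the logarithm of the Laplace functional minus its
Poisson value is a difference of two such first moments at a single s_N in (0, 1). No higher
correlation functions are needed; the price is that all limits must be proved for tilted gases. As
F_N is bounded and tends to 0 off E, the tilts are harmless, and `MeanFieldSequence` describes the
perturbations allowed.

The one-particle intensity. By exchangeability its density is N A(u)/Z_N with respect to the
one-particle measure, where A(u) (`gasA`) integrates the weight of N - 1 particles times exp(-β Σ
G(u, y_j)). So A/Z_{N-1} is a mean over the gas with N - 1 particles, and as N β → γ the law of
large numbers makes it converge to exp(-γ ∫ G(u,v) μ(dv)), even along moving points u_N → u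
(`MeanFieldSequence.tendsto_gasA_div_gasZ`). Since G(u, ·) is unbounded, it is first approximated in
L¹(e^ϑ ν) by a bounded continuous function. The error is controlled because the intensity of the gas
is at most a multiple of N e^ϑ ν (`MeanFieldSequence.exists_lintegral_sum_le`), which rests on Z_M ≤
C Z_{M+1}. The same limit in the untilted gas gives the mean-field equation for μ
(`MeanFieldKernel.eq_withDensity`), hence the continuous positive density.

The law of large numbers (`MeanFieldSequence.tendsto_gasMeasure_deviation`). Jensen's inequality
bounds Z_N below by exp(-N (F(μ) + η)). For ρ ≠ μ uniqueness gives F(ρ) > F(μ); approximating G from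
below by bounded continuous k, and the entropy by the Donsker-Varadhan formula, yields an open
neighbourhood of ρ whose weight is smaller by an exponential factor, by Chebyshev's inequality
(`MeanFieldKernel.exists_separating`, `setLIntegral_gasWeight_le`). Exponential tightness reduces
the problem to a compact set of measures, covered by finitely many of these neighbourhoods.

Finally, the factor N cancels the Jacobian of the dilation by N^{1/n}, and √det of the metric is 1
at the centre of normal coordinates, so the rescaled intensity tends to the density of μ at E. The
limiting Poisson process is built from independent pieces in spherical shells. -/

namespace MeanFieldGas

/-! ### The Boltzmann factor on [0, ∞]. -/

section ExpNeg

/-- The function `a ↦ e^{-a}` on `[0, ∞]`. -/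
def expNeg (a : ℝ≥0∞) : ℝ≥0∞ := EReal.exp (-(a : EReal))

@[simp] lemma expNeg_zero : expNeg 0 = 1 := by simp [expNeg]

@[simp] lemma expNeg_top : expNeg ⊤ = 0 := by simp [expNeg]

lemma expNeg_add (a b : ℝ≥0∞) : expNeg (a + b) = expNeg a * expNeg b := by
  rw [expNeg, EReal.coe_ennreal_add, EReal.neg_add (Or.inl (by simp)) (Or.inr (by simp)),
    sub_eq_add_neg, EReal.exp_add]
  rfl

lemma expNeg_sum {ι : Type*} (s : Finset ι) (f : ι → ℝ≥0∞) :
    expNeg (∑ i ∈ s, f i) = ∏ i ∈ s, expNeg (f i) := by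
  classical
  induction s using Finset.induction_on with
  | empty => simp
  | insert i s hi ih => rw [Finset.sum_insert hi, Finset.prod_insert hi, expNeg_add, ih]

lemma expNeg_anti : Antitone expNeg := fun a b h ↦
  EReal.exp_monotone (EReal.neg_le_neg_iff.2 (by exact_mod_cast h))

lemma expNeg_le_one (a : ℝ≥0∞) : expNeg a ≤ 1 := by
  simpa using expNeg_anti (zero_le (a := a))

lemma expNeg_ne_top (a : ℝ≥0∞) : expNeg a ≠ ⊤ :=
  ne_top_of_le_ne_top ENNReal.one_ne_top (expNeg_le_one a)

lemma expNeg_ofReal {a : ℝ} (ha : 0 ≤ a) :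
    expNeg (ENNReal.ofReal a) = ENNReal.ofReal (Real.exp (-a)) := by
  rw [expNeg, EReal.coe_ennreal_ofReal, max_eq_left ha, ← EReal.coe_neg, EReal.exp_coe]

lemma expNeg_of_ne_top {a : ℝ≥0∞} (ha : a ≠ ⊤) :
    expNeg a = ENNReal.ofReal (Real.exp (-a.toReal)) := by
  rw [← expNeg_ofReal ENNReal.toReal_nonneg, ENNReal.ofReal_toReal ha]

lemma expNeg_pos {a : ℝ≥0∞} (ha : a ≠ ⊤) : 0 < expNeg a := by
  rw [expNeg_of_ne_top ha]
  exact ENNReal.ofReal_pos.2 (Real.exp_pos _)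

lemma continuous_expNeg : Continuous expNeg :=
  ENNReal.continuous_exp.comp (continuous_neg.comp continuous_coe_ennreal_ereal)

lemma measurable_expNeg : Measurable expNeg := continuous_expNeg.measurable

lemma one_le_expNeg_add (h : ℝ≥0∞) : 1 ≤ expNeg h + h := by
  rcases eq_or_ne h ⊤ with rfl | hh
  · simp
  · rw [expNeg_of_ne_top hh]
    nth_rw 2 [← ENNReal.ofReal_toReal hh]
    rw [← ENNReal.ofReal_add (Real.exp_pos _).le ENNReal.toReal_nonneg, ← ENNReal.ofReal_one]
    exact ENNReal.ofReal_le_ofReal (by linarith [Real.add_one_le_exp (-h.toReal)])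

/-- The 1-Lipschitz bound for e^{-a}, in a one-sided form without subtraction that allows infinite
energies. Two applications compare e^{-a} with e^{-b}. -/
lemma expNeg_le_add_of_le {a b h : ℝ≥0∞} (hab : a ≤ b + h) : expNeg b ≤ expNeg a + h :=
  calc expNeg b = expNeg b * 1 := (mul_one _).symm
    _ ≤ expNeg b * (expNeg h + h) := by gcongr; exact one_le_expNeg_add h
    _ = expNeg (b + h) + expNeg b * h := by rw [mul_add, expNeg_add]
    _ ≤ expNeg a + 1 * h := by
        gcongr
        · exact expNeg_anti hab
        · exact expNeg_le_one b
    _ = expNeg a + h := by rw [one_mul]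

end ExpNeg

/-! ### Product measures: splitting off a particle, permutations, densities. -/

section Product

variable {X : Type*} [MeasurableSpace X]

lemma measurePreserving_finCons (N : ℕ) (m : Measure X) [SigmaFinite m] :
    MeasurePreserving (fun p : X × (Fin N → X) ↦ (Fin.cons p.1 p.2 : Fin (N + 1) → X))
      (m.prod (Measure.pi fun _ ↦ m)) (Measure.pi fun _ ↦ m) := by
  have h := (measurePreserving_piFinSuccAbove (fun _ : Fin (N + 1) ↦ m) 0).symm
  convert! h using 1
  ext p i
  simp [MeasurableEquiv.piFinSuccAbove]

lemma measurePreserving_comp_swap {N : ℕ} (m : Measure X) [SigmaFinite m] (j : Fin (N + 1)) :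
    MeasurePreserving (fun x : Fin (N + 1) → X ↦ x ∘ Equiv.swap 0 j)
      (Measure.pi fun _ ↦ m) (Measure.pi fun _ ↦ m) := by
  have h := measurePreserving_piCongrLeft (fun _ : Fin (N + 1) ↦ m) (Equiv.swap 0 j)
  have h3 : (fun x : Fin (N + 1) → X ↦ x ∘ Equiv.swap 0 j) =
      MeasurableEquiv.piCongrLeft (fun _ : Fin (N + 1) ↦ X) (Equiv.swap 0 j) := by
    ext x i
    have h2 := Equiv.piCongrLeft_apply_apply (fun _ : Fin (N + 1) ↦ X) (Equiv.swap 0 j) x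
      (Equiv.swap 0 j i)
    rw [Equiv.swap_apply_self] at h2
    exact h2.symm
  rw [h3]
  exact h

lemma lintegral_pi_succ (N : ℕ) (m : Measure X) [SigmaFinite m] {F : (Fin (N + 1) → X) → ℝ≥0∞}
    (hF : Measurable F) :
    ∫⁻ x, F x ∂(Measure.pi fun _ ↦ m) =
      ∫⁻ u, ∫⁻ y : Fin N → X, F (Fin.cons u y) ∂(Measure.pi fun _ ↦ m) ∂m := by
  have h := measurePreserving_finCons N m
  rw [← h.lintegral_comp hF, lintegral_prod]
  exact (hF.comp h.measurable).aemeasurable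

lemma lintegral_pi_prod (N : ℕ) (m : Measure X) [SigmaFinite m] {f : Fin N → X → ℝ≥0∞}
    (hf : ∀ i, Measurable (f i)) :
    ∫⁻ x : Fin N → X, ∏ j, f j (x j) ∂(Measure.pi fun _ ↦ m) = ∏ j, ∫⁻ u, f j u ∂m := by
  induction N with
  | zero => simp
  | succ N ih =>
    have hm : Measurable fun x : Fin (N + 1) → X ↦ ∏ j, f j (x j) :=
      Finset.measurable_prod _ fun j _ ↦ (hf j).comp (measurable_pi_apply j)
    rw [lintegral_pi_succ N m hm]
    have h : ∀ u : X, ∫⁻ y : Fin N → X, ∏ j, f j ((Fin.cons u y : Fin (N + 1) → X) j)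
        ∂(Measure.pi fun _ ↦ m) = f 0 u * ∏ j : Fin N, ∫⁻ v, f j.succ v ∂m := by
      intro u
      have hm' : Measurable fun y : Fin N → X ↦ ∏ j, f j.succ (y j) :=
        Finset.measurable_prod _ fun j _ ↦ (hf j.succ).comp (measurable_pi_apply j)
      simp only [Fin.prod_univ_succ, Fin.cons_zero, Fin.cons_succ]
      rw [lintegral_const_mul _ hm', ih fun j ↦ hf j.succ]
    simp only [h]
    rw [lintegral_mul_const _ (hf 0), Fin.prod_univ_succ]

lemma pi_withDensity (N : ℕ) (m : Measure X) [SigmaFinite m] {f : X → ℝ≥0∞}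
    (hf : Measurable f) [SigmaFinite (m.withDensity f)] :
    Measure.pi (fun _ : Fin N ↦ m.withDensity f) =
      (Measure.pi fun _ ↦ m).withDensity fun x ↦ ∏ j, f (x j) := by
  refine (Measure.pi_eq fun s hs ↦ ?_)
  rw [withDensity_apply _ (MeasurableSet.univ_pi hs), ← lintegral_indicator
    (MeasurableSet.univ_pi hs)]
  have h : ∀ x : Fin N → X, (Set.univ.pi s).indicator (fun x ↦ ∏ j, f (x j)) x =
      ∏ j, (s j).indicator f (x j) := by
    intro x
    by_cases hx : x ∈ Set.univ.pi s
    · rw [Set.indicator_of_mem hx]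
      exact Finset.prod_congr rfl fun j _ ↦
        (Set.indicator_of_mem (hx j (Set.mem_univ j)) _).symm
    · rw [Set.indicator_of_notMem hx]
      simp only [Set.mem_univ_pi, not_forall] at hx
      obtain ⟨j, hj⟩ := hx
      exact (Finset.prod_eq_zero (Finset.mem_univ j) (Set.indicator_of_notMem hj _)).symm
  simp only [h]
  rw [lintegral_pi_prod N m fun j ↦ hf.indicator (hs j)]
  refine Finset.prod_congr rfl fun j _ ↦ ?_
  rw [withDensity_apply _ (hs j), lintegral_indicator (hs j)]

end Product

/-! ### Pair energies. -/

section PairSum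

variable {X : Type*}

/-- The sum of a kernel over the unordered pairs of points of a configuration. -/
def pairSum (G : X → X → ℝ≥0∞) {N : ℕ} (x : Fin N → X) : ℝ≥0∞ :=
  ∑ i, ∑ j, if i < j then G (x i) (x j) else 0

lemma pairSum_cons (G : X → X → ℝ≥0∞) {N : ℕ} (u : X) (y : Fin N → X) :
    pairSum G (Fin.cons u y : Fin (N + 1) → X) = ∑ j, G u (y j) + pairSum G y := by
  simp [pairSum, Fin.sum_univ_succ]

/-- Summing over ordered pairs removes the order of the indices. Invariance under permutations and
comparison with full double sums are read off from this form. -/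
lemma two_mul_pairSum {G : X → X → ℝ≥0∞} (hG : ∀ u v, G u v = G v u) {N : ℕ} (x : Fin N → X) :
    2 * pairSum G x = ∑ i, ∑ j, if i ≠ j then G (x i) (x j) else 0 := by
  have h : pairSum G x = ∑ i, ∑ j, if j < i then G (x i) (x j) else 0 := by
    rw [pairSum, Finset.sum_comm]
    exact Finset.sum_congr rfl fun i _ ↦ Finset.sum_congr rfl fun j _ ↦ by rw [hG]
  rw [two_mul]
  nth_rw 2 [h]
  rw [pairSum, ← Finset.sum_add_distrib]
  refine Finset.sum_congr rfl fun i _ ↦ ?_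
  rw [← Finset.sum_add_distrib]
  refine Finset.sum_congr rfl fun j _ ↦ ?_
  rcases lt_trichotomy i j with h | h | h
  · simp [h, h.not_gt, h.ne]
  · simp [h]
  · simp [h, h.not_gt, h.ne']

lemma pairSum_comp_perm {G : X → X → ℝ≥0∞} (hG : ∀ u v, G u v = G v u) {N : ℕ} (x : Fin N → X)
    (σ : Equiv.Perm (Fin N)) : pairSum G (x ∘ σ) = pairSum G x := by
  have h : 2 * pairSum G (x ∘ σ) = 2 * pairSum G x := by
    symm
    rw [two_mul_pairSum hG, two_mul_pairSum hG, ← Equiv.sum_comp σ]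
    refine Finset.sum_congr rfl fun i _ ↦ ?_
    rw [← Equiv.sum_comp σ]
    refine Finset.sum_congr rfl fun j _ ↦ ?_
    simp [σ.injective.eq_iff]
  exact (ENNReal.mul_right_inj (by simp) (by simp)).1 h

variable [MeasurableSpace X]

lemma measurable_pairSum {G : X → X → ℝ≥0∞} (hG : Measurable (Function.uncurry G)) (N : ℕ) :
    Measurable fun x : Fin N → X ↦ pairSum G x := by
  refine Finset.measurable_sum _ fun i _ ↦ Finset.measurable_sum _ fun j _ ↦ ?_
  split_ifs
  · have h : Measurable fun x : Fin N → X ↦ (x i, x j) :=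
      (measurable_pi_apply i).prodMk (measurable_pi_apply j)
    exact hG.comp h
  · exact measurable_const

lemma measurable_sum_kernel {G : X → X → ℝ≥0∞} (hG : Measurable (Function.uncurry G)) (N : ℕ) :
    Measurable fun p : X × (Fin N → X) ↦ ∑ j, G p.1 (p.2 j) :=
  Finset.measurable_sum _ fun j _ ↦
    hG.comp (measurable_fst.prodMk ((measurable_pi_apply j).comp measurable_snd))

lemma lintegral_pi_eval (N : ℕ) (μ : Measure X) [IsProbabilityMeasure μ] (j : Fin N)
    {f : X → ℝ≥0∞} (hf : Measurable f) :
    ∫⁻ x : Fin N → X, f (x j) ∂(Measure.pi fun _ ↦ μ) = ∫⁻ u, f u ∂μ :=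
  (measurePreserving_eval (fun _ : Fin N ↦ μ) j).lintegral_comp hf

/-- All pairs have the same mean. The induction splits off one particle, which adds N pairs, and
Pascal's rule counts them. -/
lemma lintegral_pairSum {G : X → X → ℝ≥0∞} (hG : Measurable (Function.uncurry G)) (N : ℕ)
    (μ : Measure X) [IsProbabilityMeasure μ] :
    ∫⁻ x : Fin N → X, pairSum G x ∂(Measure.pi fun _ ↦ μ) =
      (N.choose 2 : ℕ) * ∫⁻ u, ∫⁻ v, G u v ∂μ ∂μ := by
  induction N with
  | zero => simp [pairSum]
  | succ N ih =>
    rw [lintegral_pi_succ N μ (measurable_pairSum hG _)]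
    have h : ∀ u, ∫⁻ y : Fin N → X, pairSum G (Fin.cons u y : Fin (N + 1) → X)
        ∂(Measure.pi fun _ ↦ μ) =
        N * ∫⁻ v, G u v ∂μ + (N.choose 2 : ℕ) * ∫⁻ u, ∫⁻ v, G u v ∂μ ∂μ := by
      intro u
      have hu : Measurable (G u) := hG.comp measurable_prodMk_left
      simp only [pairSum_cons]
      have hm : ∀ j ∈ (Finset.univ : Finset (Fin N)), Measurable fun y : Fin N → X ↦ G u (y j) :=
        fun j _ ↦ hu.comp (measurable_pi_apply j)
      rw [lintegral_add_right _ (measurable_pairSum hG N), ih, lintegral_finsetSum _ hm]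
      simp [lintegral_pi_eval N μ _ hu]
    simp only [h]
    rw [lintegral_add_right _ measurable_const, lintegral_const_mul _ hG.lintegral_prod_right]
    simp only [lintegral_const, measure_univ, mul_one]
    rw [← add_mul, Nat.choose_succ_succ' N 1]
    simp

end PairSum

/-! ### Partition functions and the insertion of a particle. -/

section Gas

variable {X : Type*} [MeasurableSpace X]

/-- The partition function of `N` particles with pair energy `b G` and one-particle measure `m`. -/
def gasZ (G : X → X → ℝ≥0∞) (b : ℝ≥0∞) (N : ℕ) (m : Measure X) : ℝ≥0∞ :=
  ∫⁻ x : Fin N → X, expNeg (b * pairSum G x) ∂(Measure.pi fun _ ↦ m)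

/-- The partition function of `N` particles that interact with an additional particle at `u`. -/
def gasA (G : X → X → ℝ≥0∞) (b : ℝ≥0∞) (N : ℕ) (m : Measure X) (u : X) : ℝ≥0∞ :=
  ∫⁻ y : Fin N → X, expNeg (b * ∑ j, G u (y j)) * expNeg (b * pairSum G y) ∂(Measure.pi fun _ ↦ m)

variable {G : X → X → ℝ≥0∞} (b : ℝ≥0∞) (N : ℕ) (m : Measure X)

lemma measurable_gasWeight (hG : Measurable (Function.uncurry G)) :
    Measurable fun x : Fin N → X ↦ expNeg (b * pairSum G x) :=
  measurable_expNeg.comp ((measurable_pairSum hG N).const_mul b)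

lemma measurable_gasA_integrand (hG : Measurable (Function.uncurry G)) :
    Measurable fun p : X × (Fin N → X) ↦
      expNeg (b * ∑ j, G p.1 (p.2 j)) * expNeg (b * pairSum G p.2) :=
  (measurable_expNeg.comp ((measurable_sum_kernel hG N).const_mul b)).mul
    ((measurable_gasWeight b N hG).comp measurable_snd)

lemma measurable_sum_kernel_right (hG : Measurable (Function.uncurry G)) (u : X) :
    Measurable fun y : Fin N → X ↦ expNeg (b * ∑ j, G u (y j)) := by
  have hu : Measurable (G u) := hG.comp measurable_prodMk_left
  exact measurable_expNeg.comp ((Finset.measurable_sum _ fun j _ ↦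
    hu.comp (measurable_pi_apply j)).const_mul b)

lemma measurable_gasA [SigmaFinite m] (hG : Measurable (Function.uncurry G)) :
    Measurable (gasA G b N m) :=
  (measurable_gasA_integrand b N hG).lintegral_prod_right'

lemma gasA_le_gasZ (u : X) : gasA G b N m u ≤ gasZ G b N m :=
  lintegral_mono fun _ ↦ mul_le_of_le_one_left (zero_le) (expNeg_le_one _)

lemma gasZ_le [IsFiniteMeasure m] : gasZ G b N m ≤ m Set.univ ^ N :=
  calc gasZ G b N m ≤ ∫⁻ _ : Fin N → X, 1 ∂(Measure.pi fun _ ↦ m) :=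
        lintegral_mono fun _ ↦ expNeg_le_one _
    _ = m Set.univ ^ N := by simp [Measure.pi_univ]

lemma gasZ_ne_top [IsFiniteMeasure m] : gasZ G b N m ≠ ⊤ :=
  ne_top_of_le_ne_top (ENNReal.pow_ne_top (measure_ne_top m _)) (gasZ_le b N m)

/-- By exchangeability particle j may be swapped with particle 0, which is then integrated last.
This exhibits `gasA` as the unnormalised one-particle density of the gas with N + 1 particles. -/
lemma lintegral_eval_mul_gasWeight [SigmaFinite m] (hG : Measurable (Function.uncurry G))
    (hs : ∀ u v, G u v = G v u) {h : X → ℝ≥0∞} (hh : Measurable h) (j : Fin (N + 1)) :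
    ∫⁻ x : Fin (N + 1) → X, h (x j) * expNeg (b * pairSum G x) ∂(Measure.pi fun _ ↦ m) =
      ∫⁻ u, h u * gasA G b N m u ∂m := by
  have hmp := measurePreserving_comp_swap m j
  have hm : ∀ i, Measurable fun x : Fin (N + 1) → X ↦ h (x i) * expNeg (b * pairSum G x) :=
    fun i ↦ (hh.comp (measurable_pi_apply i)).mul (measurable_gasWeight b _ hG)
  have h1 : ∫⁻ x : Fin (N + 1) → X, h (x j) * expNeg (b * pairSum G x) ∂(Measure.pi fun _ ↦ m) =
      ∫⁻ x : Fin (N + 1) → X, h (x 0) * expNeg (b * pairSum G x) ∂(Measure.pi fun _ ↦ m) := by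
    rw [← hmp.lintegral_comp (hm j)]
    refine lintegral_congr fun x ↦ ?_
    rw [pairSum_comp_perm hs, Function.comp_apply, Equiv.swap_apply_right]
  rw [h1, lintegral_pi_succ N m (hm 0)]
  refine lintegral_congr fun u ↦ ?_
  have hu : Measurable fun y : Fin N → X ↦
      expNeg (b * ∑ j, G u (y j)) * expNeg (b * pairSum G y) :=
    (measurable_sum_kernel_right b N hG u).mul (measurable_gasWeight b N hG)
  rw [gasA, ← lintegral_const_mul _ hu]
  refine lintegral_congr fun y ↦ ?_
  rw [pairSum_cons, Fin.cons_zero, mul_add, expNeg_add]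

lemma lintegral_sum_mul_gasWeight [SigmaFinite m] (hG : Measurable (Function.uncurry G))
    (hs : ∀ u v, G u v = G v u) {h : X → ℝ≥0∞} (hh : Measurable h) :
    ∫⁻ x : Fin (N + 1) → X, (∑ j, h (x j)) * expNeg (b * pairSum G x) ∂(Measure.pi fun _ ↦ m) =
      (N + 1 : ℕ) * ∫⁻ u, h u * gasA G b N m u ∂m := by
  simp only [Finset.sum_mul]
  rw [lintegral_finsetSum]
  · simp [lintegral_eval_mul_gasWeight b N m hG hs hh]
  · exact fun j _ ↦ (hh.comp (measurable_pi_apply j)).mul (measurable_gasWeight b _ hG)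

lemma lintegral_gasA [SigmaFinite m] (hG : Measurable (Function.uncurry G)) :
    ∫⁻ u, gasA G b N m u ∂m = gasZ G b (N + 1) m := by
  rw [gasZ, lintegral_pi_succ N m (measurable_gasWeight b _ hG)]
  simp only [pairSum_cons, mul_add, expNeg_add]
  rfl

end Gas

/-! ### Jensen's inequality for the exponential. -/

section Jensen

variable {Ω : Type*} [MeasurableSpace Ω]

lemma ofReal_integral_le_lintegral_ofReal {Q : Measure Ω} {f : Ω → ℝ} (hf : Integrable f Q) :
    ENNReal.ofReal (∫ x, f x ∂Q) ≤ ∫⁻ x, ENNReal.ofReal (f x) ∂Q := by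
  refine ENNReal.ofReal_le_of_le_toReal ?_
  rw [integral_eq_lintegral_pos_part_sub_lintegral_neg_part hf]
  linarith [ENNReal.toReal_nonneg (a := ∫⁻ x, ENNReal.ofReal (-f x) ∂Q)]

/-- The tangent line of exp at -∫ a lies below exp. With the right side in [0, ∞] no integrability
of e^{-a} is required. -/
lemma exp_neg_integral_le_lintegral {Q : Measure Ω} [IsProbabilityMeasure Q] {a : Ω → ℝ}
    (ha : Integrable a Q) :
    ENNReal.ofReal (Real.exp (-∫ x, a x ∂Q)) ≤ ∫⁻ x, ENNReal.ofReal (Real.exp (-a x)) ∂Q := by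
  set A := ∫ x, a x ∂Q with hA
  have hi : Integrable (fun x ↦ Real.exp (-A) * (1 + A - a x)) Q :=
    ((integrable_const _).sub ha).const_mul _
  calc ENNReal.ofReal (Real.exp (-A))
      = ENNReal.ofReal (∫ x, Real.exp (-A) * (1 + A - a x) ∂Q) := by
        rw [integral_const_mul, integral_sub (integrable_const _) ha, ← hA]
        simp
    _ ≤ ∫⁻ x, ENNReal.ofReal (Real.exp (-A) * (1 + A - a x)) ∂Q :=
        ofReal_integral_le_lintegral_ofReal hi
    _ ≤ ∫⁻ x, ENNReal.ofReal (Real.exp (-a x)) ∂Q := by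
        refine lintegral_mono fun x ↦ ENNReal.ofReal_le_ofReal ?_
        have h := Real.add_one_le_exp (A - a x)
        calc Real.exp (-A) * (1 + A - a x) ≤ Real.exp (-A) * Real.exp (A - a x) := by
              gcongr; linarith
          _ = Real.exp (-a x) := by rw [← Real.exp_add]; ring_nf

end Jensen

/-! ### Variational lower bound for the partition function. -/

section LowerBound

variable {X : Type*} [MeasurableSpace X]

/-- The measure `e^r ν`. -/
def expDensity (ν : Measure X) (r : X → ℝ) : Measure X :=
  ν.withDensity fun x ↦ ENNReal.ofReal (Real.exp (r x))

instance (ν : Measure X) [SigmaFinite ν] (r : X → ℝ) : SigmaFinite (expDensity ν r) :=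
  SigmaFinite.withDensity_ofReal _

lemma measurable_ofReal_exp {r : X → ℝ} (hr : Measurable r) :
    Measurable fun x ↦ ENNReal.ofReal (Real.exp (r x)) :=
  (Real.measurable_exp.comp hr).ennreal_ofReal

lemma lintegral_expDensity (ν : Measure X) {r : X → ℝ} (hr : Measurable r) {f : X → ℝ≥0∞}
    (hf : Measurable f) :
    ∫⁻ x, f x ∂(expDensity ν r) = ∫⁻ x, ENNReal.ofReal (Real.exp (r x)) * f x ∂ν :=
  lintegral_withDensity_eq_lintegral_mul _ (measurable_ofReal_exp hr) hf

lemma expDensity_univ (ν : Measure X) (r : X → ℝ) :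
    expDensity ν r Set.univ = ∫⁻ x, ENNReal.ofReal (Real.exp (r x)) ∂ν := by
  rw [expDensity, withDensity_apply _ MeasurableSet.univ, Measure.restrict_univ]

/-- The Gibbs variational lower bound for the partition function. -/
lemma exp_neg_le_gasZ {G : X → X → ℝ≥0∞} (hG : Measurable (Function.uncurry G)) {ν μ : Measure X}
    [IsProbabilityMeasure ν] [IsProbabilityMeasure μ] (hac : μ ≪ ν)
    (hkl : Integrable (llr μ ν) μ) (hI : ∫⁻ u, ∫⁻ v, G u v ∂μ ∂μ ≠ ⊤) {r : X → ℝ}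
    (hrm : Measurable r) (hr : Integrable r μ) {b : ℝ} (hb : 0 ≤ b) (N : ℕ) :
    ENNReal.ofReal (Real.exp (-(b * (N.choose 2) * (∫⁻ u, ∫⁻ v, G u v ∂μ ∂μ).toReal +
      N * (∫ x, llr μ ν x ∂μ - ∫ x, r x ∂μ)))) ≤
      gasZ G (ENNReal.ofReal b) N (expDensity ν r) := by
  -- Where positive, the density of μ with respect to e^r ν is e^s. Hence Z is at least the mean of
  -- exp(-b pairSum - Σ s(x_j)) under the N-fold product of μ, and Jensen applies to this mean.
  set s : X → ℝ := fun x ↦ llr μ ν x - r x with hs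
  have hsm : Measurable s := (measurable_llr μ ν).sub hrm
  have hsi : Integrable s μ := hkl.sub hr
  set q : X → ℝ≥0∞ := fun x ↦ μ.rnDeriv ν x * ENNReal.ofReal (Real.exp (-r x)) with hq
  have hqm : Measurable q := (Measure.measurable_rnDeriv μ ν).mul (measurable_ofReal_exp hrm.neg)
  have hμq : μ = (expDensity ν r).withDensity q := by
    rw [expDensity, ← withDensity_mul _ (measurable_ofReal_exp hrm) hqm]
    conv_lhs => rw [← Measure.withDensity_rnDeriv_eq μ ν hac]
    congr 1
    ext x
    simp only [Pi.mul_apply, hq]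
    rw [mul_comm (μ.rnDeriv ν x), ← mul_assoc, ← ENNReal.ofReal_mul
      (Real.exp_pos _).le, ← Real.exp_add]
    simp
  have : SigmaFinite ((expDensity ν r).withDensity q) := hμq ▸ inferInstance
  have hpi : Measure.pi (fun _ : Fin N ↦ μ) =
      (Measure.pi fun _ : Fin N ↦ expDensity ν r).withDensity fun x ↦ ∏ j, q (x j) := by
    rw [← pi_withDensity N _ hqm]
    congr 1
    ext1 _
    exact hμq
  have hSm : Measurable fun x : Fin N → X ↦ ∏ j, ENNReal.ofReal (Real.exp (-s (x j))) :=
    Finset.measurable_prod _ fun j _ ↦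
      (measurable_ofReal_exp hsm.neg).comp (measurable_pi_apply j)
  have hQm : Measurable fun x : Fin N → X ↦ ∏ j, q (x j) :=
    Finset.measurable_prod _ fun j _ ↦ hqm.comp (measurable_pi_apply j)
  -- Equality holds where dμ/dν > 0. Where it vanishes the left side is 0, and there e^s is not the
  -- density.
  have hone : ∀ᵐ x ∂ν, ENNReal.ofReal (Real.exp (-s x)) * q x ≤ 1 := by
    filter_upwards [Measure.rnDeriv_lt_top μ ν] with x hx
    by_cases h0 : μ.rnDeriv ν x = 0
    · simp [hq, h0]
    · have hpos : 0 < (μ.rnDeriv ν x).toReal := ENNReal.toReal_pos h0 hx.ne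
      rw [hq]
      dsimp only
      nth_rw 1 [← ENNReal.ofReal_toReal hx.ne]
      rw [← ENNReal.ofReal_mul hpos.le, ← ENNReal.ofReal_mul (Real.exp_pos _).le,
        ← ENNReal.ofReal_one]
      refine ENNReal.ofReal_le_ofReal (le_of_eq ?_)
      rw [hs]
      simp only [llr_def]
      rw [neg_sub, Real.exp_sub, Real.exp_log hpos, Real.exp_neg]
      field_simp
  have hone' : ∀ᵐ x ∂(Measure.pi fun _ : Fin N ↦ expDensity ν r),
      ∀ j, ENNReal.ofReal (Real.exp (-s (x j))) * q (x j) ≤ 1 := by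
    rw [ae_all_iff]
    intro j
    have h1 : ∀ᵐ x ∂(expDensity ν r), ENNReal.ofReal (Real.exp (-s x)) * q x ≤ 1 :=
      (withDensity_absolutelyContinuous ν _).ae_le hone
    exact (Measure.tendsto_eval_ae_ae (μ := fun _ : Fin N ↦ expDensity ν r) (i := j)).eventually h1
  have hlower : ∫⁻ x : Fin N → X, expNeg (ENNReal.ofReal b * pairSum G x) *
      ∏ j, ENNReal.ofReal (Real.exp (-s (x j))) ∂(Measure.pi fun _ ↦ μ) ≤
      gasZ G (ENNReal.ofReal b) N (expDensity ν r) := by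
    have hPm : Measurable fun x : Fin N → X ↦ expNeg (ENNReal.ofReal b * pairSum G x) *
        ∏ j, ENNReal.ofReal (Real.exp (-s (x j))) := (measurable_gasWeight _ N hG).mul hSm
    rw [hpi, lintegral_withDensity_eq_lintegral_mul _ hQm hPm]
    refine lintegral_mono_ae ?_
    filter_upwards [hone'] with x hx
    calc (∏ j, q (x j)) * (expNeg (ENNReal.ofReal b * pairSum G x) *
          ∏ j, ENNReal.ofReal (Real.exp (-s (x j))))
        = expNeg (ENNReal.ofReal b * pairSum G x) *
          ∏ j, (ENNReal.ofReal (Real.exp (-s (x j))) * q (x j)) := by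
          rw [Finset.prod_mul_distrib (f := fun j ↦ ENNReal.ofReal (Real.exp (-s (x j))))
            (g := fun j ↦ q (x j))]
          rw [mul_comm, mul_assoc]
      _ ≤ expNeg (ENNReal.ofReal b * pairSum G x) * 1 := by
          gcongr
          exact Finset.prod_le_one' fun j _ ↦ hx j
      _ = _ := mul_one _
  refine le_trans ?_ hlower
  have hPint : ∫⁻ x : Fin N → X, pairSum G x ∂(Measure.pi fun _ ↦ μ) ≠ ⊤ := by
    rw [lintegral_pairSum hG N μ]
    exact ENNReal.mul_ne_top (by simp) hI
  have hPfin := ae_lt_top (measurable_pairSum hG N) hPint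
  have hPi : Integrable (fun x : Fin N → X ↦ (pairSum G x).toReal) (Measure.pi fun _ ↦ μ) :=
    integrable_toReal_of_lintegral_ne_top (measurable_pairSum hG N).aemeasurable hPint
  have hev : ∀ j : Fin N, Integrable (fun x : Fin N → X ↦ s (x j)) (Measure.pi fun _ ↦ μ) :=
    fun j ↦ (measurePreserving_eval (fun _ : Fin N ↦ μ) j).integrable_comp_of_integrable hsi
  have hevint : ∀ j : Fin N, ∫ x : Fin N → X, s (x j) ∂(Measure.pi fun _ ↦ μ) = ∫ u, s u ∂μ := by
    intro j
    have hp := measurePreserving_eval (fun _ : Fin N ↦ μ) j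
    have h1 := integral_map (f := s) (μ := Measure.pi fun _ : Fin N ↦ μ)
      hp.measurable.aemeasurable hsm.aestronglyMeasurable
    rw [hp.map_eq] at h1
    exact h1.symm
  have hai : Integrable (fun x : Fin N → X ↦ b * (pairSum G x).toReal + ∑ j, s (x j))
      (Measure.pi fun _ ↦ μ) :=
    (hPi.const_mul b).add (integrable_finsetSum _ fun j _ ↦ hev j)
  have hJ := exp_neg_integral_le_lintegral hai
  rw [integral_add (hPi.const_mul b) (integrable_finsetSum _ fun j _ ↦ hev j),
    integral_const_mul, integral_finsetSum _ fun j _ ↦ hev j] at hJ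
  simp only [hevint] at hJ
  rw [integral_toReal (measurable_pairSum hG N).aemeasurable hPfin, lintegral_pairSum hG N μ,
    ENNReal.toReal_mul, ENNReal.toReal_natCast] at hJ
  simp only [Finset.sum_const, Finset.card_univ, Fintype.card_fin, nsmul_eq_mul] at hJ
  have hsint : ∫ u, s u ∂μ = ∫ x, llr μ ν x ∂μ - ∫ x, r x ∂μ := integral_sub hkl hr
  rw [hsint, ← mul_assoc] at hJ
  refine hJ.trans (le_of_eq ?_)
  refine lintegral_congr_ae ?_
  filter_upwards [hPfin] with x hx
  rw [expNeg_of_ne_top (ENNReal.mul_ne_top ENNReal.ofReal_ne_top hx.ne), ENNReal.toReal_mul,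
    ENNReal.toReal_ofReal hb, ← ENNReal.ofReal_prod_of_nonneg fun j _ ↦ (Real.exp_pos _).le,
    ← ENNReal.ofReal_mul (Real.exp_pos _).le, ← Real.exp_sum, ← Real.exp_add,
    Finset.sum_neg_distrib]
  ring_nf

end LowerBound

/-! ### The Donsker-Varadhan formula for relative entropy. -/

section DonskerVaradhan

open InformationTheory

variable {X : Type*} [MeasurableSpace X]

/-- At s = e^t the expression is the nonnegative number e^t t - e^t + 1. Moving s away from e^t in
the direction of the sign of t can only increase s t. -/
lemma sub_exp_nonneg_of_between {s t : ℝ} (h : 0 ≤ t ∧ Real.exp t ≤ s ∨ t ≤ 0 ∧ s ≤ Real.exp t) :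
    0 ≤ s * t - Real.exp t + 1 := by
  have h1 : Real.exp t * t - Real.exp t + 1 ≥ 0 := by
    have h2 := Real.add_one_le_exp (-t)
    have h3 : Real.exp t * Real.exp (-t) = 1 := by rw [← Real.exp_add]; simp
    nlinarith [Real.exp_pos t]
  rcases h with ⟨h0, h2⟩ | ⟨h0, h2⟩ <;> nlinarith

/-- The logarithm truncated to `[-n, n]`, with the value `-n` at zero. -/
def clippedLog (n : ℕ) (s : ℝ) : ℝ := if s = 0 then -n else max (-n) (min n (Real.log s))

lemma abs_clippedLog_le (n : ℕ) (s : ℝ) : |clippedLog n s| ≤ n := by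
  have hn : (0 : ℝ) ≤ n := n.cast_nonneg
  unfold clippedLog
  split_ifs
  · simp
  · exact abs_le.2 ⟨le_max_left _ _, max_le (by linarith) (min_le_left _ _)⟩

lemma measurable_clippedLog (n : ℕ) : Measurable (clippedLog n) :=
  Measurable.ite (measurableSet_singleton 0) measurable_const
    (measurable_const.max (measurable_const.min Real.measurable_log))

lemma clippedLog_nonneg {n : ℕ} {s : ℝ} (hs : 0 ≤ s) :
    0 ≤ s * clippedLog n s - Real.exp (clippedLog n s) + 1 := by
  have hn : (0 : ℝ) ≤ n := n.cast_nonneg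
  unfold clippedLog
  split_ifs with h
  · rw [h]
    have : Real.exp (-(n : ℝ)) ≤ 1 := Real.exp_le_one_iff.2 (by linarith)
    linarith
  · have hs' : 0 < s := lt_of_le_of_ne hs (Ne.symm h)
    refine sub_exp_nonneg_of_between ?_
    rcases le_total 0 (Real.log s) with hl | hl
    · left
      rw [max_eq_right (by linarith [le_min hn hl])]
      exact ⟨le_min hn hl, (Real.exp_le_exp.2 (min_le_right _ _)).trans (Real.exp_log hs').le⟩
    · right
      rw [min_eq_right (by linarith)]
      exact ⟨max_le (by linarith) hl, (Real.exp_log hs').ge.trans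
        (Real.exp_le_exp.2 (le_max_right _ _))⟩

/-- The supremum over t of s t - e^t + 1 is `klFun s`, attained at t = log s. The clipped logarithms
are bounded test values that reach it: exactly from some n on if s > 0, in the limit if s = 0. -/
lemma tendsto_clippedLog {s : ℝ} (hs : 0 ≤ s) :
    Tendsto (fun n : ℕ ↦ s * clippedLog n s - Real.exp (clippedLog n s) + 1) atTop
      (𝓝 (klFun s)) := by
  rcases eq_or_ne s 0 with rfl | h
  · simp only [clippedLog, if_true, zero_mul, klFun_zero]
    have : Tendsto (fun n : ℕ ↦ Real.exp (-(n : ℝ))) atTop (𝓝 0) :=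
      Real.tendsto_exp_neg_atTop_nhds_zero.comp tendsto_natCast_atTop_atTop
    simpa using (this.const_sub 0).add_const 1
  · have hs' : 0 < s := lt_of_le_of_ne hs (Ne.symm h)
    refine tendsto_const_nhds.congr' ?_
    obtain ⟨m, hm⟩ := exists_nat_ge |Real.log s|
    filter_upwards [eventually_ge_atTop m] with n hn
    have hmn : (m : ℝ) ≤ n := by exact_mod_cast hn
    have h1 := abs_le.1 (hm.trans hmn)
    rw [clippedLog, if_neg h, min_eq_right h1.2, max_eq_right h1.1, Real.exp_log hs', klFun_apply]
    ring

variable {ρ ν : Measure X} [IsProbabilityMeasure ρ] [IsProbabilityMeasure ν]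

lemma integrable_of_abs_le {m : Measure X} [IsFiniteMeasure m] {f : X → ℝ} (hf : Measurable f)
    {R : ℝ} (hR : ∀ x, |f x| ≤ R) : Integrable f m :=
  Integrable.of_bound hf.aestronglyMeasurable R (ae_of_all _ hR)

lemma integrable_exp_of_abs_le {m : Measure X} [IsFiniteMeasure m] {f : X → ℝ} (hf : Measurable f)
    {R : ℝ} (hR : ∀ x, |f x| ≤ R) : Integrable (fun x ↦ Real.exp (f x)) m :=
  integrable_of_abs_le (Real.measurable_exp.comp hf) (R := Real.exp R) fun x ↦ by
    rw [abs_of_pos (Real.exp_pos _)]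
    exact Real.exp_le_exp.2 (abs_le.1 (hR x)).2

/-- Test with f the clipped logarithm of d = dρ/dν. As e^y ≥ y + 1, the hypothesis bounds ∫ (d f -
e^f + 1) dν by a. These integrands are nonnegative and tend to `klFun d`, so Fatou's lemma
concludes. -/
lemma klDiv_le_of_forall_exp_le {a : ℝ}
    (H : ∀ f : X → ℝ, Measurable f → (∃ R, ∀ x, |f x| ≤ R) →
      Real.exp (∫ x, f x ∂ρ - a) ≤ ∫ x, Real.exp (f x) ∂ν) :
    klDiv ρ ν ≤ ENNReal.ofReal a := by
  have hac : ρ ≪ ν := by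
    refine Measure.AbsolutelyContinuous.mk fun A hA hA0 ↦ ?_
    by_contra hne
    have hpos : 0 < ρ.real A := ENNReal.toReal_pos hne (measure_ne_top _ _)
    -- On a ν-null set A charged by ρ, this multiple of the indicator turns the hypothesis into e ≤
    -- 1.
    have h1 := H (A.indicator fun _ ↦ (a + 1) / ρ.real A) (measurable_const.indicator hA)
      ⟨|(a + 1) / ρ.real A|, fun x ↦ by
        by_cases hx : x ∈ A <;> simp [hx]⟩
    rw [integral_indicator_const _ hA, smul_eq_mul, mul_div_cancel₀ _ hpos.ne'] at h1
    have h2 : ∫ x, Real.exp (A.indicator (fun _ ↦ (a + 1) / ρ.real A) x) ∂ν = 1 := by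
      have h3 : ∀ᵐ x ∂ν, x ∉ A := measure_eq_zero_iff_ae_notMem.1 hA0
      rw [integral_congr_ae (g := fun _ ↦ (1 : ℝ))]
      · simp
      · filter_upwards [h3] with x hx
        simp [hx]
    rw [h2] at h1
    have h4 := Real.add_one_le_exp (a + 1 - a)
    linarith
  rw [klDiv_eq_lintegral_klFun_of_ac hac]
  set d : X → ℝ := fun x ↦ (ρ.rnDeriv ν x).toReal with hd
  have hdm : Measurable d := (Measure.measurable_rnDeriv ρ ν).ennreal_toReal
  have hd0 : ∀ x, 0 ≤ d x := fun x ↦ ENNReal.toReal_nonneg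
  have hdi : Integrable d ν := Measure.integrable_toReal_rnDeriv
  set F : ℕ → X → ℝ := fun n x ↦ d x * clippedLog n (d x) - Real.exp (clippedLog n (d x)) + 1
    with hF
  have hcm : ∀ n, Measurable fun x ↦ clippedLog n (d x) := fun n ↦ (measurable_clippedLog n).comp hdm
  have hFm : ∀ n, Measurable (F n) := fun n ↦
    ((hdm.mul (hcm n)).sub (Real.measurable_exp.comp (hcm n))).add_const 1
  have hlim : ∀ x, Tendsto (fun n ↦ ENNReal.ofReal (F n x)) atTop
      (𝓝 (ENNReal.ofReal (klFun (d x)))) := fun x ↦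
    (ENNReal.continuous_ofReal.tendsto _).comp (tendsto_clippedLog (hd0 x))
  have hbound : ∀ n, ∫⁻ x, ENNReal.ofReal (F n x) ∂ν ≤ ENNReal.ofReal a := by
    intro n
    have hi1 : Integrable (fun x ↦ d x * clippedLog n (d x)) ν :=
      hdi.mul_bdd (c := n) (hcm n).aestronglyMeasurable
        (ae_of_all _ fun x ↦ abs_clippedLog_le n _)
    have hi2 : Integrable (fun x ↦ Real.exp (clippedLog n (d x))) ν :=
      integrable_exp_of_abs_le (hcm n) fun x ↦ abs_clippedLog_le n _
    have hi : Integrable (F n) ν := (hi1.sub hi2).add (integrable_const 1)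
    rw [← ofReal_integral_eq_lintegral_ofReal hi (ae_of_all _ fun x ↦ clippedLog_nonneg (hd0 x))]
    refine ENNReal.ofReal_le_ofReal ?_
    have hsplit : ∫ x, F n x ∂ν =
        ∫ x, clippedLog n (d x) ∂ρ - ∫ x, Real.exp (clippedLog n (d x)) ∂ν + 1 := by
      have e1 := integral_add (hi1.sub hi2) (integrable_const (1 : ℝ))
      have e2 := integral_sub hi1 hi2
      simp only [Pi.sub_apply] at e1
      rw [e2, integral_toReal_rnDeriv_mul hac] at e1
      simpa using e1
    rw [hsplit]
    have h1 := H _ (hcm n) ⟨n, fun x ↦ abs_clippedLog_le n _⟩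
    have h2 := Real.add_one_le_exp (∫ x, clippedLog n (d x) ∂ρ - a)
    linarith
  calc ∫⁻ x, ENNReal.ofReal (klFun (d x)) ∂ν
      = ∫⁻ x, liminf (fun n ↦ ENNReal.ofReal (F n x)) atTop ∂ν :=
        lintegral_congr fun x ↦ (hlim x).liminf_eq.symm
    _ ≤ liminf (fun n ↦ ∫⁻ x, ENNReal.ofReal (F n x) ∂ν) atTop :=
        lintegral_liminf_le fun n ↦ (hFm n).ennreal_ofReal
    _ ≤ ENNReal.ofReal a :=
        liminf_le_of_le (by isBoundedDefault) fun b hb ↦ by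
          obtain ⟨n, hn⟩ := hb.exists
          exact hn.trans (hbound n)

variable [TopologicalSpace X] [TopologicalSpace.PseudoMetrizableSpace X] [BorelSpace X]

/-- The Donsker-Varadhan variational formula: the relative entropy is the supremum over bounded
continuous functions. -/
lemma exists_boundedContinuous_of_lt_klDiv {a : ℝ} (ha : ENNReal.ofReal a < klDiv ρ ν) :
    ∃ ψ : BoundedContinuousFunction X ℝ,
      ∫ x, Real.exp (ψ x) ∂ν < Real.exp (∫ x, ψ x ∂ρ - a) := by
  by_contra! hcon
  refine absurd (klDiv_le_of_forall_exp_le fun f hf hfb ↦ ?_) (not_le.2 ha)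
  obtain ⟨R, hR⟩ := hfb
  have hfi : Integrable f (ρ + ν) := integrable_of_abs_le hf hR
  -- Bounded continuous functions are dense in L¹(ρ + ν). Clipping the approximant to [-R, R] does
  -- not increase the error, and on this interval exp is Lipschitz with constant e^R.
  have key : ∀ ε : ℝ, 0 < ε → Real.exp (∫ x, f x ∂ρ - ε - a) ≤
      ∫ x, Real.exp (f x) ∂ν + Real.exp R * ε := by
    intro ε hε
    obtain ⟨g, hg, -⟩ := hfi.exists_boundedContinuous_integral_sub_le hε
    have hR0 : ∀ x, max (-R) (min R (g x)) = max (-R) (min R (g x)) := fun _ ↦ rfl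
    by_cases hne : Nonempty X
    swap
    · exfalso
      have : ρ Set.univ = 0 := by
        rw [Set.univ_eq_empty_iff.2 (not_nonempty_iff.1 hne), measure_empty]
      simp at this
    have hRnn : 0 ≤ R := (abs_nonneg _).trans (hR hne.some)
    have hb : ∀ x, |max (-R) (min R (g x))| ≤ R := fun x ↦
      abs_le.2 ⟨le_max_left _ _, max_le (by linarith) (min_le_left _ _)⟩
    set ψ : BoundedContinuousFunction X ℝ := BoundedContinuousFunction.ofNormedAddCommGroup
      (fun x ↦ max (-R) (min R (g x)))
      (continuous_const.max (continuous_const.min g.continuous)) R hb with hψ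
    have hψa : ∀ x, ψ x = max (-R) (min R (g x)) := fun x ↦ rfl
    have hdiff : ∀ x, |f x - ψ x| ≤ ‖f x - g x‖ := by
      intro x
      have h1 : f x = max (-R) (min R (f x)) := by
        rw [min_eq_right (abs_le.1 (hR x)).2, max_eq_right (abs_le.1 (hR x)).1]
      rw [hψa]
      nth_rw 1 [h1]
      calc |max (-R) (min R (f x)) - max (-R) (min R (g x))|
          ≤ |min R (f x) - min R (g x)| := by
            have := abs_max_sub_max_le_max (-R) (min R (f x)) (-R) (min R (g x))
            simpa using this
        _ ≤ |f x - g x| := by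
            have := abs_min_sub_min_le_max R (f x) R (g x)
            simpa using this
    have hψm : Measurable ψ := ψ.continuous.measurable
    have hint : Integrable (fun x ↦ ‖f x - g x‖) (ρ + ν) :=
      (hfi.sub (g.integrable _)).norm
    rw [integral_add_measure (hint.mono_measure (Measure.le_add_right le_rfl))
      (hint.mono_measure (Measure.le_add_left le_rfl))] at hg
    have hp1 : 0 ≤ ∫ x, ‖f x - g x‖ ∂ρ := integral_nonneg fun _ ↦ norm_nonneg _
    have hp2 : 0 ≤ ∫ x, ‖f x - g x‖ ∂ν := integral_nonneg fun _ ↦ norm_nonneg _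
    have hρ : ∫ x, f x ∂ρ - ε ≤ ∫ x, ψ x ∂ρ := by
      have h1 : ∫ x, (f x - ψ x) ∂ρ ≤ ∫ x, ‖f x - g x‖ ∂ρ :=
        integral_mono ((integrable_of_abs_le hf hR).sub (ψ.integrable _))
          (hint.mono_measure (Measure.le_add_right le_rfl))
          fun x ↦ (le_abs_self _).trans (hdiff x)
      rw [integral_sub (integrable_of_abs_le hf hR) (ψ.integrable _)] at h1
      linarith
    have hν : ∫ x, Real.exp (ψ x) ∂ν ≤ ∫ x, Real.exp (f x) ∂ν + Real.exp R * ε := by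
      have h1 : ∫ x, (Real.exp (ψ x) - Real.exp (f x)) ∂ν ≤
          ∫ x, Real.exp R * ‖f x - g x‖ ∂ν := by
        refine integral_mono ((integrable_exp_of_abs_le hψm hb).sub
          (integrable_exp_of_abs_le hf hR))
          ((hint.mono_measure (Measure.le_add_left le_rfl)).const_mul _) fun x ↦ ?_
        have h2 := Real.add_one_le_exp (f x - ψ x)
        have h3 : Real.exp (ψ x) * Real.exp (f x - ψ x) = Real.exp (f x) := by
          rw [← Real.exp_add]; ring_nf
        have h4 : Real.exp (ψ x) ≤ Real.exp R := Real.exp_le_exp.2 (abs_le.1 (hb x)).2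
        have h5 := hdiff x
        have h6 := neg_abs_le (f x - ψ x)
        have h7 := Real.exp_pos (ψ x)
        dsimp only
        calc Real.exp (ψ x) - Real.exp (f x)
            ≤ Real.exp (ψ x) * |f x - ψ x| := by nlinarith
          _ ≤ Real.exp R * ‖f x - g x‖ := by gcongr
      rw [integral_sub (integrable_exp_of_abs_le hψm hb) (integrable_exp_of_abs_le hf hR),
        integral_const_mul] at h1
      have h2 : Real.exp R * ∫ x, ‖f x - g x‖ ∂ν ≤ Real.exp R * ε := by
        gcongr; linarith
      linarith
    exact (Real.exp_le_exp.2 (by linarith)).trans ((hcon ψ).trans hν)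
  have hl : Tendsto (fun ε : ℝ ↦ Real.exp (∫ x, f x ∂ρ - ε - a)) (𝓝[>] 0)
      (𝓝 (Real.exp (∫ x, f x ∂ρ - 0 - a))) :=
    ((Real.continuous_exp.comp (by fun_prop)).tendsto (0 : ℝ)).mono_left nhdsWithin_le_nhds
  have hr : Tendsto (fun ε : ℝ ↦ ∫ x, Real.exp (f x) ∂ν + Real.exp R * ε) (𝓝[>] 0)
      (𝓝 (∫ x, Real.exp (f x) ∂ν + Real.exp R * 0)) :=
    ((by fun_prop : Continuous fun ε : ℝ ↦ ∫ x, Real.exp (f x) ∂ν + Real.exp R * ε).tendsto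
      (0 : ℝ)).mono_left nhdsWithin_le_nhds
  have := le_of_tendsto_of_tendsto hl hr (eventually_mem_nhdsWithin.mono fun ε hε ↦ key ε hε)
  simpa using this

end DonskerVaradhan

open InformationTheory

/-! ### The mean-field regime: hypotheses, finite energy, rate of the partition function. -/

section MeanField

variable {X : Type*} [MeasurableSpace X]

/-- The mean-field free energy with reference measure `ν` and nonnegative kernel `G`. -/
def meanFieldEnergy (γ : ℝ) (ν : Measure X) (G : X → X → ℝ≥0∞) (μ : ProbabilityMeasure X) :
    ℝ≥0∞ :=
  ENNReal.ofReal (γ / 2) * ∫⁻ u, ∫⁻ v, G u v ∂(μ : Measure X) ∂(μ : Measure X) +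
    klDiv (μ : Measure X) ν

/-- The properties of the reference measure, the weight and the nonnegative kernel on which the
mean-field limit relies. -/
structure MeanFieldKernel [TopologicalSpace X] (ν : Measure X) (ϑ : X → ℝ) (G : X → X → ℝ≥0∞) :
    Prop where
  theta_measurable : Measurable ϑ
  theta_nonneg : ∀ x, 0 ≤ ϑ x
  lintegral_exp : ∫⁻ x, ENNReal.ofReal (Real.exp (2 * ϑ x)) ∂ν ≠ ⊤
  measurable : Measurable (Function.uncurry G)
  symm : ∀ u v, G u v = G v u
  lintegral_le : ∃ C : ℝ≥0, ∀ u, ∫⁻ x, G u x ∂(expDensity ν ϑ) ≤ C * (1 + ENNReal.ofReal (ϑ u))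
  approx : ∀ u, ∀ ε : ℝ≥0∞, ε ≠ 0 → ∃ ψ : BoundedContinuousFunction X ℝ≥0, ∀ᶠ u' in 𝓝 u,
    ∃ h : X → ℝ≥0∞, Measurable h ∧ (∀ x, G u' x ≤ ψ x + h x) ∧ (∀ x, ψ x ≤ G u' x + h x) ∧
      ∫⁻ x, h x ∂(expDensity ν ϑ) ≤ ε
  lower : ∀ ρ : Measure X, IsProbabilityMeasure ρ → ρ ≪ ν →
    ∀ a < ∫⁻ u, ∫⁻ v, G u v ∂ρ ∂ρ, ∃ k : BoundedContinuousFunction (X × X) ℝ≥0,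
      (∀ u v, k (u, v) ≤ G u v) ∧ a < ∫⁻ u, ∫⁻ v, k (u, v) ∂ρ ∂ρ
  tight : ∀ ε : ℝ≥0∞, ε ≠ 0 → ∃ K : Set X, IsCompact K ∧ MeasurableSet K ∧
    expDensity ν ϑ Kᶜ ≤ ε

/-- Sequences of inverse temperatures and of perturbations of the potential in the mean-field
regime. -/
structure MeanFieldSequence (ν : Measure X) (ϑ : X → ℝ) (γ : ℝ) (b : ℕ → ℝ) (r : ℕ → X → ℝ) :
    Prop where
  nonneg : ∀ M, 0 ≤ b M
  tendsto : Tendsto (fun M : ℕ ↦ M * b M) atTop (𝓝 γ)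
  measurable : ∀ M, Measurable (r M)
  le : ∀ M x, r M x ≤ ϑ x
  abs_le : ∃ R : ℝ, ∀ M x, |r M x| ≤ ϑ x + R
  tendsto_zero : ∀ᵐ x ∂ν, Tendsto (fun M ↦ r M x) atTop (𝓝 0)

lemma MeanFieldSequence.tendsto_b {ν : Measure X} {ϑ : X → ℝ} {γ : ℝ} {b : ℕ → ℝ}
    {r : ℕ → X → ℝ} (h : MeanFieldSequence ν ϑ γ b r) : Tendsto b atTop (𝓝 0) := by
  have h1 := h.tendsto.mul (tendsto_one_div_atTop_nhds_zero_nat (𝕜 := ℝ))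
  rw [mul_zero] at h1
  refine h1.congr' ?_
  filter_upwards [eventually_gt_atTop 0] with M hM
  have : (M : ℝ) ≠ 0 := by positivity
  field_simp

/-- Taking one particle out of the gas with M + 1 particles leaves M particles at the parameters of
index M + 1. The product M b_{M+1} still tends to γ because b tends to 0. -/
lemma MeanFieldSequence.shift {ν : Measure X} {ϑ : X → ℝ} {γ : ℝ} {b : ℕ → ℝ}
    {r : ℕ → X → ℝ} (h : MeanFieldSequence ν ϑ γ b r) :
    MeanFieldSequence ν ϑ γ (fun M ↦ b (M + 1)) (fun M ↦ r (M + 1)) where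
  nonneg M := h.nonneg _
  tendsto := by
    have h1 := (h.tendsto.comp (tendsto_add_atTop_nat 1)).sub
      (h.tendsto_b.comp (tendsto_add_atTop_nat 1))
    rw [sub_zero] at h1
    refine h1.congr fun M ↦ ?_
    simp only [Function.comp_apply]
    push_cast
    ring
  measurable M := h.measurable _
  le M := h.le _
  abs_le := by
    obtain ⟨R, hR⟩ := h.abs_le
    exact ⟨R, fun M ↦ hR _⟩
  tendsto_zero := h.tendsto_zero.mono fun x hx ↦ hx.comp (tendsto_add_atTop_nat 1)

variable {ν : Measure X} [IsProbabilityMeasure ν] {ϑ : X → ℝ} {G : X → X → ℝ≥0∞} {γ : ℝ}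

lemma expDensity_mono (ν : Measure X) {r s : X → ℝ} (h : ∀ x, r x ≤ s x) :
    expDensity ν r ≤ expDensity ν s :=
  withDensity_mono (ae_of_all _ fun x ↦ ENNReal.ofReal_le_ofReal (Real.exp_le_exp.2 (h x)))

lemma le_expDensity (ν : Measure X) {r : X → ℝ} (h : ∀ x, 0 ≤ r x) : ν ≤ expDensity ν r := by
  have h1 := expDensity_mono ν (r := fun _ ↦ 0) h
  simpa [expDensity] using h1

lemma MeanFieldSequence.expDensity_le {b : ℕ → ℝ} {r : ℕ → X → ℝ}
    (h : MeanFieldSequence ν ϑ γ b r) (M : ℕ) : expDensity ν (r M) ≤ expDensity ν ϑ :=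
  expDensity_mono ν (h.le M)

section

variable [TopologicalSpace X]

lemma MeanFieldKernel.isFiniteMeasure (hK : MeanFieldKernel ν ϑ G) :
    IsFiniteMeasure (expDensity ν ϑ) := by
  refine ⟨?_⟩
  rw [expDensity_univ]
  refine lt_of_le_of_lt (lintegral_mono fun x ↦ ?_) hK.lintegral_exp.lt_top
  exact ENNReal.ofReal_le_ofReal (Real.exp_le_exp.2 (by linarith [hK.theta_nonneg x]))

lemma MeanFieldKernel.isFiniteMeasure_seq (hK : MeanFieldKernel ν ϑ G) {b : ℕ → ℝ}
    {r : ℕ → X → ℝ} (h : MeanFieldSequence ν ϑ γ b r) (M : ℕ) :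
    IsFiniteMeasure (expDensity ν (r M)) :=
  have := hK.isFiniteMeasure
  isFiniteMeasure_of_le _ (h.expDensity_le M)

lemma MeanFieldKernel.lintegral_theta (hK : MeanFieldKernel ν ϑ G) :
    ∫⁻ x, ENNReal.ofReal (ϑ x) ∂(expDensity ν ϑ) ≠ ⊤ := by
  rw [lintegral_expDensity ν hK.theta_measurable hK.theta_measurable.ennreal_ofReal]
  refine ne_top_of_le_ne_top hK.lintegral_exp (lintegral_mono fun x ↦ ?_)
  rw [← ENNReal.ofReal_mul (Real.exp_pos _).le]
  refine ENNReal.ofReal_le_ofReal ?_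
  rw [two_mul, Real.exp_add]
  gcongr
  linarith [Real.add_one_le_exp (ϑ x)]

lemma MeanFieldKernel.lintegral_kernel_ne_top (hK : MeanFieldKernel ν ϑ G) :
    ∫⁻ u, ∫⁻ v, G u v ∂(expDensity ν ϑ) ∂(expDensity ν ϑ) ≠ ⊤ := by
  obtain ⟨C, hC⟩ := hK.lintegral_le
  have := hK.isFiniteMeasure
  refine ne_top_of_le_ne_top ?_ (lintegral_mono hC)
  rw [lintegral_const_mul' _ _ ENNReal.coe_ne_top, lintegral_add_left measurable_const]
  refine ENNReal.mul_ne_top ENNReal.coe_ne_top (ENNReal.add_ne_top.2 ⟨?_, hK.lintegral_theta⟩)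
  simp

lemma MeanFieldKernel.lintegral_reference_ne_top (hK : MeanFieldKernel ν ϑ G) :
    ∫⁻ u, ∫⁻ v, G u v ∂ν ∂ν ≠ ⊤ := by
  refine ne_top_of_le_ne_top hK.lintegral_kernel_ne_top ?_
  have h := le_expDensity ν hK.theta_nonneg
  exact lintegral_mono' h fun u ↦ lintegral_mono' h le_rfl

end

/-- Young's inequality for the convex function `klFun` and its conjugate e^t - 1, with the term -1
dropped. -/
lemma mul_le_klFun_add_exp {s : ℝ} (hs : 0 ≤ s) (t : ℝ) : s * t ≤ klFun s + Real.exp t := by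
  rw [klFun_apply]
  rcases eq_or_lt_of_le hs with rfl | h
  · simp; positivity
  · have h1 := Real.add_one_le_exp (t - Real.log s)
    rw [Real.exp_sub, Real.exp_log h, le_div_iff₀ h] at h1
    nlinarith

/-- The entropy inequality: finite relative entropy turns exponential moments under ν into first
moments under μ. -/
lemma lintegral_ne_top_of_klDiv_ne_top {μ : Measure X} [IsProbabilityMeasure μ]
    (hkl : klDiv μ ν ≠ ⊤) {f : X → ℝ} (hf : Measurable f)
    (hexp : ∫⁻ x, ENNReal.ofReal (Real.exp (f x)) ∂ν ≠ ⊤) :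
    ∫⁻ x, ENNReal.ofReal (f x) ∂μ ≠ ⊤ := by
  have hac := (klDiv_ne_top_iff.1 hkl).1
  rw [klDiv_eq_lintegral_klFun_of_ac hac] at hkl
  rw [← lintegral_rnDeriv_mul hac hf.ennreal_ofReal.aemeasurable]
  refine ne_top_of_le_ne_top (ENNReal.add_ne_top.2 ⟨hkl, hexp⟩) ?_
  rw [← lintegral_add_right _ (measurable_ofReal_exp hf)]
  refine lintegral_mono_ae ?_
  filter_upwards [Measure.rnDeriv_lt_top μ ν] with x hx
  have h0 : 0 ≤ (μ.rnDeriv ν x).toReal := ENNReal.toReal_nonneg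
  nth_rw 1 [← ENNReal.ofReal_toReal hx.ne]
  rw [← ENNReal.ofReal_mul h0, ← ENNReal.ofReal_add (klFun_nonneg h0) (Real.exp_pos _).le]
  exact ENNReal.ofReal_le_ofReal (mul_le_klFun_add_exp h0 _)

/-- Finiteness properties of a minimizer of the mean-field free energy. -/
structure FiniteEnergy (γ : ℝ) (ν : Measure X) (ϑ : X → ℝ) (G : X → X → ℝ≥0∞) (μ : Measure X) :
    Prop where
  ac : μ ≪ ν
  integrable_llr : Integrable (llr μ ν) μ
  kernel : ∫⁻ u, ∫⁻ v, G u v ∂μ ∂μ ≠ ⊤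
  theta : Integrable ϑ μ

/-- The competitor ν has zero entropy and finite interaction energy, so the minimum is finite. -/
lemma MeanFieldKernel.finiteEnergy [TopologicalSpace X] (hK : MeanFieldKernel ν ϑ G) (hγ : 0 ≤ γ)
    {μ : ProbabilityMeasure X} (hμ : IsUniqueMinimizer (meanFieldEnergy γ ν G) μ) :
    FiniteEnergy γ ν ϑ G (μ : Measure X) := by
  set νP : ProbabilityMeasure X := ⟨ν, inferInstance⟩ with hνP
  have hle := hμ.1 νP
  have hν : meanFieldEnergy γ ν G νP = ENNReal.ofReal (γ / 2) * ∫⁻ u, ∫⁻ v, G u v ∂ν ∂ν := by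
    rw [meanFieldEnergy]
    have : ((νP : ProbabilityMeasure X) : Measure X) = ν := rfl
    rw [this, klDiv_self, add_zero]
  have htop : meanFieldEnergy γ ν G μ ≠ ⊤ := by
    refine ne_top_of_le_ne_top ?_ hle
    rw [hν]
    exact ENNReal.mul_ne_top ENNReal.ofReal_ne_top hK.lintegral_reference_ne_top
  rw [meanFieldEnergy, ENNReal.add_ne_top] at htop
  have hkl := klDiv_ne_top_iff.1 htop.2
  refine ⟨hkl.1, hkl.2, ?_, ?_⟩
  -- For γ = 0 the convention 0 · ∞ = 0 hides the kernel energy of μ. In that case the relative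
  -- entropy vanishes, so μ = ν.
  · rcases eq_or_lt_of_le hγ with h0 | h0
    · have h1 : klDiv (μ : Measure X) ν = 0 := by
        rw [hν, meanFieldEnergy, ← h0] at hle
        simpa using hle
      rw [klDiv_eq_zero_iff] at h1
      rw [h1]
      exact hK.lintegral_reference_ne_top
    · intro h
      apply htop.1
      rw [h, ENNReal.mul_top]
      simpa using h0
  · have h1 := lintegral_ne_top_of_klDiv_ne_top htop.2 hK.theta_measurable (f := ϑ) (by
      rw [← expDensity_univ]
      have := hK.isFiniteMeasure
      exact measure_ne_top _ _)
    refine ⟨hK.theta_measurable.aestronglyMeasurable, ?_⟩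
    rw [hasFiniteIntegral_iff_ofReal (ae_of_all _ hK.theta_nonneg)]
    exact h1.lt_top

/-- The real value of the mean-field free energy. -/
def energyValue (γ : ℝ) (ν : Measure X) (G : X → X → ℝ≥0∞) (μ : Measure X) : ℝ :=
  γ / 2 * (∫⁻ u, ∫⁻ v, G u v ∂μ ∂μ).toReal + ∫ x, llr μ ν x ∂μ

lemma meanFieldEnergy_eq_ofReal (hγ : 0 ≤ γ) {μ : ProbabilityMeasure X}
    (hf : FiniteEnergy γ ν ϑ G (μ : Measure X)) :
    meanFieldEnergy γ ν G μ = ENNReal.ofReal (energyValue γ ν G μ) := by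
  have h1 : 0 ≤ ∫ x, llr (μ : Measure X) ν x ∂(μ : Measure X) := by
    have := integral_llr_add_sub_measure_univ_nonneg hf.ac hf.integrable_llr
    simpa using this
  rw [meanFieldEnergy, klDiv_of_ac_of_integrable hf.ac hf.integrable_llr, energyValue,
    ENNReal.ofReal_add (by positivity) h1, ENNReal.ofReal_mul (by positivity),
    ENNReal.ofReal_toReal hf.kernel]
  simp

lemma MeanFieldSequence.tendsto_integral_zero {b : ℕ → ℝ} {r : ℕ → X → ℝ} {μ : Measure X}
    [IsProbabilityMeasure μ] (h : MeanFieldSequence ν ϑ γ b r) (hf : FiniteEnergy γ ν ϑ G μ) :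
    Tendsto (fun M ↦ ∫ x, r M x ∂μ) atTop (𝓝 0) := by
  obtain ⟨R, hR⟩ := h.abs_le
  have := tendsto_integral_of_dominated_convergence (μ := μ) (f := fun _ ↦ (0 : ℝ))
    (fun x ↦ ϑ x + R) (fun M ↦ (h.measurable M).aestronglyMeasurable)
    (hf.theta.add (integrable_const R)) (fun M ↦ ae_of_all _ (hR M))
    (hf.ac.ae_le h.tendsto_zero)
  simpa using this

lemma MeanFieldSequence.integrable {b : ℕ → ℝ} {r : ℕ → X → ℝ} {μ : Measure X}
    [IsProbabilityMeasure μ] (h : MeanFieldSequence ν ϑ γ b r) (hf : FiniteEnergy γ ν ϑ G μ)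
    (M : ℕ) : Integrable (r M) μ := by
  obtain ⟨R, hR⟩ := h.abs_le
  exact (hf.theta.add (integrable_const R)).mono' (h.measurable M).aestronglyMeasurable
    (ae_of_all _ (hR M))

/-- The exponent of the Jensen bound divided by M tends to minus the free energy: b M (M - 1) / 2
equals M (M b - b) / 2, and ∫ r dμ → 0 by dominated convergence. -/
lemma MeanFieldSequence.eventually_le_gasZ {b : ℕ → ℝ} {r : ℕ → X → ℝ} {μ : Measure X}
    [IsProbabilityMeasure μ] (h : MeanFieldSequence ν ϑ γ b r) (hf : FiniteEnergy γ ν ϑ G μ)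
    (hG : Measurable (Function.uncurry G)) {η : ℝ} (hη : 0 < η) :
    ∀ᶠ M : ℕ in atTop, ENNReal.ofReal (Real.exp (-(M * (energyValue γ ν G μ + η)))) ≤
      gasZ G (ENNReal.ofReal (b M)) M (expDensity ν (r M)) := by
  set I := (∫⁻ u, ∫⁻ v, G u v ∂μ ∂μ).toReal with hI
  have hlim : Tendsto (fun M : ℕ ↦ (M * b M - b M) / 2 * I +
      (∫ x, llr μ ν x ∂μ - ∫ x, r M x ∂μ)) atTop
      (𝓝 ((γ - 0) / 2 * I + (∫ x, llr μ ν x ∂μ - 0))) :=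
    (((h.tendsto.sub h.tendsto_b).div_const 2).mul_const I).add
      ((h.tendsto_integral_zero hf).const_sub _)
  have hlt : (γ - 0) / 2 * I + (∫ x, llr μ ν x ∂μ - 0) < energyValue γ ν G μ + η := by
    rw [energyValue]; simp only [sub_zero]; linarith
  filter_upwards [hlim.eventually_lt_const hlt] with M hM
  refine le_trans ?_ (exp_neg_le_gasZ hG hf.ac hf.integrable_llr hf.kernel (h.measurable M)
    (h.integrable hf M) (h.nonneg M) M)
  refine ENNReal.ofReal_le_ofReal (Real.exp_le_exp.2 (neg_le_neg ?_))
  rw [Nat.cast_choose_two, ← hI]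
  have hM0 : (0 : ℝ) ≤ M := M.cast_nonneg
  calc b M * (M * (M - 1) / 2) * I + M * (∫ x, llr μ ν x ∂μ - ∫ x, r M x ∂μ)
      = M * ((M * b M - b M) / 2 * I + (∫ x, llr μ ν x ∂μ - ∫ x, r M x ∂μ)) := by ring
    _ ≤ M * (energyValue γ ν G μ + η) := by gcongr

end MeanField

/-! ### Normalised Gibbs measures. -/

section GasMeasure

variable {X : Type*} [MeasurableSpace X]

/-- The Gibbs measure with pair energy `b G` and one-particle measure `m`. -/
def gasMeasure (G : X → X → ℝ≥0∞) (b : ℝ≥0∞) (N : ℕ) (m : Measure X) : Measure (Fin N → X) :=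
  (gasZ G b N m)⁻¹ •
    (Measure.pi fun _ ↦ m).withDensity fun x ↦ expNeg (b * pairSum G x)

variable {G : X → X → ℝ≥0∞} {b : ℝ≥0∞} {N : ℕ} {m : Measure X}

lemma isProbabilityMeasure_gasMeasure (h0 : gasZ G b N m ≠ 0) (ht : gasZ G b N m ≠ ⊤) :
    IsProbabilityMeasure (gasMeasure G b N m) := by
  refine ⟨?_⟩
  rw [gasMeasure, Measure.smul_apply, withDensity_apply _ MeasurableSet.univ,
    Measure.restrict_univ, smul_eq_mul]
  exact ENNReal.inv_mul_cancel h0 ht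

lemma lintegral_gasMeasure (hG : Measurable (Function.uncurry G)) {φ : (Fin N → X) → ℝ≥0∞}
    (hφ : Measurable φ) :
    ∫⁻ x, φ x ∂(gasMeasure G b N m) =
      (gasZ G b N m)⁻¹ * ∫⁻ x, φ x * expNeg (b * pairSum G x) ∂(Measure.pi fun _ ↦ m) := by
  rw [gasMeasure, lintegral_smul_measure,
    lintegral_withDensity_eq_lintegral_mul _ (measurable_gasWeight b N hG) hφ, smul_eq_mul]
  congr 1
  exact lintegral_congr fun x ↦ mul_comm _ _

end GasMeasure

open InformationTheory

/-! ### Exponential Chebyshev bounds. -/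

section Chernoff

variable {X : Type*} [MeasurableSpace X] {G : X → X → ℝ≥0∞}

/-- The double sum contains N diagonal terms that the pair energy lacks. Each is at most R, and the
loss N R is negligible against N². -/
lemma ofReal_le_two_mul_pairSum (hs : ∀ u v, G u v = G v u) {k : X → X → ℝ≥0}
    (hkG : ∀ u v, k u v ≤ G u v) {R : ℝ} (hR : ∀ u v, (k u v : ℝ) ≤ R) {N : ℕ} (x : Fin N → X)
    {t : ℝ} (ht : t + N * R ≤ ∑ i, ∑ j, (k (x i) (x j) : ℝ)) :
    ENNReal.ofReal t ≤ 2 * pairSum G x := by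
  have h1 : (((∑ i, ∑ j, if i ≠ j then k (x i) (x j) else 0 : ℝ≥0)) : ℝ≥0∞) ≤
      2 * pairSum G x := by
    rw [two_mul_pairSum hs]
    push_cast
    refine Finset.sum_le_sum fun i _ ↦ Finset.sum_le_sum fun j _ ↦ ?_
    split_ifs
    · exact hkG _ _
    · simp
  refine le_trans ?_ h1
  rw [ENNReal.ofReal_le_iff_le_toReal ENNReal.coe_ne_top, ENNReal.coe_toReal]
  push_cast
  have h2 : ∀ i, ∑ j, (k (x i) (x j) : ℝ) - R ≤
      ∑ j, ((if i ≠ j then k (x i) (x j) else 0 : ℝ≥0) : ℝ) := by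
    intro i
    rw [← Finset.add_sum_erase _ _ (Finset.mem_univ i),
      ← Finset.add_sum_erase (a := i) _ (fun j ↦ ((if i ≠ j then k (x i) (x j) else 0 : ℝ≥0) : ℝ))
        (Finset.mem_univ i)]
    have h3 : ∑ j ∈ Finset.univ.erase i, (k (x i) (x j) : ℝ) =
        ∑ j ∈ Finset.univ.erase i, ((if i ≠ j then k (x i) (x j) else 0 : ℝ≥0) : ℝ) :=
      Finset.sum_congr rfl fun j hj ↦ by rw [if_pos (Finset.ne_of_mem_erase hj).symm]
    rw [h3]
    have := hR (x i) (x i)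
    simp
    linarith
  have h4 := Finset.sum_le_sum fun i (_ : i ∈ Finset.univ) ↦ h2 i
  rw [Finset.sum_sub_distrib] at h4
  simp only [Finset.sum_const, Finset.card_univ, Fintype.card_fin, nsmul_eq_mul] at h4
  linarith

lemma expNeg_le_ofReal_exp {a : ℝ≥0∞} {t : ℝ} (h : ENNReal.ofReal t ≤ a) :
    expNeg a ≤ ENNReal.ofReal (Real.exp (-t)) := by
  rcases le_total 0 t with ht | ht
  · rw [← expNeg_ofReal ht]
    exact expNeg_anti h
  · refine (expNeg_le_one a).trans ?_
    rw [← ENNReal.ofReal_one]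
    exact ENNReal.ofReal_le_ofReal (Real.one_le_exp (by linarith))

/-- Configurations with large averages of a pair function and of a one-particle function. -/
def largeAverageSet (N : ℕ) (k : X → X → ℝ≥0) (ψ : X → ℝ) (a c : ℝ) : Set (Fin N → X) :=
  {x | N ^ 2 * a ≤ ∑ i, ∑ j, (k (x i) (x j) : ℝ) ∧ N * c ≤ ∑ j, ψ (x j)}

lemma measurable_sum_eval {N : ℕ} {ψ : X → ℝ} (hψ : Measurable ψ) :
    Measurable fun x : Fin N → X ↦ ∑ j, ψ (x j) :=
  Finset.measurable_sum _ fun j _ ↦ hψ.comp (measurable_pi_apply j)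

lemma measurableSet_largeAverageSet (N : ℕ) {k : X → X → ℝ≥0} {ψ : X → ℝ}
    (hk : Measurable (Function.uncurry k)) (hψ : Measurable ψ) (a c : ℝ) :
    MeasurableSet (largeAverageSet N k ψ a c) := by
  have h : Measurable fun x : Fin N → X ↦ ∑ i, ∑ j, (k (x i) (x j) : ℝ) := by
    refine Finset.measurable_sum _ fun i _ ↦ Finset.measurable_sum _ fun j _ ↦ ?_
    have h2 : Measurable fun x : Fin N → X ↦ (x i, x j) :=
      (measurable_pi_apply i).prodMk (measurable_pi_apply j)
    exact (hk.comp h2).coe_nnreal_real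
  exact (measurableSet_le measurable_const h).inter
    (measurableSet_le measurable_const (measurable_sum_eval hψ))

/-- On the event the pair weight is at most exp(-b (N² a - N R) / 2), and 1 ≤ e^{-N c} ∏ e^{ψ(x_j)}.
The product then integrates to an N-th power. -/
lemma setLIntegral_gasWeight_le (hs : ∀ u v, G u v = G v u) {k : X → X → ℝ≥0}
    (hkm : Measurable (Function.uncurry k)) (hkG : ∀ u v, k u v ≤ G u v) {R : ℝ}
    (hR : ∀ u v, (k u v : ℝ) ≤ R) {ψ : X → ℝ} (hψ : Measurable ψ) {b : ℝ} (hb : 0 ≤ b) (N : ℕ)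
    (m : Measure X) [SigmaFinite m] (a c : ℝ) :
    ∫⁻ x in largeAverageSet N k ψ a c, expNeg (ENNReal.ofReal b * pairSum G x)
      ∂(Measure.pi fun _ ↦ m) ≤
      ENNReal.ofReal (Real.exp (-(b / 2 * (N ^ 2 * a - N * R)) - N * c)) *
        (∫⁻ x, ENNReal.ofReal (Real.exp (ψ x)) ∂m) ^ N := by
  calc ∫⁻ x in largeAverageSet N k ψ a c, expNeg (ENNReal.ofReal b * pairSum G x)
        ∂(Measure.pi fun _ ↦ m)
      ≤ ∫⁻ x in largeAverageSet N k ψ a c,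
          ENNReal.ofReal (Real.exp (-(b / 2 * (N ^ 2 * a - N * R)) - N * c)) *
          ∏ j, ENNReal.ofReal (Real.exp (ψ (x j))) ∂(Measure.pi fun _ ↦ m) := by
        refine setLIntegral_mono' (measurableSet_largeAverageSet N hkm hψ a c) fun x hx ↦ ?_
        have h1 := ofReal_le_two_mul_pairSum hs hkG hR x (t := N ^ 2 * a - N * R)
          (by linarith [hx.1])
        have h2 : ENNReal.ofReal (b / 2 * (N ^ 2 * a - N * R)) ≤
            ENNReal.ofReal b * pairSum G x := by
          have h3 : pairSum G x = ENNReal.ofReal (1 / 2) * (2 * pairSum G x) := by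
            rw [← mul_assoc]
            have : ENNReal.ofReal (1 / 2) * 2 = 1 := by
              rw [← ENNReal.ofReal_ofNat 2, ← ENNReal.ofReal_mul (by norm_num)]
              norm_num
            rw [this, one_mul]
          rw [h3, ← mul_assoc, ← ENNReal.ofReal_mul hb, ENNReal.ofReal_mul (by positivity)]
          rw [mul_one_div]
          gcongr
        refine (expNeg_le_ofReal_exp h2).trans ?_
        rw [← ENNReal.ofReal_prod_of_nonneg fun j _ ↦ (Real.exp_pos _).le,
          ← ENNReal.ofReal_mul (Real.exp_pos _).le, ← Real.exp_sum, ← Real.exp_add]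
        exact ENNReal.ofReal_le_ofReal (Real.exp_le_exp.2 (by linarith [hx.2]))
    _ ≤ ∫⁻ x : Fin N → X, ENNReal.ofReal (Real.exp (-(b / 2 * (N ^ 2 * a - N * R)) - N * c)) *
          ∏ j, ENNReal.ofReal (Real.exp (ψ (x j))) ∂(Measure.pi fun _ ↦ m) :=
        setLIntegral_le_lintegral _ _
    _ = _ := by
        rw [lintegral_const_mul' _ _ ENNReal.ofReal_ne_top,
          lintegral_pi_prod N m fun _ ↦ measurable_ofReal_exp hψ]
        simp

/-- An event of rate F + 2η divided by a partition function of rate F + η leaves e^{-N η}. -/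
lemma gasMeasure_le {b : ℝ≥0∞} {N : ℕ} {m : Measure X} {F η : ℝ}
    (hZ : ENNReal.ofReal (Real.exp (-(N * (F + η)))) ≤ gasZ G b N m) {S : Set (Fin N → X)}
    (hS : MeasurableSet S)
    (h : ∫⁻ x in S, expNeg (b * pairSum G x) ∂(Measure.pi fun _ ↦ m) ≤
      ENNReal.ofReal (Real.exp (-(N * (F + 2 * η))))) :
    gasMeasure G b N m S ≤ ENNReal.ofReal (Real.exp (-(N * η))) := by
  rw [gasMeasure, Measure.smul_apply, withDensity_apply _ hS, smul_eq_mul]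
  calc (gasZ G b N m)⁻¹ * ∫⁻ x in S, expNeg (b * pairSum G x) ∂(Measure.pi fun _ ↦ m)
      ≤ (ENNReal.ofReal (Real.exp (-(N * (F + η)))))⁻¹ *
        ENNReal.ofReal (Real.exp (-(N * (F + 2 * η)))) := by
        gcongr
    _ = ENNReal.ofReal (Real.exp (-(N * η))) := by
        rw [← ENNReal.ofReal_inv_of_pos (Real.exp_pos _), ← Real.exp_neg,
          ← ENNReal.ofReal_mul (Real.exp_pos _).le, ← Real.exp_add]
        ring_nf

lemma tendsto_ofReal_exp_neg_mul {η : ℝ} (hη : 0 < η) :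
    Tendsto (fun N : ℕ ↦ ENNReal.ofReal (Real.exp (-(N * η)))) atTop (𝓝 0) := by
  rw [← ENNReal.ofReal_zero]
  exact (ENNReal.continuous_ofReal.tendsto _).comp (Real.tendsto_exp_neg_atTop_nhds_zero.comp
    (tendsto_natCast_atTop_atTop.atTop_mul_const hη))

end Chernoff

/-! ### Unlikely events of the gas and exponential tightness. -/

section LargeDeviation

variable {X : Type*} [MeasurableSpace X] {ν : Measure X} [IsProbabilityMeasure ν] {ϑ : X → ℝ}
  {G : X → X → ℝ≥0∞} {γ : ℝ} {b : ℕ → ℝ} {r : ℕ → X → ℝ} [TopologicalSpace X]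

lemma MeanFieldSequence.tendsto_lintegral_exp (h : MeanFieldSequence ν ϑ γ b r)
    (hK : MeanFieldKernel ν ϑ G) {ψ : X → ℝ} (hψ : Measurable ψ) {R : ℝ} (hR : ∀ x, |ψ x| ≤ R) :
    Tendsto (fun M ↦ ∫⁻ x, ENNReal.ofReal (Real.exp (ψ x)) ∂(expDensity ν (r M))) atTop
      (𝓝 (ENNReal.ofReal (∫ x, Real.exp (ψ x) ∂ν))) := by
  have hfin := hK.isFiniteMeasure
  rw [ofReal_integral_eq_lintegral_ofReal (integrable_exp_of_abs_le hψ hR)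
    (ae_of_all _ fun x ↦ (Real.exp_pos _).le)]
  have h1 : ∀ M, ∫⁻ x, ENNReal.ofReal (Real.exp (ψ x)) ∂(expDensity ν (r M)) =
      ∫⁻ x, ENNReal.ofReal (Real.exp (r M x)) * ENNReal.ofReal (Real.exp (ψ x)) ∂ν :=
    fun M ↦ lintegral_expDensity ν (h.measurable M) (measurable_ofReal_exp hψ)
  simp only [h1]
  refine tendsto_lintegral_of_dominated_convergence
    (fun x ↦ ENNReal.ofReal (Real.exp (ϑ x)) * ENNReal.ofReal (Real.exp R))
    (fun M ↦ (measurable_ofReal_exp (h.measurable M)).mul (measurable_ofReal_exp hψ))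
    (fun M ↦ ae_of_all _ fun x ↦ ?_) ?_ ?_
  · dsimp only
    gcongr
    · exact h.le M x
    · exact (_root_.abs_le.1 (hR x)).2
  · rw [lintegral_mul_const' _ _ ENNReal.ofReal_ne_top, ← expDensity_univ]
    exact ENNReal.mul_ne_top (measure_ne_top _ _) ENNReal.ofReal_ne_top
  · filter_upwards [h.tendsto_zero] with x hx
    have h2 : Tendsto (fun M ↦ ENNReal.ofReal (Real.exp (r M x))) atTop (𝓝 1) := by
      have h3 := (ENNReal.continuous_ofReal.comp Real.continuous_exp).tendsto 0 |>.comp hx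
      rw [Function.comp_apply, Real.exp_zero, ENNReal.ofReal_one] at h3
      exact h3
    simpa using ENNReal.Tendsto.mul_const h2 (Or.inr ENNReal.ofReal_ne_top)

/-- The Chebyshev bound has rate γ a / 2 + c - log ∫ e^ψ dν and the partition function has at most
the rate `energyValue`. The event is negligible as soon as the first is larger. -/
lemma MeanFieldSequence.tendsto_gasMeasure_largeAverageSet (h : MeanFieldSequence ν ϑ γ b r)
    (hK : MeanFieldKernel ν ϑ G) {μ : Measure X} [IsProbabilityMeasure μ]
    (hf : FiniteEnergy γ ν ϑ G μ) {k : X → X → ℝ≥0}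
    (hkm : Measurable (Function.uncurry k)) (hkG : ∀ u v, k u v ≤ G u v) {R : ℝ}
    (hR : ∀ u v, (k u v : ℝ) ≤ R) {ψ : X → ℝ} (hψ : Measurable ψ) {R' : ℝ}
    (hR' : ∀ x, |ψ x| ≤ R') {a c : ℝ}
    (hlt : energyValue γ ν G μ + Real.log (∫ x, Real.exp (ψ x) ∂ν) < γ / 2 * a + c) :
    Tendsto (fun M ↦ gasMeasure G (ENNReal.ofReal (b M)) M (expDensity ν (r M))
      (largeAverageSet M k ψ a c)) atTop (𝓝 0) := by
  set F := energyValue γ ν G μ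
  set L := Real.log (∫ x, Real.exp (ψ x) ∂ν) with hL
  -- A third of the gap. One η is spent on the partition function, η/2 on the convergence of ∫ e^ψ,
  -- η/2 on that of M b_M, and η remains as the rate of decay.
  obtain ⟨η, hη, hgap⟩ : ∃ η : ℝ, 0 < η ∧ F + L + 3 * η = γ / 2 * a + c :=
    ⟨(γ / 2 * a + c - F - L) / 3, by linarith, by ring⟩
  have hpos : 0 < ∫ x, Real.exp (ψ x) ∂ν := integral_exp_pos (integrable_exp_of_abs_le hψ hR')
  have h1 : ∀ᶠ M in atTop, ∫⁻ x, ENNReal.ofReal (Real.exp (ψ x)) ∂(expDensity ν (r M)) ≤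
      ENNReal.ofReal (Real.exp (L + η / 2)) := by
    refine (h.tendsto_lintegral_exp hK hψ hR').eventually_le_const ?_
    rw [ENNReal.ofReal_lt_ofReal_iff (Real.exp_pos _), ← Real.exp_log hpos, Real.exp_lt_exp]
    linarith
  have hlim : Tendsto (fun M : ℕ ↦ -((M * b M) / 2 * a - b M / 2 * R) - c) atTop
      (𝓝 (-(γ / 2 * a - 0 / 2 * R) - c)) :=
    ((((h.tendsto.div_const 2).mul_const a).sub ((h.tendsto_b.div_const 2).mul_const R)).neg).sub_const
      c
  have h2 := hlim.eventually_le_const (show -(γ / 2 * a - 0 / 2 * R) - c <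
    -(γ / 2 * a) - c + η / 2 by linarith)
  refine tendsto_of_tendsto_of_tendsto_of_le_of_le' tendsto_const_nhds
    (tendsto_ofReal_exp_neg_mul hη) (Eventually.of_forall fun _ ↦ zero_le) ?_
  filter_upwards [h1, h2, h.eventually_le_gasZ hf hK.measurable hη] with M hM1 hM2 hM3
  refine gasMeasure_le hM3 (measurableSet_largeAverageSet M hkm hψ a c)
    ((setLIntegral_gasWeight_le hK.symm hkm hkG hR hψ (h.nonneg M) M _ a c).trans ?_)
  calc ENNReal.ofReal (Real.exp (-(b M / 2 * (M ^ 2 * a - M * R)) - M * c)) *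
        (∫⁻ x, ENNReal.ofReal (Real.exp (ψ x)) ∂(expDensity ν (r M))) ^ M
      ≤ ENNReal.ofReal (Real.exp (M * (-(γ / 2 * a) - c + η / 2))) *
        (ENNReal.ofReal (Real.exp (L + η / 2))) ^ M := by
        gcongr
        have hM0 : (0 : ℝ) ≤ M := M.cast_nonneg
        calc -(b M / 2 * (M ^ 2 * a - M * R)) - M * c
            = M * (-((M * b M) / 2 * a - b M / 2 * R) - c) := by ring
          _ ≤ _ := by gcongr
    _ = ENNReal.ofReal (Real.exp (-(M * (F + 2 * η)))) := by
        rw [← ENNReal.ofReal_pow (Real.exp_pos _).le, ← Real.exp_nat_mul,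
          ← ENNReal.ofReal_mul (Real.exp_pos _).le, ← Real.exp_add]
        congr 2
        have : γ / 2 * a + c = F + L + 3 * η := hgap.symm
        linear_combination (-(M : ℝ)) * this

/-- C_i carries all but a tiny mass of e^ϑ ν. Chebyshev with a large multiple of the indicator of
its complement then beats the lower bound for Z, with enough to spare to sum over i. -/
lemma MeanFieldSequence.exists_tight (h : MeanFieldSequence ν ϑ γ b r)
    (hK : MeanFieldKernel ν ϑ G) {μ : Measure X} [IsProbabilityMeasure μ]
    (hf : FiniteEnergy γ ν ϑ G μ) :
    ∃ C : ℕ → Set X, (∀ i, IsCompact (C i)) ∧ (∀ i, MeasurableSet (C i)) ∧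
      Tendsto (fun M ↦ gasMeasure G (ENNReal.ofReal (b M)) M (expDensity ν (r M))
        {x | ∃ i : ℕ, M * (1 / (i + 1) : ℝ) ≤ ∑ j, (C i)ᶜ.indicator (fun _ ↦ (1 : ℝ)) (x j)})
        atTop (𝓝 0) := by
  set F := energyValue γ ν G μ with hF
  have hfin := hK.isFiniteMeasure
  set B : ℝ := (expDensity ν ϑ).real Set.univ + 1 with hB
  have hB0 : 0 < B := by positivity
  set Λ : ℝ := max 0 (F + 2 + Real.log B) with hΛ
  have hΛ0 : 0 ≤ Λ := le_max_left _ _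
  have hΛ1 : F + 2 + Real.log B ≤ Λ := le_max_right _ _
  -- Excess mass 1/(i+1) outside C_i gains the factor e^{-M t_i/(i+1)} = e^{-M (i+1+Λ)}. Here Λ
  -- absorbs the free energy and the power B^M, while e^{-M (i+1)} is summable in i.
  set t : ℕ → ℝ := fun i ↦ (i + 1) * (i + 1 + Λ) with ht
  choose C hCc hCm hC using fun i : ℕ ↦ hK.tight (ENNReal.ofReal (Real.exp (-(t i))))
    (ENNReal.ofReal_pos.2 (Real.exp_pos _)).ne'
  refine ⟨C, hCc, hCm, ?_⟩
  set ψ : ℕ → X → ℝ := fun i ↦ (C i)ᶜ.indicator fun _ ↦ t i with hψ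
  have hψm : ∀ i, Measurable (ψ i) := fun i ↦ measurable_const.indicator (hCm i).compl
  have hψint : ∀ i, ∫⁻ x, ENNReal.ofReal (Real.exp (ψ i x)) ∂(expDensity ν ϑ) ≤
      ENNReal.ofReal B := by
    intro i
    calc ∫⁻ x, ENNReal.ofReal (Real.exp (ψ i x)) ∂(expDensity ν ϑ)
        ≤ ∫⁻ x, (1 + (C i)ᶜ.indicator (fun _ ↦ ENNReal.ofReal (Real.exp (t i))) x)
          ∂(expDensity ν ϑ) := by
          refine lintegral_mono fun x ↦ ?_
          by_cases hx : x ∈ C i <;> simp [hψ, hx]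
      _ = expDensity ν ϑ Set.univ + ENNReal.ofReal (Real.exp (t i)) * expDensity ν ϑ (C i)ᶜ := by
          rw [lintegral_add_left measurable_const, lintegral_indicator_const (hCm i).compl]
          simp
      _ ≤ ENNReal.ofReal ((expDensity ν ϑ).real Set.univ) + ENNReal.ofReal (Real.exp (t i)) *
          ENNReal.ofReal (Real.exp (-(t i))) := by
          rw [ofReal_measureReal]
          gcongr
          exact hC i
      _ = ENNReal.ofReal B := by
          rw [← ENNReal.ofReal_mul (Real.exp_pos _).le, ← Real.exp_add, add_neg_cancel,
            Real.exp_zero, ← ENNReal.ofReal_add (by positivity) zero_le_one]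
  have hmeas : ∀ (M i : ℕ), MeasurableSet {x : Fin M → X | M * (1 / (i + 1) : ℝ) ≤
      ∑ j, (C i)ᶜ.indicator (fun _ ↦ (1 : ℝ)) (x j)} := fun M i ↦
    measurableSet_le measurable_const (measurable_sum_eval (measurable_const.indicator (hCm i).compl))
  have hone : ∀ (M i : ℕ), ∫⁻ x in {x : Fin M → X | M * (1 / (i + 1) : ℝ) ≤
      ∑ j, (C i)ᶜ.indicator (fun _ ↦ (1 : ℝ)) (x j)}, expNeg (ENNReal.ofReal (b M) * pairSum G x)
      ∂(Measure.pi fun _ ↦ expDensity ν (r M)) ≤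
      ENNReal.ofReal (Real.exp (-(M * (F + 2)))) * ENNReal.ofReal (Real.exp (-(M * (i + 1)))) := by
    intro M i
    have hti : 0 ≤ (i : ℝ) + 1 + Λ := by positivity
    have hsub : {x : Fin M → X | M * (1 / (i + 1) : ℝ) ≤
        ∑ j, (C i)ᶜ.indicator (fun _ ↦ (1 : ℝ)) (x j)} ⊆
        largeAverageSet M (fun _ _ ↦ 0) (ψ i) 0 (i + 1 + Λ) := by
      intro x hx
      refine ⟨by simp, ?_⟩
      have hx' : M * (1 / (i + 1) : ℝ) ≤ ∑ j, (C i)ᶜ.indicator (fun _ ↦ (1 : ℝ)) (x j) := hx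
      have h1 : ∑ j, ψ i (x j) = t i * ∑ j, (C i)ᶜ.indicator (fun _ ↦ (1 : ℝ)) (x j) := by
        rw [Finset.mul_sum]
        refine Finset.sum_congr rfl fun j _ ↦ ?_
        by_cases hj : x j ∈ C i <;> simp [hψ, hj]
      have h2 : 0 ≤ t i := by simp only [ht]; positivity
      calc (M : ℝ) * (i + 1 + Λ) = t i * (M * (1 / (i + 1) : ℝ)) := by
            simp only [ht]; field_simp
        _ ≤ ∑ j, ψ i (x j) := by rw [h1]; gcongr
    refine (lintegral_mono_set hsub).trans ((setLIntegral_gasWeight_le hK.symm (R := 0)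
      (by exact measurable_const) (fun _ _ ↦ by simp) (fun _ _ ↦ by simp) (hψm i) (h.nonneg M) M _
      0 (i + 1 + Λ)).trans ?_)
    calc _ ≤ ENNReal.ofReal (Real.exp (-(M * (i + 1 + Λ)))) * ENNReal.ofReal B ^ M := by
          gcongr
          · simp
          · exact (lintegral_mono' (h.expDensity_le M) le_rfl).trans (hψint i)
      _ ≤ _ := by
          rw [← ENNReal.ofReal_pow hB0.le, ← Real.exp_log hB0, ← Real.exp_nat_mul,
            ← ENNReal.ofReal_mul (Real.exp_pos _).le, ← Real.exp_add,
            ← ENNReal.ofReal_mul (Real.exp_pos _).le, ← Real.exp_add]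
          refine ENNReal.ofReal_le_ofReal (Real.exp_le_exp.2 ?_)
          have hM0 : (0 : ℝ) ≤ M := M.cast_nonneg
          nlinarith
  refine tendsto_of_tendsto_of_tendsto_of_le_of_le' tendsto_const_nhds
    (tendsto_ofReal_exp_neg_mul one_pos) (Eventually.of_forall fun _ ↦ zero_le) ?_
  filter_upwards [h.eventually_le_gasZ hf hK.measurable one_pos, eventually_ge_atTop 1]
    with M hM hM1
  have hU : {x : Fin M → X | ∃ i : ℕ, M * (1 / (i + 1) : ℝ) ≤
      ∑ j, (C i)ᶜ.indicator (fun _ ↦ (1 : ℝ)) (x j)} = ⋃ i : ℕ, {x | M * (1 / (i + 1) : ℝ) ≤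
      ∑ j, (C i)ᶜ.indicator (fun _ ↦ (1 : ℝ)) (x j)} := by
    ext x; simp
  rw [hU]
  refine gasMeasure_le hM (MeasurableSet.iUnion fun i ↦ hmeas M i) ?_
  refine (lintegral_iUnion_le _ _).trans ((ENNReal.tsum_le_tsum fun i ↦ hone M i).trans ?_)
  rw [ENNReal.tsum_mul_left, mul_one]
  refine mul_le_of_le_one_right zero_le ?_
  -- For M ≥ 1 the terms are at most 2^{-(i+1)}, because e ≥ 2, and these sum to 1.
  calc ∑' i : ℕ, ENNReal.ofReal (Real.exp (-(M * (i + 1))))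
      ≤ ∑' i : ℕ, (2⁻¹ : ℝ≥0∞) ^ (i + 1) := by
        refine ENNReal.tsum_le_tsum fun i ↦ ?_
        have h2 : (2⁻¹ : ℝ≥0∞) = ENNReal.ofReal (2⁻¹ : ℝ) := by
          rw [ENNReal.ofReal_inv_of_pos two_pos, ENNReal.ofReal_ofNat]
        rw [h2, ← ENNReal.ofReal_pow (by norm_num)]
        refine ENNReal.ofReal_le_ofReal ?_
        have h3 : (2 : ℝ) ≤ Real.exp 1 := by linarith [Real.add_one_le_exp (1 : ℝ)]
        have h4 : Real.exp (-1) ≤ 2⁻¹ := by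
          rw [Real.exp_neg]; exact inv_anti₀ two_pos h3
        have hM1' : (1 : ℝ) ≤ M := by exact_mod_cast hM1
        calc Real.exp (-(M * (i + 1))) ≤ Real.exp ((i + 1 : ℕ) * (-1)) := by
              refine Real.exp_le_exp.2 ?_
              push_cast
              nlinarith [(i.cast_nonneg : (0 : ℝ) ≤ i)]
          _ = Real.exp (-1) ^ (i + 1) := Real.exp_nat_mul _ _
          _ ≤ (2⁻¹ : ℝ) ^ (i + 1) := by gcongr
    _ = 1 := by
        rw [ENNReal.tsum_geometric_add_one, ENNReal.one_sub_inv_two, inv_inv]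
        exact ENNReal.inv_mul_cancel (by simp) (by simp)

end LargeDeviation

open InformationTheory

/-! ### Empirical measures. -/

section Empirical

variable {X : Type*} [MeasurableSpace X]

/-- The empirical measure of a configuration. -/
def empirical {N : ℕ} (x : Fin N → X) : Measure X :=
  (N : ℝ≥0∞)⁻¹ • ∑ j, Measure.dirac (x j)

lemma isProbabilityMeasure_empirical {N : ℕ} (hN : N ≠ 0) (x : Fin N → X) :
    IsProbabilityMeasure (empirical x) := by
  refine ⟨?_⟩
  simp only [empirical, Measure.smul_apply, Measure.finsetSum_apply, measure_univ,
    Finset.sum_const, Finset.card_univ, Fintype.card_fin, nsmul_eq_mul, mul_one, smul_eq_mul]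
  exact ENNReal.inv_mul_cancel (by exact_mod_cast hN) (by simp)

lemma integral_empirical {N : ℕ} (x : Fin N → X) {f : X → ℝ} (hf : Measurable f) :
    ∫ u, f u ∂(empirical x) = (∑ j, f (x j)) / N := by
  rw [empirical, integral_smul_measure, integral_finsetSum_measure]
  · simp [integral_dirac' _ _ hf.stronglyMeasurable, div_eq_inv_mul]
  · exact fun j _ ↦ integrable_dirac' hf.stronglyMeasurable (by simp)

lemma empirical_apply {N : ℕ} (x : Fin N → X) {S : Set X} (hS : MeasurableSet S) :
    empirical x S = ENNReal.ofReal ((∑ j, S.indicator (fun _ ↦ (1 : ℝ)) (x j)) / N) := by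
  have hm : Measurable (S.indicator fun _ ↦ (1 : ℝ)) := measurable_const.indicator hS
  rcases eq_or_ne N 0 with rfl | hN
  · simp [empirical]
  have := isProbabilityMeasure_empirical hN x
  rw [← integral_empirical x hm, integral_indicator_const _ hS, smul_eq_mul, mul_one,
    ofReal_measureReal]

end Empirical

/-! ### Concentration of the empirical measure at the minimizer. -/

section LawOfLargeNumbers

variable {X : Type*} [MeasurableSpace X] {ν : Measure X} [IsProbabilityMeasure ν] {ϑ : X → ℝ}
  {G : X → X → ℝ≥0∞} {γ : ℝ} {b : ℕ → ℝ} {r : ℕ → X → ℝ} [TopologicalSpace X]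
  [TopologicalSpace.PseudoMetrizableSpace X] [BorelSpace X]

/-- If no pair (k, ψ) separated ρ from μ, then the supremum over ψ would bound the entropy of ρ by
the Donsker-Varadhan formula, and the supremum over k ≤ G its full free energy. So ρ would be a
second minimizer. -/
lemma MeanFieldKernel.exists_separating (hK : MeanFieldKernel ν ϑ G) (hγ : 0 ≤ γ)
    {μ : ProbabilityMeasure X} (hμ : IsUniqueMinimizer (meanFieldEnergy γ ν G) μ)
    {ρ : ProbabilityMeasure X} (hne : ρ ≠ μ) :
    ∃ (k : BoundedContinuousFunction (X × X) ℝ≥0) (ψ : BoundedContinuousFunction X ℝ),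
      (∀ u v, k (u, v) ≤ G u v) ∧
      energyValue γ ν G μ + Real.log (∫ x, Real.exp (ψ x) ∂ν) <
        γ / 2 * (∫⁻ u, ∫⁻ v, k (u, v) ∂(ρ : Measure X) ∂(ρ : Measure X)).toReal +
          ∫ x, ψ x ∂(ρ : Measure X) := by
  have hf := hK.finiteEnergy hγ hμ
  set F := energyValue γ ν G μ with hF
  by_contra! hcon
  set E : BoundedContinuousFunction (X × X) ℝ≥0 → ℝ≥0∞ := fun k ↦
    ∫⁻ u, ∫⁻ v, k (u, v) ∂(ρ : Measure X) ∂(ρ : Measure X) with hE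
  have hEtop : ∀ k, E k ≠ ⊤ := by
    intro k
    have h1 : E k ≤ ∫⁻ _u, ∫⁻ _v, ((nndist k 0 : ℝ≥0) : ℝ≥0∞) ∂(ρ : Measure X) ∂(ρ : Measure X) :=
      lintegral_mono fun u ↦ lintegral_mono fun v ↦ by
        exact ENNReal.coe_le_coe.2 (BoundedContinuousFunction.NNReal.upper_bound k (u, v))
    exact ne_top_of_le_ne_top (by simp) h1
  have key : ∀ k : BoundedContinuousFunction (X × X) ℝ≥0, (∀ u v, k (u, v) ≤ G u v) →
      ENNReal.ofReal (γ / 2) * E k + klDiv (ρ : Measure X) ν ≤ ENNReal.ofReal F := by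
    intro k hk
    have h0 := hcon k 0 hk
    simp only [BoundedContinuousFunction.coe_zero, Pi.zero_apply, Real.exp_zero, integral_const,
      probReal_univ, smul_eq_mul, mul_one, Real.log_one, add_zero, mul_zero] at h0
    have hk1 : klDiv (ρ : Measure X) ν ≤ ENNReal.ofReal (F - γ / 2 * (E k).toReal) := by
      by_contra! hlt
      obtain ⟨ψ, hψ⟩ := exists_boundedContinuous_of_lt_klDiv hlt
      have h1 := hcon k ψ hk
      have hpos : 0 < ∫ x, Real.exp (ψ x) ∂ν := integral_exp_pos
        (integrable_exp_of_abs_le ψ.continuous.measurable (R := ‖ψ‖) ψ.norm_coe_le_norm)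
      rw [← Real.log_lt_iff_lt_exp hpos] at hψ
      linarith
    calc ENNReal.ofReal (γ / 2) * E k + klDiv (ρ : Measure X) ν
        ≤ ENNReal.ofReal (γ / 2 * (E k).toReal) + ENNReal.ofReal (F - γ / 2 * (E k).toReal) := by
          rw [ENNReal.ofReal_mul (by positivity), ENNReal.ofReal_toReal (hEtop k)]
          gcongr
      _ = ENNReal.ofReal F := by
          rw [← ENNReal.ofReal_add (by positivity) (by linarith)]
          ring_nf
  -- The choice k = 0 shows that ρ has finite entropy, hence ρ ≪ ν, as the approximation of G from
  -- below demands.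
  have hkl : klDiv (ρ : Measure X) ν ≠ ⊤ := by
    have h1 := key 0 (fun u v ↦ by simp)
    exact ne_top_of_le_ne_top ENNReal.ofReal_ne_top (le_trans le_add_self h1)
  have hle : meanFieldEnergy γ ν G ρ ≤ ENNReal.ofReal F := by
    rw [meanFieldEnergy]
    by_contra! hlt
    have h1 : ENNReal.ofReal F - klDiv (ρ : Measure X) ν <
        ENNReal.ofReal (γ / 2) * ∫⁻ u, ∫⁻ v, G u v ∂(ρ : Measure X) ∂(ρ : Measure X) :=
      ENNReal.sub_lt_of_lt_add (le_trans le_add_self (key 0 (fun u v ↦ by simp))) hlt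
    have hg0 : ENNReal.ofReal (γ / 2) ≠ 0 := by
      intro h
      rw [h, zero_mul] at h1
      exact not_lt_zero h1
    have h2 : (ENNReal.ofReal F - klDiv (ρ : Measure X) ν) / ENNReal.ofReal (γ / 2) <
        ∫⁻ u, ∫⁻ v, G u v ∂(ρ : Measure X) ∂(ρ : Measure X) := by
      rw [ENNReal.div_lt_iff (Or.inl hg0) (Or.inl ENNReal.ofReal_ne_top), mul_comm]
      exact h1
    obtain ⟨k, hk, hlt2⟩ := hK.lower ρ inferInstance (klDiv_ne_top_iff.1 hkl).1 _ h2
    rw [ENNReal.div_lt_iff (Or.inl hg0) (Or.inl ENNReal.ofReal_ne_top), mul_comm] at hlt2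
    have h3 := key k hk
    have h4 := ENNReal.le_sub_of_add_le_right hkl h3
    exact absurd hlt2 (not_lt.2 h4)
  refine hne (hμ.2 ρ fun ρ' ↦ ?_)
  rw [← meanFieldEnergy_eq_ofReal hγ hf] at hle
  exact hle.trans (hμ.1 ρ')

omit [TopologicalSpace.PseudoMetrizableSpace X] in
lemma continuous_integral_probabilityMeasure (f : BoundedContinuousFunction X ℝ) :
    Continuous fun ρ : ProbabilityMeasure X ↦ ∫ x, f x ∂(ρ : Measure X) :=
  continuous_iff_continuousAt.2 fun _ ↦
    ProbabilityMeasure.tendsto_iff_forall_integral_tendsto.1 tendsto_id f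

variable [SecondCountableTopology X]

/-- The empirical measures of a mean-field gas concentrate at the minimizer. -/
lemma MeanFieldSequence.tendsto_gasMeasure_deviation [T2Space X]
    (h : MeanFieldSequence ν ϑ γ b r)
    (hK : MeanFieldKernel ν ϑ G) (hγ : 0 ≤ γ) {μ : ProbabilityMeasure X}
    (hμ : IsUniqueMinimizer (meanFieldEnergy γ ν G) μ) (f : BoundedContinuousFunction X ℝ)
    {ε : ℝ} (hε : 0 < ε) :
    Tendsto (fun M ↦ gasMeasure G (ENNReal.ofReal (b M)) M (expDensity ν (r M))
      {x | ε ≤ |(∑ j, f (x j)) / M - ∫ x, f x ∂(μ : Measure X)|}) atTop (𝓝 0) := by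
  have hf := hK.finiteEnergy hγ hμ
  obtain ⟨C, hCc, hCm, hC⟩ := h.exists_tight hK hf
  -- Outside the unlikely event of `exists_tight` the empirical measure lies in 𝒦, which is compact
  -- by Prokhorov's theorem.
  set 𝒦 : Set (ProbabilityMeasure X) := {ρ | ∀ i, ρ (C i)ᶜ ≤ (1 / (i + 1) : ℝ≥0)} with h𝒦
  have h𝒦c : IsCompact 𝒦 := isCompact_setOfPred_probabilityMeasure_mass_eq_compl_isCompact_le
    tendsto_one_div_add_atTop_nhds_zero_nat hCc (Or.inl inferInstance)
  have hcont := continuous_integral_probabilityMeasure f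
  set A : Set (ProbabilityMeasure X) :=
    {ρ | ε ≤ |∫ x, f x ∂(ρ : Measure X) - ∫ x, f x ∂(μ : Measure X)|} with hA
  have hAclosed : IsClosed A := isClosed_le continuous_const ((hcont.sub continuous_const).abs)
  have hcompact : IsCompact (𝒦 ∩ A) := h𝒦c.inter_right hAclosed
  have hlocal : ∀ ρ ∈ 𝒦 ∩ A, ∃ (k : BoundedContinuousFunction (X × X) ℝ≥0)
      (ψ : BoundedContinuousFunction X ℝ) (a c : ℝ), (∀ u v, k (u, v) ≤ G u v) ∧
      energyValue γ ν G μ + Real.log (∫ x, Real.exp (ψ x) ∂ν) < γ / 2 * a + c ∧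
      a < (∫⁻ u, ∫⁻ v, k (u, v) ∂(ρ : Measure X) ∂(ρ : Measure X)).toReal ∧
      c < ∫ x, ψ x ∂(ρ : Measure X) := by
    intro ρ hρ
    have hne : ρ ≠ μ := by
      rintro rfl
      have : ε ≤ |∫ x, f x ∂(ρ : Measure X) - ∫ x, f x ∂(ρ : Measure X)| := hρ.2
      rw [sub_self, abs_zero] at this
      linarith
    obtain ⟨k, ψ, hk, hlt⟩ := hK.exists_separating hγ hμ hne
    set a := (∫⁻ u, ∫⁻ v, k (u, v) ∂(ρ : Measure X) ∂(ρ : Measure X)).toReal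
    set c := ∫ x, ψ x ∂(ρ : Measure X)
    set g := γ / 2 * a + c - (energyValue γ ν G μ + Real.log (∫ x, Real.exp (ψ x) ∂ν)) with hg
    have hg0 : 0 < g := by linarith
    -- Lowering both thresholds by δ costs (γ/2 + 1) δ = g/2, so the strict inequality survives
    -- while the values at ρ exceed the thresholds strictly.
    set δ := g / (2 * (γ / 2 + 1)) with hδ
    have hδ0 : 0 < δ := by positivity
    have hδ1 : (γ / 2 + 1) * δ = g / 2 := by rw [hδ]; field_simp
    exact ⟨k, ψ, a - δ, c - δ, hk, by linarith, by linarith, by linarith⟩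
  choose! k ψ a c hk hlt ha hc using hlocal
  -- Both conditions are open in ρ', the first through weak continuity of ρ' ↦ ρ' ⊗ ρ'. If the
  -- empirical measure of x lies in O ρ, then x lies in the corresponding `largeAverageSet`.
  set O : ProbabilityMeasure X → Set (ProbabilityMeasure X) := fun ρ ↦
    {ρ' | a ρ < ∫ z, ((k ρ z : ℝ≥0) : ℝ) ∂((ρ'.prod ρ' : ProbabilityMeasure (X × X)) :
      Measure (X × X))} ∩ {ρ' | c ρ < ∫ x, ψ ρ x ∂(ρ' : Measure X)} with hO
  have hkint : ∀ (κ : BoundedContinuousFunction (X × X) ℝ≥0) (ρ' : Measure X)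
      [IsProbabilityMeasure ρ'],
      ∫ z, ((κ z : ℝ≥0) : ℝ) ∂(ρ'.prod ρ') = (∫⁻ u, ∫⁻ v, κ (u, v) ∂ρ' ∂ρ').toReal := by
    intro κ ρ' _
    rw [← BoundedContinuousFunction.toReal_lintegral_coe_eq_integral, lintegral_prod]
    exact κ.measurable_coe_ennreal_comp.aemeasurable
  have hkb : ∀ (κ : BoundedContinuousFunction (X × X) ℝ≥0) (z : X × X),
      ((κ z : ℝ≥0) : ℝ) ≤ nndist κ 0 := fun κ z ↦ by
    exact_mod_cast BoundedContinuousFunction.NNReal.upper_bound κ z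
  set kR : ProbabilityMeasure X → BoundedContinuousFunction (X × X) ℝ := fun ρ ↦
    BoundedContinuousFunction.ofNormedAddCommGroup (fun z ↦ ((k ρ z : ℝ≥0) : ℝ))
      (NNReal.continuous_coe.comp (k ρ).continuous) (nndist (k ρ) 0) (fun z ↦ by
        rw [Real.norm_of_nonneg (NNReal.coe_nonneg _)]; exact hkb _ z) with hkR
  have hOopen : ∀ ρ, IsOpen (O ρ) := by
    intro ρ
    refine IsOpen.inter (isOpen_lt continuous_const ?_)
      (isOpen_lt continuous_const (continuous_integral_probabilityMeasure (ψ ρ)))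
    exact (continuous_integral_probabilityMeasure (kR ρ)).comp
      (ProbabilityMeasure.continuous_prod.comp (continuous_id.prodMk continuous_id))
  have hOmem : ∀ ρ ∈ 𝒦 ∩ A, O ρ ∈ 𝓝 ρ := by
    intro ρ hρ
    refine (hOopen ρ).mem_nhds ⟨?_, hc ρ hρ⟩
    have h1 := ha ρ hρ
    rw [← hkint (k ρ) ρ] at h1
    exact h1
  obtain ⟨t, htA, htcover⟩ := hcompact.elim_nhds_subcover O hOmem
  have hsum : Tendsto (fun M ↦ gasMeasure G (ENNReal.ofReal (b M)) M (expDensity ν (r M))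
        {x | ∃ i : ℕ, M * (1 / (i + 1) : ℝ) ≤ ∑ j, (C i)ᶜ.indicator (fun _ ↦ (1 : ℝ)) (x j)} +
      ∑ ρ ∈ t, gasMeasure G (ENNReal.ofReal (b M)) M (expDensity ν (r M))
        (largeAverageSet M (fun u v ↦ k ρ (u, v)) (ψ ρ) (a ρ) (c ρ))) atTop (𝓝 (0 + ∑ ρ ∈ t, 0)) := by
    refine hC.add (tendsto_finsetSum _ fun ρ hρ ↦ ?_)
    exact h.tendsto_gasMeasure_largeAverageSet hK hf (k := fun u v ↦ k ρ (u, v)) (k ρ).continuous.measurable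
      (hk ρ (htA ρ hρ)) (fun u v ↦ hkb (k ρ) (u, v)) (ψ ρ).continuous.measurable
      (R' := ‖ψ ρ‖) (ψ ρ).norm_coe_le_norm (hlt ρ (htA ρ hρ))
  simp only [Finset.sum_const_zero, add_zero] at hsum
  refine tendsto_of_tendsto_of_tendsto_of_le_of_le' tendsto_const_nhds hsum
    (Eventually.of_forall fun _ ↦ zero_le) ?_
  filter_upwards [eventually_gt_atTop 0] with M hM
  have hM0 : (0 : ℝ) < M := by exact_mod_cast hM
  refine le_trans (measure_mono ?_) ((measure_union_le _ _).trans
    (add_le_add_right (measure_biUnion_finset_le t _) _))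
  intro x hx
  have hprob := isProbabilityMeasure_empirical hM.ne' x
  set L : ProbabilityMeasure X := ⟨empirical x, hprob⟩ with hL
  have hLA : L ∈ A := by
    have h1 : ∫ u, f u ∂(L : Measure X) = (∑ j, f (x j)) / M :=
      integral_empirical x f.continuous.measurable
    simp only [hA, Set.mem_ofPred_eq, h1]
    exact hx
  by_cases hLK : L ∈ 𝒦
  · right
    obtain ⟨ρ, hρ, hLO⟩ := Set.mem_iUnion₂.1 (htcover ⟨hLK, hLA⟩)
    refine Set.mem_iUnion₂.2 ⟨ρ, hρ, ?_, ?_⟩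
    · have h1 : a ρ < ∫ z, ((k ρ z : ℝ≥0) : ℝ) ∂((empirical x).prod (empirical x)) := hLO.1
      have h2 : ∫ z, ((k ρ z : ℝ≥0) : ℝ) ∂((empirical x).prod (empirical x)) =
          (∑ i, (∑ j, (k ρ (x i, x j) : ℝ)) / M) / M := by
        have hkm : Measurable fun z ↦ ((k ρ z : ℝ≥0) : ℝ) :=
          (NNReal.continuous_coe.comp (k ρ).continuous).measurable
        have hki : Integrable (fun z ↦ ((k ρ z : ℝ≥0) : ℝ)) ((empirical x).prod (empirical x)) :=
          (kR ρ).integrable _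
        rw [integral_prod _ hki]
        have h3 : ∀ u, ∫ v, ((k ρ (u, v) : ℝ≥0) : ℝ) ∂(empirical x) =
            (∑ j, (k ρ (u, x j) : ℝ)) / M := fun u ↦
          integral_empirical x (hkm.comp measurable_prodMk_left)
        simp only [h3]
        refine integral_empirical x (f := fun u ↦ (∑ j, (k ρ (u, x j) : ℝ)) / M) ?_
        exact (Finset.measurable_sum _ fun j _ ↦ hkm.comp measurable_prodMk_right).div_const _
      rw [h2, ← Finset.sum_div, div_div, lt_div_iff₀ (by positivity)] at h1
      have h4 : (M : ℝ) ^ 2 * a ρ = a ρ * (M * M) := by ring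
      rw [h4]
      exact h1.le
    · have h1 : c ρ < ∫ u, ψ ρ u ∂(empirical x) := hLO.2
      rw [integral_empirical x (ψ ρ).continuous.measurable, lt_div_iff₀ hM0] at h1
      rw [mul_comm]
      exact h1.le
  · left
    simp only [h𝒦, Set.mem_ofPred_eq, not_forall, not_le] at hLK
    obtain ⟨i, hi⟩ := hLK
    refine ⟨i, ?_⟩
    have h1 : ((1 / (i + 1) : ℝ≥0) : ℝ≥0∞) < empirical x (C i)ᶜ := by
      rw [← ENNReal.coe_lt_coe] at hi
      rwa [ProbabilityMeasure.ennreal_coeFn_eq_coeFn_toMeasure] at hi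
    rw [empirical_apply x (hCm i).compl] at h1
    have h2 : ((1 / (i + 1) : ℝ≥0) : ℝ) <
        (∑ j, (C i)ᶜ.indicator (fun _ ↦ (1 : ℝ)) (x j)) / M := by
      by_contra! hcon
      refine absurd h1 (not_lt.2 ?_)
      rw [ENNReal.ofReal_le_iff_le_toReal ENNReal.coe_ne_top]
      exact hcon
    rw [lt_div_iff₀ hM0] at h2
    push_cast at h2
    rw [mul_comm]
    exact h2.le

/-- The law of large numbers for bounded continuous statistics of a mean-field gas. -/
lemma MeanFieldSequence.tendsto_lintegral_deviation [T2Space X]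
    (h : MeanFieldSequence ν ϑ γ b r)
    (hK : MeanFieldKernel ν ϑ G) (hγ : 0 ≤ γ) {μ : ProbabilityMeasure X}
    (hμ : IsUniqueMinimizer (meanFieldEnergy γ ν G) μ) (f : BoundedContinuousFunction X ℝ) :
    Tendsto (fun M ↦ ∫⁻ x, ENNReal.ofReal |(∑ j, f (x j)) / M - ∫ x, f x ∂(μ : Measure X)|
      ∂(gasMeasure G (ENNReal.ofReal (b M)) M (expDensity ν (r M)))) atTop (𝓝 0) := by
  have hf := hK.finiteEnergy hγ hμ
  rw [ENNReal.tendsto_nhds_zero]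
  intro ε hε
  obtain ⟨δ, hδ0, hδε⟩ : ∃ δ : ℝ, 0 < δ ∧ ENNReal.ofReal δ ≤ ε / 2 := by
    rcases eq_or_ne ε ⊤ with rfl | hεt
    · exact ⟨1, one_pos, by simp [ENNReal.top_div]⟩
    · have h2 : ε / 2 ≠ ⊤ := (ENNReal.half_lt_self hε.ne' hεt).ne_top
      exact ⟨(ε / 2).toReal, ENNReal.toReal_pos (ENNReal.half_pos hε.ne').ne' h2,
        (ENNReal.ofReal_toReal h2).le⟩
  have hd := h.tendsto_gasMeasure_deviation hK hγ hμ f hδ0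
  have hd2 := ENNReal.Tendsto.const_mul (a := ENNReal.ofReal (2 * ‖f‖)) hd
    (Or.inr ENNReal.ofReal_ne_top)
  rw [mul_zero] at hd2
  filter_upwards [h.eventually_le_gasZ hf hK.measurable one_pos,
    hd2.eventually_le_const (ENNReal.half_pos hε.ne'), eventually_gt_atTop 0] with M hZ hM2 hM
  have hM0 : (0 : ℝ) < M := by exact_mod_cast hM
  have hfin := hK.isFiniteMeasure_seq h M
  have hprob : IsProbabilityMeasure (gasMeasure G (ENNReal.ofReal (b M)) M (expDensity ν (r M))) :=
    isProbabilityMeasure_gasMeasure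
      (ne_of_gt (lt_of_lt_of_le (ENNReal.ofReal_pos.2 (Real.exp_pos _)) hZ))
      (gasZ_ne_top _ _ _)
  set S : Set (Fin M → X) := {x | δ ≤ |(∑ j, f (x j)) / M - ∫ x, f x ∂(μ : Measure X)|} with hS
  have hSm : MeasurableSet S := measurableSet_le measurable_const
    (((measurable_sum_eval f.continuous.measurable).div_const _).sub_const _).abs
  calc ∫⁻ x, ENNReal.ofReal |(∑ j, f (x j)) / M - ∫ x, f x ∂(μ : Measure X)|
        ∂(gasMeasure G (ENNReal.ofReal (b M)) M (expDensity ν (r M)))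
      ≤ ∫⁻ x, (ENNReal.ofReal δ + S.indicator (fun _ ↦ ENNReal.ofReal (2 * ‖f‖)) x)
        ∂(gasMeasure G (ENNReal.ofReal (b M)) M (expDensity ν (r M))) := by
        refine lintegral_mono fun x ↦ ?_
        dsimp only
        by_cases hx : x ∈ S
        · rw [Set.indicator_of_mem hx]
          refine le_trans (ENNReal.ofReal_le_ofReal ?_) le_add_self
          have h1 : |(∑ j, f (x j)) / M| ≤ ‖f‖ := by
            rw [abs_div, abs_of_pos hM0, div_le_iff₀ hM0]
            calc |∑ j, f (x j)| ≤ ∑ j, |f (x j)| := Finset.abs_sum_le_sum_abs _ _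
              _ ≤ ∑ _j : Fin M, ‖f‖ := Finset.sum_le_sum fun j _ ↦ f.norm_coe_le_norm _
              _ = ‖f‖ * M := by simp [mul_comm]
          have h2 : |∫ x, f x ∂(μ : Measure X)| ≤ ‖f‖ := f.norm_integral_le_norm _
          calc _ ≤ |(∑ j, f (x j)) / M| + |∫ x, f x ∂(μ : Measure X)| := abs_sub _ _
            _ ≤ 2 * ‖f‖ := by linarith
        · rw [Set.indicator_of_notMem hx, add_zero]
          exact ENNReal.ofReal_le_ofReal (not_le.1 hx).le
    _ = ENNReal.ofReal δ + ENNReal.ofReal (2 * ‖f‖) *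
        gasMeasure G (ENNReal.ofReal (b M)) M (expDensity ν (r M)) S := by
        rw [lintegral_add_left measurable_const, lintegral_indicator_const hSm]
        simp
    _ ≤ ε / 2 + ε / 2 := add_le_add hδε hM2
    _ = ε := ENNReal.add_halves ε

end LawOfLargeNumbers

/-! ### A priori bounds for the one-particle intensity. -/

section OneParticle

variable {X : Type*} [MeasurableSpace X] {ν : Measure X} [IsProbabilityMeasure ν] {ϑ : X → ℝ}
  {G : X → X → ℝ≥0∞} {γ : ℝ} {b : ℕ → ℝ} {r : ℕ → X → ℝ} [TopologicalSpace X]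

lemma MeanFieldSequence.eventually_gasZ_ne_zero (h : MeanFieldSequence ν ϑ γ b r)
    (hK : MeanFieldKernel ν ϑ G) {μ : Measure X} [IsProbabilityMeasure μ]
    (hf : FiniteEnergy γ ν ϑ G μ) :
    ∀ᶠ M : ℕ in atTop, gasZ G (ENNReal.ofReal (b M)) M (expDensity ν (r M)) ≠ 0 := by
  filter_upwards [h.eventually_le_gasZ hf hK.measurable one_pos] with M hZ
  exact ne_of_gt (lt_of_lt_of_le (ENNReal.ofReal_pos.2 (Real.exp_pos _)) hZ)

lemma le_add_exp_sub (a B : ℝ) : a ≤ B + Real.exp (a - B) := by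
  linarith [Real.add_one_le_exp (a - B)]

/-- As e^{2ϑ} is ν-integrable and Z is at least e^{-M (F+1)}, the mean of exp(Σ ϑ(x_j)) is at most
e^{M c}. The inequality a ≤ B + e^{a-B} with B = M c turns this into a bound linear in M. -/
lemma MeanFieldSequence.exists_lintegral_theta_le (h : MeanFieldSequence ν ϑ γ b r)
    (hK : MeanFieldKernel ν ϑ G) {μ : Measure X} [IsProbabilityMeasure μ]
    (hf : FiniteEnergy γ ν ϑ G μ) :
    ∃ C : ℝ≥0, ∀ᶠ M : ℕ in atTop, ∫⁻ x, ENNReal.ofReal (∑ j, ϑ (x j))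
      ∂(gasMeasure G (ENNReal.ofReal (b M)) M (expDensity ν (r M))) ≤ C * M := by
  have hfin := hK.isFiniteMeasure
  set F := energyValue γ ν G μ with hF
  have hKtop : ∫⁻ x, ENNReal.ofReal (Real.exp (ϑ x)) ∂(expDensity ν ϑ) ≠ ⊤ := by
    rw [lintegral_expDensity ν hK.theta_measurable (measurable_ofReal_exp hK.theta_measurable)]
    convert hK.lintegral_exp using 4 with x
    rw [← ENNReal.ofReal_mul (Real.exp_pos _).le, ← Real.exp_add, two_mul]
  set K : ℝ := (∫⁻ x, ENNReal.ofReal (Real.exp (ϑ x)) ∂(expDensity ν ϑ)).toReal + 1 with hKdef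
  have hK0 : 0 < K := by positivity
  have hKle : ∫⁻ x, ENNReal.ofReal (Real.exp (ϑ x)) ∂(expDensity ν ϑ) ≤ ENNReal.ofReal K := by
    rw [← ENNReal.ofReal_toReal hKtop]
    exact ENNReal.ofReal_le_ofReal (by linarith)
  set c : ℝ := max 0 (F + 1 + Real.log K) with hc
  have hc0 : 0 ≤ c := le_max_left _ _
  have hc1 : F + 1 + Real.log K ≤ c := le_max_right _ _
  refine ⟨(c + 1).toNNReal, ?_⟩
  filter_upwards [h.eventually_le_gasZ hf hK.measurable one_pos, eventually_ge_atTop 1]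
    with M hZ hM
  have hM1 : (1 : ℝ) ≤ M := by exact_mod_cast hM
  have hfinM := hK.isFiniteMeasure_seq h M
  have hZ0 := ne_of_gt (lt_of_lt_of_le (ENNReal.ofReal_pos.2 (Real.exp_pos _)) hZ)
  have hprob : IsProbabilityMeasure (gasMeasure G (ENNReal.ofReal (b M)) M (expDensity ν (r M))) :=
    isProbabilityMeasure_gasMeasure hZ0 (gasZ_ne_top _ _ _)
  have hPm : Measurable fun x : Fin M → X ↦ ∏ j, ENNReal.ofReal (Real.exp (ϑ (x j))) :=
    Finset.measurable_prod _ fun j _ ↦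
      (measurable_ofReal_exp hK.theta_measurable).comp (measurable_pi_apply j)
  have hexp : ∫⁻ x, ∏ j, ENNReal.ofReal (Real.exp (ϑ (x j)))
      ∂(gasMeasure G (ENNReal.ofReal (b M)) M (expDensity ν (r M))) ≤
      ENNReal.ofReal (Real.exp (M * c)) := by
    rw [lintegral_gasMeasure hK.measurable hPm]
    calc _ ≤ (ENNReal.ofReal (Real.exp (-(M * (F + 1)))))⁻¹ *
          ∫⁻ x : Fin M → X, ∏ j, ENNReal.ofReal (Real.exp (ϑ (x j)))
            ∂(Measure.pi fun _ ↦ expDensity ν (r M)) := by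
          gcongr with x
          exact mul_le_of_le_one_right zero_le (expNeg_le_one _)
      _ ≤ ENNReal.ofReal (Real.exp (M * (F + 1))) * ENNReal.ofReal K ^ M := by
          rw [lintegral_pi_prod M _ fun _ ↦ measurable_ofReal_exp hK.theta_measurable,
            ← ENNReal.ofReal_inv_of_pos (Real.exp_pos _), ← Real.exp_neg, neg_neg,
            Finset.prod_const, Finset.card_univ, Fintype.card_fin]
          gcongr
          exact (lintegral_mono' (h.expDensity_le M) le_rfl).trans hKle
      _ ≤ ENNReal.ofReal (Real.exp (M * c)) := by
          rw [← ENNReal.ofReal_pow hK0.le, ← ENNReal.ofReal_mul (Real.exp_pos _).le,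
            ← Real.exp_log hK0, ← Real.exp_nat_mul, ← Real.exp_add, ← mul_add]
          gcongr
  calc ∫⁻ x, ENNReal.ofReal (∑ j, ϑ (x j))
        ∂(gasMeasure G (ENNReal.ofReal (b M)) M (expDensity ν (r M)))
      ≤ ∫⁻ x, (ENNReal.ofReal (M * c) + ENNReal.ofReal (Real.exp (-(M * c))) *
          ∏ j, ENNReal.ofReal (Real.exp (ϑ (x j))))
        ∂(gasMeasure G (ENNReal.ofReal (b M)) M (expDensity ν (r M))) := by
        refine lintegral_mono fun x ↦ ?_
        dsimp only
        rw [← ENNReal.ofReal_prod_of_nonneg fun j _ ↦ (Real.exp_pos _).le, ← Real.exp_sum,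
          ← ENNReal.ofReal_mul (Real.exp_pos _).le, ← Real.exp_add,
          ← ENNReal.ofReal_add (by positivity) (Real.exp_pos _).le]
        refine ENNReal.ofReal_le_ofReal ((le_add_exp_sub _ (M * c)).trans (le_of_eq ?_))
        rw [sub_eq_neg_add]
    _ ≤ ENNReal.ofReal (M * c) + ENNReal.ofReal (Real.exp (-(M * c))) *
          ENNReal.ofReal (Real.exp (M * c)) := by
        rw [lintegral_add_left measurable_const, lintegral_const, measure_univ, mul_one,
          lintegral_const_mul' _ _ ENNReal.ofReal_ne_top]
        gcongr
    _ ≤ ((c + 1).toNNReal : ℝ≥0∞) * M := by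
        rw [← ENNReal.ofReal_mul (Real.exp_pos _).le, ← Real.exp_add, neg_add_cancel,
          Real.exp_zero, ← ENNReal.ofReal_add (by positivity) zero_le_one,
          ← ENNReal.ofReal_natCast M, ← ENNReal.ofReal.eq_1, ← ENNReal.ofReal_mul (by positivity)]
        exact ENNReal.ofReal_le_ofReal (by nlinarith)

/-- Either a ≤ t, and the first term is at least 1, or a ≥ t, and the second is. Integrated, this
converts an upper bound for the mean of a into a lower bound for the mean of e^{-a}. -/
lemma one_le_exp_mul_expNeg_add (a : ℝ≥0∞) {t : ℝ} (ht : 0 < t) :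
    1 ≤ ENNReal.ofReal (Real.exp t) * expNeg a + (ENNReal.ofReal t)⁻¹ * a := by
  have ht0 : ENNReal.ofReal t ≠ 0 := (ENNReal.ofReal_pos.2 ht).ne'
  rcases le_total a (ENNReal.ofReal t) with h | h
  · refine le_trans ?_ le_self_add
    calc (1 : ℝ≥0∞) = ENNReal.ofReal (Real.exp t) * expNeg (ENNReal.ofReal t) := by
          rw [expNeg_ofReal ht.le, ← ENNReal.ofReal_mul (Real.exp_pos _).le, ← Real.exp_add]
          simp
      _ ≤ _ := by gcongr; exact expNeg_anti h
  · refine le_trans ?_ le_add_self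
    calc (1 : ℝ≥0∞) = (ENNReal.ofReal t)⁻¹ * ENNReal.ofReal t :=
          (ENNReal.inv_mul_cancel ht0 ENNReal.ofReal_ne_top).symm
      _ ≤ _ := by gcongr

lemma MeanFieldSequence.eventually_half_le (h : MeanFieldSequence ν ϑ γ b r)
    (hK : MeanFieldKernel ν ϑ G) :
    ∀ᶠ M : ℕ in atTop, (2⁻¹ : ℝ≥0∞) ≤ expDensity ν (r M) Set.univ := by
  have h1 := h.tendsto_lintegral_exp hK (ψ := fun _ ↦ 0) measurable_const (R := 0) (by simp)
  simp only [Real.exp_zero, ENNReal.ofReal_one, lintegral_const, one_mul, integral_const,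
    probReal_univ, smul_eq_mul, mul_one] at h1
  exact h1.eventually_const_le (by simp)

lemma measurable_sum_kernel_left (hG : Measurable (Function.uncurry G)) {M : ℕ} (y : Fin M → X) :
    Measurable fun u ↦ ∑ j, G u (y j) :=
  Finset.measurable_sum _ fun _ _ ↦ hG.comp (measurable_id.prodMk measurable_const)

lemma MeanFieldKernel.symm_integral_le (hK : MeanFieldKernel ν ϑ G) (x : X) (m : Measure X) :
    ∫⁻ u, G u x ∂m = ∫⁻ u, G x u ∂m := lintegral_congr fun u ↦ hK.symm u x

lemma measurable_expNeg_sum_kernel (hG : Measurable (Function.uncurry G)) (B : ℝ≥0∞) (M : ℕ) :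
    Measurable fun p : X × (Fin M → X) ↦ expNeg (B * ∑ j, G p.1 (p.2 j)) :=
  have h : Measurable fun p : X × (Fin M → X) ↦ B * ∑ j, G p.1 (p.2 j) :=
    (measurable_sum_kernel hG M).const_mul B
  measurable_expNeg.comp h

/-- Insertion of a particle: the quotient of consecutive partition functions is the mean, over the
smaller gas, of the weight of one more particle. -/
lemma lintegral_expNeg_gasMeasure (hG : Measurable (Function.uncurry G)) (B : ℝ≥0∞) (M : ℕ)
    (m : Measure X) [IsFiniteMeasure m] :
    ∫⁻ y, ∫⁻ u, expNeg (B * ∑ j, G u (y j)) ∂m ∂(gasMeasure G B M m) =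
      (gasZ G B M m)⁻¹ * gasZ G B (M + 1) m := by
  rw [lintegral_gasMeasure hG (measurable_expNeg_sum_kernel hG B M).lintegral_prod_left',
    ← lintegral_gasA B M m hG]
  congr 1
  simp only [gasA]
  rw [lintegral_lintegral_swap (measurable_gasA_integrand B M hG).aemeasurable]
  refine lintegral_congr fun y ↦ ?_
  rw [lintegral_mul_const' _ _ (expNeg_ne_top _)]

lemma MeanFieldSequence.lintegral_sum_kernel_le (h : MeanFieldSequence ν ϑ γ b r)
    (hK : MeanFieldKernel ν ϑ G) {C : ℝ≥0}
    (hC : ∀ u, ∫⁻ x, G u x ∂(expDensity ν ϑ) ≤ C * (1 + ENNReal.ofReal (ϑ u))) {B : ℝ≥0∞}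
    (hB : B ≠ ⊤) (M K : ℕ) (y : Fin M → X) :
    ∫⁻ u, B * ∑ j, G u (y j) ∂(expDensity ν (r K)) ≤
      B * (C * (M + ENNReal.ofReal (∑ j, ϑ (y j)))) := by
  rw [lintegral_const_mul' _ _ hB, lintegral_finsetSum]
  · gcongr
    calc ∑ j, ∫⁻ u, G u (y j) ∂(expDensity ν (r K))
        ≤ ∑ j, C * (1 + ENNReal.ofReal (ϑ (y j))) := by
          refine Finset.sum_le_sum fun j _ ↦ ?_
          rw [hK.symm_integral_le]
          exact (lintegral_mono' (h.expDensity_le K) le_rfl).trans (hC (y j))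
      _ = C * (M + ENNReal.ofReal (∑ j, ϑ (y j))) := by
          rw [← Finset.mul_sum, Finset.sum_add_distrib,
            ENNReal.ofReal_sum_of_nonneg fun j _ ↦ hK.theta_nonneg _]
          simp
  · exact fun j _ ↦ hK.measurable.comp (measurable_id.prodMk measurable_const)

lemma univ_le_of_lintegral_kernel_le (hG : Measurable (Function.uncurry G)) (B : ℝ≥0∞) (M : ℕ)
    (m : Measure X) [IsFiniteMeasure m] [IsProbabilityMeasure (gasMeasure G B M m)] {D : ℝ≥0∞}
    (hD : ∫⁻ y, ∫⁻ u, B * ∑ j, G u (y j) ∂m ∂(gasMeasure G B M m) ≤ D) {t : ℝ} (ht : 0 < t) :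
    m Set.univ ≤ ENNReal.ofReal (Real.exp t) * ((gasZ G B M m)⁻¹ * gasZ G B (M + 1) m) +
      (ENNReal.ofReal t)⁻¹ * D := by
  have hti : (ENNReal.ofReal t)⁻¹ ≠ ⊤ := ENNReal.inv_ne_top.2 (ENNReal.ofReal_pos.2 ht).ne'
  have hpt : ∀ y : Fin M → X, m Set.univ ≤
      ENNReal.ofReal (Real.exp t) * ∫⁻ u, expNeg (B * ∑ j, G u (y j)) ∂m +
        (ENNReal.ofReal t)⁻¹ * ∫⁻ u, B * ∑ j, G u (y j) ∂m := by
    intro y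
    have hy : Measurable fun u ↦ expNeg (B * ∑ j, G u (y j)) :=
      measurable_expNeg.comp ((measurable_sum_kernel_left hG y).const_mul B)
    rw [← lintegral_const_mul' _ _ ENNReal.ofReal_ne_top, ← lintegral_const_mul' _ _ hti,
      ← lintegral_add_left (hy.const_mul _)]
    calc m Set.univ = ∫⁻ _, 1 ∂m := by simp
      _ ≤ _ := lintegral_mono fun u ↦ one_le_exp_mul_expNeg_add _ ht
  calc m Set.univ = ∫⁻ _, m Set.univ ∂(gasMeasure G B M m) := by simp
    _ ≤ _ := lintegral_mono hpt
    _ ≤ _ := by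
        rw [lintegral_add_left
          ((measurable_expNeg_sum_kernel hG B M).lintegral_prod_left'.const_mul _),
          lintegral_const_mul' _ _ ENNReal.ofReal_ne_top, lintegral_expNeg_gasMeasure hG,
          lintegral_const_mul' _ _ hti]
        gcongr

/-- With t = 4 D the last term of the hypothesis is 1/4. As m is at least 1/2, the other term is at
least 1/4. -/
lemma le_mul_of_half_le {m Z Z' : ℝ≥0∞} (hm : 2⁻¹ ≤ m) {D : ℝ≥0} (hD : 0 < D) (hZ0 : Z ≠ 0)
    (hZt : Z ≠ ⊤) {t : ℝ} (ht : t = 4 * D)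
    (h : m ≤ ENNReal.ofReal (Real.exp t) * (Z⁻¹ * Z') + (ENNReal.ofReal t)⁻¹ * D) :
    Z ≤ (4 * (Real.exp t).toNNReal : ℝ≥0) * Z' := by
  have hquarter : (ENNReal.ofReal t)⁻¹ * D = 4⁻¹ := by
    have hDt : ENNReal.ofReal t = 4 * D := by
      rw [ht, ENNReal.ofReal_mul (by norm_num), ENNReal.ofReal_coe_nnreal, ENNReal.ofReal_ofNat]
    rw [hDt, ENNReal.mul_inv (by simp) (by simp), mul_assoc,
      ENNReal.inv_mul_cancel (by exact_mod_cast hD.ne') ENNReal.coe_ne_top, mul_one]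
  have h4 : (4⁻¹ : ℝ≥0∞) ≤ ENNReal.ofReal (Real.exp t) * (Z⁻¹ * Z') := by
    have h5 : (4⁻¹ : ℝ≥0∞) + 4⁻¹ ≤ ENNReal.ofReal (Real.exp t) * (Z⁻¹ * Z') + 4⁻¹ := by
      rw [hquarter] at h
      refine le_trans (le_of_eq ?_) (hm.trans h)
      rw [show (4 : ℝ≥0∞) = 2 * 2 by norm_num, ENNReal.mul_inv (by simp) (by simp), ← mul_add,
        ENNReal.inv_two_add_inv_two, mul_one]
    exact (ENNReal.add_le_add_iff_right (by simp)).1 h5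
  calc Z = 4 * (Z * 4⁻¹) := by
        rw [mul_comm Z, ← mul_assoc, ENNReal.mul_inv_cancel (by simp) (by simp), one_mul]
    _ ≤ 4 * (Z * (ENNReal.ofReal (Real.exp t) * (Z⁻¹ * Z'))) := by gcongr
    _ = 4 * ENNReal.ofReal (Real.exp t) * (Z * Z⁻¹) * Z' := by ring
    _ = _ := by
        rw [ENNReal.mul_inv_cancel hZ0 hZt, mul_one, ENNReal.ofReal]
        push_cast
        rfl

/-- A particle can be inserted at bounded cost. The integral over its position of its interaction
energy is at most b C (M + Σ ϑ(y_j)), and this has bounded mean since M b is bounded and the mean of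
Σ ϑ is O(M). -/
lemma MeanFieldSequence.exists_mul_gasZ_le (h : MeanFieldSequence ν ϑ γ b r)
    (hK : MeanFieldKernel ν ϑ G) {μ : Measure X} [IsProbabilityMeasure μ]
    (hf : FiniteEnergy γ ν ϑ G μ) :
    ∃ C : ℝ≥0, ∀ᶠ M : ℕ in atTop, gasZ G (ENNReal.ofReal (b M)) M (expDensity ν (r M)) ≤
      C * gasZ G (ENNReal.ofReal (b M)) (M + 1) (expDensity ν (r M)) := by
  obtain ⟨C₁, hC₁⟩ := h.exists_lintegral_theta_le hK hf
  obtain ⟨C₂, hC₂⟩ := hK.lintegral_le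
  have hb : ∀ᶠ M : ℕ in atTop, M * b M ≤ γ + 1 :=
    h.tendsto.eventually_le_const (lt_add_one γ)
  set D : ℝ≥0 := (γ + 1).toNNReal * (C₂ * (1 + C₁)) + 1 with hD
  have hD0 : 0 < D := by rw [hD]; positivity
  refine ⟨4 * (Real.exp (4 * D)).toNNReal, ?_⟩
  filter_upwards [hC₁, hb, h.eventually_gasZ_ne_zero hK hf, h.eventually_half_le hK]
    with M hM1 hM2 hZ0 hhalf
  have hfinM : IsFiniteMeasure (expDensity ν (r M)) := hK.isFiniteMeasure_seq h M
  have hZt := gasZ_ne_top (G := G) (ENNReal.ofReal (b M)) M (expDensity ν (r M))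
  have hprob := isProbabilityMeasure_gasMeasure hZ0 hZt
  refine le_mul_of_half_le hhalf hD0 hZ0 hZt rfl ?_
  refine univ_le_of_lintegral_kernel_le hK.measurable _ M _ ?_ (by positivity)
  refine (lintegral_mono (h.lintegral_sum_kernel_le hK hC₂ ENNReal.ofReal_ne_top M M)).trans ?_
  rw [lintegral_const_mul' _ _ ENNReal.ofReal_ne_top,
    lintegral_const_mul' _ _ ENNReal.coe_ne_top, lintegral_add_left measurable_const,
    lintegral_const, measure_univ, mul_one]
  calc ENNReal.ofReal (b M) * (C₂ * (M + ∫⁻ x, ENNReal.ofReal (∑ j, ϑ (x j))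
        ∂(gasMeasure G (ENNReal.ofReal (b M)) M (expDensity ν (r M)))))
      ≤ ENNReal.ofReal (b M) * (C₂ * (M + C₁ * M)) := by gcongr
    _ = (M * ENNReal.ofReal (b M)) * (C₂ * (1 + C₁)) := by ring
    _ ≤ ENNReal.ofReal (γ + 1) * (C₂ * (1 + C₁)) := by
        gcongr
        rw [← ENNReal.ofReal_natCast M, ← ENNReal.ofReal_mul (by positivity)]
        exact ENNReal.ofReal_le_ofReal hM2
    _ ≤ D := by
        rw [hD, ENNReal.ofReal]
        push_cast
        exact le_self_add

lemma eventually_atTop_of_succ {p : ℕ → Prop} (h : ∀ᶠ M in atTop, p (M + 1)) :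
    ∀ᶠ M in atTop, p M := by
  obtain ⟨M₀, hM₀⟩ := eventually_atTop.1 h
  filter_upwards [eventually_ge_atTop (M₀ + 1)] with M hM
  obtain ⟨k, rfl⟩ : ∃ k, M = k + 1 := ⟨M - 1, by omega⟩
  exact hM₀ k (by omega)

/-- The intensity of a mean-field gas is bounded by a multiple of the dominating measure. -/
lemma MeanFieldSequence.exists_lintegral_sum_le (h : MeanFieldSequence ν ϑ γ b r)
    (hK : MeanFieldKernel ν ϑ G) {μ : Measure X} [IsProbabilityMeasure μ]
    (hf : FiniteEnergy γ ν ϑ G μ) :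
    ∃ C : ℝ≥0, ∀ᶠ M : ℕ in atTop, ∀ f : X → ℝ≥0∞, Measurable f →
      ∫⁻ x, ∑ j, f (x j) ∂(gasMeasure G (ENNReal.ofReal (b M)) M (expDensity ν (r M))) ≤
        M * (C * ∫⁻ u, f u ∂(expDensity ν ϑ)) := by
  -- The normalised one-particle density of M + 1 particles is `gasA` divided by Z_{M+1}, and `gasA`
  -- is at most Z_M ≤ C Z_{M+1}. Both partition functions carry the parameters of index M + 1,
  -- whence the shift.
  obtain ⟨C, hC⟩ := h.shift.exists_mul_gasZ_le hK hf
  refine ⟨C, eventually_atTop_of_succ ?_⟩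
  filter_upwards [hC, (tendsto_add_atTop_nat 1).eventually (h.eventually_gasZ_ne_zero hK hf)]
    with M hM hZ0 f hfm
  have hfinM := hK.isFiniteMeasure_seq h (M + 1)
  have hsum : Measurable fun x : Fin (M + 1) → X ↦ ∑ j, f (x j) :=
    Finset.measurable_sum _ fun j _ ↦ hfm.comp (measurable_pi_apply j)
  rw [lintegral_gasMeasure hK.measurable hsum,
    lintegral_sum_mul_gasWeight _ M _ hK.measurable hK.symm hfm]
  set Z := gasZ G (ENNReal.ofReal (b (M + 1))) (M + 1) (expDensity ν (r (M + 1)))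
  have hZt : Z ≠ ⊤ := gasZ_ne_top _ _ _
  calc Z⁻¹ * ((M + 1 : ℕ) * ∫⁻ u, f u * gasA G (ENNReal.ofReal (b (M + 1))) M
        (expDensity ν (r (M + 1))) u ∂(expDensity ν (r (M + 1))))
      ≤ Z⁻¹ * ((M + 1 : ℕ) * ∫⁻ u, f u * (C * Z) ∂(expDensity ν ϑ)) := by
        gcongr with u
        · exact h.expDensity_le (M + 1)
        · exact (gasA_le_gasZ _ _ _ u).trans hM
    _ = (M + 1 : ℕ) * ((Z⁻¹ * Z) * C * ∫⁻ u, f u ∂(expDensity ν ϑ)) := by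
        rw [lintegral_mul_const _ hfm]; ring
    _ = _ := by rw [ENNReal.inv_mul_cancel hZ0 hZt, one_mul]

end OneParticle

/-! ### The limit of the one-particle function. -/

section OneParticleLimit

variable {X : Type*} [MeasurableSpace X] {ν : Measure X} [IsProbabilityMeasure ν] {ϑ : X → ℝ}
  {G : X → X → ℝ≥0∞} {γ : ℝ} {b : ℕ → ℝ} {r : ℕ → X → ℝ}
  [TopologicalSpace X] [TopologicalSpace.PseudoMetrizableSpace X] [BorelSpace X]
  [SecondCountableTopology X]

lemma tendsto_of_forall_eventually_le {ι : Type*} {l : Filter ι} {f : ι → ℝ≥0∞} {a K : ℝ≥0∞}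
    (ha : a ≠ ⊤) (hK : K ≠ ⊤)
    (h : ∀ ε : ℝ≥0∞, ε ≠ 0 → ∀ᶠ i in l, f i ≤ a + K * ε ∧ a ≤ f i + K * ε) :
    Tendsto f l (𝓝 a) := by
  rw [ENNReal.tendsto_nhds ha]
  intro ε hε
  have hε' : ε / (K + 1) ≠ 0 := ENNReal.div_ne_zero.2 ⟨hε.ne', by simpa using hK⟩
  have hle : K * (ε / (K + 1)) ≤ ε := by
    calc K * (ε / (K + 1)) ≤ (K + 1) * (ε / (K + 1)) := by gcongr; exact le_self_add
      _ ≤ ε := ENNReal.mul_div_le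
  filter_upwards [h _ hε'] with i hi
  refine ⟨tsub_le_iff_right.2 (hi.2.trans ?_), hi.1.trans ?_⟩ <;> gcongr

/-- The law of large numbers with the deviation stored as an additive error D of vanishing mean, so
that estimates in [0, ∞] need no subtraction. -/
lemma MeanFieldSequence.exists_deviation [T2Space X] (h : MeanFieldSequence ν ϑ γ b r)
    (hK : MeanFieldKernel ν ϑ G) (hγ : 0 ≤ γ) {μ : ProbabilityMeasure X}
    (hμ : IsUniqueMinimizer (meanFieldEnergy γ ν G) μ) (ψ : BoundedContinuousFunction X ℝ≥0) :
    ∃ D : ∀ M : ℕ, (Fin M → X) → ℝ≥0∞, (∀ M, Measurable (D M)) ∧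
      Tendsto (fun M ↦ ∫⁻ x, D M x ∂(gasMeasure G (ENNReal.ofReal (b M)) M
        (expDensity ν (r M)))) atTop (𝓝 0) ∧
      ∀ M, 0 < M → ∀ x, ∑ j, (ψ (x j) : ℝ≥0∞) ≤ M * (∫⁻ u, ψ u ∂(μ : Measure X) + D M x) ∧
        M * ∫⁻ u, ψ u ∂(μ : Measure X) ≤ ∑ j, (ψ (x j) : ℝ≥0∞) + M * D M x := by
  have hR' : ∀ x, ‖((ψ x : ℝ≥0) : ℝ)‖ ≤ nndist ψ 0 := fun x ↦ by
    rw [Real.norm_of_nonneg (NNReal.coe_nonneg _)]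
    exact_mod_cast BoundedContinuousFunction.NNReal.upper_bound ψ x
  let f : BoundedContinuousFunction X ℝ := BoundedContinuousFunction.ofNormedAddCommGroup
    (fun x ↦ (ψ x : ℝ)) (NNReal.continuous_coe.comp ψ.continuous) _ hR'
  have hfψ : ∀ x, f x = ψ x := fun x ↦ rfl
  have hint : ∫⁻ u, ψ u ∂(μ : Measure X) = ENNReal.ofReal (∫ x, f x ∂(μ : Measure X)) := by
    rw [ofReal_integral_eq_lintegral_ofReal (f.integrable _) (ae_of_all _ fun x ↦ by simp [hfψ])]
    simp [hfψ]
  have hint0 : 0 ≤ ∫ x, f x ∂(μ : Measure X) := integral_nonneg fun x ↦ by simp [hfψ]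
  refine ⟨fun M x ↦ ENNReal.ofReal |(∑ j, f (x j)) / M - ∫ x, f x ∂(μ : Measure X)|,
    fun M ↦ ?_, h.tendsto_lintegral_deviation hK hγ hμ f, fun M hM x ↦ ?_⟩
  · exact (((measurable_sum_eval f.continuous.measurable).div_const _).sub_const
      _).abs.ennreal_ofReal
  · have hM0 : (0 : ℝ) < M := by exact_mod_cast hM
    have hs : ∑ j, (ψ (x j) : ℝ≥0∞) = ENNReal.ofReal (∑ j, f (x j)) := by
      rw [ENNReal.ofReal_sum_of_nonneg fun j _ ↦ by simp [hfψ]]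
      simp [hfψ]
    have hs0 : 0 ≤ ∑ j, f (x j) := Finset.sum_nonneg fun j _ ↦ by simp [hfψ]
    set S := ∑ j, f (x j)
    set I := ∫ x, f x ∂(μ : Measure X)
    have hS : M * (S / M) = S := by field_simp
    rw [hs, hint, ← ENNReal.ofReal_natCast M, ← ENNReal.ofReal_add hint0 (abs_nonneg _),
      ← ENNReal.ofReal_mul hM0.le, ← ENNReal.ofReal_mul hM0.le, ← ENNReal.ofReal_mul hM0.le,
      ← ENNReal.ofReal_add hs0 (by positivity)]
    constructor
    · refine ENNReal.ofReal_le_ofReal ?_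
      calc S = M * (S / M) := hS.symm
        _ ≤ _ := by gcongr; linarith [le_abs_self (S / M - I)]
    · refine ENNReal.ofReal_le_ofReal ?_
      calc M * I ≤ M * (S / M + |S / M - I|) := by gcongr; linarith [neg_abs_le (S / M - I)]
        _ = _ := by rw [mul_add, hS]

/-- The untilted gas, through which estimates for gases are transferred to the minimizer itself. -/
lemma exists_meanFieldSequence (ν : Measure X) [IsProbabilityMeasure ν] (hθ : ∀ x, 0 ≤ ϑ x)
    (hγ : 0 ≤ γ) : MeanFieldSequence ν ϑ γ (fun M ↦ γ / M) (fun _ _ ↦ 0) where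
  nonneg M := by positivity
  tendsto := by
    refine tendsto_const_nhds.congr' ?_
    filter_upwards [eventually_gt_atTop 0] with M hM
    have : (M : ℝ) ≠ 0 := by positivity
    field_simp
  measurable _ := measurable_const
  le _ x := hθ x
  abs_le := ⟨0, fun _ x ↦ by simpa using hθ x⟩
  tendsto_zero := ae_of_all _ fun _ ↦ tendsto_const_nhds

/-- Indicators of closed sets are limits of bounded continuous functions, and finite Borel measures
are inner regular for closed sets. -/
lemma measure_le_of_forall_lintegral_le {μ m : Measure X} [IsFiniteMeasure μ] [IsFiniteMeasure m]
    (h : ∀ ψ : BoundedContinuousFunction X ℝ≥0, ∫⁻ x, ψ x ∂μ ≤ ∫⁻ x, ψ x ∂m) : μ ≤ m := by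
  let _ := TopologicalSpace.pseudoMetrizableSpacePseudoMetric X
  have hcl : ∀ F : Set X, IsClosed F → μ F ≤ m F := fun F hF ↦
    le_of_tendsto_of_tendsto' (HasOuterApproxClosed.tendsto_lintegral_apprSeq hF μ)
      (HasOuterApproxClosed.tendsto_lintegral_apprSeq hF m) fun n ↦ h _
  refine Measure.le_iff.2 fun s hs ↦ ?_
  rw [hs.measure_eq_iSup_isClosed_of_ne_top (measure_ne_top μ s)]
  exact iSup₂_le fun F hF ↦ iSup_le fun hFc ↦ (hcl F hFc).trans (measure_mono hF)

/-- The minimizer is dominated by a multiple of the weighted reference measure. -/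
lemma MeanFieldKernel.exists_le_smul [T2Space X] (hK : MeanFieldKernel ν ϑ G) (hγ : 0 ≤ γ)
    {μ : ProbabilityMeasure X} (hμ : IsUniqueMinimizer (meanFieldEnergy γ ν G) μ) :
    ∃ C : ℝ≥0, (μ : Measure X) ≤ C • expDensity ν ϑ := by
  have h := exists_meanFieldSequence ν hK.theta_nonneg hγ
  have hf := hK.finiteEnergy hγ hμ
  have hfin := hK.isFiniteMeasure
  -- The intensity divided by M is at most C e^ϑ ν for large M, and tested against ψ it tends to ∫ ψ
  -- dμ. The bound passes to the limit.
  obtain ⟨C, hC⟩ := h.exists_lintegral_sum_le hK hf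
  refine ⟨C, measure_le_of_forall_lintegral_le fun ψ ↦ ?_⟩
  obtain ⟨D, hDm, hD, hDle⟩ := h.exists_deviation hK hγ hμ ψ
  have hlim := (tendsto_const_nhds (x := C * ∫⁻ x, ψ x ∂(expDensity ν ϑ))).add hD
  rw [add_zero] at hlim
  rw [lintegral_smul_measure]
  refine ge_of_tendsto hlim ?_
  filter_upwards [hC, h.eventually_gasZ_ne_zero hK hf, eventually_gt_atTop 0] with M hM hZ0 hpos
  have hfinM := hK.isFiniteMeasure_seq h M
  have hprob := isProbabilityMeasure_gasMeasure hZ0 (gasZ_ne_top _ M _)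
  have hψm : Measurable fun x ↦ (ψ x : ℝ≥0∞) := ψ.continuous.measurable.coe_nnreal_ennreal
  have hM0 : (M : ℝ≥0∞) ≠ 0 := by exact_mod_cast hpos.ne'
  rw [← ENNReal.mul_le_mul_iff_right hM0 (ENNReal.natCast_ne_top M)]
  calc M * ∫⁻ x, ψ x ∂(μ : Measure X)
      = ∫⁻ _, M * ∫⁻ x, ψ x ∂(μ : Measure X) ∂(gasMeasure G (ENNReal.ofReal (γ / M)) M
          (expDensity ν fun _ ↦ 0)) := by simp
    _ ≤ ∫⁻ x, (∑ j, (ψ (x j) : ℝ≥0∞) + M * D M x) ∂(gasMeasure G (ENNReal.ofReal (γ / M)) M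
          (expDensity ν fun _ ↦ 0)) := lintegral_mono fun x ↦ (hDle M hpos x).2
    _ ≤ _ := by
        rw [lintegral_add_right _ ((hDm M).const_mul _),
          lintegral_const_mul' _ _ (ENNReal.natCast_ne_top M), mul_add]
        gcongr
        exact hM _ hψm

/-- The mean-field potential generated by `μ`. -/
def meanPotential (G : X → X → ℝ≥0∞) (μ : Measure X) (u : X) : ℝ≥0∞ := ∫⁻ v, G u v ∂μ

lemma measurable_meanPotential (hG : Measurable (Function.uncurry G)) (μ : Measure X)
    [SigmaFinite μ] : Measurable (meanPotential G μ) := hG.lintegral_prod_right'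

lemma MeanFieldKernel.meanPotential_ne_top (hK : MeanFieldKernel ν ϑ G) {μ : Measure X}
    {C : ℝ≥0} (hC : μ ≤ C • expDensity ν ϑ) (u : X) : meanPotential G μ u ≠ ⊤ := by
  obtain ⟨C', hC'⟩ := hK.lintegral_le
  refine ne_top_of_le_ne_top ?_ (lintegral_mono' hC le_rfl)
  rw [lintegral_smul_measure]
  refine ENNReal.mul_ne_top ENNReal.coe_ne_top (ne_top_of_le_ne_top ?_ (hC' u))
  exact ENNReal.mul_ne_top ENNReal.coe_ne_top (by simp)

/-- The error h of the approximation is small for e^ϑ ν, which dominates μ up to the factor C. One ψ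
serves a whole neighbourhood of u, which yields continuity of the potential and limits along moving
points. -/
lemma MeanFieldKernel.approx_meanPotential (hK : MeanFieldKernel ν ϑ G) {μ : Measure X}
    {C : ℝ≥0} (hC : μ ≤ C • expDensity ν ϑ) (u : X) {ε : ℝ≥0∞} (hε : ε ≠ 0) :
    ∃ ψ : BoundedContinuousFunction X ℝ≥0,
      (∀ᶠ u' in 𝓝 u, meanPotential G μ u' ≤ ∫⁻ x, ψ x ∂μ + C * ε ∧
        ∫⁻ x, ψ x ∂μ ≤ meanPotential G μ u' + C * ε) ∧
      ∀ᶠ u' in 𝓝 u, ∃ h : X → ℝ≥0∞, Measurable h ∧ (∀ x, G u' x ≤ ψ x + h x) ∧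
        (∀ x, ψ x ≤ G u' x + h x) ∧ ∫⁻ x, h x ∂(expDensity ν ϑ) ≤ ε := by
  obtain ⟨ψ, hψ⟩ := hK.approx u ε hε
  refine ⟨ψ, hψ.mono fun u' hu' ↦ ?_, hψ⟩
  obtain ⟨h, hm, h1, h2, h3⟩ := hu'
  have h4 : ∫⁻ x, h x ∂μ ≤ C * ε := by
    refine (lintegral_mono' hC le_rfl).trans ?_
    rw [lintegral_smul_measure]
    exact mul_le_mul_right h3 _
  constructor
  · refine (lintegral_mono h1).trans ?_
    rw [lintegral_add_right _ hm]
    gcongr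
  · refine (lintegral_mono h2).trans ?_
    rw [lintegral_add_right _ hm]
    exact add_le_add_right h4 _

lemma MeanFieldKernel.continuous_meanPotential (hK : MeanFieldKernel ν ϑ G) {μ : Measure X}
    {C : ℝ≥0} (hC : μ ≤ C • expDensity ν ϑ) : Continuous (meanPotential G μ) := by
  refine continuous_iff_continuousAt.2 fun u ↦ ?_
  refine tendsto_of_forall_eventually_le (K := 2 * C) (hK.meanPotential_ne_top hC u)
    (ENNReal.mul_ne_top (by simp) ENNReal.coe_ne_top) fun ε hε ↦ ?_
  obtain ⟨ψ, hψ, -⟩ := hK.approx_meanPotential hC u hε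
  have hu := hψ.self_of_nhds
  filter_upwards [hψ] with u' hu'
  constructor
  · calc _ ≤ _ := hu'.1
      _ ≤ (meanPotential G μ u + C * ε) + C * ε := by gcongr; exact hu.2
      _ = _ := by ring
  · calc _ ≤ _ := hu.1
      _ ≤ (meanPotential G μ u' + C * ε) + C * ε := by gcongr; exact hu'.2
      _ = _ := by ring

lemma lintegral_expNeg_gasMeasure_eq_gasA (hG : Measurable (Function.uncurry G)) (B : ℝ≥0∞)
    (M : ℕ) (m : Measure X) (u : X) :
    ∫⁻ y, expNeg (B * ∑ j, G u (y j)) ∂(gasMeasure G B M m) =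
      (gasZ G B M m)⁻¹ * gasA G B M m u :=
  lintegral_gasMeasure hG (measurable_sum_kernel_right B M hG u)

lemma MeanFieldSequence.tendsto_mul (h : MeanFieldSequence ν ϑ γ b r) :
    Tendsto (fun M : ℕ ↦ M * ENNReal.ofReal (b M)) atTop (𝓝 (ENNReal.ofReal γ)) := by
  refine (ENNReal.tendsto_ofReal h.tendsto).congr fun M ↦ ?_
  rw [ENNReal.ofReal_mul (by positivity), ENNReal.ofReal_natCast]

/-- The interaction of the gas with an additional particle becomes deterministic. -/
lemma MeanFieldSequence.tendsto_gasA_div_gasZ [T2Space X] (h : MeanFieldSequence ν ϑ γ b r)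
    (hK : MeanFieldKernel ν ϑ G) (hγ : 0 ≤ γ) {μ : ProbabilityMeasure X}
    (hμ : IsUniqueMinimizer (meanFieldEnergy γ ν G) μ) {u : X} {v : ℕ → X}
    (hv : Tendsto v atTop (𝓝 u)) :
    Tendsto (fun M ↦ (gasZ G (ENNReal.ofReal (b M)) M (expDensity ν (r M)))⁻¹ *
      gasA G (ENNReal.ofReal (b M)) M (expDensity ν (r M)) (v M)) atTop
      (𝓝 (expNeg (ENNReal.ofReal γ * meanPotential G μ u))) := by
  have hf := hK.finiteEnergy hγ hμ
  obtain ⟨C, hC⟩ := hK.exists_le_smul hγ hμ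
  obtain ⟨C₁, hC₁⟩ := h.exists_lintegral_sum_le hK hf
  set g : ℝ≥0∞ := ENNReal.ofReal γ + 1 with hg
  have hgt : g ≠ ⊤ := by simp [hg]
  -- The terms of K come from replacing ψ by G(u, ·) under μ (g C), from M b → γ (1), and from the
  -- error H in the gas (g (C₁ + 1)). The constant g bounds γ and, for large M, also M b.
  refine tendsto_of_forall_eventually_le (K := g * C + 1 + g * (C₁ + 1)) (expNeg_ne_top _)
    (by finiteness) fun ε hε ↦ ?_
  obtain ⟨ψ, hψ, hψ'⟩ := hK.approx_meanPotential hC u hε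
  obtain ⟨D, hDm, hD, hDle⟩ := h.exists_deviation hK hγ hμ ψ
  set I := ∫⁻ x, ψ x ∂(μ : Measure X) with hI
  have hIt : I ≠ ⊤ := (ψ.lintegral_lt_top_of_nnreal _).ne
  have hu := hψ.self_of_nhds
  have hs : Tendsto (fun M : ℕ ↦ expNeg (M * ENNReal.ofReal (b M) * I)) atTop
      (𝓝 (expNeg (ENNReal.ofReal γ * I))) :=
    (continuous_expNeg.tendsto _).comp (ENNReal.Tendsto.mul_const h.tendsto_mul (Or.inr hIt))
  rw [ENNReal.tendsto_nhds (expNeg_ne_top _)] at hs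
  filter_upwards [hs ε (pos_iff_ne_zero.2 hε), hC₁, hv.eventually hψ',
    h.tendsto_mul.eventually_le_const (show ENNReal.ofReal γ < g from
      ENNReal.lt_add_right ENNReal.ofReal_ne_top one_ne_zero),
    hD.eventually_le_const (pos_iff_ne_zero.2 hε), eventually_gt_atTop 0,
    h.eventually_gasZ_ne_zero hK hf] with M hsM hM ⟨k, hkm, hk1, hk2, hk3⟩ hBM hDM hM0 hZ0
  have hfinM := hK.isFiniteMeasure_seq h M
  have hprob := isProbabilityMeasure_gasMeasure hZ0 (gasZ_ne_top _ M _)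
  set B := ENNReal.ofReal (b M) with hB
  have hBt : B ≠ ⊤ := ENNReal.ofReal_ne_top
  rw [← lintegral_expNeg_gasMeasure_eq_gasA hK.measurable]
  set P := gasMeasure G B M (expDensity ν (r M)) with hP
  -- H collects the error of ψ as a substitute for G(v_M, ·) and the deviation from the law of large
  -- numbers. The function k depends on M, so the intensity bound must hold for all test functions
  -- from the same M on.
  set H : (Fin M → X) → ℝ≥0∞ := fun y ↦ B * ∑ j, k (y j) + B * M * D M y with hH
  have hksum : Measurable fun y : Fin M → X ↦ ∑ j, k (y j) :=
    Finset.measurable_sum _ fun j _ ↦ hkm.comp (measurable_pi_apply j)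
  have hHm : Measurable H := (hksum.const_mul _).add ((hDm M).const_mul _)
  have hHint : ∫⁻ y, H y ∂P ≤ g * (C₁ + 1) * ε := by
    rw [hH, lintegral_add_left (hksum.const_mul _), lintegral_const_mul' _ _ hBt,
      lintegral_const_mul' _ _ (by finiteness)]
    calc B * ∫⁻ y, ∑ j, k (y j) ∂P + B * M * ∫⁻ y, D M y ∂P
        ≤ B * (M * (C₁ * ε)) + B * M * ε := by
          gcongr
          exact (hM k hkm).trans (by gcongr)
      _ = (M * B) * ((C₁ + 1) * ε) := by ring
      _ ≤ g * ((C₁ + 1) * ε) := by gcongr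
      _ = _ := by ring
  have hle1 : ∀ y : Fin M → X, B * ∑ j, G (v M) (y j) ≤ M * B * I + H y := by
    intro y
    calc B * ∑ j, G (v M) (y j) ≤ B * ∑ j, (ψ (y j) + k (y j)) := by
          gcongr with j; exact hk1 _
      _ = B * ∑ j, (ψ (y j) : ℝ≥0∞) + B * ∑ j, k (y j) := by
          rw [Finset.sum_add_distrib, mul_add]
      _ ≤ B * (M * (I + D M y)) + B * ∑ j, k (y j) := by gcongr; exact (hDle M hM0 y).1
      _ = _ := by rw [hH]; ring
  have hle2 : ∀ y : Fin M → X, M * B * I ≤ B * ∑ j, G (v M) (y j) + H y := by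
    intro y
    calc M * B * I = B * (M * I) := by ring
      _ ≤ B * (∑ j, (ψ (y j) : ℝ≥0∞) + M * D M y) := by gcongr; exact (hDle M hM0 y).2
      _ ≤ B * (∑ j, (G (v M) (y j) + k (y j)) + M * D M y) := by gcongr with j; exact hk2 _
      _ = _ := by rw [hH, Finset.sum_add_distrib]; ring
  have hint1 : expNeg (M * B * I) ≤
      ∫⁻ y, expNeg (B * ∑ j, G (v M) (y j)) ∂P + g * (C₁ + 1) * ε := by
    calc expNeg (M * B * I) = ∫⁻ _, expNeg (M * B * I) ∂P := by simp
      _ ≤ ∫⁻ y, (expNeg (B * ∑ j, G (v M) (y j)) + H y) ∂P :=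
          lintegral_mono fun y ↦ expNeg_le_add_of_le (hle1 y)
      _ ≤ _ := by rw [lintegral_add_right _ hHm]; gcongr
  have hint2 : ∫⁻ y, expNeg (B * ∑ j, G (v M) (y j)) ∂P ≤
      expNeg (M * B * I) + g * (C₁ + 1) * ε := by
    calc _ ≤ ∫⁻ y, (expNeg (M * B * I) + H y) ∂P :=
          lintegral_mono fun y ↦ expNeg_le_add_of_le (hle2 y)
      _ ≤ _ := by rw [lintegral_add_right _ hHm]; gcongr; simp
  have hγg : ENNReal.ofReal γ ≤ g := le_self_add
  have hΦ1 : expNeg (ENNReal.ofReal γ * I) ≤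
      expNeg (ENNReal.ofReal γ * meanPotential G μ u) + g * C * ε := by
    refine expNeg_le_add_of_le ?_
    calc _ ≤ ENNReal.ofReal γ * (I + C * ε) := by gcongr; exact hu.1
      _ = ENNReal.ofReal γ * I + ENNReal.ofReal γ * C * ε := by ring
      _ ≤ _ := by gcongr
  have hΦ2 : expNeg (ENNReal.ofReal γ * meanPotential G μ u) ≤
      expNeg (ENNReal.ofReal γ * I) + g * C * ε := by
    refine expNeg_le_add_of_le ?_
    calc _ ≤ ENNReal.ofReal γ * (meanPotential G μ u + C * ε) := by gcongr; exact hu.2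
      _ = ENNReal.ofReal γ * meanPotential G μ u + ENNReal.ofReal γ * C * ε := by ring
      _ ≤ _ := by gcongr
  have hs1 := tsub_le_iff_right.1 hsM.1
  constructor
  · calc _ ≤ _ := hint2
      _ ≤ (expNeg (ENNReal.ofReal γ * I) + ε) + g * (C₁ + 1) * ε := by gcongr; exact hsM.2
      _ ≤ ((expNeg (ENNReal.ofReal γ * meanPotential G μ u) + g * C * ε) + ε) +
          g * (C₁ + 1) * ε := by gcongr
      _ = _ := by ring
  · calc _ ≤ _ := hΦ2
      _ ≤ (expNeg (M * B * I) + ε) + g * C * ε := by gcongr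
      _ ≤ ((∫⁻ y, expNeg (B * ∑ j, G (v M) (y j)) ∂P + g * (C₁ + 1) * ε) + ε) + g * C * ε := by
          gcongr
      _ = _ := by ring

end OneParticleLimit

/-! ### The correlation function and the mean-field equation. -/

section OneParticleDensity

variable {X : Type*} [MeasurableSpace X] {ν : Measure X} [IsProbabilityMeasure ν] {ϑ : X → ℝ}
  {G : X → X → ℝ≥0∞} {γ : ℝ} {b : ℕ → ℝ} {r : ℕ → X → ℝ}
  [TopologicalSpace X] [TopologicalSpace.PseudoMetrizableSpace X] [BorelSpace X]
  [SecondCountableTopology X] [T2Space X]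

/-- The integrand converges at almost every point, and since `gasA` is at most Z it is dominated by
a multiple of e^ϑ. -/
lemma MeanFieldSequence.tendsto_lintegral_mul_gasA (h : MeanFieldSequence ν ϑ γ b r)
    (hK : MeanFieldKernel ν ϑ G) (hγ : 0 ≤ γ) {μ : ProbabilityMeasure X}
    (hμ : IsUniqueMinimizer (meanFieldEnergy γ ν G) μ) {F : X → ℝ≥0∞} (hF : Measurable F)
    {K : ℝ≥0} (hFK : ∀ u, F u ≤ K) :
    Tendsto (fun M ↦ (gasZ G (ENNReal.ofReal (b M)) M (expDensity ν (r M)))⁻¹ *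
      ∫⁻ u, F u * gasA G (ENNReal.ofReal (b M)) M (expDensity ν (r M)) u ∂(expDensity ν (r M)))
      atTop (𝓝 (∫⁻ u, F u * expNeg (ENNReal.ofReal γ * meanPotential G μ u) ∂ν)) := by
  have hf := hK.finiteEnergy hγ hμ
  have hfin := hK.isFiniteMeasure
  have hA : ∀ M, Measurable (gasA G (ENNReal.ofReal (b M)) M (expDensity ν (r M))) := fun M ↦
    measurable_gasA _ M _ hK.measurable
  have hrw : ∀ᶠ M in atTop, ∫⁻ u, ENNReal.ofReal (Real.exp (r M u)) * (F u *
      ((gasZ G (ENNReal.ofReal (b M)) M (expDensity ν (r M)))⁻¹ *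
        gasA G (ENNReal.ofReal (b M)) M (expDensity ν (r M)) u)) ∂ν =
      (gasZ G (ENNReal.ofReal (b M)) M (expDensity ν (r M)))⁻¹ *
      ∫⁻ u, F u * gasA G (ENNReal.ofReal (b M)) M (expDensity ν (r M)) u ∂(expDensity ν (r M)) := by
    filter_upwards [h.eventually_gasZ_ne_zero hK hf] with M hZ0
    have hFA : Measurable fun u ↦
        F u * gasA G (ENNReal.ofReal (b M)) M (expDensity ν (r M)) u := hF.mul (hA M)
    rw [lintegral_expDensity ν (h.measurable M) hFA,
      ← lintegral_const_mul' _ _ (ENNReal.inv_ne_top.2 hZ0)]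
    exact lintegral_congr fun u ↦ by ring
  refine Tendsto.congr' hrw ?_
  refine tendsto_lintegral_of_dominated_convergence
    (fun u ↦ ENNReal.ofReal (Real.exp (ϑ u)) * (K * 1)) ?_ ?_ ?_ ?_
  · exact fun M ↦ (measurable_ofReal_exp (h.measurable M)).mul (hF.mul ((hA M).const_mul _))
  · refine fun M ↦ ae_of_all _ fun u ↦ ?_
    dsimp only
    gcongr
    · exact h.le M u
    · exact hFK u
    · exact (mul_le_mul_right (gasA_le_gasZ _ M _ u) _).trans (ENNReal.inv_mul_le_one _)
  · rw [lintegral_mul_const' _ _ (by simp), ← expDensity_univ]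
    exact ENNReal.mul_ne_top (measure_ne_top _ _) (by simp)
  · filter_upwards [h.tendsto_zero] with u hu
    have h1 : Tendsto (fun M ↦ ENNReal.ofReal (Real.exp (r M u))) atTop (𝓝 1) := by
      simpa using ENNReal.tendsto_ofReal ((Real.continuous_exp.tendsto _).comp hu)
    have h2 := h.tendsto_gasA_div_gasZ hK hγ hμ (u := u) (v := fun _ ↦ u) tendsto_const_nhds
    have h3 := ENNReal.Tendsto.const_mul (a := F u) h2
      (Or.inr (ne_top_of_le_ne_top ENNReal.coe_ne_top (hFK u)))
    have h4 := ENNReal.Tendsto.mul h1 (Or.inl one_ne_zero) h3 (Or.inr ENNReal.one_ne_top)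
    rwa [one_mul] at h4

/-- The normalizing constant of the self-consistent density. -/
def meanPartition (γ : ℝ) (ν : Measure X) (G : X → X → ℝ≥0∞) (μ : Measure X) : ℝ≥0∞ :=
  ∫⁻ u, expNeg (ENNReal.ofReal γ * meanPotential G μ u) ∂ν

lemma measurable_expNeg_meanPotential (hG : Measurable (Function.uncurry G)) (μ : Measure X)
    [SigmaFinite μ] (γ : ℝ) :
    Measurable fun u ↦ expNeg (ENNReal.ofReal γ * meanPotential G μ u) :=
  measurable_expNeg.comp ((measurable_meanPotential hG μ).const_mul _)

lemma meanPartition_ne_top (γ : ℝ) (G : X → X → ℝ≥0∞) (μ : Measure X) :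
    meanPartition γ ν G μ ≠ ⊤ := by
  refine ne_top_of_le_ne_top ENNReal.one_ne_top ?_
  calc meanPartition γ ν G μ ≤ ∫⁻ _, 1 ∂ν := lintegral_mono fun u ↦ expNeg_le_one _
    _ = 1 := by simp

lemma MeanFieldKernel.meanPartition_ne_zero (hK : MeanFieldKernel ν ϑ G) {μ : Measure X}
    [SigmaFinite μ] {C : ℝ≥0} (hC : μ ≤ C • expDensity ν ϑ) (γ : ℝ) :
    meanPartition γ ν G μ ≠ 0 := by
  rw [meanPartition, Ne, lintegral_eq_zero_iff (measurable_expNeg_meanPotential hK.measurable μ γ)]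
  intro h0
  obtain ⟨u, hu⟩ := h0.exists
  exact (expNeg_pos (ENNReal.mul_ne_top ENNReal.ofReal_ne_top (hK.meanPotential_ne_top hC u))).ne'
    hu

lemma MeanFieldSequence.tendsto_gasZ_div (h : MeanFieldSequence ν ϑ γ b r)
    (hK : MeanFieldKernel ν ϑ G) (hγ : 0 ≤ γ) {μ : ProbabilityMeasure X}
    (hμ : IsUniqueMinimizer (meanFieldEnergy γ ν G) μ) :
    Tendsto (fun M ↦ (gasZ G (ENNReal.ofReal (b M)) M (expDensity ν (r M)))⁻¹ *
      gasZ G (ENNReal.ofReal (b M)) (M + 1) (expDensity ν (r M))) atTop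
      (𝓝 (meanPartition γ ν G μ)) := by
  have hfin : ∀ M, IsFiniteMeasure (expDensity ν (r M)) := hK.isFiniteMeasure_seq h
  have h1 := h.tendsto_lintegral_mul_gasA hK hγ hμ (F := fun _ ↦ 1) measurable_const (K := 1)
    (by simp)
  simp only [one_mul] at h1
  refine h1.congr fun M ↦ ?_
  rw [lintegral_gasA _ _ _ hK.measurable]

lemma inv_mul_eq_div {A Z Z' : ℝ≥0∞} (h0 : Z ≠ 0) (ht : Z ≠ ⊤) :
    Z⁻¹ * A * (Z⁻¹ * Z')⁻¹ = Z'⁻¹ * A := by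
  rw [ENNReal.mul_inv (Or.inl (ENNReal.inv_ne_zero.2 ht)) (Or.inl (ENNReal.inv_ne_top.2 h0)),
    inv_inv]
  calc Z⁻¹ * A * (Z * Z'⁻¹) = (Z⁻¹ * Z) * (Z'⁻¹ * A) := by ring
    _ = _ := by rw [ENNReal.inv_mul_cancel h0 ht, one_mul]

/-- This changes the normalisation from M to M + 1 particles. The quotient of the two partition
functions tends to `meanPartition`, which is neither 0 nor ∞. -/
lemma MeanFieldSequence.tendsto_mul_inv_gasZ (h : MeanFieldSequence ν ϑ γ b r)
    (hK : MeanFieldKernel ν ϑ G) (hγ : 0 ≤ γ) {μ : ProbabilityMeasure X}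
    (hμ : IsUniqueMinimizer (meanFieldEnergy γ ν G) μ) {A : ℕ → ℝ≥0∞} {a : ℝ≥0∞} (ha : a ≠ ⊤)
    (hA : Tendsto (fun M ↦ (gasZ G (ENNReal.ofReal (b M)) M (expDensity ν (r M)))⁻¹ * A M) atTop
      (𝓝 a)) :
    Tendsto (fun M ↦ (gasZ G (ENNReal.ofReal (b M)) (M + 1) (expDensity ν (r M)))⁻¹ * A M) atTop
      (𝓝 (a * (meanPartition γ ν G μ)⁻¹)) := by
  have hf := hK.finiteEnergy hγ hμ
  obtain ⟨C, hC⟩ := hK.exists_le_smul hγ hμ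
  have h1 := ENNReal.Tendsto.mul hA (Or.inr (ENNReal.inv_ne_top.2
    (hK.meanPartition_ne_zero hC γ))) (h.tendsto_gasZ_div hK hγ hμ).inv (Or.inr ha)
  refine h1.congr' ?_
  filter_upwards [h.eventually_gasZ_ne_zero hK hf] with M hM
  have hfin : IsFiniteMeasure (expDensity ν (r M)) := hK.isFiniteMeasure_seq h M
  exact inv_mul_eq_div hM (gasZ_ne_top _ _ _)

/-- The correlation function at a converging sequence of points. -/
lemma MeanFieldSequence.tendsto_gasA_div (h : MeanFieldSequence ν ϑ γ b r)
    (hK : MeanFieldKernel ν ϑ G) (hγ : 0 ≤ γ) {μ : ProbabilityMeasure X}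
    (hμ : IsUniqueMinimizer (meanFieldEnergy γ ν G) μ) {u : X} {v : ℕ → X}
    (hv : Tendsto v atTop (𝓝 u)) :
    Tendsto (fun M ↦ (gasZ G (ENNReal.ofReal (b M)) (M + 1) (expDensity ν (r M)))⁻¹ *
      gasA G (ENNReal.ofReal (b M)) M (expDensity ν (r M)) (v M)) atTop
      (𝓝 (expNeg (ENNReal.ofReal γ * meanPotential G μ u) * (meanPartition γ ν G μ)⁻¹)) :=
  h.tendsto_mul_inv_gasZ hK hγ hμ (expNeg_ne_top _) (h.tendsto_gasA_div_gasZ hK hγ hμ hv)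

lemma MeanFieldSequence.exists_gasA_div_le (h : MeanFieldSequence ν ϑ γ b r)
    (hK : MeanFieldKernel ν ϑ G) {μ : Measure X} [IsProbabilityMeasure μ]
    (hf : FiniteEnergy γ ν ϑ G μ) :
    ∃ C : ℝ≥0, ∀ᶠ M : ℕ in atTop, ∀ u,
      (gasZ G (ENNReal.ofReal (b M)) (M + 1) (expDensity ν (r M)))⁻¹ *
        gasA G (ENNReal.ofReal (b M)) M (expDensity ν (r M)) u ≤ C := by
  obtain ⟨C, hC⟩ := h.exists_mul_gasZ_le hK hf
  refine ⟨C, hC.mono fun M hM u ↦ ?_⟩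
  calc _ ≤ (gasZ G (ENNReal.ofReal (b M)) (M + 1) (expDensity ν (r M)))⁻¹ *
        (C * gasZ G (ENNReal.ofReal (b M)) (M + 1) (expDensity ν (r M))) := by
        gcongr
        exact (gasA_le_gasZ _ _ _ u).trans hM
    _ = C * ((gasZ G (ENNReal.ofReal (b M)) (M + 1) (expDensity ν (r M)))⁻¹ *
        gasZ G (ENNReal.ofReal (b M)) (M + 1) (expDensity ν (r M))) := by ring
    _ ≤ C * 1 := by gcongr; exact ENNReal.inv_mul_le_one _
    _ = C := mul_one _

/-- The minimizer solves the mean-field equation. -/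
theorem MeanFieldKernel.eq_withDensity (hK : MeanFieldKernel ν ϑ G) (hγ : 0 ≤ γ)
    {μ : ProbabilityMeasure X} (hμ : IsUniqueMinimizer (meanFieldEnergy γ ν G) μ) :
    (μ : Measure X) = ν.withDensity fun u ↦
      expNeg (ENNReal.ofReal γ * meanPotential G μ u) * (meanPartition γ ν G μ)⁻¹ := by
  -- The mean of Σ ψ(x_j) / (M + 1) in the gas with M + 1 particles has two limits: ∫ ψ dμ by the
  -- law of large numbers (`hlim1`), and the integral of ψ against the self-consistent density by
  -- the limit of the one-particle function (`hlim2`).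
  have h := exists_meanFieldSequence ν hK.theta_nonneg hγ
  have hf := hK.finiteEnergy hγ hμ
  obtain ⟨C, hC⟩ := hK.exists_le_smul hγ hμ
  have hm := measurable_expNeg_meanPotential hK.measurable (μ : Measure X) γ
  have hp0 := hK.meanPartition_ne_zero hC γ
  have hpt := meanPartition_ne_top (ν := ν) γ G (μ : Measure X)
  have hfin : IsFiniteMeasure (ν.withDensity fun u ↦
      expNeg (ENNReal.ofReal γ * meanPotential G μ u) * (meanPartition γ ν G μ)⁻¹) := by
    refine isFiniteMeasure_withDensity ?_
    rw [lintegral_mul_const _ hm]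
    exact ENNReal.mul_ne_top hpt (ENNReal.inv_ne_top.2 hp0)
  refine ext_of_forall_lintegral_eq_of_IsFiniteMeasure fun ψ ↦ ?_
  have hψm : Measurable fun x ↦ (ψ x : ℝ≥0∞) := ψ.continuous.measurable.coe_nnreal_ennreal
  rw [lintegral_withDensity_eq_lintegral_mul _ (hm.mul_const _) hψm]
  obtain ⟨D, hDm, hD, hDle⟩ := h.exists_deviation hK hγ hμ ψ
  set I := ∫⁻ x, ψ x ∂(μ : Measure X) with hI
  have hIt : I ≠ ⊤ := (ψ.lintegral_lt_top_of_nnreal _).ne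
  have hlim1 : Tendsto (fun M ↦ (gasZ G (ENNReal.ofReal (γ / (M + 1 : ℕ))) (M + 1)
      (expDensity ν fun _ ↦ 0))⁻¹ * ∫⁻ u, ψ u * gasA G (ENNReal.ofReal (γ / (M + 1 : ℕ))) M
        (expDensity ν fun _ ↦ 0) u ∂(expDensity ν fun _ ↦ 0)) atTop (𝓝 I) := by
    have hD' := hD.comp (tendsto_add_atTop_nat 1)
    refine tendsto_of_forall_eventually_le (K := 1) hIt (by simp) fun ε hε ↦ ?_
    filter_upwards [hD'.eventually_le_const (pos_iff_ne_zero.2 hε),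
      (tendsto_add_atTop_nat 1).eventually (h.eventually_gasZ_ne_zero hK hf)] with M hM hZ0
    have hfinM := hK.isFiniteMeasure_seq h (M + 1)
    have hprob := isProbabilityMeasure_gasMeasure hZ0 (gasZ_ne_top _ (M + 1) _)
    have hM0 : ((M + 1 : ℕ) : ℝ≥0∞) ≠ 0 := by simp
    have hsum : Measurable fun x : Fin (M + 1) → X ↦ ∑ j, (ψ (x j) : ℝ≥0∞) :=
      Finset.measurable_sum _ fun j _ ↦ hψm.comp (measurable_pi_apply j)
    have hE := lintegral_gasMeasure (b := ENNReal.ofReal (γ / (M + 1 : ℕ)))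
      (m := expDensity ν fun _ ↦ 0) hK.measurable hsum
    rw [lintegral_sum_mul_gasWeight _ M _ hK.measurable hK.symm hψm, mul_left_comm] at hE
    simp only [Function.comp_apply] at hM
    set P := gasMeasure G (ENNReal.ofReal (γ / (M + 1 : ℕ))) (M + 1) (expDensity ν fun _ ↦ 0)
    rw [one_mul]
    constructor
    · rw [← ENNReal.mul_le_mul_iff_right hM0 (ENNReal.natCast_ne_top _), ← hE]
      calc _ ≤ ∫⁻ x, (M + 1 : ℕ) * (I + D (M + 1) x) ∂P :=
            lintegral_mono fun x ↦ (hDle (M + 1) M.succ_pos x).1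
        _ = (M + 1 : ℕ) * (I + ∫⁻ x, D (M + 1) x ∂P) := by
            rw [lintegral_const_mul' _ _ (ENNReal.natCast_ne_top _),
              lintegral_add_left measurable_const]
            simp
        _ ≤ _ := by gcongr
    · rw [← ENNReal.mul_le_mul_iff_right hM0 (ENNReal.natCast_ne_top _), mul_add, ← hE]
      calc (M + 1 : ℕ) * I = ∫⁻ _, (M + 1 : ℕ) * I ∂P := by simp
        _ ≤ ∫⁻ x, (∑ j, (ψ (x j) : ℝ≥0∞) + (M + 1 : ℕ) * D (M + 1) x) ∂P :=
            lintegral_mono fun x ↦ (hDle (M + 1) M.succ_pos x).2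
        _ ≤ _ := by
            rw [lintegral_add_left hsum, lintegral_const_mul' _ _ (ENNReal.natCast_ne_top _)]
            gcongr
  have hlim2 := h.shift.tendsto_mul_inv_gasZ hK hγ hμ ?_
    (h.shift.tendsto_lintegral_mul_gasA hK hγ hμ hψm (K := nndist ψ 0) fun u ↦ by
      exact_mod_cast BoundedContinuousFunction.NNReal.upper_bound ψ u)
  · have hψE : Measurable fun u ↦ (ψ u : ℝ≥0∞) *
        expNeg (ENNReal.ofReal γ * meanPotential G (μ : Measure X) u) := hψm.mul hm
    rw [tendsto_nhds_unique hlim1 hlim2, ← lintegral_mul_const _ hψE]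
    exact lintegral_congr fun u ↦ by simp only [Pi.mul_apply]; ring
  · refine ne_top_of_le_ne_top (ψ.lintegral_lt_top_of_nnreal ν).ne (lintegral_mono fun u ↦ ?_)
    exact mul_le_of_le_one_right zero_le (expNeg_le_one _)

end OneParticleDensity

/-! ### Construction of Poisson processes. -/

section PoissonProcess

open ProbabilityTheory

variable {S : Type*} [MeasurableSpace S]

/-- A Poisson number of independent points with law `p`. -/
def finitePoissonMeasure (l : ℝ≥0) (p : Measure S) : Measure (ℕ × (ℕ → S)) :=
  (poissonMeasure l).prod (Measure.infinitePi fun _ ↦ p)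

/-- The counting measure of the first `w.1` points of the sequence `w.2`. -/
def initialPoints (w : ℕ × (ℕ → S)) : Measure S :=
  ∑ k ∈ Finset.range w.1, Measure.dirac (w.2 k)

/-- The superposition of countably many finite point configurations. -/
def superposition (w : ℕ → ℕ × (ℕ → S)) : Measure S := Measure.sum fun i ↦ initialPoints (w i)

instance (l : ℝ≥0) (p : Measure S) [IsProbabilityMeasure p] :
    IsProbabilityMeasure (finitePoissonMeasure l p) := by
  unfold finitePoissonMeasure; infer_instance

lemma lintegral_initialPoints (w : ℕ × (ℕ → S)) {f : S → ℝ≥0∞} (hf : Measurable f) :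
    ∫⁻ y, f y ∂(initialPoints w) = ∑ k ∈ Finset.range w.1, f (w.2 k) := by
  rw [initialPoints, lintegral_finsetSum_measure]
  exact Finset.sum_congr rfl fun k _ ↦ lintegral_dirac' _ hf

lemma measurable_sum_initialPoints {f : S → ℝ≥0∞} (hf : Measurable f) :
    Measurable fun w : ℕ × (ℕ → S) ↦ ∑ k ∈ Finset.range w.1, f (w.2 k) :=
  measurable_from_prod_countable_right fun N ↦
    (Finset.measurable_sum (Finset.range N) fun k _ ↦ hf.comp (measurable_pi_apply k) :
      Measurable fun x : ℕ → S ↦ ∑ k ∈ Finset.range N, f (x k))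

lemma measurable_initialPoints : Measurable (initialPoints (S := S)) := by
  refine Measure.measurable_of_measurable_coe _ fun s hs ↦ ?_
  have h : (fun w : ℕ × (ℕ → S) ↦ initialPoints w s) =
      fun w ↦ ∑ k ∈ Finset.range w.1, s.indicator (1 : S → ℝ≥0∞) (w.2 k) := by
    funext w
    rw [← lintegral_indicator_one hs, lintegral_initialPoints w (measurable_one.indicator hs)]
  rw [h]
  exact measurable_sum_initialPoints (measurable_one.indicator hs)

lemma measurable_superposition : Measurable (superposition (S := S)) := by
  refine Measure.measurable_of_measurable_coe _ fun s hs ↦ ?_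
  simp only [superposition, Measure.sum_apply _ hs]
  exact Measurable.tsum fun i ↦
    (Measure.measurable_coe hs).comp (measurable_initialPoints.comp (measurable_pi_apply i))

lemma lintegral_expNeg_sum_infinitePi (p : Measure S) [IsProbabilityMeasure p] {f : S → ℝ≥0∞}
    (hf : Measurable f) (N : ℕ) :
    ∫⁻ x : ℕ → S, expNeg (∑ k ∈ Finset.range N, f (x k)) ∂(Measure.infinitePi fun _ ↦ p) =
      (∫⁻ y, expNeg (f y) ∂p) ^ N := by
  have hm : Measurable fun y ↦ expNeg (f y) := measurable_expNeg.comp hf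
  have hind : iIndepFun (fun (k : ℕ) (x : ℕ → S) ↦ expNeg (f (x k)))
      (Measure.infinitePi fun _ ↦ p) := iIndepFun_infinitePi (X := fun _ y ↦ expNeg (f y))
        fun _ ↦ hm
  simp only [expNeg_sum]
  rw [lintegral_prod_eq_prod_lintegral_of_indepFun _ _ hind
    fun k ↦ hm.comp (measurable_pi_apply k)]
  rw [Finset.prod_congr rfl fun k _ ↦
    (measurePreserving_eval_infinitePi (fun _ : ℕ ↦ p) k).lintegral_comp hm]
  simp

lemma lintegral_pow_poissonMeasure (l : ℝ≥0) {q : ℝ} (hq0 : 0 ≤ q) (hq1 : q ≤ 1) :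
    ∫⁻ N, ENNReal.ofReal q ^ N ∂(poissonMeasure l) = expNeg (l * ENNReal.ofReal (1 - q)) := by
  have hs : HasSum (fun N : ℕ ↦ Real.exp (-l) * ((l * q) ^ N / N.factorial))
      (Real.exp (-l) * Real.exp (l * q)) := by
    rw [Real.exp_eq_exp_ℝ]
    exact (NormedSpace.expSeries_div_hasSum_exp (l * q : ℝ)).mul_left _
  have hl : (l : ℝ≥0∞) * ENNReal.ofReal (1 - q) = ENNReal.ofReal (l * (1 - q)) := by
    rw [ENNReal.ofReal_mul (NNReal.coe_nonneg l), ENNReal.ofReal_coe_nnreal]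
  rw [hl, expNeg_ofReal (mul_nonneg (NNReal.coe_nonneg l) (by linarith)), poissonMeasure, lintegral_sum_measure]
  simp only [lintegral_smul_measure, lintegral_dirac, smul_eq_mul]
  rw [show -((l : ℝ) * (1 - q)) = -l + l * q by ring, Real.exp_add, ← hs.tsum_eq,
    ENNReal.ofReal_tsum_of_nonneg (fun N ↦ by positivity) hs.summable]
  refine tsum_congr fun N ↦ ?_
  rw [← ENNReal.ofReal_pow hq0, ← ENNReal.ofReal_mul (by positivity)]
  congr 1
  rw [mul_pow]
  ring

/-- Given N points the functional equals q^N with q = ∫ e^{-f} dp. The generating function of the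
Poisson law turns this into exp(-l (1 - q)), and 1 - q = ∫ (1 - e^{-f}) dp. -/
lemma lintegral_expNeg_finitePoissonMeasure (l : ℝ≥0) (p : Measure S) [IsProbabilityMeasure p]
    {f : S → ℝ≥0} (hf : Measurable f) :
    ∫⁻ w, expNeg (∫⁻ y, f y ∂(initialPoints w)) ∂(finitePoissonMeasure l p) =
      expNeg (∫⁻ y, ENNReal.ofReal (1 - Real.exp (-(f y : ℝ))) ∂(l • p)) := by
  have hf' : Measurable fun y ↦ (f y : ℝ≥0∞) := hf.coe_nnreal_ennreal
  have hm : Measurable fun y ↦ expNeg (f y) := measurable_expNeg.comp hf'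
  have hm1 : Measurable fun y ↦ ENNReal.ofReal (1 - Real.exp (-(f y : ℝ))) :=
    (measurable_const.sub (Real.measurable_exp.comp hf.coe_nnreal_real.neg)).ennreal_ofReal
  set q := ∫⁻ y, expNeg (f y) ∂p with hq
  have hq1 : q ≤ 1 := by
    calc q ≤ ∫⁻ _, 1 ∂p := lintegral_mono fun y ↦ expNeg_le_one _
      _ = 1 := by simp
  have hqt : q ≠ ⊤ := ne_top_of_le_ne_top ENNReal.one_ne_top hq1
  have hqr : q.toReal ≤ 1 := ENNReal.toReal_le_of_le_ofReal zero_le_one (by simpa using hq1)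
  have hsplit : ∫⁻ y, ENNReal.ofReal (1 - Real.exp (-(f y : ℝ))) ∂p =
      ENNReal.ofReal (1 - q.toReal) := by
    have h1 : ∫⁻ y, ENNReal.ofReal (1 - Real.exp (-(f y : ℝ))) ∂p + q = 1 := by
      rw [hq, ← lintegral_add_left hm1]
      calc _ = ∫⁻ _, 1 ∂p := lintegral_congr fun y ↦ by
            rw [expNeg_of_ne_top ENNReal.coe_ne_top, ENNReal.coe_toReal, ← ENNReal.ofReal_add _
              (Real.exp_pos _).le]
            · simp
            · simp
        _ = 1 := by simp
    rw [ENNReal.ofReal_sub _ ENNReal.toReal_nonneg, ENNReal.ofReal_toReal hqt, ENNReal.ofReal_one]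
    exact ENNReal.eq_sub_of_add_eq hqt h1
  simp only [lintegral_initialPoints _ hf']
  have hm2 : Measurable fun w : ℕ × (ℕ → S) ↦
      expNeg (∑ k ∈ Finset.range w.1, (f (w.2 k) : ℝ≥0∞)) :=
    measurable_expNeg.comp (measurable_sum_initialPoints hf')
  rw [finitePoissonMeasure, lintegral_prod _ hm2.aemeasurable]
  simp only [lintegral_expNeg_sum_infinitePi p hf']
  have h3 := lintegral_pow_poissonMeasure l ENNReal.toReal_nonneg hqr
  rw [ENNReal.ofReal_toReal hqt] at h3
  rw [h3, lintegral_smul_measure, hsplit]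
  rfl

/-- Independence makes the functional multiplicative over finitely many pieces, and dominated
convergence with bound 1 passes to countably many. -/
lemma lintegral_expNeg_superposition (l : ℕ → ℝ≥0) (p : ℕ → Measure S)
    [∀ i, IsProbabilityMeasure (p i)] {f : S → ℝ≥0} (hf : Measurable f) :
    ∫⁻ w, expNeg (∫⁻ y, f y ∂(superposition w))
        ∂(Measure.infinitePi fun i ↦ finitePoissonMeasure (l i) (p i)) =
      expNeg (∫⁻ y, ENNReal.ofReal (1 - Real.exp (-(f y : ℝ)))
        ∂(Measure.sum fun i ↦ l i • p i)) := by
  have hf' : Measurable fun y ↦ (f y : ℝ≥0∞) := hf.coe_nnreal_ennreal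
  set P := fun i ↦ finitePoissonMeasure (l i) (p i)
  have ha : Measurable fun w : ℕ × (ℕ → S) ↦ ∫⁻ y, f y ∂(initialPoints w) := by
    simp only [lintegral_initialPoints _ hf']
    exact measurable_sum_initialPoints hf'
  have hae : Measurable fun w : ℕ × (ℕ → S) ↦ expNeg (∫⁻ y, f y ∂(initialPoints w)) :=
    measurable_expNeg.comp ha
  have hind : iIndepFun (fun (i : ℕ) (w : ℕ → ℕ × (ℕ → S)) ↦
      expNeg (∫⁻ y, f y ∂(initialPoints (w i)))) (Measure.infinitePi P) :=
    iIndepFun_infinitePi (X := fun _ w ↦ expNeg (∫⁻ y, f y ∂(initialPoints w))) fun _ ↦ hae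
  simp only [superposition, lintegral_sum_measure]
  have hsum : ∀ a : ℕ → ℝ≥0∞, Tendsto (fun n ↦ expNeg (∑ i ∈ Finset.range n, a i)) atTop
      (𝓝 (expNeg (∑' i, a i))) := fun a ↦
    (continuous_expNeg.tendsto _).comp ENNReal.summable.hasSum.tendsto_sum_nat
  have h1 : Tendsto (fun n ↦ ∫⁻ w : ℕ → ℕ × (ℕ → S), expNeg (∑ i ∈ Finset.range n,
      ∫⁻ y, f y ∂(initialPoints (w i))) ∂(Measure.infinitePi P)) atTop
      (𝓝 (∫⁻ w : ℕ → ℕ × (ℕ → S), expNeg (∑' i, ∫⁻ y, f y ∂(initialPoints (w i)))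
        ∂(Measure.infinitePi P))) := by
    refine tendsto_lintegral_of_dominated_convergence (fun _ ↦ 1) (fun n ↦ ?_)
      (fun n ↦ ae_of_all _ fun w ↦ expNeg_le_one _) (by simp) (ae_of_all _ fun w ↦ hsum _)
    exact measurable_expNeg.comp (Finset.measurable_sum _ fun i _ ↦
      ha.comp (measurable_pi_apply i))
  refine tendsto_nhds_unique h1 ((hsum _).congr fun n ↦ ?_)
  simp only [expNeg_sum]
  rw [lintegral_prod_eq_prod_lintegral_of_indepFun _ _ hind
    fun i ↦ hae.comp (measurable_pi_apply i)]
  refine Finset.prod_congr rfl fun i _ ↦ ?_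
  rw [(measurePreserving_eval_infinitePi P i).lintegral_comp hae,
    lintegral_expNeg_finitePoissonMeasure (l i) (p i) hf]

lemma ae_ne_infinitePi [TopologicalSpace S] [T2Space S] [SecondCountableTopology S]
    [OpensMeasurableSpace S] (p : Measure S) [IsProbabilityMeasure p] (hp : ∀ x, p {x} = 0)
    {k l : ℕ} (hkl : k ≠ l) : ∀ᵐ x ∂(Measure.infinitePi fun _ : ℕ ↦ p), x k ≠ x l := by
  have h0 : p.prod p (Set.diagonal S) = 0 := by
    rw [Measure.measure_prod_null measurableSet_diagonal]
    refine ae_of_all _ fun x ↦ ?_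
    have h : Prod.mk x ⁻¹' Set.diagonal S = {x} := by
      ext y; simp [eq_comm]
    simp [h, hp]
  have hm : Measurable fun x : ℕ → S ↦ (x k, x l) :=
    (measurable_pi_apply k).prodMk (measurable_pi_apply l)
  rw [← Measure.infinitePi_map_eval_prod (P := fun _ : ℕ ↦ p) hkl,
    Measure.map_apply hm measurableSet_diagonal] at h0
  exact measure_eq_zero_iff_ae_notMem.1 h0

/-- Almost surely points of one piece are distinct, as p i has no atoms, and points of different
pieces are distinct, as the s i are disjoint. Only finitely many pieces meet a compact set. -/
lemma isPointProcess_superposition [TopologicalSpace S] [T2Space S] [SecondCountableTopology S]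
    [OpensMeasurableSpace S] (l : ℕ → ℝ≥0) (p : ℕ → Measure S) [∀ i, IsProbabilityMeasure (p i)]
    (hp : ∀ i x, p i {x} = 0) (s : ℕ → Set S) (hps : ∀ i, ∀ᵐ x ∂(p i), x ∈ s i)
    (hd : Pairwise (Function.onFun Disjoint s))
    (hs : ∀ K, IsCompact K → ∃ R, ∀ i, (s i ∩ K).Nonempty → i < R) :
    IsPointProcess (Measure.infinitePi fun i ↦ finitePoissonMeasure (l i) (p i))
      (superposition (S := S)) := by
  refine ⟨measurable_superposition, ?_⟩
  set P := fun i ↦ finitePoissonMeasure (l i) (p i)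
  have h1 : ∀ᵐ w ∂(Measure.infinitePi P), ∀ i k, (w i).2 k ∈ s i := by
    refine ae_all_iff.2 fun i ↦ (measurePreserving_eval_infinitePi P i).quasiMeasurePreserving.ae
      (p := fun w ↦ ∀ k, w.2 k ∈ s i) ?_
    refine Measure.quasiMeasurePreserving_snd.ae (p := fun x : ℕ → S ↦ ∀ k, x k ∈ s i) ?_
    exact ae_all_iff.2 fun k ↦
      (measurePreserving_eval_infinitePi (fun _ : ℕ ↦ p i) k).quasiMeasurePreserving.ae (hps i)
  have h2 : ∀ᵐ w ∂(Measure.infinitePi P), ∀ i k k', k ≠ k' → (w i).2 k ≠ (w i).2 k' := by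
    refine ae_all_iff.2 fun i ↦ (measurePreserving_eval_infinitePi P i).quasiMeasurePreserving.ae
      (p := fun w ↦ ∀ k k', k ≠ k' → w.2 k ≠ w.2 k') ?_
    refine Measure.quasiMeasurePreserving_snd.ae
      (p := fun x : ℕ → S ↦ ∀ k k', k ≠ k' → x k ≠ x k') ?_
    refine ae_all_iff.2 fun k ↦ ae_all_iff.2 fun k' ↦ ?_
    by_cases hkk : k = k'
    · exact ae_of_all _ fun x hx ↦ absurd hkk hx
    · exact (ae_ne_infinitePi (p i) (hp i) hkk).mono fun x hx _ ↦ hx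
  filter_upwards [h1, h2] with w hw1 hw2
  let e : (Σ i, Fin (w i).1) → S := fun q ↦ (w q.1).2 q.2
  have he : Function.Injective e := by
    rintro ⟨i, k⟩ ⟨j, k'⟩ h
    have hij : i = j := by
      by_contra hij
      exact Set.disjoint_left.1 (hd hij) (hw1 i k) (by rw [show (w i).2 k = (w j).2 k' from h];
                                                       exact hw1 j k')
    subst hij
    by_contra hne
    exact hw2 i k k' (fun hk ↦ hne (by rw [Fin.ext hk])) h
  refine ⟨Set.range e, fun K hK ↦ ?_, ?_⟩
  · obtain ⟨R, hR⟩ := hs K hK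
    refine (((Finset.range R).sigma fun i ↦ (Finset.univ : Finset (Fin (w i).1))).finite_toSet.image
      e).subset ?_
    rintro _ ⟨⟨q, rfl⟩, hq⟩
    refine ⟨q, ?_, rfl⟩
    simpa using hR q.1 ⟨_, hw1 q.1 q.2, hq⟩
  · ext t ht
    rw [superposition, Measure.sum_apply _ ht, Measure.sum_apply _ ht,
      ← (Equiv.ofInjective e he).tsum_eq, ENNReal.tsum_sigma']
    refine tsum_congr fun i ↦ ?_
    rw [tsum_fintype, initialPoints, Measure.finsetSum_apply, Finset.sum_range]
    rfl

/-- Existence of the homogeneous Poisson process. -/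
theorem exists_isPoissonProcess {n : ℕ} (hn : 1 ≤ n) (c : ℝ≥0) :
    ∃ (Ω : Type) (_ : MeasurableSpace Ω) (P : Measure Ω)
      (Ξ : Ω → Measure (EuclideanSpace ℝ (Fin n))),
      IsProbabilityMeasure P ∧
        IsPoissonProcess P Ξ ((c : ℝ≥0∞) • (volume : Measure (EuclideanSpace ℝ (Fin n)))) := by
  have : Nonempty (Fin n) := ⟨⟨0, hn⟩⟩
  -- The shells i ≤ ‖y‖ < i + 1 are disjoint, have positive finite volume, and only finitely many of
  -- them meet a bounded set.
  let s : ℕ → Set (EuclideanSpace ℝ (Fin n)) := fun i ↦ {y | ⌊‖y‖⌋₊ = i}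
  have hsm : ∀ i, MeasurableSet (s i) := fun i ↦
    (Nat.measurable_floor.comp measurable_norm) (measurableSet_singleton i)
  have hs0 : ∀ i, volume (s i) ≠ 0 := by
    intro i
    have hopen : IsOpen {y : EuclideanSpace ℝ (Fin n) | (i : ℝ) < ‖y‖ ∧ ‖y‖ < i + 1} :=
      (isOpen_lt continuous_const continuous_norm).inter
        (isOpen_lt continuous_norm continuous_const)
    have hne : {y : EuclideanSpace ℝ (Fin n) | (i : ℝ) < ‖y‖ ∧ ‖y‖ < i + 1}.Nonempty := by
      obtain ⟨y, hy⟩ := exists_norm_eq (EuclideanSpace ℝ (Fin n))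
        (show (0 : ℝ) ≤ i + 1 / 2 by positivity)
      exact ⟨y, by constructor <;> rw [hy] <;> linarith⟩
    refine ne_of_gt (lt_of_lt_of_le (hopen.measure_pos volume hne) (measure_mono ?_))
    intro y hy
    exact (Nat.floor_eq_iff (norm_nonneg y)).2 ⟨hy.1.le, hy.2⟩
  have hst : ∀ i, volume (s i) ≠ ⊤ := by
    intro i
    refine ne_top_of_le_ne_top (measure_ball_lt_top (x := (0 : EuclideanSpace ℝ (Fin n)))
      (r := i + 1)).ne (measure_mono fun y hy ↦ ?_)
    rw [mem_ball_zero_iff]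
    exact ((Nat.floor_eq_iff (norm_nonneg y)).1 hy).2
  let p : ℕ → Measure (EuclideanSpace ℝ (Fin n)) := fun i ↦ volume[|s i]
  have hprob : ∀ i, IsProbabilityMeasure (p i) := fun i ↦
    cond_isProbabilityMeasure_of_finite (hs0 i) (hst i)
  let l : ℕ → ℝ≥0 := fun i ↦ c * (volume (s i)).toNNReal
  have hd : Pairwise (Function.onFun Disjoint s) := fun i j hij ↦
    Set.disjoint_left.2 fun y hi hj ↦ hij (hi.symm.trans hj)
  have hlp : ∀ i, l i • p i = (c : ℝ≥0∞) • volume.restrict (s i) := by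
    intro i
    ext t ht
    simp only [p, l, ProbabilityTheory.cond, Measure.smul_apply, ENNReal.smul_def, smul_eq_mul,
      ENNReal.coe_mul, ENNReal.coe_toNNReal (hst i)]
    rw [mul_assoc, ← mul_assoc (volume (s i)), ENNReal.mul_inv_cancel (hs0 i) (hst i), one_mul]
  have hsum : Measure.sum (fun i ↦ l i • p i) =
      (c : ℝ≥0∞) • (volume : Measure (EuclideanSpace ℝ (Fin n))) := by
    have hU : ⋃ i, s i = Set.univ := Set.eq_univ_of_forall fun y ↦ Set.mem_iUnion.2 ⟨_, rfl⟩
    simp only [hlp]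
    have hv : (volume : Measure (EuclideanSpace ℝ (Fin n))) =
        Measure.sum fun i ↦ volume.restrict (s i) := by
      rw [← Measure.restrict_iUnion hd hsm, hU, Measure.restrict_univ]
    ext t ht
    rw [hv, Measure.smul_apply, Measure.sum_apply _ ht, Measure.sum_apply _ ht, smul_eq_mul,
      ← ENNReal.tsum_mul_left, ← hv]
    rfl
  refine ⟨_, _, Measure.infinitePi fun i ↦ finitePoissonMeasure (l i) (p i), superposition,
    inferInstance, isPointProcess_superposition l p (fun i x ↦ ?_) s (fun i ↦ ?_) hd
      (fun K hK ↦ ?_), fun f hf ↦ ?_⟩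
  · exact cond_absolutelyContinuous (measure_singleton x)
  · exact ae_cond_mem (hsm i)
  · obtain ⟨R, hR⟩ := hK.isBounded.exists_norm_le
    refine ⟨⌊R⌋₊ + 1, fun i ⟨y, hi, hy⟩ ↦ ?_⟩
    rw [← show ⌊‖y‖⌋₊ = i from hi]
    exact Nat.lt_succ_of_le (Nat.floor_mono (hR y hy))
  · have h := lintegral_expNeg_superposition l p hf
    rw [hsum] at h
    exact h

end PoissonProcess

/-! ### Riemannian volume in charts. -/

section Geometry

variable {n : ℕ} {X : Type*} [MetricSpace X] [ChartedSpace (EuclideanSpace ℝ (Fin n)) X]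
  [IsManifold (𝓡 n) ∞ X] [RiemannianBundle (fun x : X ↦ TangentSpace (𝓡 n) x)]

/-- The inner product of the tangent space at `p`. -/
def tangentInner (p : X) (v w : TangentSpace (𝓡 n) p) : ℝ := inner ℝ v w

/-- The derivative of the inverse of a chart, as a map on the model space. -/
def chartDeriv (e : OpenPartialHomeomorph X (EuclideanSpace ℝ (Fin n)))
    (y : EuclideanSpace ℝ (Fin n)) : EuclideanSpace ℝ (Fin n) →L[ℝ] EuclideanSpace ℝ (Fin n) :=
  mfderiv (𝓡 n) (𝓡 n) e.symm y

lemma metricMatrix_apply (e : OpenPartialHomeomorph X (EuclideanSpace ℝ (Fin n)))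
    (y : EuclideanSpace ℝ (Fin n)) (i j : Fin n) :
    metricMatrix e y i j = tangentInner (e.symm y) (chartDeriv e y (EuclideanSpace.single i 1))
      (chartDeriv e y (EuclideanSpace.single j 1)) := rfl

lemma tangentInner_sum (p : X) {ι : Type*} (s : Finset ι) (a b : ι → ℝ)
    (v w : ι → TangentSpace (𝓡 n) p) :
    tangentInner p (∑ k ∈ s, a k • v k) (∑ l ∈ s, b l • w l) =
      ∑ k ∈ s, ∑ l ∈ s, a k * b l * tangentInner p (v k) (w l) := by
  simp only [tangentInner, sum_inner, inner_sum, real_inner_smul_left, real_inner_smul_right]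
  rw [Finset.sum_comm]
  exact Finset.sum_congr rfl fun k _ ↦ Finset.sum_congr rfl fun l _ ↦ by ring

/-- The coordinate fields are images of constant sections under the tangent map of a smooth inverse
chart, hence continuous, and the metric is continuous on pairs of continuous sections. -/
lemma continuousOn_metricMatrix [IsContMDiffRiemannianBundle (𝓡 n) ∞ (EuclideanSpace ℝ (Fin n))
      (fun x : X ↦ TangentSpace (𝓡 n) x)]
    {e : OpenPartialHomeomorph X (EuclideanSpace ℝ (Fin n))}
    (he : e ∈ IsManifold.maximalAtlas (𝓡 n) ∞ X) (i j : Fin n) :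
    ContinuousOn (fun y ↦ metricMatrix e y i j) e.target := by
  have hsec : ∀ i, ContinuousOn (fun y ↦ (⟨e.symm y, coordVector e y i⟩ :
      TotalSpace (EuclideanSpace ℝ (Fin n)) (fun x : X ↦ TangentSpace (𝓡 n) x))) e.target := by
    intro i
    have h1 := (contMDiffOn_symm_of_mem_maximalAtlas he).continuousOn_tangentMapWithin
      (by simp) e.open_target.uniqueMDiffOn
    have h2 : Continuous fun y : EuclideanSpace ℝ (Fin n) ↦
        ((tangentBundleModelSpaceHomeomorph (𝓡 n)).symm (y, EuclideanSpace.single i (1 : ℝ))) :=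
      (tangentBundleModelSpaceHomeomorph (𝓡 n)).symm.continuous.comp
        (Continuous.prodMk continuous_id continuous_const)
    have h3 := h1.comp (s := e.target) h2.continuousOn fun y hy ↦ hy
    refine h3.congr fun y hy ↦ ?_
    simp only [Function.comp_apply, tangentMapWithin, coordVector]
    rw [← mfderivWithin_of_isOpen e.open_target hy]
    rfl
  have hR : IsContinuousRiemannianBundle (EuclideanSpace ℝ (Fin n))
      (fun x : X ↦ TangentSpace (𝓡 n) x) := by
    obtain ⟨g, hg, hg'⟩ := IsContMDiffRiemannianBundle.exists_contMDiff (IB := 𝓡 n) (n := ∞)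
      (F := EuclideanSpace ℝ (Fin n)) (E := fun x : X ↦ TangentSpace (𝓡 n) x)
    exact ⟨g, hg.continuous, hg'⟩
  exact ContinuousOn.inner_bundle (hsec i) (hsec j)

section Transition

variable {e e' : OpenPartialHomeomorph X (EuclideanSpace ℝ (Fin n))}

/-- The domain of the transition map between two charts. -/
def overlap (e e' : OpenPartialHomeomorph X (EuclideanSpace ℝ (Fin n))) :
    Set (EuclideanSpace ℝ (Fin n)) := e.target ∩ e.symm ⁻¹' e'.source

lemma isOpen_overlap (e e' : OpenPartialHomeomorph X (EuclideanSpace ℝ (Fin n))) :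
    IsOpen (overlap e e') :=
  e.symm.isOpen_inter_preimage e'.open_source

lemma mdifferentiableAt_transition (he : e ∈ IsManifold.maximalAtlas (𝓡 n) ∞ X)
    (he' : e' ∈ IsManifold.maximalAtlas (𝓡 n) ∞ X) {y : EuclideanSpace ℝ (Fin n)}
    (hy : y ∈ overlap e e') : MDifferentiableAt (𝓡 n) (𝓡 n) (e' ∘ e.symm) y :=
  ((contMDiffAt_of_mem_maximalAtlas he' hy.2).mdifferentiableAt (by simp)).comp y
    ((contMDiffAt_symm_of_mem_maximalAtlas he hy.1).mdifferentiableAt (by simp))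

lemma differentiableAt_transition (he : e ∈ IsManifold.maximalAtlas (𝓡 n) ∞ X)
    (he' : e' ∈ IsManifold.maximalAtlas (𝓡 n) ∞ X) {y : EuclideanSpace ℝ (Fin n)}
    (hy : y ∈ overlap e e') : DifferentiableAt ℝ (e' ∘ e.symm) y :=
  mdifferentiableAt_iff_differentiableAt.1 (mdifferentiableAt_transition he he' hy)

lemma chartDeriv_eq (he : e ∈ IsManifold.maximalAtlas (𝓡 n) ∞ X)
    (he' : e' ∈ IsManifold.maximalAtlas (𝓡 n) ∞ X) {y : EuclideanSpace ℝ (Fin n)}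
    (hy : y ∈ overlap e e') (v : EuclideanSpace ℝ (Fin n)) :
    chartDeriv e y v = chartDeriv e' (e' (e.symm y)) (fderiv ℝ (e' ∘ e.symm) y v) := by
  have h1 : (e.symm : EuclideanSpace ℝ (Fin n) → X) =ᶠ[𝓝 y] e'.symm ∘ (e' ∘ e.symm) := by
    filter_upwards [(isOpen_overlap e e').mem_nhds hy] with z hz
    exact (e'.left_inv hz.2).symm
  have h2 := h1.mfderiv_eq (I := 𝓡 n) (I' := 𝓡 n)
  have h3 : MDifferentiableAt (𝓡 n) (𝓡 n) e'.symm ((e' ∘ e.symm) y) :=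
    (contMDiffAt_symm_of_mem_maximalAtlas he' (e'.map_source hy.2)).mdifferentiableAt (by simp)
  have h4 := mfderiv_comp_apply y h3 (mdifferentiableAt_transition he he' hy) v
  rw [mfderiv_eq_fderiv] at h4
  exact (congrArg (fun L : EuclideanSpace ℝ (Fin n) →L[ℝ] EuclideanSpace ℝ (Fin n) ↦ L v)
    h2).trans h4

/-- The Jacobian matrix of the transition map. -/
def jacobian (e e' : OpenPartialHomeomorph X (EuclideanSpace ℝ (Fin n)))
    (y : EuclideanSpace ℝ (Fin n)) : Matrix (Fin n) (Fin n) ℝ :=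
  Matrix.of fun k i ↦ fderiv ℝ (e' ∘ e.symm) y (EuclideanSpace.single i 1) k

lemma det_jacobian (e e' : OpenPartialHomeomorph X (EuclideanSpace ℝ (Fin n)))
    (y : EuclideanSpace ℝ (Fin n)) :
    (jacobian e e' y).det = (fderiv ℝ (e' ∘ e.symm) y).det := by
  have h := LinearMap.det_toMatrix (EuclideanSpace.basisFun (Fin n) ℝ).toBasis
    (fderiv ℝ (e' ∘ e.symm) y : EuclideanSpace ℝ (Fin n) →ₗ[ℝ] EuclideanSpace ℝ (Fin n))
  rw [ContinuousLinearMap.det, ← h]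
  rfl

lemma metricMatrix_eq (he : e ∈ IsManifold.maximalAtlas (𝓡 n) ∞ X)
    (he' : e' ∈ IsManifold.maximalAtlas (𝓡 n) ∞ X) {y : EuclideanSpace ℝ (Fin n)}
    (hy : y ∈ overlap e e') :
    metricMatrix e y =
      (jacobian e e' y).transpose * metricMatrix e' (e' (e.symm y)) * jacobian e e' y := by
  have hv : ∀ i, chartDeriv e y (EuclideanSpace.single i 1) =
      ∑ k, jacobian e e' y k i •
        chartDeriv e' (e' (e.symm y)) (EuclideanSpace.single k 1) := by
    intro i
    have h0 : fderiv ℝ (e' ∘ e.symm) y (EuclideanSpace.single i 1) =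
        ∑ k, jacobian e e' y k i • EuclideanSpace.single k (1 : ℝ) := by
      ext k
      simp [jacobian, Finset.sum_apply, Pi.single_apply]
    rw [chartDeriv_eq he he' hy, h0, map_sum]
    simp only [map_smul]
  ext i j
  rw [metricMatrix_apply, hv i, hv j]
  refine (tangentInner_sum (e.symm y) Finset.univ (fun k ↦ jacobian e e' y k i)
    (fun k ↦ jacobian e e' y k j)
    (fun k ↦ chartDeriv e' (e' (e.symm y)) (EuclideanSpace.single k 1))
    (fun k ↦ chartDeriv e' (e' (e.symm y)) (EuclideanSpace.single k 1))).trans ?_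
  simp only [Matrix.mul_apply, Matrix.transpose_apply, Finset.sum_mul]
  rw [Finset.sum_comm]
  refine Finset.sum_congr rfl fun l _ ↦ Finset.sum_congr rfl fun k _ ↦ ?_
  rw [metricMatrix_apply, e'.left_inv hy.2]
  ring

/-- The Gram matrix transforms as Jᵀ g J, so √det acquires |det J|, exactly the factor in the change
of variables formula. -/
lemma sqrt_det_metricMatrix (he : e ∈ IsManifold.maximalAtlas (𝓡 n) ∞ X)
    (he' : e' ∈ IsManifold.maximalAtlas (𝓡 n) ∞ X) {y : EuclideanSpace ℝ (Fin n)}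
    (hy : y ∈ overlap e e') :
    √(metricMatrix e y).det = |(fderiv ℝ (e' ∘ e.symm) y).det| *
      √(metricMatrix e' (e' (e.symm y))).det := by
  rw [metricMatrix_eq he he' hy, Matrix.det_mul, Matrix.det_mul, Matrix.det_transpose,
    det_jacobian, mul_right_comm, ← sq, Real.sqrt_mul (sq_nonneg _), Real.sqrt_sq_eq_abs]

end Transition

section Volume

variable [MeasurableSpace X] [BorelSpace X]
  [IsContMDiffRiemannianBundle (𝓡 n) ∞ (EuclideanSpace ℝ (Fin n))
    (fun x : X ↦ TangentSpace (𝓡 n) x)]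
  {e e' : OpenPartialHomeomorph X (EuclideanSpace ℝ (Fin n))}

lemma continuousOn_sqrt_det (he : e ∈ IsManifold.maximalAtlas (𝓡 n) ∞ X) :
    ContinuousOn (fun y ↦ √(metricMatrix e y).det) e.target := by
  refine Real.continuous_sqrt.comp_continuousOn ?_
  have h : ContinuousOn (fun y ↦ metricMatrix e y) e.target :=
    continuousOn_pi.2 fun i ↦ continuousOn_pi.2 fun j ↦ continuousOn_metricMatrix he i j
  exact Continuous.comp_continuousOn (g := Matrix.det) (by fun_prop) h

lemma aemeasurable_chartDensity (he : e ∈ IsManifold.maximalAtlas (𝓡 n) ∞ X) :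
    AEMeasurable (fun y ↦ ENNReal.ofReal √(metricMatrix e y).det) (volume.restrict e.target) :=
  ((continuousOn_sqrt_det he).aemeasurable e.open_target.measurableSet).ennreal_ofReal

lemma aemeasurable_chart_symm (e : OpenPartialHomeomorph X (EuclideanSpace ℝ (Fin n))) :
    AEMeasurable e.symm ((volume.restrict e.target).withDensity
      fun y ↦ ENNReal.ofReal √(metricMatrix e y).det) :=
  (e.continuousOn_symm.aemeasurable e.open_target.measurableSet).mono_ac
    (withDensity_absolutelyContinuous _ _)

/-- Integration with respect to the Riemannian volume in a chart. -/
lemma lintegral_chartVolume (he : e ∈ IsManifold.maximalAtlas (𝓡 n) ∞ X) {F : X → ℝ≥0∞}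
    (hF : Measurable F) :
    ∫⁻ x, F x ∂(chartVolume e) =
      ∫⁻ y in e.target, ENNReal.ofReal √(metricMatrix e y).det * F (e.symm y) := by
  rw [chartVolume, lintegral_map' hF.aemeasurable (aemeasurable_chart_symm e),
    lintegral_withDensity_eq_lintegral_mul₀ (aemeasurable_chartDensity he)]
  · rfl
  · exact hF.comp_aemeasurable (e.continuousOn_symm.aemeasurable e.open_target.measurableSet)

lemma measurableSet_chart_preimage (e : OpenPartialHomeomorph X (EuclideanSpace ℝ (Fin n)))
    {A : Set X} (hA : MeasurableSet A) : MeasurableSet (e.target ∩ e.symm ⁻¹' A) := by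
  have h := (continuousOn_iff_continuous_domRestrict.1 e.continuousOn_symm).measurable hA
  have h2 := e.open_target.measurableSet.subtype_image h
  convert h2 using 1
  ext y
  simp [Set.domRestrict, and_comm]

lemma chartVolume_apply (he : e ∈ IsManifold.maximalAtlas (𝓡 n) ∞ X) {A : Set X}
    (hA : MeasurableSet A) :
    chartVolume e A =
      ∫⁻ y in e.target ∩ e.symm ⁻¹' A, ENNReal.ofReal √(metricMatrix e y).det := by
  have hpre := measurableSet_chart_preimage e hA
  rw [← lintegral_indicator_one hA, lintegral_chartVolume he (measurable_one.indicator hA),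
    ← lintegral_indicator e.open_target.measurableSet, ← lintegral_indicator hpre]
  refine lintegral_congr fun y ↦ ?_
  by_cases h1 : y ∈ e.target <;> by_cases h2 : e.symm y ∈ A <;> simp [h1, h2]

lemma chartVolume_compl_source (he : e ∈ IsManifold.maximalAtlas (𝓡 n) ∞ X) :
    chartVolume e e.sourceᶜ = 0 := by
  rw [chartVolume_apply he e.open_source.measurableSet.compl]
  have h : e.target ∩ e.symm ⁻¹' e.sourceᶜ = ∅ :=
    Set.eq_empty_of_forall_notMem fun y hy ↦ hy.2 (e.map_target hy.1)
  rw [h, Measure.restrict_empty, lintegral_zero_measure]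

/-- The volumes defined by two charts agree on the intersection of their domains. -/
lemma chartVolume_eq (he : e ∈ IsManifold.maximalAtlas (𝓡 n) ∞ X)
    (he' : e' ∈ IsManifold.maximalAtlas (𝓡 n) ∞ X) {A : Set X} (hA : MeasurableSet A)
    (hAe : A ⊆ e.source) (hAe' : A ⊆ e'.source) : chartVolume e A = chartVolume e' A := by
  rw [chartVolume_apply he hA, chartVolume_apply he' hA]
  set s := e.target ∩ e.symm ⁻¹' A with hs
  have hsub : s ⊆ overlap e e' := fun y hy ↦ ⟨hy.1, hAe' hy.2⟩
  have himg : e'.target ∩ e'.symm ⁻¹' A = (e' ∘ e.symm) '' s := by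
    ext z
    constructor
    · rintro ⟨hz1, hz2⟩
      refine ⟨e (e'.symm z), ⟨e.map_source (hAe hz2), ?_⟩, ?_⟩
      · rw [Set.mem_preimage, e.left_inv (hAe hz2)]
        exact hz2
      · rw [Function.comp_apply, e.left_inv (hAe hz2), e'.right_inv hz1]
    · rintro ⟨y, hy, rfl⟩
      refine ⟨e'.map_source (hAe' hy.2), ?_⟩
      rw [Set.mem_preimage, Function.comp_apply, e'.left_inv (hAe' hy.2)]
      exact hy.2
  have hinj : Set.InjOn (e' ∘ e.symm) s := by
    intro y hy z hz h
    exact e.symm.injOn hy.1 hz.1 (e'.injOn (hAe' hy.2) (hAe' hz.2) h)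
  have hms : MeasurableSet s := measurableSet_chart_preimage e hA
  rw [himg, lintegral_image_eq_lintegral_abs_det_fderiv_mul volume hms
    (fun y hy ↦ (differentiableAt_transition he he' (hsub hy)).hasFDerivAt.hasFDerivWithinAt) hinj]
  refine setLIntegral_congr_fun hms fun y hy ↦ ?_
  rw [sqrt_det_metricMatrix he he' (hsub hy), ENNReal.ofReal_mul (abs_nonneg _)]
  rfl

/-- The Riemannian volume is given by the chart volume on the domain of a chart. -/
lemma riemannianVolume_restrict (he : e ∈ IsManifold.maximalAtlas (𝓡 n) ∞ X) :
    (riemannianVolume n X).restrict e.source = chartVolume e := by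
  have hsm := e.open_source.measurableSet
  have hle : chartVolume e ≤ riemannianVolume n X :=
    le_iSup₂_of_le (f := fun e (_ : e ∈ IsManifold.maximalAtlas (𝓡 n) ∞ X) ↦ chartVolume e)
      e he le_rfl
  -- One upper bound of all chart volumes bounds their supremum. The one chosen is `chartVolume e`
  -- plus the volume outside `e.source`, and its second summand disappears on `e.source`.
  have hub : riemannianVolume n X ≤
      chartVolume e + (riemannianVolume n X).restrict e.sourceᶜ := by
    refine iSup₂_le fun e' he' ↦ Measure.le_iff.2 fun A hA ↦ ?_
    rw [Measure.add_apply, Measure.restrict_apply hA, ← measure_inter_add_sdiff A hsm]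
    refine add_le_add ?_ ?_
    · have h0 : chartVolume e' (A ∩ e.source) ≤ chartVolume e' (A ∩ e.source ∩ e'.source) := by
        rw [measure_inter_conull (chartVolume_compl_source he')]
      refine h0.trans ?_
      rw [chartVolume_eq he' he ((hA.inter hsm).inter e'.open_source.measurableSet)
        (fun x hx ↦ hx.2) fun x hx ↦ hx.1.2]
      exact measure_mono fun x hx ↦ hx.1.1
    · exact Measure.le_iff'.1 (le_iSup₂_of_le
        (f := fun e (_ : e ∈ IsManifold.maximalAtlas (𝓡 n) ∞ X) ↦ chartVolume e) e' he' le_rfl) _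
  ext A hA
  rw [Measure.restrict_apply hA]
  refine le_antisymm ((hub _).trans ?_) ?_
  · rw [Measure.add_apply, Measure.restrict_apply (hA.inter hsm)]
    have h : A ∩ e.source ∩ e.sourceᶜ = ∅ :=
      Set.eq_empty_of_forall_notMem fun x hx ↦ hx.2 hx.1.2
    rw [h, measure_empty, add_zero]
    exact measure_mono Set.inter_subset_left
  · rw [← measure_inter_conull (chartVolume_compl_source he)]
    exact hle _

lemma setLIntegral_riemannianVolume (he : e ∈ IsManifold.maximalAtlas (𝓡 n) ∞ X) {F : X → ℝ≥0∞}
    (hF : Measurable F) :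
    ∫⁻ x in e.source, F x ∂(riemannianVolume n X) =
      ∫⁻ y in e.target, ENNReal.ofReal √(metricMatrix e y).det * F (e.symm y) := by
  rw [riemannianVolume_restrict he, lintegral_chartVolume he hF]

/-- The density is continuous in a chart, hence integrable over a compact neighbourhood. With second
countability this supplies the σ-finiteness that product measures need. -/
instance isLocallyFiniteMeasure_riemannianVolume :
    IsLocallyFiniteMeasure (riemannianVolume n X) := by
  refine ⟨fun x ↦ ?_⟩
  set e := chartAt (EuclideanSpace ℝ (Fin n)) x
  have he : e ∈ IsManifold.maximalAtlas (𝓡 n) ∞ X := IsManifold.chart_mem_maximalAtlas x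
  have hx : x ∈ e.source := mem_chart_source _ x
  obtain ⟨K, hK, hxK, hKt⟩ := exists_compact_subset e.open_target (e.map_source hx)
  set U : Set X := e.source ∩ e ⁻¹' interior K
  have hU : IsOpen U := e.isOpen_inter_preimage isOpen_interior
  refine ⟨U, hU.mem_nhds ⟨hx, hxK⟩, ?_⟩
  have h1 : riemannianVolume n X U = chartVolume e U := by
    rw [← riemannianVolume_restrict he, Measure.restrict_apply hU.measurableSet]
    congr 1
    ext z; simp only [U, Set.mem_inter_iff]; tauto
  rw [h1, chartVolume_apply he hU.measurableSet]
  have hc : ContinuousOn (fun y ↦ √(metricMatrix e y).det) K := (continuousOn_sqrt_det he).mono hKt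
  calc ∫⁻ y in e.target ∩ e.symm ⁻¹' U, ENNReal.ofReal √(metricMatrix e y).det
      ≤ ∫⁻ y in K, ENNReal.ofReal √(metricMatrix e y).det := by
        refine lintegral_mono_set fun y hy ↦ interior_subset ?_
        have h := hy.2.2
        rwa [Set.mem_preimage, e.right_inv hy.1] at h
    _ < ⊤ := by
        rw [← ofReal_integral_eq_lintegral_ofReal (hc.integrableOn_compact hK)
          (ae_of_all _ fun y ↦ Real.sqrt_nonneg _)]
        exact ENNReal.ofReal_lt_top

end Volume

end Geometry

/-! ### Lower semicontinuous functions as limits of Lipschitz functions. -/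

section LowerSemicontinuous

variable {Y : Type*} [PseudoMetricSpace Y]

/-- The largest `k`-Lipschitz minorant of `min f k`. -/
def lipschitzMinorant (f : Y → ℝ≥0∞) (k : ℕ) (z : Y) : ℝ≥0∞ := ⨅ y, (min (f y) k + k * edist z y)

lemma lipschitzMinorant_le (f : Y → ℝ≥0∞) (k : ℕ) (z : Y) :
    lipschitzMinorant f k z ≤ min (f z) k :=
  (iInf_le _ z).trans (by simp)

lemma lipschitzMinorant_ne_top (f : Y → ℝ≥0∞) (k : ℕ) (z : Y) : lipschitzMinorant f k z ≠ ⊤ :=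
  ne_top_of_le_ne_top (ENNReal.natCast_ne_top k)
    ((lipschitzMinorant_le f k z).trans (min_le_right _ _))

lemma lipschitzMinorant_le_add (f : Y → ℝ≥0∞) (k : ℕ) (z z' : Y) :
    lipschitzMinorant f k z ≤ lipschitzMinorant f k z' + k * edist z z' := by
  rw [lipschitzMinorant, lipschitzMinorant, ENNReal.iInf_add]
  refine le_iInf fun y ↦ (iInf_le _ y).trans ?_
  calc min (f y) k + k * edist z y ≤ min (f y) k + k * (edist z z' + edist z' y) := by
        gcongr; exact edist_triangle _ _ _
    _ = _ := by ring

lemma continuous_lipschitzMinorant (f : Y → ℝ≥0∞) (k : ℕ) :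
    Continuous fun z ↦ (lipschitzMinorant f k z).toNNReal := by
  have h : LipschitzWith k fun z ↦ (lipschitzMinorant f k z).toReal := by
    refine LipschitzWith.of_le_add_mul _ fun z z' ↦ ?_
    have h1 := ENNReal.toReal_mono (ENNReal.add_ne_top.2 ⟨lipschitzMinorant_ne_top f k z',
      ENNReal.mul_ne_top (ENNReal.natCast_ne_top k) (edist_ne_top z z')⟩)
      (lipschitzMinorant_le_add f k z z')
    rw [ENNReal.toReal_add (lipschitzMinorant_ne_top f k z')
      (ENNReal.mul_ne_top (ENNReal.natCast_ne_top k) (edist_ne_top z z')), ENNReal.toReal_mul,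
      ← dist_edist] at h1
    simpa using h1
  have h2 := continuous_real_toNNReal.comp h.continuous
  refine h2.congr fun z ↦ ?_
  simp [ENNReal.toReal, Real.toNNReal_coe]

lemma lipschitzMinorant_mono (f : Y → ℝ≥0∞) : Monotone (lipschitzMinorant f) := by
  intro k l hkl z
  refine iInf_mono fun y ↦ ?_
  gcongr

/-- Given a' < f z, lower semicontinuity keeps f above a' on a ball of radius δ about z. Outside the
ball the penalty k · edist exceeds a' once k ≥ a'/δ. -/
lemma iSup_lipschitzMinorant {f : Y → ℝ≥0∞} (hf : LowerSemicontinuous f) (z : Y) :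
    ⨆ k, lipschitzMinorant f k z = f z := by
  refine le_antisymm (iSup_le fun k ↦ (lipschitzMinorant_le f k z).trans (min_le_left _ _)) ?_
  refine le_of_forall_lt fun a ha ↦ ?_
  obtain ⟨a', haa', ha'⟩ := exists_between ha
  obtain ⟨δ, hδ, hball⟩ := EMetric.mem_nhds_iff.1 (hf z a' ha')
  have hat : a' ≠ ⊤ := ha'.ne_top
  obtain ⟨k, hk⟩ := ENNReal.exists_nat_gt (max_ne_top hat (show a' / δ ≠ ⊤ from
    ENNReal.div_ne_top hat hδ.ne'))
  refine lt_of_lt_of_le haa' (le_iSup_of_le k (le_iInf fun y ↦ ?_))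
  by_cases hy : edist z y < δ
  · refine le_trans (le_min ?_ ((le_max_left _ _).trans hk.le)) le_self_add
    exact (hball (by rwa [Metric.mem_eball, edist_comm])).le
  · refine le_trans ?_ le_add_self
    calc a' ≤ a' / δ * edist z y := by
          rcases eq_or_ne δ ⊤ with rfl | hδt
          · have : edist z y = ⊤ := top_le_iff.1 (not_lt.1 hy)
            exact absurd this (edist_ne_top z y)
          · calc a' = a' / δ * δ := (ENNReal.div_mul_cancel hδ.ne' hδt).symm
              _ ≤ _ := by gcongr; exact not_lt.1 hy
      _ ≤ k * edist z y := by gcongr; exact (le_max_right _ _).trans hk.le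

/-- The Lipschitz minorants are bounded and continuous and increase to f, so monotone convergence
applies. -/
lemma exists_boundedContinuous_lt_lintegral [MeasurableSpace Y] [OpensMeasurableSpace Y]
    {f : Y → ℝ≥0∞} (hf : LowerSemicontinuous f) (m : Measure Y) {a : ℝ≥0∞}
    (ha : a < ∫⁻ z, f z ∂m) :
    ∃ k : BoundedContinuousFunction Y ℝ≥0, (∀ z, k z ≤ f z) ∧ a < ∫⁻ z, k z ∂m := by
  have hcoe : ∀ k z, ((lipschitzMinorant f k z).toNNReal : ℝ≥0∞) = lipschitzMinorant f k z :=
    fun k z ↦ ENNReal.coe_toNNReal (lipschitzMinorant_ne_top f k z)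
  have hm : ∀ k, Measurable (lipschitzMinorant f k) := fun k ↦ by
    have h := (continuous_lipschitzMinorant f k).measurable.coe_nnreal_ennreal
    simpa only [hcoe] using h
  have h1 : ∫⁻ z, f z ∂m = ⨆ k, ∫⁻ z, lipschitzMinorant f k z ∂m := by
    rw [← lintegral_iSup hm (lipschitzMinorant_mono f)]
    exact lintegral_congr fun z ↦ (iSup_lipschitzMinorant hf z).symm
  rw [h1] at ha
  obtain ⟨k, hk⟩ := lt_iSup_iff.1 ha
  refine ⟨BoundedContinuousFunction.mkOfBound
    ⟨fun z ↦ (lipschitzMinorant f k z).toNNReal, continuous_lipschitzMinorant f k⟩ k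
    fun z z' ↦ ?_, fun z ↦ ?_, ?_⟩
  · have h2 : ∀ z, ((lipschitzMinorant f k z).toNNReal : ℝ) ≤ k := fun z ↦ by
      have h3 := (lipschitzMinorant_le f k z).trans (min_le_right _ _)
      have h4 := ENNReal.toNNReal_mono (ENNReal.natCast_ne_top k) h3
      rw [ENNReal.toNNReal_natCast] at h4
      exact_mod_cast h4
    rw [NNReal.dist_eq]
    refine abs_sub_le_iff.2 ⟨?_, ?_⟩ <;> simp only [ContinuousMap.coe_mk]
    · linarith [h2 z, NNReal.coe_nonneg (lipschitzMinorant f k z').toNNReal]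
    · linarith [h2 z', NNReal.coe_nonneg (lipschitzMinorant f k z).toNNReal]
  · exact (hcoe k z).le.trans ((lipschitzMinorant_le f k z).trans (min_le_left _ _))
  · refine lt_of_lt_of_le hk (le_of_eq ?_)
    exact lintegral_congr fun z ↦ (hcoe k z).symm

end LowerSemicontinuous

/-! ### One-particle weights and the reference measure. -/

section Boltzmann

variable {X : Type*} [MeasurableSpace X]

/-- The weight `e^{-(V - κ ϑ)}`. -/
def boltzmann (V : X → EReal) (ϑ : X → ℝ) (κ : ℝ) (x : X) : ℝ≥0∞ :=
  EReal.exp (-tiltedPotential V ϑ κ x)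

lemma exp_neg_sub_coe (v : EReal) (c : ℝ) :
    EReal.exp (-(v - (c : EReal))) = EReal.exp (-v) * ENNReal.ofReal (Real.exp c) := by
  rw [EReal.neg_sub (Or.inr (EReal.coe_ne_bot c)) (Or.inr (EReal.coe_ne_top c)), EReal.exp_add,
    EReal.exp_coe]

lemma boltzmann_eq (V : X → EReal) (ϑ : X → ℝ) (κ : ℝ) (x : X) :
    boltzmann V ϑ κ x = EReal.exp (-V x) * ENNReal.ofReal (Real.exp (κ * ϑ x)) :=
  exp_neg_sub_coe _ _

lemma boltzmann_add (V : X → EReal) (ϑ : X → ℝ) (κ s : ℝ) (x : X) :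
    boltzmann V ϑ (κ + s) x = boltzmann V ϑ κ x * ENNReal.ofReal (Real.exp (s * ϑ x)) := by
  rw [boltzmann_eq, boltzmann_eq, mul_assoc, ← ENNReal.ofReal_mul (Real.exp_pos _).le,
    ← Real.exp_add, add_mul]

variable [MetricSpace X] {n : ℕ} {vol : Measure X} {g : X → X → EReal} {V : X → EReal}
  {ϑ : X → ℝ}

lemma tiltedPotential_zero (V : X → EReal) (ϑ : X → ℝ) : tiltedPotential V ϑ 0 = V := by
  funext x; simp [tiltedPotential]

lemma GasAssumptions.isOpen (hA : GasAssumptions n vol g V ϑ) : IsOpen {x | V x < ⊤} := by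
  have h := (hA.potential_regular 0 le_rfl).isOpen
  rwa [tiltedPotential_zero] at h

lemma GasAssumptions.continuousOn (hA : GasAssumptions n vol g V ϑ) :
    ContinuousOn V {x | V x < ⊤} := by
  have h := (hA.potential_regular 0 le_rfl).continuousOn
  rwa [tiltedPotential_zero] at h

lemma GasAssumptions.exp_neg_ne_top (hA : GasAssumptions n vol g V ϑ) (x : X) :
    EReal.exp (-V x) ≠ ⊤ := by
  rw [Ne, EReal.exp_eq_top_iff, EReal.neg_eq_top_iff]
  exact hA.potential_ne_bot x

lemma GasAssumptions.boltzmann_ne_top (hA : GasAssumptions n vol g V ϑ) (κ : ℝ) (x : X) :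
    boltzmann V ϑ κ x ≠ ⊤ := by
  rw [boltzmann_eq]
  exact ENNReal.mul_ne_top (hA.exp_neg_ne_top x) ENNReal.ofReal_ne_top

lemma boltzmann_pos {x : X} (hx : V x < ⊤) (κ : ℝ) : 0 < boltzmann V ϑ κ x := by
  rw [boltzmann_eq, pos_iff_ne_zero]
  refine mul_ne_zero ?_ (ENNReal.ofReal_pos.2 (Real.exp_pos _)).ne'
  rw [Ne, EReal.exp_eq_zero_iff, EReal.neg_eq_bot_iff]
  exact hx.ne

lemma GasAssumptions.continuousOn_toReal_boltzmann (hA : GasAssumptions n vol g V ϑ) (κ : ℝ) :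
    ContinuousOn (fun x ↦ (boltzmann V ϑ κ x).toReal) {x | V x < ⊤} := by
  have h1 : ContinuousOn (fun x ↦ (EReal.exp (-V x)).toReal) {x | V x < ⊤} := by
    intro x hx
    exact (ENNReal.tendsto_toReal (hA.exp_neg_ne_top x)).comp
      ((ENNReal.continuous_exp.comp continuous_neg).continuousAt.comp_continuousWithinAt
        (hA.continuousOn x hx))
  have h2 : Continuous fun x ↦ Real.exp (κ * ϑ x) :=
    Real.continuous_exp.comp (continuous_const.mul hA.theta_continuous)
  refine (h1.mul h2.continuousOn).congr fun x _ ↦ ?_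
  rw [boltzmann_eq, ENNReal.toReal_mul, ENNReal.toReal_ofReal (Real.exp_pos _).le, Pi.mul_apply]

lemma boltzmann_eq_zero {x : X} (hx : ¬ V x < ⊤) (κ : ℝ) : boltzmann V ϑ κ x = 0 := by
  rw [boltzmann_eq, not_lt_top_iff.1 hx]
  simp

lemma GasAssumptions.measurable_boltzmann [BorelSpace X] (hA : GasAssumptions n vol g V ϑ)
    (κ : ℝ) : Measurable (boltzmann V ϑ κ) := by
  classical
  have h := (hA.continuousOn_toReal_boltzmann κ).measurable_piecewise
    (g := fun _ ↦ (0 : ℝ)) continuousOn_const hA.isOpen.measurableSet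
  convert h.ennreal_ofReal using 1
  funext x
  by_cases hx : x ∈ {x | V x < ⊤}
  · rw [Set.piecewise_eq_of_mem _ _ _ hx, ENNReal.ofReal_toReal (hA.boltzmann_ne_top κ x)]
  · rw [Set.piecewise_eq_of_notMem _ _ _ hx, boltzmann_eq_zero hx, ENNReal.ofReal_zero]

lemma GasAssumptions.exists_boltzmann_le (hA : GasAssumptions n vol g V ϑ) {κ : ℝ} (hκ : 0 ≤ κ) :
    ∃ K : ℝ≥0, ∀ x, boltzmann V ϑ κ x ≤ K := by
  obtain ⟨m, hm⟩ := hA.potential_bddBelow κ hκ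
  refine ⟨(Real.exp (-m)).toNNReal, fun x ↦ ?_⟩
  calc boltzmann V ϑ κ x ≤ EReal.exp (-(m : EReal)) :=
        EReal.exp_le_exp_iff.2 (EReal.neg_le_neg_iff.2 (hm x))
    _ = _ := by rw [← EReal.coe_neg, EReal.exp_coe]; rfl

lemma GasAssumptions.lintegral_boltzmann_ne_top (hA : GasAssumptions n vol g V ϑ) {κ : ℝ}
    (hκ : 0 ≤ κ) : ∫⁻ x, boltzmann V ϑ κ x ∂vol ≠ ⊤ :=
  (hA.potential_regular κ hκ).integrable.ne

lemma referenceMeasure_eq (vol : Measure X) (V : X → EReal) (ϑ : X → ℝ) (γ : ℝ) :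
    referenceMeasure vol V ϑ γ =
      (∫⁻ x, boltzmann V ϑ γ x ∂vol)⁻¹ • vol.withDensity (boltzmann V ϑ γ) := rfl

lemma GasAssumptions.isProbabilityMeasure (hA : GasAssumptions n vol g V ϑ) {γ : ℝ} (hγ : 0 ≤ γ)
    (h0 : ∫⁻ x, boltzmann V ϑ γ x ∂vol ≠ 0) :
    IsProbabilityMeasure (referenceMeasure vol V ϑ γ) := by
  refine ⟨?_⟩
  rw [referenceMeasure_eq, Measure.smul_apply, withDensity_apply _ MeasurableSet.univ,
    Measure.restrict_univ, smul_eq_mul]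
  exact ENNReal.inv_mul_cancel h0 (hA.lintegral_boltzmann_ne_top hγ)

lemma GasAssumptions.lintegral_reference [BorelSpace X] (hA : GasAssumptions n vol g V ϑ) (γ : ℝ)
    {F : X → ℝ≥0∞} (hF : Measurable F) :
    ∫⁻ x, F x ∂(referenceMeasure vol V ϑ γ) =
      (∫⁻ x, boltzmann V ϑ γ x ∂vol)⁻¹ * ∫⁻ x, boltzmann V ϑ γ x * F x ∂vol := by
  rw [referenceMeasure_eq, lintegral_smul_measure,
    lintegral_withDensity_eq_lintegral_mul _ (hA.measurable_boltzmann γ) hF]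
  rfl

/-- A tilt by s ϑ only moves κ from γ to γ + s. Weighted reference measures are therefore governed
by the assumption on the potential at another κ. -/
lemma GasAssumptions.expDensity_reference [BorelSpace X] (hA : GasAssumptions n vol g V ϑ) (γ : ℝ)
    (s : ℝ) : expDensity (referenceMeasure vol V ϑ γ) (fun x ↦ s * ϑ x) =
      (∫⁻ x, boltzmann V ϑ γ x ∂vol)⁻¹ • vol.withDensity (boltzmann V ϑ (γ + s)) := by
  have hm : Measurable fun x ↦ ENNReal.ofReal (Real.exp (s * ϑ x)) :=
    measurable_ofReal_exp (hA.theta_continuous.measurable.const_mul s)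
  rw [expDensity, referenceMeasure_eq, withDensity_smul_measure,
    ← withDensity_mul _ (hA.measurable_boltzmann γ) hm]
  congr 2
  funext x
  exact (boltzmann_add V ϑ γ s x).symm

end Boltzmann

/-! ### The gas kernel satisfies the mean-field hypotheses. -/

section KernelApproximation

variable {X : Type*} [MeasurableSpace X] [MetricSpace X] [BorelSpace X]
  [SecondCountableTopology X] {n : ℕ} {vol : Measure X} {g : X → X → EReal} {V : X → EReal}
  {ϑ : X → ℝ}

/-- The nonnegative kernel `g(u,x) + ϑ(u) + ϑ(x)`. -/
def gasKernel (g : X → X → EReal) (ϑ : X → ℝ) (u x : X) : ℝ≥0∞ := (tiltedKernel g ϑ u x).toENNReal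

lemma GasAssumptions.lowerSemicontinuous_gasKernel (hA : GasAssumptions n vol g V ϑ) :
    LowerSemicontinuous fun z : X × X ↦ gasKernel g ϑ z.1 z.2 := by
  have hc : Continuous fun z : X × X ↦ ((ϑ z.1 + ϑ z.2 : ℝ) : EReal) :=
    continuous_coe_real_ereal.comp ((hA.theta_continuous.comp continuous_fst).add
      (hA.theta_continuous.comp continuous_snd))
  have h1 := hA.kernel_regular.lsc.add' hc.lowerSemicontinuous fun z ↦
    EReal.continuousAt_add (Or.inr (EReal.coe_ne_bot _)) (Or.inr (EReal.coe_ne_top _))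
  exact (continuous_id.ereal_toENNReal).comp_lowerSemicontinuous h1
    fun x y h ↦ EReal.toENNReal_le_toENNReal h

lemma GasAssumptions.measurable_gasKernel (hA : GasAssumptions n vol g V ϑ) :
    Measurable (Function.uncurry (gasKernel g ϑ)) :=
  hA.lowerSemicontinuous_gasKernel.measurable

lemma GasAssumptions.gasKernel_symm (hA : GasAssumptions n vol g V ϑ) (u x : X) :
    gasKernel g ϑ u x = gasKernel g ϑ x u := by
  rw [gasKernel, gasKernel, tiltedKernel, tiltedKernel, hA.kernel_regular.symm u x, add_comm (ϑ u)]

/-- The continuous part of the decomposition of the kernel, with the weights. -/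
def lowKernel (gL : X → X → ℝ) (ϑ : X → ℝ) (u x : X) : ℝ := max (gL u x + (ϑ u + ϑ x)) 0

lemma tiltedKernel_eq {gL : X → X → ℝ} {gU : X → X → ℝ≥0∞}
    (h : ∀ u x, g u x = (gL u x : EReal) + (gU u x : EReal)) (u x : X) :
    tiltedKernel g ϑ u x = ((gL u x + (ϑ u + ϑ x) : ℝ) : EReal) + (gU u x : EReal) := by
  rw [tiltedKernel, h, add_right_comm, ← EReal.coe_add]

lemma ofReal_lowKernel (gL : X → X → ℝ) (ϑ : X → ℝ) (u x : X) :
    ENNReal.ofReal (lowKernel gL ϑ u x) = ENNReal.ofReal (gL u x + (ϑ u + ϑ x)) := by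
  rw [lowKernel, ENNReal.ofReal_max]; simp

/-- Together with `gasKernel_le` this is the sandwich x⁺ ≤ (x + y)⁺ ≤ x⁺ + y for y ≥ 0, which
confines the singular part of G to an additive error. -/
lemma ofReal_lowKernel_le {gL : X → X → ℝ} {gU : X → X → ℝ≥0∞}
    (h : ∀ u x, g u x = (gL u x : EReal) + (gU u x : EReal)) (u x : X) :
    ENNReal.ofReal (lowKernel gL ϑ u x) ≤ gasKernel g ϑ u x := by
  rw [ofReal_lowKernel, gasKernel, tiltedKernel_eq h, ← EReal.real_coe_toENNReal]
  exact EReal.toENNReal_le_toENNReal (le_add_of_nonneg_right (EReal.coe_ennreal_nonneg _))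

lemma gasKernel_le {gL : X → X → ℝ} {gU : X → X → ℝ≥0∞}
    (h : ∀ u x, g u x = (gL u x : EReal) + (gU u x : EReal)) (u x : X) :
    gasKernel g ϑ u x ≤ ENNReal.ofReal (lowKernel gL ϑ u x) + gU u x := by
  rw [ofReal_lowKernel, gasKernel, tiltedKernel_eq h]
  exact EReal.toENNReal_add_le.trans (by rw [EReal.real_coe_toENNReal, EReal.toENNReal_coe])

lemma lowKernel_nonneg (gL : X → X → ℝ) (ϑ : X → ℝ) (u x : X) : 0 ≤ lowKernel gL ϑ u x :=
  le_max_right _ _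

lemma lowKernel_le {gL : X → X → ℝ} {k : ℕ} (hk : ∀ u x, gL u x ≤ k) (hθ : ∀ x, 0 ≤ ϑ x)
    (u x : X) : lowKernel gL ϑ u x ≤ k + (ϑ u + ϑ x) :=
  max_le (by linarith [hk u x]) (add_nonneg k.cast_nonneg (add_nonneg (hθ u) (hθ x)))

lemma continuous_lowKernel {gL : X → X → ℝ} (hc : Continuous fun z : X × X ↦ gL z.1 z.2)
    (hθ : Continuous ϑ) : Continuous fun z : X × X ↦ lowKernel gL ϑ z.1 z.2 :=
  (hc.add ((hθ.comp continuous_fst).add (hθ.comp continuous_snd))).max continuous_const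

/-- If a ≥ η then a/η ≤ (a/η)^p. The coefficient of a^p is η^{1-p}. -/
lemma le_add_mul_rpow {p : ℝ} (hp : 1 ≤ p) {η : ℝ≥0∞} (h0 : η ≠ 0) (ht : η ≠ ⊤) (a : ℝ≥0∞) :
    a ≤ η + η * η⁻¹ ^ p * a ^ p := by
  rcases le_total a η with h | h
  · exact h.trans le_self_add
  · refine le_trans ?_ le_add_self
    have h1 : 1 ≤ η⁻¹ * a := by
      calc (1 : ℝ≥0∞) = η⁻¹ * η := (ENNReal.inv_mul_cancel h0 ht).symm
        _ ≤ _ := by gcongr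
    calc a = η * (η⁻¹ * a) := by rw [← mul_assoc, ENNReal.mul_inv_cancel h0 ht, one_mul]
      _ ≤ η * (η⁻¹ * a) ^ p := by gcongr; exact ENNReal.le_rpow_self_of_one_le h1 hp
      _ = _ := by rw [ENNReal.mul_rpow_of_nonneg _ _ (by linarith), mul_assoc]

/-- The singular part of the kernel is uniformly small with respect to a weighted measure. -/
lemma exists_lintegral_le_of_rpow {w : X → ℝ≥0∞} (hw : Measurable w) (hwt : ∫⁻ x, w x ∂vol ≠ ⊤)
    {K : ℝ≥0} (hK : ∀ x, w x ≤ K) {p : ℝ} (hp : 1 < p) {gU : ℕ → X → X → ℝ≥0∞} {c : ℕ → ℝ}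
    (hc : Tendsto c atTop (𝓝 0))
    (hgU : ∀ k, 1 ≤ k → ∀ u, ∫⁻ x, gU k u x ^ p ∂vol ≤ ENNReal.ofReal (c k))
    {ε : ℝ≥0∞} (hε : ε ≠ 0) :
    ∃ k, 1 ≤ k ∧ ∀ u, ∫⁻ x, gU k u x ∂(vol.withDensity w) ≤ ε := by
  set I := ∫⁻ x, w x ∂vol
  -- First η is fixed so that η ∫ w is at most ε/2. The coefficient of a^p is then a constant, and
  -- c_k → 0 makes the other half small, uniformly in u.
  obtain ⟨η, hη0, hηt, hη⟩ : ∃ η : ℝ≥0∞, η ≠ 0 ∧ η ≠ ⊤ ∧ η * I ≤ ε / 2 := by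
    rcases eq_or_ne ε ⊤ with rfl | hεt
    · exact ⟨1, one_ne_zero, ENNReal.one_ne_top, by simp [ENNReal.top_div]⟩
    · refine ⟨ε / 2 / (I + 1), ?_, ?_, ?_⟩
      · exact ENNReal.div_ne_zero.2 ⟨(ENNReal.half_pos hε).ne', by simpa using hwt⟩
      · exact ENNReal.div_ne_top (ENNReal.div_ne_top hεt (by simp)) (by simp)
      · calc ε / 2 / (I + 1) * I ≤ ε / 2 / (I + 1) * (I + 1) := by gcongr; exact le_self_add
          _ = ε / 2 := ENNReal.div_mul_cancel (by simp) (by simpa using hwt)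
  have hL : η * η⁻¹ ^ p * K ≠ ⊤ := by
    refine ENNReal.mul_ne_top (ENNReal.mul_ne_top hηt ?_) ENNReal.coe_ne_top
    exact ENNReal.rpow_ne_top_of_nonneg (by linarith) (ENNReal.inv_ne_top.2 hη0)
  have hlim : Tendsto (fun k ↦ η * η⁻¹ ^ p * K * ENNReal.ofReal (c k)) atTop (𝓝 0) := by
    have h := ENNReal.Tendsto.const_mul (a := η * η⁻¹ ^ p * K) (ENNReal.tendsto_ofReal hc)
      (Or.inr hL)
    simpa using h
  obtain ⟨k, hk, hk1⟩ := ((hlim.eventually_le_const (ENNReal.half_pos hε)).and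
    (eventually_ge_atTop 1)).exists
  refine ⟨k, hk1, fun u ↦ ?_⟩
  calc ∫⁻ x, gU k u x ∂(vol.withDensity w) ≤ ∫⁻ x, (w * gU k u) x ∂vol :=
        lintegral_withDensity_le_lintegral_mul _ hw _
    _ ≤ ∫⁻ x, (η * w x + η * η⁻¹ ^ p * K * gU k u x ^ p) ∂vol := by
        refine lintegral_mono fun x ↦ ?_
        simp only [Pi.mul_apply]
        calc w x * gU k u x ≤ w x * (η + η * η⁻¹ ^ p * gU k u x ^ p) := by
              gcongr; exact le_add_mul_rpow hp.le hη0 hηt _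
          _ = η * w x + η * η⁻¹ ^ p * w x * gU k u x ^ p := by ring
          _ ≤ _ := by gcongr; exact hK x
    _ = η * I + η * η⁻¹ ^ p * K * ∫⁻ x, gU k u x ^ p ∂vol := by
        rw [lintegral_add_left (hw.const_mul _), lintegral_const_mul' _ _ hηt,
          lintegral_const_mul' _ _ hL]
    _ ≤ ε / 2 + ε / 2 := by
        refine add_le_add hη (le_trans ?_ hk)
        gcongr
        exact hgU k hk1 u
    _ = ε := ENNReal.add_halves ε

/-- The truncation of the continuous part of the kernel at a fixed particle. -/
def truncatedKernel {gL : X → X → ℝ} (hc : Continuous fun z : X × X ↦ gL z.1 z.2)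
    (hθ : Continuous ϑ) (u : X) (R : ℕ) : BoundedContinuousFunction X ℝ≥0 :=
  BoundedContinuousFunction.mkOfBound
    ⟨fun x ↦ min (lowKernel gL ϑ u x).toNNReal R,
      (continuous_real_toNNReal.comp ((continuous_lowKernel hc hθ).comp
        (Continuous.prodMk continuous_const continuous_id))).min continuous_const⟩ R
    fun x y ↦ by
      rw [NNReal.dist_eq]
      have h : ∀ z, ((min (lowKernel gL ϑ u z).toNNReal (R : ℝ≥0) : ℝ≥0) : ℝ) ≤ R := fun z ↦ by
        exact_mod_cast min_le_right (lowKernel gL ϑ u z).toNNReal (R : ℝ≥0)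
      refine abs_sub_le_iff.2 ⟨?_, ?_⟩ <;> simp only [ContinuousMap.coe_mk]
      · linarith [h x, NNReal.coe_nonneg (min (lowKernel gL ϑ u y).toNNReal (R : ℝ≥0))]
      · linarith [h y, NNReal.coe_nonneg (min (lowKernel gL ϑ u x).toNNReal (R : ℝ≥0))]

lemma truncatedKernel_apply {gL : X → X → ℝ} (hc : Continuous fun z : X × X ↦ gL z.1 z.2)
    (hθ : Continuous ϑ) (u : X) (R : ℕ) (x : X) :
    (truncatedKernel hc hθ u R x : ℝ≥0∞) = min (ENNReal.ofReal (lowKernel gL ϑ u x)) R := by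
  change ((min (lowKernel gL ϑ u x).toNNReal (R : ℝ≥0) : ℝ≥0) : ℝ≥0∞) = _
  rw [ENNReal.coe_min, ENNReal.ofReal]
  simp

variable {m : Measure X} [IsFiniteMeasure m]

lemma lintegral_add_theta_ne_top (hθt : ∫⁻ x, ENNReal.ofReal (ϑ x) ∂m ≠ ⊤) (t : ℝ) :
    ∫⁻ x, (ENNReal.ofReal t + ENNReal.ofReal (ϑ x)) ∂m ≠ ⊤ := by
  rw [lintegral_add_left measurable_const, lintegral_const]
  exact ENNReal.add_ne_top.2
    ⟨ENNReal.mul_ne_top ENNReal.ofReal_ne_top (measure_ne_top _ _), hθt⟩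

lemma tendsto_lintegral_truncatedKernel {gL : X → X → ℝ}
    (hc : Continuous fun z : X × X ↦ gL z.1 z.2) (hθ : Continuous ϑ) (hθ0 : ∀ x, 0 ≤ ϑ x)
    (hθt : ∫⁻ x, ENNReal.ofReal (ϑ x) ∂m ≠ ⊤) {k : ℕ} (hk : ∀ u x, gL u x ≤ k) (u : X) :
    Tendsto (fun R : ℕ ↦ ∫⁻ x, (ENNReal.ofReal (lowKernel gL ϑ u x) -
      truncatedKernel hc hθ u R x) ∂m) atTop (𝓝 0) := by
  have hm : Measurable fun x ↦ ENNReal.ofReal (lowKernel gL ϑ u x) :=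
    ((continuous_lowKernel hc hθ).comp
      (Continuous.prodMk continuous_const continuous_id)).measurable.ennreal_ofReal
  rw [← lintegral_zero (μ := m) (α := X)]
  refine tendsto_lintegral_of_dominated_convergence
    (fun x ↦ ENNReal.ofReal (k + ϑ u) + ENNReal.ofReal (ϑ x)) (fun R ↦ ?_)
    (fun R ↦ ae_of_all _ fun x ↦ ?_) (lintegral_add_theta_ne_top hθt _)
    (ae_of_all _ fun x ↦ ?_)
  · exact hm.sub (truncatedKernel hc hθ u R).continuous.measurable.coe_nnreal_ennreal
  · refine tsub_le_self.trans ?_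
    dsimp only
    rw [← ENNReal.ofReal_add (add_nonneg k.cast_nonneg (hθ0 u)) (hθ0 x)]
    exact ENNReal.ofReal_le_ofReal ((lowKernel_le hk hθ0 u x).trans (by linarith))
  · obtain ⟨R₀, hR₀⟩ := ENNReal.exists_nat_gt (ENNReal.ofReal_ne_top (r := lowKernel gL ϑ u x))
    refine tendsto_const_nhds.congr' ?_
    filter_upwards [eventually_ge_atTop R₀] with R hR
    rw [truncatedKernel_apply, min_eq_left (hR₀.le.trans (by exact_mod_cast hR)), tsub_self]

lemma tendsto_lintegral_lowKernel {gL : X → X → ℝ}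
    (hc : Continuous fun z : X × X ↦ gL z.1 z.2) (hθ : Continuous ϑ) (hθ0 : ∀ x, 0 ≤ ϑ x)
    (hθt : ∫⁻ x, ENNReal.ofReal (ϑ x) ∂m ≠ ⊤) {k : ℕ} (hk : ∀ u x, gL u x ≤ k) (u : X) :
    Tendsto (fun u' ↦ ∫⁻ x, ENNReal.ofReal |lowKernel gL ϑ u' x - lowKernel gL ϑ u x| ∂m)
      (𝓝 u) (𝓝 0) := by
  have hcont : ∀ u, Continuous fun x ↦ lowKernel gL ϑ u x := fun u ↦
    (continuous_lowKernel hc hθ).comp (Continuous.prodMk continuous_const continuous_id)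
  rw [← lintegral_zero (μ := m) (α := X)]
  refine tendsto_lintegral_filter_of_dominated_convergence
    (fun x ↦ ENNReal.ofReal (k + ϑ u + 1) + ENNReal.ofReal (ϑ x)) (Eventually.of_forall fun u' ↦ ?_)
    ?_ (lintegral_add_theta_ne_top hθt _) (ae_of_all _ fun x ↦ ?_)
  · exact ((hcont u').sub (hcont u)).abs.measurable.ennreal_ofReal
  · filter_upwards [hθ.continuousAt.eventually_le_const (lt_add_one (ϑ u))] with u' hu'
    refine ae_of_all _ fun x ↦ ?_
    have h0 : 0 ≤ k + ϑ u + 1 := by have := hθ0 u; positivity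
    rw [← ENNReal.ofReal_add h0 (hθ0 x)]
    refine ENNReal.ofReal_le_ofReal (abs_sub_le_iff.2 ⟨?_, ?_⟩)
    · linarith [lowKernel_le hk hθ0 u' x, lowKernel_nonneg gL ϑ u x]
    · linarith [lowKernel_le hk hθ0 u x, lowKernel_nonneg gL ϑ u' x]
  · have h1 : Continuous fun u' ↦ ENNReal.ofReal |lowKernel gL ϑ u' x - lowKernel gL ϑ u x| :=
      ENNReal.continuous_ofReal.comp (((continuous_lowKernel hc hθ).comp
        (Continuous.prodMk continuous_id continuous_const)).sub continuous_const).abs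
    simpa using h1.tendsto u

/-- The kernel at particles close to `u` is approximated in `L¹` by a bounded continuous
function. -/
lemma GasAssumptions.exists_approx (hA : GasAssumptions n vol g V ϑ)
    (hθt : ∫⁻ x, ENNReal.ofReal (ϑ x) ∂m ≠ ⊤) {gL : X → X → ℝ} {gU : X → X → ℝ≥0∞} {k : ℕ}
    (h : ∀ u x, g u x = (gL u x : EReal) + (gU u x : EReal))
    (hc : Continuous fun z : X × X ↦ gL z.1 z.2) (hk : ∀ u x, gL u x ≤ k) {ε : ℝ≥0∞} (hε : ε ≠ 0)
    (hU : ∀ u, ∫⁻ x, gU u x ∂m ≤ ε) (u : X) :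
    ∃ ψ : BoundedContinuousFunction X ℝ≥0, ∀ᶠ u' in 𝓝 u, ∃ h : X → ℝ≥0∞, Measurable h ∧
      (∀ x, gasKernel g ϑ u' x ≤ ψ x + h x) ∧ (∀ x, ψ x ≤ gasKernel g ϑ u' x + h x) ∧
      ∫⁻ x, h x ∂m ≤ 5 * ε := by
  have hθ := hA.theta_continuous
  have hcont : ∀ u, Continuous fun x ↦ lowKernel gL ϑ u x := fun u ↦
    (continuous_lowKernel hc hθ).comp (Continuous.prodMk continuous_const continuous_id)
  obtain ⟨R, hR⟩ := ((tendsto_lintegral_truncatedKernel hc hθ hA.theta_nonneg hθt hk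
    u).eventually_le_const (pos_iff_ne_zero.2 hε)).exists
  set ψ := truncatedKernel hc hθ u R with hψ
  have hψle : ∀ x, (ψ x : ℝ≥0∞) ≤ ENNReal.ofReal (lowKernel gL ϑ u x) := fun x ↦ by
    rw [hψ, truncatedKernel_apply]; exact min_le_left _ _
  have hψm : Measurable fun x ↦ (ψ x : ℝ≥0∞) := ψ.continuous.measurable.coe_nnreal_ennreal
  refine ⟨ψ, ?_⟩
  filter_upwards [(tendsto_lintegral_lowKernel hc hθ hA.theta_nonneg hθt hk
    u).eventually_le_const (pos_iff_ne_zero.2 hε)] with u' hu'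
  -- The errors are d for moving u to u', t for the truncation, and `gU` for the singular part. The
  -- final h is |G(u', ·) - ψ|, written as a sum of two truncated differences.
  set d : X → ℝ≥0∞ := fun x ↦ ENNReal.ofReal |lowKernel gL ϑ u' x - lowKernel gL ϑ u x|
  set t : X → ℝ≥0∞ := fun x ↦ ENNReal.ofReal (lowKernel gL ϑ u x) - ψ x
  have hdm : Measurable d := ((hcont u').sub (hcont u)).abs.measurable.ennreal_ofReal
  have htm : Measurable t := (hcont u).measurable.ennreal_ofReal.sub hψm
  have hGm : Measurable (gasKernel g ϑ u') := by
    have h2 := hA.measurable_gasKernel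
    exact h2.comp (measurable_const.prodMk measurable_id)
  have hd1 : ∀ x, ENNReal.ofReal (lowKernel gL ϑ u' x) ≤
      ENNReal.ofReal (lowKernel gL ϑ u x) + d x := fun x ↦ by
    rw [← ENNReal.ofReal_add (lowKernel_nonneg _ _ _ _) (abs_nonneg _)]
    exact ENNReal.ofReal_le_ofReal
      (by linarith [le_abs_self (lowKernel gL ϑ u' x - lowKernel gL ϑ u x)])
  have hd2 : ∀ x, ENNReal.ofReal (lowKernel gL ϑ u x) ≤
      ENNReal.ofReal (lowKernel gL ϑ u' x) + d x := fun x ↦ by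
    rw [← ENNReal.ofReal_add (lowKernel_nonneg _ _ _ _) (abs_nonneg _)]
    exact ENNReal.ofReal_le_ofReal
      (by linarith [neg_abs_le (lowKernel gL ϑ u' x - lowKernel gL ϑ u x)])
  have hup : ∀ x, gasKernel g ϑ u' x - ψ x ≤ t x + d x + gU u' x := fun x ↦ by
    rw [tsub_le_iff_left]
    calc gasKernel g ϑ u' x ≤ ENNReal.ofReal (lowKernel gL ϑ u' x) + gU u' x := gasKernel_le h _ _
      _ ≤ (ENNReal.ofReal (lowKernel gL ϑ u x) + d x) + gU u' x := by gcongr; exact hd1 x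
      _ ≤ ((ψ x + t x) + d x) + gU u' x := by gcongr; exact le_add_tsub
      _ = _ := by ring
  have hlow : ∀ x, ψ x - gasKernel g ϑ u' x ≤ d x := fun x ↦ by
    rw [tsub_le_iff_left]
    calc (ψ x : ℝ≥0∞) ≤ ENNReal.ofReal (lowKernel gL ϑ u' x) + d x := (hψle x).trans (hd2 x)
      _ ≤ _ := by gcongr; exact ofReal_lowKernel_le h _ _
  refine ⟨fun x ↦ (gasKernel g ϑ u' x - ψ x) + (ψ x - gasKernel g ϑ u' x),
    (hGm.sub hψm).add (hψm.sub hGm), fun x ↦ ?_, fun x ↦ ?_, ?_⟩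
  · rw [← add_assoc]
    exact le_add_tsub.trans le_self_add
  · rw [add_left_comm]
    exact le_add_tsub.trans le_add_self
  · calc _ ≤ ∫⁻ x, (t x + (d x + (d x + gU u' x))) ∂m := by
          refine lintegral_mono fun x ↦ (add_le_add (hup x) (hlow x)).trans (le_of_eq ?_)
          ring
      _ = ∫⁻ x, t x ∂m + (∫⁻ x, d x ∂m + (∫⁻ x, d x ∂m + ∫⁻ x, gU u' x ∂m)) := by
          rw [lintegral_add_left htm, lintegral_add_left hdm, lintegral_add_left hdm]
      _ ≤ ε + (ε + (ε + ε)) := by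
          gcongr
          exact hU u'
      _ = 4 * ε := by ring
      _ ≤ 5 * ε := by gcongr; norm_num

lemma exists_isCompact_measure_compl_le [SigmaCompactSpace X] {ε : ℝ≥0∞} (hε : ε ≠ 0) :
    ∃ K : Set X, IsCompact K ∧ MeasurableSet K ∧ m Kᶜ ≤ ε := by
  have h := tendsto_measure_iInter_atTop (μ := m) (s := fun i ↦ (compactCovering X i)ᶜ)
    (fun i ↦ (isCompact_compactCovering X i).measurableSet.compl.nullMeasurableSet)
    (fun i j hij ↦ Set.compl_subset_compl.2 (compactCovering_subset X hij))
    ⟨0, measure_ne_top _ _⟩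
  rw [← Set.compl_iUnion, iUnion_compactCovering, Set.compl_univ, measure_empty] at h
  obtain ⟨i, hi⟩ := (h.eventually_le_const (pos_iff_ne_zero.2 hε)).exists
  exact ⟨_, isCompact_compactCovering X i, (isCompact_compactCovering X i).measurableSet, hi⟩

/-- The kernel of a gas satisfies the hypotheses of the mean-field limit. -/
theorem GasAssumptions.meanFieldKernel [SigmaCompactSpace X] (hA : GasAssumptions n vol g V ϑ)
    {γ : ℝ} (hγ : 0 ≤ γ) (h0 : ∫⁻ x, boltzmann V ϑ γ x ∂vol ≠ 0) :
    MeanFieldKernel (referenceMeasure vol V ϑ γ) ϑ (gasKernel g ϑ) := by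
  -- So e^ϑ ν is a multiple of e^{-(V - (γ+1) ϑ)} ω, whose density is bounded and integrable by the
  -- assumptions at κ = γ + 1.
  have hm : expDensity (referenceMeasure vol V ϑ γ) ϑ =
      (∫⁻ x, boltzmann V ϑ γ x ∂vol)⁻¹ • vol.withDensity (boltzmann V ϑ (γ + 1)) := by
    simpa using hA.expDensity_reference γ 1
  have hinv : (∫⁻ x, boltzmann V ϑ γ x ∂vol)⁻¹ ≠ ⊤ := ENNReal.inv_ne_top.2 h0
  have hθm := hA.theta_continuous.measurable
  have hexp : ∫⁻ x, ENNReal.ofReal (Real.exp (2 * ϑ x)) ∂(referenceMeasure vol V ϑ γ) ≠ ⊤ := by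
    rw [hA.lintegral_reference γ (measurable_ofReal_exp (hθm.const_mul 2))]
    simp only [← boltzmann_add]
    exact ENNReal.mul_ne_top hinv (hA.lintegral_boltzmann_ne_top (by linarith))
  have hfin : IsFiniteMeasure (expDensity (referenceMeasure vol V ϑ γ) ϑ) := by
    refine ⟨?_⟩
    rw [expDensity_univ]
    refine lt_of_le_of_lt (lintegral_mono fun x ↦ ?_) hexp.lt_top
    exact ENNReal.ofReal_le_ofReal (Real.exp_le_exp.2 (by linarith [hA.theta_nonneg x]))
  have hθt : ∫⁻ x, ENNReal.ofReal (ϑ x) ∂(expDensity (referenceMeasure vol V ϑ γ) ϑ) ≠ ⊤ := by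
    rw [lintegral_expDensity _ hθm hθm.ennreal_ofReal]
    refine ne_top_of_le_ne_top hexp (lintegral_mono fun x ↦ ?_)
    rw [← ENNReal.ofReal_mul (Real.exp_pos _).le]
    refine ENNReal.ofReal_le_ofReal ?_
    rw [two_mul, Real.exp_add]
    gcongr
    linarith [Real.add_one_le_exp (ϑ x)]
  obtain ⟨gL, gU, p, c, hp, hc, hdec⟩ := hA.kernel_decomp
  obtain ⟨K, hK⟩ := hA.exists_boltzmann_le (κ := γ + 1) (by linarith)
  have hsmall : ∀ ε : ℝ≥0∞, ε ≠ 0 → ∃ k, 1 ≤ k ∧ ∀ u,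
      ∫⁻ x, gU k u x ∂(expDensity (referenceMeasure vol V ϑ γ) ϑ) ≤ ε := by
    intro ε hε
    set I := (∫⁻ x, boltzmann V ϑ γ x ∂vol)⁻¹
    have hε' : ε / (I + 1) ≠ 0 := ENNReal.div_ne_zero.2 ⟨hε, by simpa using hinv⟩
    obtain ⟨k, hk1, hk⟩ := exists_lintegral_le_of_rpow (hA.measurable_boltzmann (γ + 1))
      (hA.lintegral_boltzmann_ne_top (by linarith)) hK hp hc (fun k hk ↦ (hdec k hk).2.2.2) hε'
    refine ⟨k, hk1, fun u ↦ ?_⟩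
    rw [hm, lintegral_smul_measure, smul_eq_mul]
    calc I * _ ≤ (I + 1) * (ε / (I + 1)) := by
          gcongr
          · exact le_self_add
          · exact hk u
      _ ≤ ε := ENNReal.mul_div_le
  refine ⟨hθm, hA.theta_nonneg, hexp, hA.measurable_gasKernel, hA.gasKernel_symm, ?_, ?_, ?_,
    fun ε hε ↦ exists_isCompact_measure_compl_le hε⟩
  · obtain ⟨k, hk1, hk⟩ := hsmall 1 one_ne_zero
    set m := expDensity (referenceMeasure vol V ϑ γ) ϑ
    set M := m Set.univ with hM
    have hMt : M ≠ ⊤ := measure_ne_top _ _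
    set T := ∫⁻ x, ENNReal.ofReal (ϑ x) ∂m
    refine ⟨(k * M + M + T + 1).toNNReal, fun u ↦ ?_⟩
    have hum : Measurable fun x ↦ ENNReal.ofReal (k + ϑ u) + ENNReal.ofReal (ϑ x) :=
      measurable_const.add hθm.ennreal_ofReal
    rw [ENNReal.coe_toNNReal (by finiteness)]
    calc ∫⁻ x, gasKernel g ϑ u x ∂m
        ≤ ∫⁻ x, ((ENNReal.ofReal (k + ϑ u) + ENNReal.ofReal (ϑ x)) + gU k u x) ∂m := by
          refine lintegral_mono fun x ↦ (gasKernel_le (hdec k hk1).1 u x).trans ?_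
          gcongr
          rw [← ENNReal.ofReal_add (add_nonneg k.cast_nonneg (hA.theta_nonneg u))
            (hA.theta_nonneg x)]
          exact ENNReal.ofReal_le_ofReal
            ((lowKernel_le (hdec k hk1).2.2.1 hA.theta_nonneg u x).trans (by linarith))
      _ ≤ ((k + ENNReal.ofReal (ϑ u)) * M + T) + 1 := by
          rw [lintegral_add_left hum,
            lintegral_add_left measurable_const, lintegral_const,
            ENNReal.ofReal_add k.cast_nonneg (hA.theta_nonneg u), ENNReal.ofReal_natCast]
          gcongr
          exact hk u
      _ = k * M + T + 1 + M * ENNReal.ofReal (ϑ u) := by ring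
      _ ≤ (k * M + M + T + 1) + (k * M + M + T + 1) * ENNReal.ofReal (ϑ u) := by
          gcongr
          · exact le_self_add
          · calc M ≤ M + (k * M + T + 1) := le_self_add
              _ = _ := by ring
      _ = _ := by ring
  · intro u ε hε
    have hε' : ε / 5 ≠ 0 := ENNReal.div_ne_zero.2 ⟨hε, by simp⟩
    obtain ⟨k, hk1, hk⟩ := hsmall (ε / 5) hε'
    obtain ⟨ψ, hψ⟩ := hA.exists_approx hθt (hdec k hk1).1 (hdec k hk1).2.1 (hdec k hk1).2.2.1
      hε' hk u
    refine ⟨ψ, hψ.mono ?_⟩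
    rintro u' ⟨q, h1, h2, h3, h4⟩
    exact ⟨q, h1, h2, h3, h4.trans ENNReal.mul_div_le⟩
  · intro ρ hρ _ a ha
    have hint : ∀ F : X × X → ℝ≥0∞, Measurable F →
        ∫⁻ z, F z ∂(ρ.prod ρ) = ∫⁻ u, ∫⁻ v, F (u, v) ∂ρ ∂ρ := fun F hF ↦
      lintegral_prod _ hF.aemeasurable
    have h1 := hint _ hA.measurable_gasKernel
    obtain ⟨k, hk, hak⟩ := exists_boundedContinuous_lt_lintegral hA.lowerSemicontinuous_gasKernel
      (ρ.prod ρ) (a := a) (lt_of_lt_of_eq ha h1.symm)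
    rw [hint _ k.continuous.measurable.coe_nnreal_ennreal] at hak
    exact ⟨k, fun u v ↦ hk (u, v), hak⟩

end KernelApproximation

/-! ### Changes of the one-particle measure. -/

section Reweighting

variable {X : Type*} [MeasurableSpace X]

lemma gasZ_smul {G : X → X → ℝ≥0∞} (hG : Measurable (Function.uncurry G))
    (b : ℝ≥0∞) (N : ℕ) (m : Measure X) [SigmaFinite m] (c : ℝ≥0) :
    gasZ G b N ((c : ℝ≥0∞) • m) = (c : ℝ≥0∞) ^ N * gasZ G b N m := by
  have hs : SigmaFinite (m.withDensity fun _ ↦ (c : ℝ≥0∞)) :=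
    SigmaFinite.withDensity (fun _ ↦ c)
  have h := pi_withDensity N m (f := fun _ ↦ (c : ℝ≥0∞)) measurable_const
  rw [withDensity_const] at h
  rw [gasZ, h, lintegral_withDensity_eq_lintegral_mul _ measurable_const
    (measurable_gasWeight b N hG)]
  simp only [Pi.mul_apply, Finset.prod_const, Finset.card_univ, Fintype.card_fin]
  rw [lintegral_const_mul _ (measurable_gasWeight b N hG), gasZ]

lemma expDensity_expDensity (m : Measure X) {r s : X → ℝ} (hr : Measurable r) (hs : Measurable s) :
    expDensity (expDensity m r) s = expDensity m fun x ↦ r x + s x := by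
  rw [expDensity, expDensity, ← withDensity_mul _ (measurable_ofReal_exp hr)
    (measurable_ofReal_exp hs), expDensity]
  congr 1
  funext x
  rw [Pi.mul_apply, ← ENNReal.ofReal_mul (Real.exp_pos _).le, Real.exp_add]

/-- The weight of the gas with respect to the weighted reference measure, tilted by a one-particle
function. -/
lemma lintegral_expNeg_sum_mul_gasWeight {G : X → X → ℝ≥0∞}
    (hG : Measurable (Function.uncurry G)) (b : ℝ≥0∞) (N : ℕ) (m : Measure X) [SigmaFinite m]
    {r : X → ℝ} (hr : Measurable r) {Ψ : (Fin N → X) → ℝ≥0∞} (hΨ : Measurable Ψ) :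
    ∫⁻ x, Ψ x * expNeg (b * pairSum G x) ∂(Measure.pi fun _ : Fin N ↦ expDensity m r) =
      ∫⁻ x, (∏ j, ENNReal.ofReal (Real.exp (r (x j)))) * (Ψ x * expNeg (b * pairSum G x))
        ∂(Measure.pi fun _ : Fin N ↦ m) := by
  have hs : SigmaFinite (m.withDensity fun x ↦ ENNReal.ofReal (Real.exp (r x))) :=
    inferInstanceAs (SigmaFinite (expDensity m r))
  have hm : Measurable fun x : Fin N → X ↦ ∏ j, ENNReal.ofReal (Real.exp (r (x j))) :=
    Finset.measurable_prod _ fun j _ ↦ (measurable_ofReal_exp hr).comp (measurable_pi_apply j)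
  have hΨW : Measurable fun x : Fin N → X ↦ Ψ x * expNeg (b * pairSum G x) :=
    hΨ.mul (measurable_gasWeight b N hG)
  rw [show (fun _ : Fin N ↦ expDensity m r) =
    fun _ ↦ m.withDensity fun x ↦ ENNReal.ofReal (Real.exp (r x)) from rfl,
    pi_withDensity N m (measurable_ofReal_exp hr),
    lintegral_withDensity_eq_lintegral_mul _ hm hΨW]
  rfl

end Reweighting

/-! ### From the Gibbs measure to the gas with nonnegative kernel. -/

section Bridge

lemma exp_neg_sum {ι : Type*} (s : Finset ι) {T : ι → EReal} (hT : ∀ j, T j ≠ ⊥) :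
    ∑ j ∈ s, T j ≠ ⊥ ∧ EReal.exp (-∑ j ∈ s, T j) = ∏ j ∈ s, EReal.exp (-T j) := by
  classical
  induction s using Finset.induction_on with
  | empty => simp
  | insert a s ha ih =>
    rw [Finset.sum_insert ha, Finset.prod_insert ha]
    refine ⟨EReal.add_ne_bot_iff.2 ⟨hT a, ih.1⟩, ?_⟩
    rw [EReal.neg_add (Or.inl (hT a)) (Or.inr ih.1), sub_eq_add_neg, EReal.exp_add, ih.2]

lemma coe_ennreal_finsetSum {ι : Type*} (s : Finset ι) (f : ι → ℝ≥0∞) :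
    ((∑ j ∈ s, f j : ℝ≥0∞) : EReal) = ∑ j ∈ s, (f j : EReal) := by
  classical
  induction s using Finset.induction_on with
  | empty => simp
  | insert a s ha ih => rw [Finset.sum_insert ha, Finset.sum_insert ha, EReal.coe_ennreal_add, ih]

lemma coe_real_finsetSum {ι : Type*} (s : Finset ι) (f : ι → ℝ) :
    ((∑ j ∈ s, f j : ℝ) : EReal) = ∑ j ∈ s, (f j : EReal) := by
  classical
  induction s using Finset.induction_on with
  | empty => simp
  | insert a s ha ih => rw [Finset.sum_insert ha, Finset.sum_insert ha, EReal.coe_add, ih]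

lemma sum_pairs {N : ℕ} (a : Fin N → ℝ) :
    ∑ q : Fin N × Fin N with q.1 < q.2, (a q.1 + a q.2) = (N - 1) * ∑ j, a j := by
  have h1 : ∑ q : Fin N × Fin N with q.1 < q.2, (a q.1 + a q.2) =
      ∑ i, ∑ j, (if i < j then a i else 0) + ∑ i, ∑ j, (if j < i then a i else 0) := by
    rw [Finset.sum_add_distrib, Finset.sum_filter, Finset.sum_filter, Fintype.sum_prod_type,
      Fintype.sum_prod_type]
    congr 1
    exact Finset.sum_comm
  rw [h1, ← Finset.sum_add_distrib, Finset.mul_sum]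
  refine Finset.sum_congr rfl fun i _ ↦ ?_
  rw [← Finset.sum_add_distrib]
  have h2 : ∀ j, (if i < j then a i else 0) + (if j < i then a i else 0) =
      a i - if j = i then a i else 0 := by
    intro j
    rcases lt_trichotomy i j with h | h | h
    · simp [h, h.not_gt, h.ne']
    · simp [h]
    · simp [h, h.not_gt, h.ne]
  simp only [h2, Finset.sum_sub_distrib, Finset.sum_ite_eq', Finset.mem_univ, if_true,
    Finset.sum_const, Finset.card_univ, Fintype.card_fin, nsmul_eq_mul]
  ring

variable {X : Type*} [MeasurableSpace X] [MetricSpace X] {n : ℕ} {vol : Measure X}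
  {g : X → X → EReal} {V : X → EReal} {ϑ : X → ℝ}

lemma GasAssumptions.coe_gasKernel (hA : GasAssumptions n vol g V ϑ) (u x : X) :
    (gasKernel g ϑ u x : EReal) = tiltedKernel g ϑ u x := by
  refine EReal.coe_toENNReal ?_
  have h := add_le_add_right (EReal.neg_le.1 (hA.kernel_lower u x)) ((ϑ u + ϑ x : ℝ) : EReal)
  rw [tiltedKernel, add_comm]
  refine le_trans (le_of_eq ?_) h
  rw [← EReal.coe_neg, ← EReal.coe_add, add_neg_cancel, EReal.coe_zero]

lemma GasAssumptions.kernel_eq (hA : GasAssumptions n vol g V ϑ) (u x : X) :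
    g u x = (gasKernel g ϑ u x : EReal) + ((-(ϑ u + ϑ x) : ℝ) : EReal) := by
  rw [hA.coe_gasKernel, tiltedKernel, EReal.coe_neg, ← sub_eq_add_neg, EReal.add_sub_cancel_right]

/-- Passing from g to G adds β (ϑ(x_i) + ϑ(x_j)) for every pair. Each index lies in N - 1 pairs, so
the modified potential with κ = β (N - 1) compensates exactly. -/
lemma GasAssumptions.energy_eq (hA : GasAssumptions n vol g V ϑ) {β : ℝ} (hβ : 0 ≤ β) {N : ℕ}
    (x : Fin N → X) :
    energy g V β x = ((ENNReal.ofReal β * pairSum (gasKernel g ϑ) x : ℝ≥0∞) : EReal) +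
      ∑ j, tiltedPotential V ϑ (β * (N - 1)) (x j) := by
  have h1 : ∑ q : Fin N × Fin N with q.1 < q.2, g (x q.1) (x q.2) =
      ((pairSum (gasKernel g ϑ) x : ℝ≥0∞) : EReal) +
        ((-((N - 1) * ∑ j, ϑ (x j)) : ℝ) : EReal) := by
    rw [← sum_pairs fun j ↦ ϑ (x j), ← Finset.sum_neg_distrib, coe_real_finsetSum,
      show pairSum (gasKernel g ϑ) x =
        ∑ q : Fin N × Fin N with q.1 < q.2, gasKernel g ϑ (x q.1) (x q.2) by
        rw [Finset.sum_filter, Fintype.sum_prod_type]; rfl,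
      coe_ennreal_finsetSum, ← Finset.sum_add_distrib]
    exact Finset.sum_congr rfl fun q _ ↦ hA.kernel_eq _ _
  have h2 : ∑ j, tiltedPotential V ϑ (β * (N - 1)) (x j) =
      ∑ j, V (x j) + ((-(β * ((N - 1) * ∑ j, ϑ (x j))) : ℝ) : EReal) := by
    simp only [tiltedPotential, sub_eq_add_neg, ← EReal.coe_neg]
    rw [Finset.sum_add_distrib, ← coe_real_finsetSum, Finset.sum_neg_distrib, ← Finset.mul_sum,
      ← mul_assoc]
  have hβ' : (0 : EReal) ≤ (β : EReal) := by exact_mod_cast hβ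
  rw [energy, h1, h2, EReal.left_distrib_of_nonneg_of_ne_top hβ' (EReal.coe_ne_top β),
    ← EReal.coe_mul, EReal.coe_ennreal_mul, EReal.coe_ennreal_ofReal, max_eq_left hβ, mul_neg,
    add_assoc, add_comm ((-(β * ((N - 1) * ∑ j, ϑ (x j))) : ℝ) : EReal)]

lemma GasAssumptions.exp_neg_energy (hA : GasAssumptions n vol g V ϑ) {β : ℝ} (hβ : 0 ≤ β) {N : ℕ}
    (x : Fin N → X) :
    EReal.exp (-energy g V β x) = (∏ j, boltzmann V ϑ (β * (N - 1)) (x j)) *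
      expNeg (ENNReal.ofReal β * pairSum (gasKernel g ϑ) x) := by
  have h := exp_neg_sum Finset.univ (T := fun j ↦ tiltedPotential V ϑ (β * (N - 1)) (x j))
    fun j ↦ by
      rw [tiltedPotential, sub_eq_add_neg, ← EReal.coe_neg]
      exact EReal.add_ne_bot_iff.2 ⟨hA.potential_ne_bot _, EReal.coe_ne_bot _⟩
  rw [hA.energy_eq hβ, EReal.neg_add (Or.inl (EReal.coe_ennreal_ne_bot _)) (Or.inr h.1),
    sub_eq_add_neg, EReal.exp_add, h.2, mul_comm]
  rfl

/-- Exponential moments of one-particle statistics under the Gibbs measure. -/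
lemma GasAssumptions.lintegral_gibbsMeasure [BorelSpace X] [SecondCountableTopology X]
    [SigmaFinite vol] (hA : GasAssumptions n vol g V ϑ) {γ : ℝ} (hγ : 0 ≤ γ)
    (h0 : ∫⁻ x, boltzmann V ϑ γ x ∂vol ≠ 0) {β : ℝ} (hβ : 0 ≤ β) (N : ℕ) {F : X → ℝ}
    (hF : Measurable F) (hF0 : ∀ x, 0 ≤ F x) :
    ∫⁻ x, expNeg (∑ j, ENNReal.ofReal (F (x j))) ∂(gibbsMeasure vol g V β N) =
      (gasZ (gasKernel g ϑ) (ENNReal.ofReal β) N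
        (expDensity (referenceMeasure vol V ϑ γ) fun x ↦ (β * (N - 1) - γ) * ϑ x))⁻¹ *
      gasZ (gasKernel g ϑ) (ENNReal.ofReal β) N
        (expDensity (referenceMeasure vol V ϑ γ) fun x ↦ (β * (N - 1) - γ) * ϑ x - F x) := by
  set κ : ℝ := β * (N - 1) with hκ
  have hG := hA.measurable_gasKernel
  have hθ := hA.theta_continuous.measurable
  have hb := hA.measurable_boltzmann κ
  set m := vol.withDensity (boltzmann V ϑ κ) with hm
  have hms : SigmaFinite m := SigmaFinite.withDensity_of_ne_top
    (ae_of_all _ fun x ↦ hA.boltzmann_ne_top κ x)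
  have hE : (fun x : Fin N → X ↦ EReal.exp (-energy g V β x)) =
      (fun x ↦ ∏ j, boltzmann V ϑ κ (x j)) *
        fun x ↦ expNeg (ENNReal.ofReal β * pairSum (gasKernel g ϑ) x) := by
    funext x; exact hA.exp_neg_energy hβ x
  have hprod : Measurable fun x : Fin N → X ↦ ∏ j, boltzmann V ϑ κ (x j) :=
    Finset.measurable_prod _ fun j _ ↦ hb.comp (measurable_pi_apply j)
  have hW : Measurable fun x : Fin N → X ↦
      expNeg (ENNReal.ofReal β * pairSum (gasKernel g ϑ) x) := measurable_gasWeight _ N hG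
  have hdens : (Measure.pi fun _ : Fin N ↦ vol).withDensity
      (fun x ↦ EReal.exp (-energy g V β x)) = (Measure.pi fun _ : Fin N ↦ m).withDensity
        fun x ↦ expNeg (ENNReal.ofReal β * pairSum (gasKernel g ϑ) x) := by
    rw [hE, withDensity_mul _ hprod hW, hm, pi_withDensity N vol hb]
  have hZ : partitionFunction vol g V β N = gasZ (gasKernel g ϑ) (ENNReal.ofReal β) N m := by
    have h1 : partitionFunction vol g V β N = (Measure.pi fun _ : Fin N ↦ vol).withDensity
        (fun x ↦ EReal.exp (-energy g V β x)) Set.univ := by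
      rw [withDensity_apply _ MeasurableSet.univ, Measure.restrict_univ]; rfl
    rw [h1, hdens, withDensity_apply _ MeasurableSet.univ, Measure.restrict_univ]
    rfl
  have hΨ : Measurable fun x : Fin N → X ↦ expNeg (∑ j, ENNReal.ofReal (F (x j))) :=
    measurable_expNeg.comp (Finset.measurable_sum _ fun j _ ↦
      hF.ennreal_ofReal.comp (measurable_pi_apply j))
  have hnum : ∫⁻ x, expNeg (∑ j, ENNReal.ofReal (F (x j))) *
      expNeg (ENNReal.ofReal β * pairSum (gasKernel g ϑ) x) ∂(Measure.pi fun _ : Fin N ↦ m) =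
      gasZ (gasKernel g ϑ) (ENNReal.ofReal β) N (expDensity m fun x ↦ -F x) := by
    have h2 := lintegral_expNeg_sum_mul_gasWeight hG (ENNReal.ofReal β) N m (r := fun x ↦ -F x)
      hF.neg (Ψ := fun _ ↦ 1) measurable_const
    simp only [one_mul] at h2
    rw [gasZ, h2]
    refine lintegral_congr fun x ↦ ?_
    rw [expNeg_sum]
    congr 1
    exact Finset.prod_congr rfl fun j _ ↦ expNeg_ofReal (hF0 _)
  -- The normalising constant of the reference measure enters both partition functions as C^N and
  -- cancels.
  obtain ⟨C, hC⟩ : ∃ C : ℝ≥0, (C : ℝ≥0∞) = (∫⁻ x, boltzmann V ϑ γ x ∂vol)⁻¹ :=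
    ⟨_, ENNReal.coe_toNNReal (ENNReal.inv_ne_top.2 h0)⟩
  have hC0 : (C : ℝ≥0∞) ≠ 0 := by
    rw [hC]; exact ENNReal.inv_ne_zero.2 (hA.lintegral_boltzmann_ne_top hγ)
  have hm0 : expDensity (referenceMeasure vol V ϑ γ) (fun x ↦ (κ - γ) * ϑ x) =
      (C : ℝ≥0∞) • m := by
    rw [hA.expDensity_reference γ (κ - γ), hC, add_sub_cancel]
  have hm1 : expDensity (referenceMeasure vol V ϑ γ) (fun x ↦ (κ - γ) * ϑ x - F x) =
      (C : ℝ≥0∞) • expDensity m fun x ↦ -F x := by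
    have h3 := expDensity_expDensity (referenceMeasure vol V ϑ γ) (r := fun x ↦ (κ - γ) * ϑ x)
      (s := fun x ↦ -F x) (hθ.const_mul _) hF.neg
    simp only [← sub_eq_add_neg] at h3
    rw [← h3, hm0, expDensity, withDensity_smul_measure]
    rfl
  rw [gibbsMeasure, lintegral_smul_measure, hdens,
    lintegral_withDensity_eq_lintegral_mul _ hW hΨ, hm0, hm1, gasZ_smul hG, gasZ_smul hG, hZ,
    smul_eq_mul, ← hnum, ENNReal.mul_inv (Or.inl (pow_ne_zero N hC0))
      (Or.inl (ENNReal.pow_ne_top ENNReal.coe_ne_top))]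
  have hCN : ((C : ℝ≥0∞) ^ N)⁻¹ * (C : ℝ≥0∞) ^ N = 1 :=
    ENNReal.inv_mul_cancel (pow_ne_zero N hC0) (ENNReal.pow_ne_top ENNReal.coe_ne_top)
  rw [mul_mul_mul_comm, hCN, one_mul]
  congr 1
  exact lintegral_congr fun x ↦ mul_comm _ _

end Bridge

/-! ### Derivative of the partition function along a tilt. -/

section Derivative

/-- Differentiation of the exponential weight under the integral sign. -/
lemma hasDerivAt_integral_exp_neg_mul {Ω : Type*} [MeasurableSpace Ω] {m : Measure Ω}
    {S W : Ω → ℝ} {B : ℝ} (hS : Measurable S) (hSB : ∀ x, |S x| ≤ B) (hW : Integrable W m)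
    (s : ℝ) :
    HasDerivAt (fun t ↦ ∫ x, Real.exp (-(t * S x)) * W x ∂m)
      (∫ x, -(S x * (Real.exp (-(s * S x)) * W x)) ∂m) s := by
  have hmeas : ∀ t : ℝ, AEStronglyMeasurable (fun x ↦ Real.exp (-(t * S x)) * W x) m := fun t ↦
    ((hS.const_mul t).neg.exp.aestronglyMeasurable).mul hW.aestronglyMeasurable
  have hexp : ∀ t ∈ Metric.ball s 1, ∀ x, Real.exp (-(t * S x)) ≤ Real.exp ((|s| + 1) * B) := by
    intro t ht x
    have hB : 0 ≤ B := (_root_.abs_nonneg _).trans (hSB x)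
    have ht' : |t| ≤ |s| + 1 := by
      rw [Metric.mem_ball, Real.dist_eq] at ht
      have := abs_sub_abs_le_abs_sub t s
      linarith
    refine Real.exp_le_exp.2 ((neg_le_abs _).trans ?_)
    rw [abs_mul]
    exact mul_le_mul ht' (hSB x) (_root_.abs_nonneg _) (by positivity)
  have hbd : Integrable (fun x ↦ Real.exp ((|s| + 1) * B) * |W x|) m := hW.abs.const_mul _
  refine (hasDerivAt_integral_of_dominated_loc_of_deriv_le
    (bound := fun x ↦ B * (Real.exp ((|s| + 1) * B) * |W x|))
    (F' := fun t x ↦ -(S x * (Real.exp (-(t * S x)) * W x)))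
    (Metric.ball_mem_nhds s one_pos) (Eventually.of_forall hmeas) ?_ ?_ ?_ (hbd.const_mul B) ?_).2
  · refine hbd.mono' (hmeas s) (ae_of_all _ fun x ↦ ?_)
    rw [Real.norm_eq_abs, abs_mul, abs_of_pos (Real.exp_pos _)]
    exact mul_le_mul_of_nonneg_right (hexp s (Metric.mem_ball_self one_pos) x)
      (_root_.abs_nonneg _)
  · exact (hS.aestronglyMeasurable.mul (hmeas s)).neg
  · refine ae_of_all _ fun x t ht ↦ ?_
    rw [Real.norm_eq_abs, abs_neg, abs_mul, abs_mul, abs_of_pos (Real.exp_pos _)]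
    exact mul_le_mul (hSB x) (mul_le_mul_of_nonneg_right (hexp t ht x) (_root_.abs_nonneg _))
      (by positivity) ((_root_.abs_nonneg _).trans (hSB x))
  · refine ae_of_all _ fun x t _ ↦ ?_
    have h1 : HasDerivAt (fun t : ℝ ↦ -(t * S x)) (-(1 * S x)) t :=
      ((hasDerivAt_id t).mul_const _).neg
    have h2 := h1.exp.mul_const (W x)
    have h3 : -(S x * (Real.exp (-(t * S x)) * W x)) =
        Real.exp (-(t * S x)) * -(1 * S x) * W x := by ring
    rw [h3]
    exact h2

variable {X : Type*} [MeasurableSpace X] {G : X → X → ℝ≥0∞} {b : ℝ≥0∞} {M : ℕ} {m : Measure X}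
  {F : X → ℝ} {B : ℝ}

lemma lintegral_mul_gasWeight_neg_mul [IsFiniteMeasure m]
    (hG : Measurable (Function.uncurry G)) (hF : Measurable F) (b : ℝ≥0∞) (N : ℕ) (s : ℝ)
    {Ψ : (Fin N → X) → ℝ≥0∞} (hΨ : Measurable Ψ) :
    ∫⁻ x, Ψ x * expNeg (b * pairSum G x)
        ∂(Measure.pi fun _ : Fin N ↦ expDensity m fun x ↦ -(s * F x)) =
      ∫⁻ x, Ψ x * ENNReal.ofReal (Real.exp (-(s * ∑ j, F (x j))) *
        (expNeg (b * pairSum G x)).toReal) ∂(Measure.pi fun _ : Fin N ↦ m) := by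
  have hr : Measurable fun x ↦ -(s * F x) := (hF.const_mul s).neg
  rw [lintegral_expNeg_sum_mul_gasWeight hG b N m hr hΨ]
  refine lintegral_congr fun x ↦ ?_
  rw [← ENNReal.ofReal_prod_of_nonneg fun j _ ↦ (Real.exp_pos _).le, ← Real.exp_sum,
    Finset.sum_neg_distrib, ← Finset.mul_sum, ENNReal.ofReal_mul (Real.exp_pos _).le,
    ENNReal.ofReal_toReal (expNeg_ne_top _), mul_left_comm]

/-- A tilt multiplies the integrand by a positive factor, so it cannot make the integral vanish. -/
lemma gasZ_neg_mul_ne_zero [IsFiniteMeasure m] (hG : Measurable (Function.uncurry G))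
    (hF : Measurable F) {N : ℕ} (h0 : gasZ G b N m ≠ 0) (s : ℝ) :
    gasZ G b N (expDensity m fun x ↦ -(s * F x)) ≠ 0 := by
  have hW : Measurable fun x : Fin N → X ↦ expNeg (b * pairSum G x) := measurable_gasWeight b N hG
  have hm : Measurable fun x : Fin N → X ↦ ∑ j, F (x j) :=
    Finset.measurable_sum _ fun j _ ↦ hF.comp (measurable_pi_apply j)
  have h1 := lintegral_mul_gasWeight_neg_mul (m := m) hG hF b N s (Ψ := fun _ ↦ 1)
    measurable_const
  simp only [one_mul] at h1
  have hE : Measurable fun x : Fin N → X ↦ ENNReal.ofReal (Real.exp (-(s * ∑ j, F (x j))) *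
      (expNeg (b * pairSum G x)).toReal) :=
    ((hm.const_mul s).neg.exp.mul hW.ennreal_toReal).ennreal_ofReal
  intro h
  rw [gasZ, h1, lintegral_eq_zero_iff hE] at h
  refine h0 ((lintegral_eq_zero_iff hW).2 (h.mono fun x hx ↦ ?_))
  have h2 : Real.exp (-(s * ∑ j, F (x j))) * (expNeg (b * pairSum G x)).toReal ≤ 0 :=
    ENNReal.ofReal_eq_zero.1 hx
  have h3 : (expNeg (b * pairSum G x)).toReal ≤ 0 :=
    nonpos_of_mul_nonpos_right h2 (Real.exp_pos _)
  have h4 := le_antisymm h3 ENNReal.toReal_nonneg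
  exact ((ENNReal.toReal_eq_zero_iff _).1 h4).resolve_right (expNeg_ne_top _)

/-- Differentiation brings down -Σ F(x_j), and exchangeability expresses the resulting integral
through `gasA`. -/
lemma hasDerivAt_gasZ [IsFiniteMeasure m] (hG : Measurable (Function.uncurry G))
    (hs : ∀ u v, G u v = G v u) (hF : Measurable F) (hF0 : ∀ x, 0 ≤ F x) (hFB : ∀ x, F x ≤ B)
    (s : ℝ) :
    HasDerivAt (fun t ↦ (gasZ G b (M + 1) (expDensity m fun x ↦ -(t * F x))).toReal)
      (-((M + 1 : ℕ) * ∫⁻ u, ENNReal.ofReal (F u) *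
        gasA G b M (expDensity m fun x ↦ -(s * F x)) u
          ∂(expDensity m fun x ↦ -(s * F x))).toReal) s := by
  have hW : Measurable fun x : Fin (M + 1) → X ↦ (expNeg (b * pairSum G x)).toReal :=
    (measurable_gasWeight b (M + 1) hG).ennreal_toReal
  have hm : Measurable fun x : Fin (M + 1) → X ↦ ∑ j, F (x j) :=
    Finset.measurable_sum _ fun j _ ↦ hF.comp (measurable_pi_apply j)
  have hm0 : ∀ x : Fin (M + 1) → X, 0 ≤ ∑ j, F (x j) := fun x ↦
    Finset.sum_nonneg fun j _ ↦ hF0 _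
  have hWi : Integrable (fun x : Fin (M + 1) → X ↦ (expNeg (b * pairSum G x)).toReal)
      (Measure.pi fun _ ↦ m) := by
    refine (integrable_const (1 : ℝ)).mono' hW.aestronglyMeasurable (ae_of_all _ fun x ↦ ?_)
    rw [Real.norm_of_nonneg ENNReal.toReal_nonneg]
    exact ENNReal.toReal_le_of_le_ofReal zero_le_one (by simpa using expNeg_le_one _)
  have hE : ∀ t : ℝ, Measurable fun x : Fin (M + 1) → X ↦
      Real.exp (-(t * ∑ j, F (x j))) * (expNeg (b * pairSum G x)).toReal := fun t ↦
    (hm.const_mul t).neg.exp.mul hW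
  have hE0 : ∀ (t : ℝ) (x : Fin (M + 1) → X),
      0 ≤ Real.exp (-(t * ∑ j, F (x j))) * (expNeg (b * pairSum G x)).toReal := fun t x ↦
    mul_nonneg (Real.exp_pos _).le ENNReal.toReal_nonneg
  have h := hasDerivAt_integral_exp_neg_mul (B := (M + 1) * B) hm (fun x ↦ by
    rw [abs_of_nonneg (hm0 x)]
    refine (Finset.sum_le_card_nsmul _ _ B fun j _ ↦ hFB _).trans (le_of_eq ?_)
    simp) hWi s
  convert h using 1
  · funext t
    have h1 := lintegral_mul_gasWeight_neg_mul (m := m) hG hF b (M + 1) t (Ψ := fun _ ↦ 1)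
      measurable_const
    simp only [one_mul] at h1
    rw [gasZ, h1, integral_eq_lintegral_of_nonneg_ae (ae_of_all _ (hE0 t))
      (hE t).aestronglyMeasurable]
  · have hΨ : Measurable fun x : Fin (M + 1) → X ↦ ∑ j, ENNReal.ofReal (F (x j)) :=
      Finset.measurable_sum _ fun j _ ↦ hF.ennreal_ofReal.comp (measurable_pi_apply j)
    have h1 := lintegral_mul_gasWeight_neg_mul (m := m) hG hF b (M + 1) s hΨ
    rw [← lintegral_sum_mul_gasWeight b M _ hG hs hF.ennreal_ofReal, h1, integral_neg,
      integral_eq_lintegral_of_nonneg_ae (ae_of_all _ fun x ↦ mul_nonneg (hm0 x) (hE0 s x))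
      (hm.mul (hE s)).aestronglyMeasurable]
    congr 2
    refine lintegral_congr fun x ↦ ?_
    rw [← ENNReal.ofReal_sum_of_nonneg fun j _ ↦ hF0 _, ← ENNReal.ofReal_mul (hm0 x)]

/-- Comparison of the logarithm of a Laplace functional of the gas with that of a Poisson
process. -/
lemma exists_log_gasZ_sub_log_gasZ [IsFiniteMeasure m] (hG : Measurable (Function.uncurry G))
    (hs : ∀ u v, G u v = G v u) (hF : Measurable F) (hF0 : ∀ x, 0 ≤ F x) (hFB : ∀ x, F x ≤ B)
    (h0 : gasZ G b (M + 1) m ≠ 0) {Y : Type*} [MeasurableSpace Y] {l : Measure Y}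
    [IsFiniteMeasure l] {f : Y → ℝ} {A : ℝ} (hf : Measurable f) (hfA : ∀ y, |f y| ≤ A) (c : ℝ) :
    ∃ s ∈ Set.Ioo (0 : ℝ) 1,
      Real.log (gasZ G b (M + 1) (expDensity m fun x ↦ -F x)).toReal -
        Real.log (gasZ G b (M + 1) m).toReal - c * (∫ y, (Real.exp (-f y) - 1) ∂l) =
      c * (∫ y, f y * Real.exp (-(s * f y)) ∂l) -
        ((gasZ G b (M + 1) (expDensity m fun x ↦ -(s * F x)))⁻¹ * ((M + 1 : ℕ) *
          ∫⁻ u, ENNReal.ofReal (F u) * gasA G b M (expDensity m fun x ↦ -(s * F x)) u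
            ∂(expDensity m fun x ↦ -(s * F x)))).toReal := by
  set Z : ℝ → ℝ≥0∞ := fun t ↦ gasZ G b (M + 1) (expDensity m fun x ↦ -(t * F x)) with hZ
  set T : ℝ → ℝ≥0∞ := fun t ↦ (M + 1 : ℕ) * ∫⁻ u, ENNReal.ofReal (F u) *
    gasA G b M (expDensity m fun x ↦ -(t * F x)) u ∂(expDensity m fun x ↦ -(t * F x)) with hT
  have hfin : ∀ t ∈ Set.Icc (0 : ℝ) 1, Z t ≠ ⊤ := by
    intro t ht
    have : IsFiniteMeasure (expDensity m fun x ↦ -(t * F x)) := by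
      refine ⟨?_⟩
      rw [expDensity_univ]
      refine lt_of_le_of_lt (lintegral_mono (g := fun _ ↦ 1) fun x ↦ ?_) (by simp)
      rw [← ENNReal.ofReal_one]
      refine ENNReal.ofReal_le_ofReal (Real.exp_le_one_iff.2 ?_)
      exact neg_nonpos.2 (mul_nonneg ht.1 (hF0 x))
    exact gasZ_ne_top b (M + 1) _
  have hpos : ∀ t ∈ Set.Icc (0 : ℝ) 1, (Z t).toReal ≠ 0 := fun t ht ↦
    (ENNReal.toReal_pos (gasZ_neg_mul_ne_zero hG hF h0 t) (hfin t ht)).ne'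
  have hd1 : ∀ t, HasDerivAt (fun t ↦ (Z t).toReal) (-(T t).toReal) t := fun t ↦
    hasDerivAt_gasZ hG hs hF hF0 hFB t
  have hd2 : ∀ t, HasDerivAt (fun t ↦ ∫ y, Real.exp (-(t * f y)) * 1 ∂l)
      (∫ y, -(f y * (Real.exp (-(t * f y)) * 1)) ∂l) t := fun t ↦
    hasDerivAt_integral_exp_neg_mul hf hfA (integrable_const 1) t
  simp only [mul_one] at hd2
  have hd : ∀ t ∈ Set.Icc (0 : ℝ) 1, HasDerivAt
      (fun t ↦ Real.log (Z t).toReal - c * ∫ y, Real.exp (-(t * f y)) ∂l)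
      (-(T t).toReal / (Z t).toReal - c * ∫ y, -(f y * Real.exp (-(t * f y))) ∂l) t := fun t ht ↦
    ((hd1 t).log (hpos t ht)).sub ((hd2 t).const_mul c)
  -- The mean value theorem is applied to the difference of log Z and the Poisson exponent, so that
  -- both derivatives are taken at the same s.
  obtain ⟨s, hs', h⟩ := exists_hasDerivAt_eq_slope
    (fun t ↦ Real.log (Z t).toReal - c * ∫ y, Real.exp (-(t * f y)) ∂l) _ zero_lt_one
    (fun t ht ↦ (hd t ht).continuousAt.continuousWithinAt)
    fun t ht ↦ hd t (Set.Ioo_subset_Icc_self ht)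
  refine ⟨s, hs', ?_⟩
  have hm0 : expDensity m (fun x ↦ 0) = m := by simp [expDensity]
  have he : Integrable (fun y ↦ Real.exp (-f y)) l := by
    refine (integrable_const (Real.exp A)).mono' hf.neg.exp.aestronglyMeasurable
      (ae_of_all _ fun y ↦ ?_)
    rw [Real.norm_of_nonneg (Real.exp_pos _).le]
    exact Real.exp_le_exp.2 ((neg_le_abs _).trans (hfA y))
  rw [ENNReal.toReal_mul, ENNReal.toReal_inv, integral_sub he (integrable_const 1)]
  simp only [hZ, one_mul, zero_mul, neg_zero, Real.exp_zero, sub_zero, div_one, integral_neg]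
    at h
  simp only [hZ, hT] at *
  rw [div_eq_inv_mul] at h
  rw [hm0] at h
  linarith

end Derivative

/-! ### Rescaled intensities in normal coordinates. -/

section LocalLimit

variable {n : ℕ} {X : Type*} [MetricSpace X] [ChartedSpace (EuclideanSpace ℝ (Fin n)) X]
  [IsManifold (𝓡 n) ∞ X] [RiemannianBundle (fun x : X ↦ TangentSpace (𝓡 n) x)]

/-- The density, in the coordinates of a chart, of a measure with a density with respect to the
Riemannian volume. -/
def chartDensity (φ : OpenPartialHomeomorph X (EuclideanSpace ℝ (Fin n))) (k : X → ℝ≥0∞) :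
    EuclideanSpace ℝ (Fin n) → ℝ≥0∞ :=
  φ.target.indicator fun y ↦ ENNReal.ofReal √(metricMatrix φ y).det * k (φ.symm y)

variable [MeasurableSpace X] [BorelSpace X]
  [IsContMDiffRiemannianBundle (𝓡 n) ∞ (EuclideanSpace ℝ (Fin n))
    (fun x : X ↦ TangentSpace (𝓡 n) x)]
  {φ : OpenPartialHomeomorph X (EuclideanSpace ℝ (Fin n))} {E : X}

lemma measurable_chartDensity (hφ : φ ∈ IsManifold.maximalAtlas (𝓡 n) ∞ X) {k : X → ℝ≥0∞}
    (hk : Measurable k) : Measurable (chartDensity φ k) := by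
  classical
  rcases φ.target.eq_empty_or_nonempty with h | ⟨y₀, hy₀⟩
  · rw [chartDensity, h, Set.indicator_empty]
    exact measurable_const
  have h1 := (continuousOn_sqrt_det hφ).measurable_piecewise (g := fun _ ↦ (0 : ℝ))
    continuousOn_const φ.open_target.measurableSet
  have h2 := φ.continuousOn_symm.measurable_piecewise (g := fun _ ↦ φ.symm y₀)
    continuousOn_const φ.open_target.measurableSet
  convert h1.ennreal_ofReal.mul (hk.comp h2) using 1
  funext y
  by_cases hy : y ∈ φ.target
  · simp [chartDensity, hy]
  · simp [chartDensity, hy]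

/-- The dilation by l has Jacobian l^n. For l = N^{1/n} the prefactor is the number of particles. -/
lemma lintegral_comp_smul_chart (hφ : φ ∈ IsManifold.maximalAtlas (𝓡 n) ∞ X) {l : ℝ} (hl : 0 < l)
    {Φ : EuclideanSpace ℝ (Fin n) → ℝ≥0∞} (hΦ : Measurable Φ) {k : X → ℝ≥0∞}
    (hk : Measurable k) :
    ENNReal.ofReal (l ^ n) * ∫⁻ x in φ.source, Φ (l • φ x) * k x ∂(riemannianVolume n X) =
      ∫⁻ z, Φ z * chartDensity φ k (l⁻¹ • z) := by
  classical
  have hP : Measurable (φ.source.piecewise φ fun _ ↦ 0) :=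
    φ.continuousOn.measurable_piecewise continuousOn_const φ.open_source.measurableSet
  set P := φ.source.piecewise φ fun _ ↦ 0
  have hF : Measurable fun x ↦ Φ (l • P x) * k x := (hΦ.comp (hP.const_smul l)).mul hk
  have h1 : ∫⁻ x in φ.source, Φ (l • φ x) * k x ∂(riemannianVolume n X) =
      ∫⁻ x in φ.source, Φ (l • P x) * k x ∂(riemannianVolume n X) :=
    setLIntegral_congr_fun φ.open_source.measurableSet fun x hx ↦ by
      simp only [P, Set.piecewise_eq_of_mem _ _ _ hx]
  have hH : Measurable fun y ↦ Φ (l • y) * chartDensity φ k y :=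
    (hΦ.comp (measurable_const_smul l)).mul (measurable_chartDensity hφ hk)
  have h2 : ∫⁻ x in φ.source, Φ (l • φ x) * k x ∂(riemannianVolume n X) =
      ∫⁻ y, Φ (l • y) * chartDensity φ k y := by
    rw [h1, setLIntegral_riemannianVolume hφ hF,
      ← lintegral_indicator φ.open_target.measurableSet]
    refine lintegral_congr fun y ↦ ?_
    by_cases hy : y ∈ φ.target
    · rw [chartDensity, Set.indicator_of_mem hy, Set.indicator_of_mem hy]
      simp only [P, Set.piecewise_eq_of_mem _ _ _ (φ.map_target hy), φ.right_inv hy]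
      ring
    · rw [chartDensity, Set.indicator_of_notMem hy, Set.indicator_of_notMem hy, mul_zero]
  have hl' : l⁻¹ ≠ 0 := (inv_pos.2 hl).ne'
  have h3 : ∫⁻ z : EuclideanSpace ℝ (Fin n), Φ z * chartDensity φ k (l⁻¹ • z) =
      ∫⁻ y, Φ (l • y) * chartDensity φ k y ∂(volume.map fun z ↦ l⁻¹ • z) := by
    rw [lintegral_map hH (measurable_const_smul _)]
    refine lintegral_congr fun z ↦ ?_
    rw [smul_inv_smul₀ hl.ne']
  rw [h2, h3, Measure.map_addHaar_smul _ hl', lintegral_smul_measure, finrank_euclideanSpace_fin,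
    inv_pow, inv_inv, abs_of_pos (pow_pos hl n), smul_eq_mul]

/-- A point is a Lebesgue null set in a chart, as n ≥ 1. This is what makes the tilts, which
concentrate at E, tend to 0 almost everywhere. -/
lemma riemannianVolume_singleton (hn : 1 ≤ n) (x : X) : riemannianVolume n X {x} = 0 := by
  have : Nontrivial (EuclideanSpace ℝ (Fin n)) := by
    have : Nonempty (Fin n) := ⟨⟨0, hn⟩⟩
    infer_instance
  set e := chartAt (EuclideanSpace ℝ (Fin n)) x
  have he : e ∈ IsManifold.maximalAtlas (𝓡 n) ∞ X := IsManifold.chart_mem_maximalAtlas x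
  have hx : x ∈ e.source := mem_chart_source _ x
  have hm : Measurable (({x} : Set X).indicator (1 : X → ℝ≥0∞)) :=
    measurable_one.indicator (measurableSet_singleton x)
  have h := setLIntegral_riemannianVolume he hm
  rw [lintegral_indicator_one (measurableSet_singleton x),
    Measure.restrict_apply (measurableSet_singleton x),
    Set.inter_eq_left.2 (Set.singleton_subset_iff.2 hx)] at h
  rw [h, ← nonpos_iff_eq_zero]
  calc ∫⁻ y in e.target, ENNReal.ofReal √(metricMatrix e y).det *
        ({x} : Set X).indicator (1 : X → ℝ≥0∞) (e.symm y)
      ≤ ∫⁻ y in e.target, ({e x} : Set _).indicator (fun _ ↦ ⊤) y := by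
        refine setLIntegral_mono ((measurable_const).indicator (measurableSet_singleton _))
          fun y hy ↦ ?_
        by_cases h1 : e.symm y = x
        · have : y ∈ ({e x} : Set (EuclideanSpace ℝ (Fin n))) := by
            rw [Set.mem_singleton_iff, ← h1, e.right_inv hy]
          rw [Set.indicator_of_mem this]
          exact le_top
        · rw [Set.indicator_of_notMem (by simpa using h1), mul_zero]
          exact zero_le
    _ ≤ ∫⁻ y, ({e x} : Set _).indicator (fun _ ↦ ⊤) y :=
        lintegral_mono' Measure.restrict_le_self le_rfl
    _ = 0 := by
        rw [lintegral_indicator (measurableSet_singleton _)]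
        simp

lemma IsNormalChart.zero_mem (hφ : IsNormalChart φ E) : (0 : EuclideanSpace ℝ (Fin n)) ∈ φ.target := by
  rw [← hφ.map_center]
  exact φ.map_source hφ.mem_source

lemma IsNormalChart.symm_zero (hφ : IsNormalChart φ E) : φ.symm 0 = E := by
  rw [← hφ.map_center]
  exact φ.left_inv hφ.mem_source

/-- The metric matrix is continuous and is the identity at the centre. Hence the limiting intensity
is the density at E without a Jacobian factor. -/
lemma IsNormalChart.tendsto_sqrt_det (hφ : IsNormalChart φ E) :
    Tendsto (fun y ↦ √(metricMatrix φ y).det) (𝓝 0) (𝓝 1) := by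
  have h := (continuousOn_sqrt_det hφ.mem_atlas).continuousAt
    (φ.open_target.mem_nhds hφ.zero_mem)
  rw [ContinuousAt, hφ.orthonormal, Matrix.det_one, Real.sqrt_one] at h
  exact h

lemma IsNormalChart.tendsto_chartDensity (hφ : IsNormalChart φ E) {k : ℕ → X → ℝ≥0∞} {L : ℝ≥0∞}
    (hk : ∀ v : ℕ → X, Tendsto v atTop (𝓝 E) → Tendsto (fun N ↦ k N (v N)) atTop (𝓝 L))
    {y : ℕ → EuclideanSpace ℝ (Fin n)} (hy : Tendsto y atTop (𝓝 0)) :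
    Tendsto (fun N ↦ chartDensity φ (k N) (y N)) atTop (𝓝 L) := by
  have h1 : Tendsto (fun N ↦ φ.symm (y N)) atTop (𝓝 E) := by
    have := (φ.continuousAt_symm hφ.zero_mem).tendsto.comp hy
    rwa [hφ.symm_zero] at this
  have h2 := ENNReal.tendsto_ofReal (hφ.tendsto_sqrt_det.comp hy)
  have h3 := ENNReal.Tendsto.mul h2 (Or.inl (by simp)) (hk _ h1) (Or.inr (by simp))
  rw [ENNReal.ofReal_one, one_mul] at h3
  refine h3.congr' ?_
  filter_upwards [hy.eventually (φ.open_target.mem_nhds hφ.zero_mem)] with N hN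
  rw [chartDensity, Set.indicator_of_mem hN]
  rfl

lemma IsNormalChart.eventually_chartDensity_le (hφ : IsNormalChart φ E) :
    ∀ᶠ y in 𝓝 (0 : EuclideanSpace ℝ (Fin n)), ∀ (k : X → ℝ≥0∞) (C : ℝ≥0), (∀ x, k x ≤ C) →
      chartDensity φ k y ≤ (2 * C : ℝ≥0) := by
  filter_upwards [hφ.tendsto_sqrt_det.eventually_le_const one_lt_two] with y hy k C hC
  refine Set.indicator_apply_le' (fun _ ↦ ?_) fun _ ↦ zero_le
  rw [ENNReal.coe_mul]
  refine mul_le_mul' ?_ (hC _)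
  rw [ENNReal.coe_ofNat, ← ENNReal.ofReal_ofNat]
  exact ENNReal.ofReal_le_ofReal hy

/-- Convergence of the rescaled one-particle intensity, tested against a compactly supported
function. -/
lemma IsNormalChart.tendsto_integral_sub_lintegral (hφ : IsNormalChart φ E) {k : ℕ → X → ℝ≥0∞}
    (hkm : ∀ N, Measurable (k N)) {C : ℝ≥0} (hC : ∀ᶠ N in atTop, ∀ x, k N x ≤ C) {L : ℝ≥0∞}
    (hL : L ≠ ⊤) (hk : ∀ v : ℕ → X, Tendsto v atTop (𝓝 E) → Tendsto (fun N ↦ k N (v N)) atTop (𝓝 L))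
    {l : ℕ → ℝ} (hl : Tendsto l atTop atTop) {f : EuclideanSpace ℝ (Fin n) → ℝ}
    (hf : Continuous f) (hfc : HasCompactSupport f) (hf0 : ∀ z, 0 ≤ f z) {s : ℕ → ℝ}
    (hs : ∀ N, 0 ≤ s N) :
    Tendsto (fun N ↦ L.toReal * (∫ z in tsupport f, f z * Real.exp (-(s N * f z))) -
      (∫⁻ z, ENNReal.ofReal (f z * Real.exp (-(s N * f z))) *
        chartDensity φ (k N) ((l N)⁻¹ • z)).toReal) atTop (𝓝 0) := by
  obtain ⟨A, hA⟩ := hfc.exists_bound_of_continuous hf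
  have hK : IsCompact (tsupport f) := hfc
  have hfin : IsFiniteMeasure (volume.restrict (tsupport f)) :=
    ⟨by rw [Measure.restrict_apply_univ]; exact hK.measure_lt_top⟩
  have hfe : ∀ N, Measurable fun z ↦ f z * Real.exp (-(s N * f z)) := fun N ↦
    (hf.mul (hf.const_mul (s N)).neg.rexp).measurable
  have hfe0 : ∀ N z, 0 ≤ f z * Real.exp (-(s N * f z)) := fun N z ↦
    mul_nonneg (hf0 z) (Real.exp_pos _).le
  have hfeA : ∀ N z, f z * Real.exp (-(s N * f z)) ≤ A := fun N z ↦
    (mul_le_of_le_one_right (hf0 z) (Real.exp_le_one_iff.2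
      (neg_nonpos.2 (mul_nonneg (hs N) (hf0 z))))).trans ((le_abs_self _).trans (hA z))
  have hlinv : Tendsto (fun N ↦ (l N)⁻¹) atTop (𝓝 0) := tendsto_inv_atTop_zero.comp hl
  have hq : ∀ N, Measurable fun z ↦ chartDensity φ (k N) ((l N)⁻¹ • z) := fun N ↦
    (measurable_chartDensity hφ.mem_atlas (hkm N)).comp (measurable_const_smul _)
  have hbound : ∀ᶠ N in atTop, ∀ z ∈ tsupport f,
      chartDensity φ (k N) ((l N)⁻¹ • z) ≤ (2 * C : ℝ≥0) := by
    obtain ⟨δ, hδ, hball⟩ := Metric.eventually_nhds_iff_ball.1 hφ.eventually_chartDensity_le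
    obtain ⟨R, hR⟩ := hK.isBounded.exists_norm_le
    have h1 : Tendsto (fun N ↦ |(l N)⁻¹| * R) atTop (𝓝 0) := by
      simpa using hlinv.abs.mul_const R
    filter_upwards [hC, h1.eventually_lt_const hδ] with N hN hN2 z hz
    refine hball _ ?_ _ C hN
    rw [mem_ball_zero_iff, norm_smul, Real.norm_eq_abs]
    exact (mul_le_mul_of_nonneg_left (hR z hz) (_root_.abs_nonneg _)).trans_lt hN2
  -- The parameters s N need not converge, so the two integrals need have no separate limits. Their
  -- difference tends to 0 because the test functions stay below A and the densities converge
  -- pointwise.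
  have key : Tendsto (fun N ↦ ∫ z in tsupport f, f z * Real.exp (-(s N * f z)) *
      (L.toReal - (chartDensity φ (k N) ((l N)⁻¹ • z)).toReal)) atTop
      (𝓝 (∫ _ in tsupport f, (0 : ℝ))) := by
    refine tendsto_integral_filter_of_dominated_convergence
      (fun _ ↦ A * (L.toReal + (2 * C : ℝ≥0))) ?_ ?_ (integrable_const _) ?_
    · exact Eventually.of_forall fun N ↦
        ((hfe N).mul ((hq N).ennreal_toReal.const_sub _)).aestronglyMeasurable
    · filter_upwards [hbound] with N hN
      refine (ae_restrict_iff' (isClosed_tsupport f).measurableSet).2 (ae_of_all _ fun z hz ↦ ?_)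
      rw [norm_mul, Real.norm_of_nonneg (hfe0 N z)]
      refine mul_le_mul (hfeA N z) ?_ (norm_nonneg _) ((hfe0 N z).trans (hfeA N z))
      refine (norm_sub_le _ _).trans ?_
      rw [Real.norm_of_nonneg ENNReal.toReal_nonneg, Real.norm_of_nonneg ENNReal.toReal_nonneg]
      gcongr
      exact ENNReal.toReal_mono ENNReal.coe_ne_top (hN z hz)
    · refine ae_of_all _ fun z ↦ ?_
      have hy : Tendsto (fun N ↦ (l N)⁻¹ • z) atTop (𝓝 0) := by
        simpa using hlinv.smul_const z
      have h1 := (ENNReal.tendsto_toReal hL).comp (hφ.tendsto_chartDensity hk hy)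
      have h2 : Tendsto (fun N ↦ A * |L.toReal -
          (chartDensity φ (k N) ((l N)⁻¹ • z)).toReal|) atTop (𝓝 0) := by
        have := ((h1.const_sub L.toReal).abs).const_mul A
        simpa using this
      refine squeeze_zero_norm (fun N ↦ ?_) h2
      rw [norm_mul, Real.norm_of_nonneg (hfe0 N z), Real.norm_eq_abs]
      exact mul_le_mul_of_nonneg_right (hfeA N z) (_root_.abs_nonneg _)
  rw [integral_zero] at key
  refine key.congr' ?_
  filter_upwards [hbound] with N hN
  have hAi : ∀ h : EuclideanSpace ℝ (Fin n) → ℝ, Measurable h → (∃ D, ∀ z ∈ tsupport f, |h z| ≤ D) →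
      Integrable (fun z ↦ f z * Real.exp (-(s N * f z)) * h z) (volume.restrict (tsupport f)) := by
    rintro h hh ⟨D, hD⟩
    refine (integrable_const (A * D)).mono' ((hfe N).mul hh).aestronglyMeasurable
      ((ae_restrict_iff' (isClosed_tsupport f).measurableSet).2 (ae_of_all _ fun z hz ↦ ?_))
    rw [norm_mul, Real.norm_of_nonneg (hfe0 N z)]
    exact mul_le_mul (hfeA N z) (hD z hz) (norm_nonneg _) ((hfe0 N z).trans (hfeA N z))
  have e1 : (∫⁻ z, ENNReal.ofReal (f z * Real.exp (-(s N * f z))) *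
        chartDensity φ (k N) ((l N)⁻¹ • z)).toReal =
      ∫ z in tsupport f, f z * Real.exp (-(s N * f z)) *
        (chartDensity φ (k N) ((l N)⁻¹ • z)).toReal := by
    rw [integral_eq_lintegral_of_nonneg_ae
      (ae_of_all _ fun z ↦ mul_nonneg (hfe0 N z) ENNReal.toReal_nonneg)
      ((hfe N).mul (hq N).ennreal_toReal).aestronglyMeasurable]
    congr 1
    rw [← setLIntegral_eq_of_support_subset (s := tsupport f) fun z hz ↦ ?_]
    · refine setLIntegral_congr_fun (isClosed_tsupport f).measurableSet fun z hz ↦ ?_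
      rw [ENNReal.ofReal_mul (hfe0 N z),
        ENNReal.ofReal_toReal (ne_top_of_le_ne_top ENNReal.coe_ne_top (hN z hz))]
    · refine subset_tsupport f fun h ↦ hz ?_
      simp [h]
  rw [e1]
  simp only [mul_sub]
  rw [integral_sub (hAi _ measurable_const ⟨|L.toReal|, fun _ _ ↦ le_rfl⟩)
    (hAi _ (hq N).ennreal_toReal ⟨(2 * C : ℝ≥0), fun z hz ↦ by
      rw [abs_of_nonneg ENNReal.toReal_nonneg]
      exact ENNReal.toReal_mono ENNReal.coe_ne_top (hN z hz)⟩), integral_mul_const, mul_comm]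

end LocalLimit

/-! ### Test functions in a chart and the corresponding tilts. -/

section LaplaceFunctional

/-- The perturbation (κ - γ) ϑ - s F, with κ = M b_M, is known to be at most ϑ once |κ - γ| ≤ 1. The
value 0 otherwise makes the bounds hold for every M and does not affect limits. -/
lemma meanFieldSequence_tilt {X : Type*} [MeasurableSpace X] {ν : Measure X} {ϑ : X → ℝ} {γ : ℝ}
    (hθ : Measurable ϑ) (hθ0 : ∀ x, 0 ≤ ϑ x) {b : ℕ → ℝ} (hb : ∀ M, 0 ≤ b M)
    (hbγ : Tendsto (fun M : ℕ ↦ M * b M) atTop (𝓝 γ)) {F : ℕ → X → ℝ} (hF : ∀ M, Measurable (F M))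
    (hF0 : ∀ M x, 0 ≤ F M x) {B : ℝ} (hFB : ∀ M x, F M x ≤ B)
    (hFt : ∀ᵐ x ∂ν, Tendsto (fun M ↦ F M x) atTop (𝓝 0)) {s : ℕ → ℝ}
    (hs : ∀ M, s M ∈ Set.Icc (0 : ℝ) 1) :
    MeanFieldSequence ν ϑ γ b (fun M x ↦
      if |M * b M - γ| ≤ 1 then (M * b M - γ) * ϑ x - s M * F M x else 0) where
  nonneg := hb
  tendsto := hbγ
  measurable M := by
    split_ifs
    · exact (hθ.const_mul _).sub ((hF M).const_mul _)
    · exact measurable_const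
  le M x := by
    split_ifs with h
    · have h1 := mul_le_mul_of_nonneg_right ((le_abs_self _).trans h) (hθ0 x)
      have h2 := mul_nonneg (hs M).1 (hF0 M x)
      linarith
    · exact hθ0 x
  abs_le := by
    refine ⟨|B|, fun M x ↦ ?_⟩
    have hB : 0 ≤ |B| := _root_.abs_nonneg B
    split_ifs with h
    · refine (_root_.abs_sub _ _).trans ?_
      rw [abs_mul, abs_of_nonneg (hθ0 x), abs_of_nonneg (mul_nonneg (hs M).1 (hF0 M x))]
      have h1 := mul_le_mul_of_nonneg_right h (hθ0 x)
      have h2 := mul_le_mul (hs M).2 (((hFB M x).trans (le_abs_self B))) (hF0 M x) zero_le_one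
      linarith
    · rw [abs_zero]
      exact add_nonneg (hθ0 x) hB
  tendsto_zero := by
    filter_upwards [hFt] with x hx
    have hκ : Tendsto (fun M : ℕ ↦ M * b M - γ) atTop (𝓝 0) := by
      simpa using hbγ.sub_const γ
    have h1 : Tendsto (fun M ↦ s M * F M x) atTop (𝓝 0) := by
      refine squeeze_zero (fun M ↦ mul_nonneg (hs M).1 (hF0 M x)) (fun M ↦ ?_) hx
      exact mul_le_of_le_one_left (hF0 M x) (hs M).2
    have h2 : Tendsto (fun M : ℕ ↦ (M * b M - γ) * ϑ x - s M * F M x) atTop (𝓝 0) := by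
      simpa using (hκ.mul_const (ϑ x)).sub h1
    refine h2.congr' ?_
    have h3 : Tendsto (fun M : ℕ ↦ |M * b M - γ|) atTop (𝓝 0) := by simpa using hκ.abs
    filter_upwards [h3.eventually_le_const one_pos] with M hM
    rw [if_pos hM]

variable {n : ℕ} {X : Type*} [MetricSpace X] [ChartedSpace (EuclideanSpace ℝ (Fin n)) X]

/-- A test function on the Euclidean space, read at scale `l⁻¹` in a chart. -/
def chartTest (φ : OpenPartialHomeomorph X (EuclideanSpace ℝ (Fin n)))
    (f : EuclideanSpace ℝ (Fin n) → ℝ) (l : ℝ) : X → ℝ :=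
  φ.source.indicator fun x ↦ f (l • φ x)

section ChartTest

variable {φ : OpenPartialHomeomorph X (EuclideanSpace ℝ (Fin n))}
  {f : EuclideanSpace ℝ (Fin n) → ℝ}

lemma chartTest_of_mem (f : EuclideanSpace ℝ (Fin n) → ℝ) (l : ℝ) {x : X} (hx : x ∈ φ.source) :
    chartTest φ f l x = f (l • φ x) := Set.indicator_of_mem hx _

lemma chartTest_of_notMem (f : EuclideanSpace ℝ (Fin n) → ℝ) (l : ℝ) {x : X}
    (hx : x ∉ φ.source) : chartTest φ f l x = 0 := Set.indicator_of_notMem hx _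

lemma chartTest_nonneg (hf : ∀ z, 0 ≤ f z) (l : ℝ) (x : X) : 0 ≤ chartTest φ f l x :=
  Set.indicator_nonneg (fun _ _ ↦ hf _) x

lemma chartTest_le {A : ℝ} (hA : 0 ≤ A) (hf : ∀ z, f z ≤ A) (l : ℝ) (x : X) :
    chartTest φ f l x ≤ A := by
  by_cases hx : x ∈ φ.source
  · rw [chartTest_of_mem f l hx]; exact hf _
  · rw [chartTest_of_notMem f l hx]; exact hA

lemma measurable_chartTest [MeasurableSpace X] [BorelSpace X] (hf : Continuous f) (l : ℝ) :
    Measurable (chartTest φ f l) := by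
  classical
  have h := ContinuousOn.measurable_piecewise (s := φ.source) (f := fun x ↦ f (l • φ x))
    (g := (0 : X → ℝ)) (hf.comp_continuousOn (φ.continuousOn.const_smul l))
    continuous_zero.continuousOn φ.open_source.measurableSet
  rwa [Set.piecewise_eq_indicator] at h

/-- Off the centre l φ(x) leaves the compact support of f for large l. -/
lemma tendsto_chartTest (hfc : HasCompactSupport f) {l : ℕ → ℝ} (hl : Tendsto l atTop atTop) {x : X}
    (hx : x ∈ φ.source → φ x ≠ 0) : Tendsto (fun M ↦ chartTest φ f (l M) x) atTop (𝓝 0) := by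
  by_cases hs : x ∈ φ.source
  · obtain ⟨R, hR⟩ := hfc.isBounded.exists_norm_le
    have h1 : Tendsto (fun M ↦ |l M| * ‖φ x‖) atTop atTop :=
      (tendsto_abs_atTop_atTop.comp hl).atTop_mul_const (norm_pos_iff.2 (hx hs))
    refine tendsto_const_nhds.congr' ?_
    filter_upwards [h1.eventually_gt_atTop R] with M hM
    rw [chartTest_of_mem f _ hs]
    refine (image_eq_zero_of_notMem_tsupport fun h ↦ ?_).symm
    have := hR _ h
    rw [norm_smul, Real.norm_eq_abs] at this
    linarith
  · simp only [chartTest_of_notMem f _ hs]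
    exact tendsto_const_nhds

/-- The integral of a test function against the local point process. -/
lemma lintegral_localProcess [MeasurableSpace X] {f : EuclideanSpace ℝ (Fin n) → ℝ≥0}
    (hf : Continuous f) {N : ℕ} (x : Fin N → X) :
    ∫⁻ y, (f y : ℝ≥0∞) ∂(localProcess φ x) =
      ∑ j, ENNReal.ofReal (chartTest φ (fun z ↦ (f z : ℝ)) ((N : ℝ) ^ (1 / (n : ℝ))) (x j)) := by
  classical
  rw [localProcess, lintegral_finsetSum_measure, Finset.sum_filter]
  refine Finset.sum_congr rfl fun j _ ↦ ?_
  split_ifs with h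
  · rw [lintegral_dirac' _ hf.measurable.coe_nnreal_ennreal, chartTest_of_mem _ _ h,
      ENNReal.ofReal_coe_nnreal]
  · rw [chartTest_of_notMem _ _ h, ENNReal.ofReal_zero]

end ChartTest

variable [IsManifold (𝓡 n) ∞ X] [RiemannianBundle (fun x : X ↦ TangentSpace (𝓡 n) x)]
  [MeasurableSpace X] [BorelSpace X]
  [IsContMDiffRiemannianBundle (𝓡 n) ∞ (EuclideanSpace ℝ (Fin n))
    (fun x : X ↦ TangentSpace (𝓡 n) x)]
  {φ : OpenPartialHomeomorph X (EuclideanSpace ℝ (Fin n))} {E : X}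
  {g : X → X → EReal} {V : X → EReal} {ϑ : X → ℝ} {γ : ℝ}

/-- The intensity of the gas, in rescaled coordinates. -/
lemma GasAssumptions.mul_lintegral_chartTest (hA : GasAssumptions n (riemannianVolume n X) g V ϑ)
    (hφ : φ ∈ IsManifold.maximalAtlas (𝓡 n) ∞ X) (κ s : ℝ) {l : ℝ} (hl : 0 < l)
    {f : EuclideanSpace ℝ (Fin n) → ℝ} (hf : Continuous f) (hf0 : ∀ z, 0 ≤ f z)
    {a : X → ℝ≥0∞} (ha : Measurable a) (c : ℝ≥0∞) :
    c * (ENNReal.ofReal (l ^ n) * ∫⁻ u, ENNReal.ofReal (chartTest φ f l u) * a u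
        ∂(expDensity (expDensity (referenceMeasure (riemannianVolume n X) V ϑ γ)
          fun x ↦ (κ - γ) * ϑ x) fun x ↦ -(s * chartTest φ f l x))) =
      ∫⁻ z, ENNReal.ofReal (f z * Real.exp (-(s * f z))) *
        chartDensity φ (fun x ↦ (∫⁻ x, boltzmann V ϑ γ x ∂(riemannianVolume n X))⁻¹ *
          boltzmann V ϑ κ x * (c * a x)) (l⁻¹ • z) := by
  set D := (∫⁻ x, boltzmann V ϑ γ x ∂(riemannianVolume n X))⁻¹
  have hF : Measurable (chartTest φ f l) := measurable_chartTest hf l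
  have hFs : Measurable fun x ↦ -(s * chartTest φ f l x) := (hF.const_mul s).neg
  have hFa : Measurable fun u ↦ ENNReal.ofReal (chartTest φ f l u) * a u := hF.ennreal_ofReal.mul ha
  have hI : Measurable fun u ↦ ENNReal.ofReal (Real.exp (-(s * chartTest φ f l u))) *
    (ENNReal.ofReal (chartTest φ f l u) * a u) := hFs.exp.ennreal_ofReal.mul hFa
  have hbz := hA.measurable_boltzmann κ
  have hk : Measurable fun x ↦ D * boltzmann V ϑ κ x * (c * a x) :=
    (hbz.const_mul D).mul (ha.const_mul c)
  have hΦ : Measurable fun z ↦ ENNReal.ofReal (f z * Real.exp (-(s * f z))) :=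
    (hf.mul (hf.const_mul s).neg.rexp).measurable.ennreal_ofReal
  have hbI : Measurable fun u ↦ boltzmann V ϑ κ u *
      (ENNReal.ofReal (Real.exp (-(s * chartTest φ f l u))) *
        (ENNReal.ofReal (chartTest φ f l u) * a u)) := hbz.mul hI
  rw [lintegral_expDensity _ hFs hFa, hA.expDensity_reference γ (κ - γ), lintegral_smul_measure,
    lintegral_withDensity_eq_lintegral_mul _ (hA.measurable_boltzmann _) hI, add_sub_cancel,
    ← lintegral_comp_smul_chart hφ hl hΦ hk, smul_eq_mul]
  simp only [Pi.mul_apply]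
  rw [mul_left_comm, ← lintegral_const_mul _ hbI, ← lintegral_const_mul _ (hbI.const_mul _),
    ← setLIntegral_eq_of_support_subset (s := φ.source) fun x hx ↦ ?_]
  · congr 1
    refine setLIntegral_congr_fun φ.open_source.measurableSet fun x hx ↦ ?_
    simp only [chartTest_of_mem f l hx]
    rw [ENNReal.ofReal_mul (hf0 _)]
    ring
  · by_contra h
    refine hx ?_
    simp [chartTest_of_notMem f l h]

end LaplaceFunctional

/-! ### Continuity of the one-particle weight in the point and in κ. -/

section LaplaceLimit

variable {X : Type*} [MeasurableSpace X] [MetricSpace X] {n : ℕ} {vol : Measure X}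
  {g : X → X → EReal} {V : X → EReal} {ϑ : X → ℝ} {γ : ℝ}

lemma GasAssumptions.boltzmann_mono (hA : GasAssumptions n vol g V ϑ) {κ κ' : ℝ} (h : κ ≤ κ')
    (x : X) : boltzmann V ϑ κ x ≤ boltzmann V ϑ κ' x := by
  rw [boltzmann_eq, boltzmann_eq]
  exact mul_le_mul_right (ENNReal.ofReal_le_ofReal (Real.exp_le_exp.2
    (mul_le_mul_of_nonneg_right h (hA.theta_nonneg x)))) _

lemma GasAssumptions.continuousAt_boltzmann (hA : GasAssumptions n vol g V ϑ) (κ : ℝ) {E : X}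
    (hE : V E < ⊤) : ContinuousAt (boltzmann V ϑ κ) E :=
  (ENNReal.tendsto_toReal_iff (fun x ↦ hA.boltzmann_ne_top κ x) (hA.boltzmann_ne_top κ E)).1
    ((hA.continuousOn_toReal_boltzmann κ).continuousAt (hA.isOpen.mem_nhds hE))

lemma GasAssumptions.tendsto_boltzmann (hA : GasAssumptions n vol g V ϑ) {κ : ℕ → ℝ}
    (hκ : Tendsto κ atTop (𝓝 γ)) {E : X} (hE : V E < ⊤) {v : ℕ → X} (hv : Tendsto v atTop (𝓝 E)) :
    Tendsto (fun M ↦ boltzmann V ϑ (κ M) (v M)) atTop (𝓝 (boltzmann V ϑ γ E)) := by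
  have h1 := (hA.continuousAt_boltzmann γ hE).tendsto.comp hv
  have h2 : Tendsto (fun M ↦ (κ M - γ) * ϑ (v M)) atTop (𝓝 0) := by
    simpa using (hκ.sub_const γ).mul ((hA.theta_continuous.tendsto E).comp hv)
  have h3 := ENNReal.tendsto_ofReal ((Real.continuous_exp.tendsto 0).comp h2)
  rw [Real.exp_zero, ENNReal.ofReal_one] at h3
  have h4 := ENNReal.Tendsto.mul h1 (Or.inr (by simp)) h3 (Or.inl (by simp))
  rw [mul_one] at h4
  refine h4.congr fun M ↦ ?_
  simp only [Function.comp_apply]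
  rw [← boltzmann_add, add_sub_cancel]

end LaplaceLimit

/-! ### Convergence of the Laplace functional. -/

section LocalLaw

variable {n : ℕ} {X : Type*} [MetricSpace X] [ChartedSpace (EuclideanSpace ℝ (Fin n)) X]
  [IsManifold (𝓡 n) ∞ X] [RiemannianBundle (fun x : X ↦ TangentSpace (𝓡 n) x)]
  [MeasurableSpace X] [BorelSpace X] [SecondCountableTopology X] [SigmaCompactSpace X]
  [IsContMDiffRiemannianBundle (𝓡 n) ∞ (EuclideanSpace ℝ (Fin n))
    (fun x : X ↦ TangentSpace (𝓡 n) x)]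
  {φ : OpenPartialHomeomorph X (EuclideanSpace ℝ (Fin n))} {E : X}
  {g : X → X → EReal} {V : X → EReal} {ϑ : X → ℝ} {γ : ℝ}

/-- The density of the minimizer of the free energy with respect to the volume. -/
def equilibriumDensity (vol : Measure X) (g : X → X → EReal) (V : X → EReal) (ϑ : X → ℝ) (γ : ℝ)
    (μ : Measure X) (x : X) : ℝ≥0∞ :=
  (∫⁻ x, boltzmann V ϑ γ x ∂vol)⁻¹ * boltzmann V ϑ γ x *
    (expNeg (ENNReal.ofReal γ * meanPotential (gasKernel g ϑ) μ x) *
      (meanPartition γ (referenceMeasure vol V ϑ γ) (gasKernel g ϑ) μ)⁻¹)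

lemma GasAssumptions.equilibriumDensity_ne_top
    (hA : GasAssumptions n (riemannianVolume n X) g V ϑ) (hγ : 0 ≤ γ)
    (h0 : ∫⁻ x, boltzmann V ϑ γ x ∂(riemannianVolume n X) ≠ 0) {μ : ProbabilityMeasure X}
    (hμ : IsUniqueMinimizer (meanFieldEnergy γ (referenceMeasure (riemannianVolume n X) V ϑ γ)
      (gasKernel g ϑ)) μ) (x : X) :
    equilibriumDensity (riemannianVolume n X) g V ϑ γ μ x ≠ ⊤ := by
  have hP := hA.isProbabilityMeasure hγ h0
  have hK := hA.meanFieldKernel hγ h0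
  obtain ⟨C, hC⟩ := hK.exists_le_smul hγ hμ
  exact ENNReal.mul_ne_top (ENNReal.mul_ne_top (ENNReal.inv_ne_top.2 h0)
    (hA.boltzmann_ne_top γ x)) (ENNReal.mul_ne_top (expNeg_ne_top _)
    (ENNReal.inv_ne_top.2 (hK.meanPartition_ne_zero hC γ)))

lemma IsNormalChart.ae_tendsto_chartTest (hφ : IsNormalChart φ E) (hn : 1 ≤ n) {ν : Measure X}
    (hν : ν ≪ riemannianVolume n X) {f : EuclideanSpace ℝ (Fin n) → ℝ} (hfc : HasCompactSupport f)
    {l : ℕ → ℝ} (hl : Tendsto l atTop atTop) :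
    ∀ᵐ x ∂ν, Tendsto (fun M ↦ chartTest φ f (l M) x) atTop (𝓝 0) := by
  have h : ∀ᵐ x ∂ν, x ≠ E := by
    rw [ae_iff]
    simpa using hν (riemannianVolume_singleton hn E)
  filter_upwards [h] with x hx
  refine tendsto_chartTest hfc hl fun hxs h0 ↦ hx ?_
  exact φ.injOn hxs hφ.mem_source (h0.trans hφ.map_center.symm)

lemma tendsto_succ_rpow_inv (hn : 1 ≤ n) :
    Tendsto (fun M : ℕ ↦ ((M + 1 : ℕ) : ℝ) ^ (1 / (n : ℝ))) atTop atTop := by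
  have h1 : (0 : ℝ) < 1 / (n : ℝ) := by positivity
  exact (tendsto_rpow_atTop h1).comp
    (tendsto_natCast_atTop_atTop.comp (tendsto_add_atTop_nat 1))

/-- The Laplace functional of the local point process converges to that of a Poisson process. -/
lemma GasAssumptions.tendsto_laplaceFunctional
    (hA : GasAssumptions n (riemannianVolume n X) g V ϑ) (hn : 1 ≤ n) (hγ : 0 ≤ γ)
    (h0 : ∫⁻ x, boltzmann V ϑ γ x ∂(riemannianVolume n X) ≠ 0) {μ : ProbabilityMeasure X}
    (hμ : IsUniqueMinimizer (meanFieldEnergy γ (referenceMeasure (riemannianVolume n X) V ϑ γ)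
      (gasKernel g ϑ)) μ) (hE : V E < ⊤) (hφ : IsNormalChart φ E) {b : ℕ → ℝ} (hb : ∀ M, 0 ≤ b M)
    (hbγ : Tendsto (fun M : ℕ ↦ M * b M) atTop (𝓝 γ)) {f : EuclideanSpace ℝ (Fin n) → ℝ≥0}
    (hf : Continuous f) (hfc : HasCompactSupport f) :
    Tendsto (fun M : ℕ ↦ laplaceFunctional
        (gibbsMeasure (riemannianVolume n X) g V (b M) (M + 1)) (fun x ↦ localProcess φ x) f)
      atTop (𝓝 (ENNReal.ofReal (Real.exp
        ((equilibriumDensity (riemannianVolume n X) g V ϑ γ μ E).toReal *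
          ∫ z in tsupport fun z ↦ (f z : ℝ), (Real.exp (-(f z : ℝ)) - 1))))) := by
  have hP := hA.isProbabilityMeasure hγ h0
  have hK := hA.meanFieldKernel hγ h0
  obtain ⟨C₁, hC₁⟩ := hK.exists_le_smul hγ hμ
  have hfe := hK.finiteEnergy hγ hμ
  set vol := riemannianVolume n X with hvol
  set ν := referenceMeasure vol V ϑ γ with hν
  set G := gasKernel g ϑ with hGdef
  have hG : Measurable (Function.uncurry G) := hK.measurable
  set F : ℕ → X → ℝ := fun M ↦
    chartTest φ (fun z ↦ (f z : ℝ)) (((M + 1 : ℕ) : ℝ) ^ (1 / (n : ℝ))) with hFdef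
  have hl := tendsto_succ_rpow_inv hn
  set l : ℕ → ℝ := fun M ↦ ((M + 1 : ℕ) : ℝ) ^ (1 / (n : ℝ)) with hldef
  have hl0 : ∀ M, 0 < l M := fun M ↦ Real.rpow_pos_of_pos (by positivity) _
  have hln : ∀ M, ENNReal.ofReal (l M ^ n) = (M + 1 : ℕ) := fun M ↦ by
    have hn' : n ≠ 0 := by omega
    rw [hldef]
    dsimp only
    rw [one_div, Real.rpow_inv_natCast_pow (by positivity) hn', ENNReal.ofReal_natCast]
  have hfR : Continuous fun z ↦ (f z : ℝ) := NNReal.continuous_coe.comp hf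
  have hfcR : HasCompactSupport fun z ↦ (f z : ℝ) := hfc.comp_left (g := NNReal.toReal) rfl
  obtain ⟨A, hA'⟩ := hfcR.exists_bound_of_continuous hfR
  have hA0 : 0 ≤ A := (norm_nonneg _).trans (hA' 0)
  have hfA : ∀ z, (f z : ℝ) ≤ A := fun z ↦ (le_abs_self _).trans (hA' z)
  have hFm : ∀ M, Measurable (F M) := fun M ↦ measurable_chartTest hfR _
  have hF0 : ∀ M x, 0 ≤ F M x := fun M x ↦ chartTest_nonneg (fun z ↦ NNReal.coe_nonneg _) _ x
  have hFA : ∀ M x, F M x ≤ A := fun M x ↦ chartTest_le hA0 hfA _ x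
  have hνvol : ν ≪ vol := by
    rw [hν, referenceMeasure_eq]
    exact (withDensity_absolutelyContinuous _ _).smul_left _
  have hFt : ∀ᵐ x ∂ν, Tendsto (fun M ↦ F M x) atTop (𝓝 0) :=
    hφ.ae_tendsto_chartTest hn hνvol hfcR hl
  set κ : ℕ → ℝ := fun M ↦ M * b M with hκ
  set m : ℕ → Measure X := fun M ↦ expDensity ν fun x ↦ (κ M - γ) * ϑ x with hm
  have hθm := hA.theta_continuous.measurable
  have hκ1 : ∀ᶠ M in atTop, |κ M - γ| ≤ 1 := by
    have h3 : Tendsto (fun M ↦ |κ M - γ|) atTop (𝓝 0) := by simpa using (hbγ.sub_const γ).abs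
    exact h3.eventually_le_const one_pos
  have hseq := fun (s : ℕ → ℝ) (hs : ∀ M, s M ∈ Set.Icc (0 : ℝ) 1) ↦
    meanFieldSequence_tilt hθm hA.theta_nonneg hb hbγ hFm hF0 hFA hFt hs
  have hmf : ∀ M, |κ M - γ| ≤ 1 → IsFiniteMeasure (m M) := by
    intro M hM
    have := hK.isFiniteMeasure
    refine isFiniteMeasure_of_le (expDensity ν ϑ) (expDensity_mono ν fun x ↦ ?_)
    have := mul_le_mul_of_nonneg_right ((le_abs_self _).trans hM) (hA.theta_nonneg x)
    rwa [one_mul] at this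
  have hms : ∀ M (t : ℝ), expDensity (m M) (fun x ↦ -(t * F M x)) =
      expDensity ν fun x ↦ (κ M - γ) * ϑ x - t * F M x := by
    intro M t
    have h1 : Measurable fun x ↦ -(t * F M x) := ((hFm M).const_mul t).neg
    have := expDensity_expDensity ν (r := fun x ↦ (κ M - γ) * ϑ x) (s := fun x ↦ -(t * F M x))
      (hθm.const_mul _) h1
    simpa only [← sub_eq_add_neg] using this
  -- If Z vanished, Z⁻¹ times `gasA` would be 0 or ∞, whereas its limit is positive and finite.
  have hZ0 : ∀ᶠ M in atTop, gasZ G (ENNReal.ofReal (b M)) (M + 1) (m M) ≠ 0 := by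
    have h1 := (hseq (fun _ ↦ 0) fun _ ↦ by simp).tendsto_gasA_div hK hγ hμ
      (tendsto_const_nhds (x := E))
    have h2 : expNeg (ENNReal.ofReal γ * meanPotential G μ E) * (meanPartition γ ν G μ)⁻¹ ≠ 0 :=
      mul_ne_zero (expNeg_pos (ENNReal.mul_ne_top ENNReal.ofReal_ne_top
        (hK.meanPotential_ne_top hC₁ E))).ne' (ENNReal.inv_ne_zero.2 (meanPartition_ne_top γ G μ))
    have h3 : expNeg (ENNReal.ofReal γ * meanPotential G μ E) * (meanPartition γ ν G μ)⁻¹ ≠ ⊤ :=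
      ENNReal.mul_ne_top (expNeg_ne_top _)
        (ENNReal.inv_ne_top.2 (hK.meanPartition_ne_zero hC₁ γ))
    filter_upwards [h1.eventually_ne h2, h1.eventually_ne h3, hκ1] with M h4 h5 h6 h7
    have hmM : expDensity ν (fun x ↦ if |M * b M - γ| ≤ 1 then
        (M * b M - γ) * ϑ x - 0 * F M x else 0) = m M := by
      rw [hm]
      dsimp only
      congr 1
      funext x
      rw [if_pos h6, zero_mul, sub_zero]
    rw [hmM, h7, ENNReal.inv_zero] at h4 h5
    rw [ENNReal.top_mul (right_ne_zero_of_mul h4)] at h5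
    exact h5 rfl
  have hK' : IsFiniteMeasure (volume.restrict (tsupport fun z ↦ (f z : ℝ))) :=
    ⟨by rw [Measure.restrict_apply_univ]; exact hfcR.isCompact.measure_lt_top⟩
  set L := equilibriumDensity vol g V ϑ γ μ E with hL
  set W : ℕ → ℝ := fun M ↦
    Real.log (gasZ G (ENNReal.ofReal (b M)) (M + 1) (expDensity (m M) fun x ↦ -F M x)).toReal -
      Real.log (gasZ G (ENNReal.ofReal (b M)) (M + 1) (m M)).toReal with hW
  set I := L.toReal * ∫ z in tsupport fun z ↦ (f z : ℝ), (Real.exp (-(f z : ℝ)) - 1) with hI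
  -- The parameter is chosen for every M, with an arbitrary value where the hypotheses fail, so that
  -- the choices form one sequence of tilts to which the mean-field limits apply.
  have hex : ∀ M, ∃ t ∈ Set.Icc (0 : ℝ) 1, |κ M - γ| ≤ 1 →
      gasZ G (ENNReal.ofReal (b M)) (M + 1) (m M) ≠ 0 →
      W M - I = L.toReal * (∫ z in tsupport fun z ↦ (f z : ℝ), (f z : ℝ) *
          Real.exp (-(t * (f z : ℝ)))) -
        ((gasZ G (ENNReal.ofReal (b M)) (M + 1) (expDensity (m M) fun x ↦ -(t * F M x)))⁻¹ *
          ((M + 1 : ℕ) * ∫⁻ u, ENNReal.ofReal (F M u) *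
            gasA G (ENNReal.ofReal (b M)) M (expDensity (m M) fun x ↦ -(t * F M x)) u
            ∂(expDensity (m M) fun x ↦ -(t * F M x)))).toReal := by
    intro M
    by_cases h : |κ M - γ| ≤ 1 ∧ gasZ G (ENNReal.ofReal (b M)) (M + 1) (m M) ≠ 0
    · have := hmf M h.1
      obtain ⟨t, ht, he⟩ := exists_log_gasZ_sub_log_gasZ hG hK.symm (hFm M) (hF0 M) (hFA M) h.2
        (l := volume.restrict (tsupport fun z ↦ (f z : ℝ))) hfR.measurable hA' L.toReal
      exact ⟨t, Set.Ioo_subset_Icc_self ht, fun _ _ ↦ he⟩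
    · exact ⟨0, by simp, fun h1 h2 ↦ absurd ⟨h1, h2⟩ h⟩
  choose s hs hWs using hex
  have hr := hseq s hs
  obtain ⟨C, hC⟩ := hr.exists_gasA_div_le hK hfe
  have hra : ∀ᶠ M in atTop, (expDensity (m M) fun x ↦ -(s M * F M x)) =
      expDensity ν fun x ↦ if |M * b M - γ| ≤ 1 then (M * b M - γ) * ϑ x - s M * F M x else 0 := by
    filter_upwards [hκ1] with M hM
    rw [hms]
    congr 1
    funext x
    rw [if_pos hM]
  -- The one-particle intensity per particle as a density with respect to the volume, except for the
  -- factor e^{-s F}, which stays with the test function.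
  set k : ℕ → X → ℝ≥0∞ := fun M x ↦ (∫⁻ x, boltzmann V ϑ γ x ∂vol)⁻¹ * boltzmann V ϑ (κ M) x *
    ((gasZ G (ENNReal.ofReal (b M)) (M + 1) (expDensity (m M) fun x ↦ -(s M * F M x)))⁻¹ *
      gasA G (ENNReal.ofReal (b M)) M (expDensity (m M) fun x ↦ -(s M * F M x)) x) with hk
  have ha : ∀ M, Measurable (gasA G (ENNReal.ofReal (b M)) M
      (expDensity (m M) fun x ↦ -(s M * F M x))) := fun M ↦ measurable_gasA _ _ _ hG
  have hkm : ∀ M, Measurable (k M) := fun M ↦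
    ((hA.measurable_boltzmann _).const_mul _).mul ((ha M).const_mul _)
  obtain ⟨B, hB⟩ := hA.exists_boltzmann_le (κ := γ + 1) (by linarith)
  obtain ⟨D, hD⟩ : ∃ D : ℝ≥0, (D : ℝ≥0∞) = (∫⁻ x, boltzmann V ϑ γ x ∂vol)⁻¹ :=
    ⟨_, ENNReal.coe_toNNReal (ENNReal.inv_ne_top.2 h0)⟩
  have hkC : ∀ᶠ M in atTop, ∀ x, k M x ≤ (D * B * C : ℝ≥0) := by
    filter_upwards [hC, hra, hκ1] with M h1 h2 h3 x
    simp only [hk]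
    rw [h2, ← hD, ENNReal.coe_mul, ENNReal.coe_mul]
    have h4 : κ M ≤ γ + 1 := by linarith [(le_abs_self _).trans h3]
    exact mul_le_mul' (mul_le_mul' le_rfl ((hA.boltzmann_mono h4 x).trans (hB x))) (h1 x)
  have hkL : ∀ v : ℕ → X, Tendsto v atTop (𝓝 E) → Tendsto (fun M ↦ k M (v M)) atTop (𝓝 L) := by
    intro v hv
    have h1 := hr.tendsto_gasA_div hK hγ hμ hv
    have h2 := hA.tendsto_boltzmann hbγ hE hv
    have h3 := ENNReal.Tendsto.const_mul h2 (a := (∫⁻ x, boltzmann V ϑ γ x ∂vol)⁻¹)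
      (Or.inr (ENNReal.inv_ne_top.2 h0))
    have h4 := ENNReal.Tendsto.mul h3 (Or.inr (ENNReal.mul_ne_top (expNeg_ne_top _)
      (ENNReal.inv_ne_top.2 (hK.meanPartition_ne_zero hC₁ γ)))) h1
      (Or.inr (ENNReal.mul_ne_top (ENNReal.inv_ne_top.2 h0) (hA.boltzmann_ne_top γ E)))
    refine h4.congr' ?_
    filter_upwards [hra] with M hM
    simp only [hk]
    rw [hM]
  have hLt : L ≠ ⊤ := hA.equilibriumDensity_ne_top hγ h0 hμ E
  have hlim := hφ.tendsto_integral_sub_lintegral hkm hkC hLt hkL hl hfR hfcR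
    (fun z ↦ NNReal.coe_nonneg _) (s := s) fun M ↦ (hs M).1
  have hWI : Tendsto (fun M ↦ W M - I) atTop (𝓝 0) := by
    refine hlim.congr' ?_
    filter_upwards [hκ1, hZ0] with M h1 h2
    rw [hWs M h1 h2, ← hln M, hA.mul_lintegral_chartTest hφ.mem_atlas (κ M) (s M) (hl0 M) hfR
      (fun z ↦ NNReal.coe_nonneg _) (ha M)]
  have hWI' : Tendsto W atTop (𝓝 I) := by
    simpa using hWI.add_const I
  have hexp := ENNReal.tendsto_ofReal ((Real.continuous_exp.tendsto I).comp hWI')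
  refine hexp.congr' ?_
  filter_upwards [hκ1, hZ0] with M h1 h2
  have := hmf M h1
  have hm1 : expDensity (m M) (fun x ↦ -F M x) =
      expDensity ν fun x ↦ (κ M - γ) * ϑ x - F M x := by
    have := hms M 1
    simpa only [one_mul] using this
  -- With M + 1 particles the exponent κ is b ((M + 1) - 1) = M b.
  have hκM : b M * (((M + 1 : ℕ) : ℝ) - 1) = κ M := by
    rw [hκ]
    push_cast
    ring
  have hlap : laplaceFunctional (gibbsMeasure vol g V (b M) (M + 1))
      (fun x ↦ localProcess φ x) f = (gasZ G (ENNReal.ofReal (b M)) (M + 1) (m M))⁻¹ *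
      gasZ G (ENNReal.ofReal (b M)) (M + 1) (expDensity (m M) fun x ↦ -F M x) := by
    have h3 := hA.lintegral_gibbsMeasure hγ h0 (hb M) (M + 1) (hFm M) (hF0 M)
    rw [hκM] at h3
    rw [hm1, ← h3]
    refine lintegral_congr fun x ↦ ?_
    rw [lintegral_localProcess hf]
    rfl
  have hne : gasZ G (ENNReal.ofReal (b M)) (M + 1) (expDensity (m M) fun x ↦ -F M x) ≠ 0 := by
    have := gasZ_neg_mul_ne_zero hG (hFm M) h2 1
    simpa only [one_mul] using this
  have hfin : IsFiniteMeasure (expDensity (m M) fun x ↦ -F M x) := by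
    refine isFiniteMeasure_of_le (m M) ?_
    have h5 : expDensity (m M) (fun _ ↦ 0) = m M := by simp [expDensity]
    conv_rhs => rw [← h5]
    exact expDensity_mono _ fun x ↦ neg_nonpos.2 (hF0 M x)
  have ht0 := gasZ_ne_top (G := G) (ENNReal.ofReal (b M)) (M + 1) (m M)
  have ht1 := gasZ_ne_top (G := G) (ENNReal.ofReal (b M)) (M + 1)
    (expDensity (m M) fun x ↦ -F M x)
  rw [hlap]
  simp only [Function.comp_apply, hW]
  rw [Real.exp_sub, Real.exp_log (ENNReal.toReal_pos hne ht1),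
    Real.exp_log (ENNReal.toReal_pos h2 ht0), ENNReal.ofReal_div_of_pos (ENNReal.toReal_pos h2 ht0),
    ENNReal.ofReal_toReal ht1, ENNReal.ofReal_toReal ht0, div_eq_mul_inv, mul_comm]

end LocalLaw

/-! ### The density of the minimizer. -/

section Equilibrium

variable {n : ℕ} {X : Type*} [MetricSpace X] [ChartedSpace (EuclideanSpace ℝ (Fin n)) X]

lemma nontrivial_of_chartedSpace [Nonempty X] (hn : 1 ≤ n) : Nontrivial X := by
  by_contra h
  rw [not_nontrivial_iff_subsingleton] at h
  have : Nontrivial (EuclideanSpace ℝ (Fin n)) := by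
    have : Nonempty (Fin n) := ⟨⟨0, hn⟩⟩
    infer_instance
  obtain ⟨x⟩ := ‹Nonempty X›
  set e := chartAt (EuclideanSpace ℝ (Fin n)) x
  have hi := infinite_of_mem_nhds (e x) (e.open_target.mem_nhds (e.map_source
    (mem_chart_source (EuclideanSpace ℝ (Fin n)) x)))
  refine hi (Set.Subsingleton.finite fun y hy z hz ↦ ?_)
  exact e.symm.injOn hy hz (Subsingleton.elim _ _)

variable [MeasurableSpace X] [BorelSpace X] {vol : Measure X} {g : X → X → EReal} {V : X → EReal}
  {ϑ : X → ℝ} {γ : ℝ}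

/-- If the normaliser were 0, the reference measure would vanish and the free energy would be ∞
everywhere. All probability measures would then be minimizers, against uniqueness, since X has two
distinct points when n ≥ 1. -/
lemma lintegral_boltzmann_ne_zero [Nonempty X] (hn : 1 ≤ n) {μ : ProbabilityMeasure X}
    (hμ : IsUniqueMinimizer (freeEnergy vol g V ϑ γ) μ) :
    ∫⁻ x, boltzmann V ϑ γ x ∂vol ≠ 0 := by
  intro h
  have h1 : referenceMeasure vol V ϑ γ = 0 := by
    have h2 : vol.withDensity (boltzmann V ϑ γ) = 0 := by
      rw [← Measure.measure_univ_eq_zero, withDensity_apply _ MeasurableSet.univ,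
        Measure.restrict_univ, h]
    rw [referenceMeasure_eq, h2, smul_zero]
  have h3 : ∀ μ' : ProbabilityMeasure X, freeEnergy vol g V ϑ γ μ' = ⊤ := by
    intro μ'
    have : ¬ (μ' : Measure X) ≪ 0 := fun hac ↦
      IsProbabilityMeasure.ne_zero (μ' : Measure X) (Measure.absolutelyContinuous_zero_iff.1 hac)
    rw [freeEnergy, h1, InformationTheory.klDiv_of_not_ac this, add_top]
  have h4 : ∀ μ' : ProbabilityMeasure X, μ' = μ := fun μ' ↦
    hμ.2 μ' fun μ'' ↦ by rw [h3, h3]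
  obtain ⟨a, c, hac⟩ := nontrivial_of_chartedSpace (X := X) hn
  have h5 : (⟨Measure.dirac a, inferInstance⟩ : ProbabilityMeasure X) =
      ⟨Measure.dirac c, inferInstance⟩ := (h4 _).trans (h4 _).symm
  have h6 : Measure.dirac a = Measure.dirac c := congrArg Subtype.val h5
  have h7 : Measure.dirac a {a} = Measure.dirac c {a} := by rw [h6]
  simp [hac.symm] at h7

variable [SecondCountableTopology X] [SigmaCompactSpace X] {μ : ProbabilityMeasure X}

lemma GasAssumptions.measurable_equilibriumDensity (hA : GasAssumptions n vol g V ϑ) (γ : ℝ)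
    (μ : ProbabilityMeasure X) : Measurable (equilibriumDensity vol g V ϑ γ μ) :=
  ((hA.measurable_boltzmann γ).const_mul _).mul
    ((measurable_expNeg_meanPotential hA.measurable_gasKernel μ γ).mul_const _)

lemma GasAssumptions.eq_withDensity_equilibriumDensity (hA : GasAssumptions n vol g V ϑ)
    (hγ : 0 ≤ γ) (h0 : ∫⁻ x, boltzmann V ϑ γ x ∂vol ≠ 0)
    (hμ : IsUniqueMinimizer (meanFieldEnergy γ (referenceMeasure vol V ϑ γ) (gasKernel g ϑ)) μ) :
    (μ : Measure X) = vol.withDensity (equilibriumDensity vol g V ϑ γ μ) := by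
  have hP := hA.isProbabilityMeasure hγ h0
  have hb := hA.measurable_boltzmann γ
  have hd : Measurable fun u ↦ expNeg (ENNReal.ofReal γ * meanPotential (gasKernel g ϑ) μ u) *
      (meanPartition γ (referenceMeasure vol V ϑ γ) (gasKernel g ϑ) μ)⁻¹ :=
    (measurable_expNeg_meanPotential hA.measurable_gasKernel μ γ).mul_const _
  have h1 : referenceMeasure vol V ϑ γ =
      vol.withDensity ((∫⁻ x, boltzmann V ϑ γ x ∂vol)⁻¹ • boltzmann V ϑ γ) := by
    rw [referenceMeasure_eq, withDensity_smul _ hb]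
  have h2 : equilibriumDensity vol g V ϑ γ μ = ((∫⁻ x, boltzmann V ϑ γ x ∂vol)⁻¹ •
      boltzmann V ϑ γ) * fun u ↦ expNeg (ENNReal.ofReal γ * meanPotential (gasKernel g ϑ) μ u) *
        (meanPartition γ (referenceMeasure vol V ϑ γ) (gasKernel g ϑ) μ)⁻¹ := rfl
  rw [h2, withDensity_mul _ (hb.const_smul _) hd, ← h1]
  exact (hA.meanFieldKernel hγ h0).eq_withDensity hγ hμ

lemma GasAssumptions.equilibriumDensity_pos (hA : GasAssumptions n vol g V ϑ)
    (hγ : 0 ≤ γ) (h0 : ∫⁻ x, boltzmann V ϑ γ x ∂vol ≠ 0)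
    (hμ : IsUniqueMinimizer (meanFieldEnergy γ (referenceMeasure vol V ϑ γ) (gasKernel g ϑ)) μ)
    {x : X} (hx : V x < ⊤) : 0 < equilibriumDensity vol g V ϑ γ μ x := by
  have hP := hA.isProbabilityMeasure hγ h0
  have hK := hA.meanFieldKernel hγ h0
  obtain ⟨C, hC⟩ := hK.exists_le_smul hγ hμ
  refine pos_iff_ne_zero.2 (mul_ne_zero (mul_ne_zero (ENNReal.inv_ne_zero.2
    (hA.lintegral_boltzmann_ne_top hγ)) (boltzmann_pos hx γ).ne') (mul_ne_zero ?_ ?_))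
  · exact (expNeg_pos (ENNReal.mul_ne_top ENNReal.ofReal_ne_top
      (hK.meanPotential_ne_top hC x))).ne'
  · exact ENNReal.inv_ne_zero.2 (meanPartition_ne_top γ _ _)

lemma GasAssumptions.continuousOn_equilibriumDensity (hA : GasAssumptions n vol g V ϑ)
    (hγ : 0 ≤ γ) (h0 : ∫⁻ x, boltzmann V ϑ γ x ∂vol ≠ 0)
    (hμ : IsUniqueMinimizer (meanFieldEnergy γ (referenceMeasure vol V ϑ γ) (gasKernel g ϑ)) μ) :
    ContinuousOn (fun x ↦ (equilibriumDensity vol g V ϑ γ μ x).toReal) {x | V x < ⊤} := by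
  have hP := hA.isProbabilityMeasure hγ h0
  have hK := hA.meanFieldKernel hγ h0
  obtain ⟨C, hC⟩ := hK.exists_le_smul hγ hμ
  have h1 : Continuous fun x ↦
      (expNeg (ENNReal.ofReal γ * meanPotential (gasKernel g ϑ) μ x)).toReal := by
    refine continuous_iff_continuousAt.2 fun x ↦ (ENNReal.tendsto_toReal (expNeg_ne_top _)).comp ?_
    exact (continuous_expNeg.comp ((ENNReal.continuous_const_mul ENNReal.ofReal_ne_top).comp
      (hK.continuous_meanPotential hC))).continuousAt
  simp only [equilibriumDensity, ENNReal.toReal_mul]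
  exact (continuousOn_const.mul (hA.continuousOn_toReal_boltzmann γ)).mul
    (h1.continuousOn.mul continuousOn_const)

end Equilibrium

/-- The Laplace functional of a homogeneous Poisson process, as a real integral. -/
lemma IsPoissonProcess.laplaceFunctional_eq {n : ℕ} {Ω : Type*} [MeasurableSpace Ω] {P : Measure Ω}
    {Ξ : Ω → Measure (EuclideanSpace ℝ (Fin n))} {c : ℝ} (hc : 0 ≤ c)
    (h : IsPoissonProcess P Ξ (ENNReal.ofReal c • volume)) {f : EuclideanSpace ℝ (Fin n) → ℝ≥0}
    (hf : Continuous f) (hfc : HasCompactSupport f) :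
    laplaceFunctional P Ξ f = ENNReal.ofReal (Real.exp
      (c * ∫ z in tsupport fun z ↦ (f z : ℝ), (Real.exp (-(f z : ℝ)) - 1))) := by
  have hfR : Continuous fun z ↦ (f z : ℝ) := NNReal.continuous_coe.comp hf
  have hfcR : HasCompactSupport fun z ↦ (f z : ℝ) := hfc.comp_left (g := NNReal.toReal) rfl
  have hK : IsFiniteMeasure (volume.restrict (tsupport fun z ↦ (f z : ℝ))) :=
    ⟨by rw [Measure.restrict_apply_univ]; exact hfcR.isCompact.measure_lt_top⟩
  have hm : Measurable fun z ↦ 1 - Real.exp (-(f z : ℝ)) :=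
    (continuous_const.sub hfR.neg.rexp).measurable
  have h0 : ∀ z, 0 ≤ 1 - Real.exp (-(f z : ℝ)) := fun z ↦
    sub_nonneg.2 (Real.exp_le_one_iff.2 (neg_nonpos.2 (NNReal.coe_nonneg _)))
  have hi : Integrable (fun z ↦ 1 - Real.exp (-(f z : ℝ)))
      (volume.restrict (tsupport fun z ↦ (f z : ℝ))) := by
    refine (integrable_const (1 : ℝ)).mono' hm.aestronglyMeasurable (ae_of_all _ fun z ↦ ?_)
    rw [Real.norm_of_nonneg (h0 z)]
    linarith [Real.exp_pos (-(f z : ℝ))]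
  have h1 : ∫⁻ z, ENNReal.ofReal (1 - Real.exp (-(f z : ℝ))) ∂(ENNReal.ofReal c • volume) =
      ENNReal.ofReal (c * ∫ z in tsupport fun z ↦ (f z : ℝ), (1 - Real.exp (-(f z : ℝ)))) := by
    rw [lintegral_smul_measure, smul_eq_mul, ENNReal.ofReal_mul hc,
      ofReal_integral_eq_lintegral_ofReal hi (ae_of_all _ h0),
      setLIntegral_eq_of_support_subset fun z hz ↦ ?_]
    refine subset_tsupport (fun z ↦ (f z : ℝ)) fun hz' ↦ hz ?_
    have hz'' : (f z : ℝ) = 0 := hz'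
    simp [hz'']
  rw [h.2 f hf.measurable, h1]
  refine (expNeg_ofReal (mul_nonneg hc (integral_nonneg h0))).trans ?_
  congr 2
  rw [← mul_neg, ← integral_neg]
  simp only [neg_sub]

end MeanFieldGas

end

/-! ### The main theorem. -/

open MeanFieldGas in
theorem mainTheorem1 {n : ℕ} (hn : 1 ≤ n)
    {X : Type*} [MetricSpace X] [ConnectedSpace X] [SecondCountableTopology X]
    [MeasurableSpace X] [BorelSpace X]
    [ChartedSpace (EuclideanSpace ℝ (Fin n)) X] [IsManifold (𝓡 n) ∞ X]
    [RiemannianBundle (fun x : X ↦ TangentSpace (𝓡 n) x)]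
    [IsContMDiffRiemannianBundle (𝓡 n) ∞ (EuclideanSpace ℝ (Fin n))
      (fun x : X ↦ TangentSpace (𝓡 n) x)]
    [IsRiemannianManifold (𝓡 n) X]
    (g : X → X → EReal) (V : X → EReal) (ϑ : X → ℝ)
    (hA : GasAssumptions n (riemannianVolume n X) g V ϑ)
    (γ : ℝ) (hγ : 0 ≤ γ)
    (μ : ProbabilityMeasure X)
    (hμ : IsUniqueMinimizer (freeEnergy (riemannianVolume n X) g V ϑ γ) μ) :
    ∃ ρ : X → ℝ, Measurable ρ ∧ (∀ x, 0 ≤ ρ x) ∧ ContinuousOn ρ {x | V x < ⊤} ∧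
      (μ : Measure X) = (riemannianVolume n X).withDensity (fun x ↦ ENNReal.ofReal (ρ x)) ∧
      ∀ E : X, V E < ⊤ → 0 < ρ E ∧
        ∀ φ : OpenPartialHomeomorph X (EuclideanSpace ℝ (Fin n)),
          IsNormalChart φ E → φ.source ⊆ {x | V x < ⊤} →
        ∀ β : ℕ → ℝ, (∀ N, 0 < β N) → Tendsto (fun N : ℕ ↦ (N : ℝ) * β N) atTop (𝓝 γ) →
        ∃ (Ω : Type) (_ : MeasurableSpace Ω) (P : Measure Ω)
          (Ξ : Ω → Measure (EuclideanSpace ℝ (Fin n))),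
          IsProbabilityMeasure P ∧
          IsPoissonProcess P Ξ (ENNReal.ofReal (ρ E) • volume) ∧
          ConvergesInDistribution
            (fun N ↦ gibbsMeasure (riemannianVolume n X) g V (β N) N)
            (fun _ x ↦ localProcess φ x) P Ξ := by
  have : LocallyCompactSpace X := ChartedSpace.locallyCompactSpace (EuclideanSpace ℝ (Fin n)) X
  have h0 := lintegral_boltzmann_ne_zero hn hμ
  have hμ' : IsUniqueMinimizer (meanFieldEnergy γ (referenceMeasure (riemannianVolume n X) V ϑ γ)
    (gasKernel g ϑ)) μ := hμ
  have ht := hA.equilibriumDensity_ne_top hγ h0 hμ'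
  refine ⟨fun x ↦ (equilibriumDensity (riemannianVolume n X) g V ϑ γ μ x).toReal,
    (hA.measurable_equilibriumDensity γ μ).ennreal_toReal, fun x ↦ ENNReal.toReal_nonneg,
    hA.continuousOn_equilibriumDensity hγ h0 hμ', ?_, fun E hE ↦
      ⟨ENNReal.toReal_pos (hA.equilibriumDensity_pos hγ h0 hμ' hE).ne' (ht E),
        fun φ hφ _ β hβ hβγ ↦ ?_⟩⟩
  · simp only [ENNReal.ofReal_toReal (ht _)]
    exact hA.eq_withDensity_equilibriumDensity hγ h0 hμ'
  obtain ⟨Ω, hΩ, P, Ξ, hP, hΞ⟩ := exists_isPoissonProcess hn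
    (equilibriumDensity (riemannianVolume n X) g V ϑ γ μ E).toReal.toNNReal
  refine ⟨Ω, hΩ, P, Ξ, hP, hΞ, fun f hf hfc ↦ ?_⟩
  rw [IsPoissonProcess.laplaceFunctional_eq ENNReal.toReal_nonneg hΞ hf hfc,
    ← tendsto_add_atTop_iff_nat 1]
  -- With b_M = β_{M+1}, the product M b_M = (M + 1) β_{M+1} - β_{M+1} tends to γ because β tends to
  -- 0.
  refine hA.tendsto_laplaceFunctional hn hγ h0 hμ' hE hφ (b := fun M ↦ β (M + 1))
    (fun M ↦ (hβ _).le) ?_ hf hfc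
  have h1 := (tendsto_add_atTop_iff_nat 1).2 hβγ
  have h2 : Tendsto β atTop (𝓝 0) := by
    have h3 := hβγ.mul tendsto_inv_atTop_nhds_zero_nat
    rw [mul_zero] at h3
    refine h3.congr' ?_
    filter_upwards [eventually_gt_atTop 0] with N hN
    have : (N : ℝ) ≠ 0 := by positivity
    field_simp
  have h4 := h1.sub ((tendsto_add_atTop_iff_nat 1).2 h2)
  rw [sub_zero] at h4
  refine h4.congr fun M ↦ ?_
  push_cast
  ring
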